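/- Let $d\in\mathbb N$, let $V\in C^1_{\rm b}(\mathbb R^d;\mathbb R)$ and, for $0<\varepsilon\le 1$, let $\psi_0^\varepsilon\in H^3(\mathbb R^d)$ with $\|\psi^\varepsilon_0\|_{L^2}=1$ and $$\sup_{0<\varepsilon\le 1}\Big(\frac{\varepsilon^2}{2}\int_{\mathbb R^d}|\nabla\psi_0^\varepsilon|^2dx+\int_{\mathbb R^d}V|\psi^\varepsilon_0|^2dx\Big)<\infty .$$ Let $\psi^\varepsilon$ be the solution of $i\varepsilon\partial_t\psi^\varepsilon=-\frac{\varepsilon^2}{2}\Delta\psi^\varepsilon+V\psi^\varepsilon$, $\psi^\varepsilon(0)=\psi^\varepsilon_0$, for $t\in\mathbb R$ (in $C^1(\mathbb R;L^2)$ with values in $H^2$). Put $$\rho^\varepsilon=|\psi^\varepsilon|^2,\qquad J^\varepsilon=\varepsilon\,\mathrm{Im}(\overline{\psi^\varepsilon}\nabla\psi^\varepsilon),\qquad V_B^\varepsilon=-\frac{\varepsilon^2}{2}\frac{\Delta\sqrt{\rho^\varepsilon}}{\sqrt{\rho^\varepsilon}}\ \text{ on }\{\rho^\varepsilon>0\},$$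 and let $\beta^\varepsilon(t)=\rho^\varepsilon(t,x)\,\delta\big(p-J^\varepsilon(t,x)/\rho^\varepsilon(t,x)\big)$ be the Bohmian measure on $\mathbb R^d_x\times\mathbb R^d_p$. Let $\varepsilon_n\to0$ be a sequence in $(0,1]$ along which, as $n\to\infty$, * $\beta^{\varepsilon}\to\beta$ in $L^\infty(\mathbb R_t;\mathcal M^+(\mathbb R^d_x\times\mathbb R^d_p))$ weak-$*$; * $\varepsilon^2\,\nabla\sqrt{\rho^{\varepsilon}}\otimes\nabla\sqrt{\rho^{\varepsilon}}\to\mathcal A$ in $\mathcal D'(\mathbb R_t\times\mathbb R^d_x)$; * $\dfrac{J^{\varepsilon}\otimes J^{\varepsilon}}{\rho^{\varepsilon}}\to\displaystyle\int_{\mathbb R^d}p\otimes p\,\beta(t,x,dp)+\mathcal C$ in $\mathcal D'(\mathbb R_t\times\mathbb R^d_x)$. For $\varepsilon=\varepsilon_n$ let $\mathrm{div}_p(\nabla_xV_B^\varepsilon\,\beta^\varepsilon)$ be the distribution $\varphi\mapsto-\int_{\mathbb R}\iint\nabla_xV_B^\varepsilon(t,x)\cdot\nabla_p\varphi(t,x,p)\,\beta^\varepsilon(t,dx,dp)\,dt$.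 Then these integrals converge absolutely for every $\varphi\in C_c^\infty(\mathbb R_t\times\mathbb R^d_x\times\mathbb R^d_p)$; the matrix $\mathcal C$ is nonnegative, i.e. $\sum_{i,j}\xi_i\xi_j\langle \mathcal C_{ij},\chi\rangle\ge0$ for all $\xi\in\mathbb R^d$ and all $0\le\chi\in C_c^\infty(\mathbb R_t\times\mathbb R^d_x)$; the limit $$\mathcal F=\lim_{n\to\infty}\mathrm{div}_p(\nabla_xV_B^{\varepsilon_n}\beta^{\varepsilon_n})$$ exists in $\mathcal D'(\mathbb R_t\times\mathbb R^d_x\times\mathbb R^d_p)$; and its first moment in $p$ satisfies $$\int_{\mathbb R^d_p}p\,\mathcal F(t,x,p)\,dp=-\,\mathrm{div}_x\big(\mathcal A(t,x)+\mathcal C(t,x)\big)\quad\text{in }\mathcal D'(\mathbb R_t\times\mathbb R^d_x).$$ Here the moment $\int p_i\mathcal F\,dp$ is the distribution $\chi\mapsto\lim_{n\to\infty}\langle\mathcal F,\chi(t,x)\,p_i\,\theta(p/(n+1))\rangle$, the limit existing and having the same value for every $\theta\in C_c^\infty(\mathbb R^d)$ that equals $1$ near $0$. -/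

import Mathlib

open MeasureTheory Filter Topology TopologicalSpace
open scoped Distributions LineDeriv ENNReal ZeroAtInfty

noncomputable section

namespace Bohm

/-- The space `ℝ^d` with its Euclidean structure. -/
abbrev Sp (d : ℕ) : Type := EuclideanSpace ℝ (Fin d)

/-- The `i`-th standard basis vector of `ℝ^d`. -/
abbrev basisVec {d : ℕ} (i : Fin d) : Sp d := EuclideanSpace.single i (1 : ℝ)

/-- The space `L²(ℝ^d; ℂ)`. -/
abbrev L2 (d : ℕ) : Type := Lp ℂ 2 (volume : Measure (Sp d))

/-! ### Weak derivatives -/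

/-- `g` is the weak (distributional) partial derivative `∂_i f` on `ℝ^d`; both functions are
locally integrable. -/
def HasWeakPartial {d : ℕ} {F : Type*} [NormedAddCommGroup F] [NormedSpace ℝ F]
    (i : Fin d) (f g : Sp d → F) : Prop :=
  LocallyIntegrable f volume ∧ LocallyIntegrable g volume ∧
    ∀ φ : 𝓓((⊤ : Opens (Sp d)), ℝ),
      ∫ x, (∂_{basisVec i} φ) x • f x = - ∫ x, φ x • g x

open Classical in
/-- The weak partial derivative `∂_i f` (unique up to null sets; zero if there is none). -/
def weakPartial {d : ℕ} {F : Type*} [NormedAddCommGroup F] [NormedSpace ℝ F]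
    (i : Fin d) (f : Sp d → F) : Sp d → F :=
  if h : ∃ g, HasWeakPartial i f g then h.choose else 0

/-- `g` is the weak partial derivative `∂_i f` on the (not necessarily open) set `S`: up to a null
set, `S` is covered by countably many sets on each of which the pair `(f, g)` coincides with a pair
`(fₙ, ∂_i fₙ)`, where `fₙ` is weakly differentiable on `ℝ^d`. Since the weak gradient of a function
vanishes almost everywhere on the zero set of the function, this determines `g` almost everywhere on
`S`. On an open set `S` every weak derivative in the usual sense is of this kind (multiply `f` by
smooth cutoff functions), and so are the classical derivatives. -/
def HasPartialOn {d : ℕ} (S : Set (Sp d)) (i : Fin d) (f g : Sp d → ℝ) : Prop :=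
  ∃ fn gn : ℕ → Sp d → ℝ, (∀ n, HasWeakPartial i (fn n) (gn n)) ∧
    ∀ᵐ x, x ∈ S → ∃ n, f x = fn n x ∧ g x = gn n x

open Classical in
/-- The weak partial derivative `∂_i f` on the set `S` (unique almost everywhere on `S`; zero if
there is none). -/
def partialOn {d : ℕ} (S : Set (Sp d)) (i : Fin d) (f : Sp d → ℝ) : Sp d → ℝ :=
  if h : ∃ g, HasPartialOn S i f g then h.choose else 0

/-! ### Densities, Bohm potential, Bohmian measure -/

/-- The position density `ρ = |ψ|²`. -/
def density {d : ℕ} (ψ : Sp d → ℂ) (x : Sp d) : ℝ := ‖ψ x‖ ^ 2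

/-- The `i`-th component of the current density `J = ε Im (conj ψ ∇ψ)`. -/
def current {d : ℕ} (ε : ℝ) (ψ : Sp d → ℂ) (i : Fin d) (x : Sp d) : ℝ :=
  ε * ((starRingEnd ℂ) (ψ x) * weakPartial i ψ x).im

/-- The velocity field `u = J / ρ` (only its values on `{ρ > 0}` matter). -/
def velocity {d : ℕ} (ε : ℝ) (ψ : Sp d → ℂ) (x : Sp d) : Sp d :=
  WithLp.toLp 2 fun i => current ε ψ i x / density ψ x

/-- The square root of the density. -/
def sqrtDensity {d : ℕ} (ψ : Sp d → ℂ) (x : Sp d) : ℝ := Real.sqrt (density ψ x)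

/-- The set `{ρ > 0}`, on which the Bohm potential is defined. -/
def posSet {d : ℕ} (ψ : Sp d → ℂ) : Set (Sp d) := {x | 0 < density ψ x}

/-- The Bohm potential `V_B = - (ε² / 2) Δ√ρ / √ρ`, defined on `{ρ > 0}`. -/
def bohmPotential {d : ℕ} (ε : ℝ) (ψ : Sp d → ℂ) (x : Sp d) : ℝ :=
  - (ε ^ 2 / 2) *
    ((∑ i : Fin d, partialOn (posSet ψ) i (partialOn (posSet ψ) i (sqrtDensity ψ)) x) /
      sqrtDensity ψ x)

/-- The `i`-th component of `∇_x V_B`, defined on `{ρ > 0}`. -/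
def gradBohmPotential {d : ℕ} (ε : ℝ) (ψ : Sp d → ℂ) (i : Fin d) : Sp d → ℝ :=
  partialOn (posSet ψ) i (bohmPotential ε ψ)

/-- The Bohmian measure `β[ψ] = ρ(x) δ(p - J(x)/ρ(x))` on phase space, i.e. the push-forward of
`ρ dx` under `x ↦ (x, J(x)/ρ(x))`. -/
def bohmianMeasure {d : ℕ} (ε : ℝ) (ψ : Sp d → ℂ) : Measure (Sp d × Sp d) :=
  Measure.map (fun x => (x, velocity ε ψ x))
    ((volume : Measure (Sp d)).withDensity fun x => ENNReal.ofReal (density ψ x))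

/-! ### The Schrödinger equation -/

/-- `V ∈ C¹_b(ℝ^d; ℝ)`. -/
def IsC1Bounded {d : ℕ} (V : Sp d → ℝ) : Prop :=
  ContDiff ℝ 1 V ∧ ∃ M : ℝ, ∀ x, |V x| ≤ M ∧ ‖fderiv ℝ V x‖ ≤ M

/-- The `L²` function `ψ` belongs to the Sobolev space `H^s(ℝ^d)`. -/
def MemH {d : ℕ} (s : ℝ) (ψ : L2 d) : Prop :=
  TemperedDistribution.MemSobolev s 2 (ψ : TemperedDistribution (Sp d) ℂ)

/-- `ψ` is the classical (in the sense of semigroup theory) solution of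
`i ε ∂_t ψ = - (ε²/2) Δ ψ + V ψ`, `ψ(0) = ψ₀`, for all times `t ∈ ℝ`: it is continuously
differentiable with values in `L²`, takes its values in the domain `H²` of the Hamiltonian, and
satisfies the equation in `L²`. -/
structure IsSchrodingerSolution {d : ℕ} (V : Sp d → ℝ) (ε : ℝ) (ψ₀ : L2 d) (ψ : ℝ → L2 d) :
    Prop where
  initial : ψ 0 = ψ₀
  contDiff : ContDiff ℝ 1 ψ
  memH2 : ∀ t, MemH 2 (ψ t)
  equation : ∀ t, ∀ᵐ x, Complex.I * (ε : ℂ) * (deriv ψ t : L2 d) x =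
    - ((ε : ℂ) ^ 2 / 2) * (∑ i : Fin d, weakPartial i (weakPartial i (ψ t)) x) +
      (V x : ℂ) * ψ t x

/-- The energy `(ε²/2) ∫ |∇ψ|² dx + ∫ V |ψ|² dx`. -/
def energy {d : ℕ} (V : Sp d → ℝ) (ε : ℝ) (ψ : L2 d) : ℝ :=
  ε ^ 2 / 2 * (∫ x, ∑ i : Fin d, ‖weakPartial i ψ x‖ ^ 2) + ∫ x, V x * ‖ψ x‖ ^ 2

/-! ### Test functions and distributions in time, space and momentum -/

/-- Test functions on `ℝ_t × ℝ^d_x`. -/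
abbrev TestTX (d : ℕ) : Type := 𝓓((⊤ : Opens (ℝ × Sp d)), ℝ)

/-- Test functions on `ℝ_t × ℝ^d_x × ℝ^d_p`. -/
abbrev TestTXP (d : ℕ) : Type := 𝓓((⊤ : Opens (ℝ × Sp d × Sp d)), ℝ)

/-- Distributions on `ℝ_t × ℝ^d_x`. -/
abbrev DistTX (d : ℕ) : Type := 𝓓'((⊤ : Opens (ℝ × Sp d)), ℝ)

/-- Distributions on `ℝ_t × ℝ^d_x × ℝ^d_p`. -/
abbrev DistTXP (d : ℕ) : Type := 𝓓'((⊤ : Opens (ℝ × Sp d × Sp d)), ℝ)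

/-- The `i`-th component `∑_j ∂_{x_j} T_{ij}` of the spatial divergence of a matrix valued
distribution. -/
def divergence {d : ℕ} (T : Fin d → Fin d → DistTX d) (i : Fin d) : DistTX d :=
  ∑ j : Fin d, ∂_{((0 : ℝ), basisVec j)} (T i j)

/-- The test function `χ(t,x) p_i θ(p/(n+1))`. -/
def momentTest {d : ℕ} (χ : TestTX d) (θ : 𝓓((⊤ : Opens (Sp d)), ℝ)) (i : Fin d) (n : ℕ) :
    TestTXP d where
  toFun z := χ (z.1, z.2.1) * (z.2.2 i * θ (((n : ℝ) + 1)⁻¹ • z.2.2))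
  contDiff' := by
    have h1 := χ.contDiff
    have h2 := θ.contDiff
    have h3 : ContDiff ℝ (⊤ : ℕ∞) (fun z : ℝ × Sp d × Sp d => z.2.2 i) := by fun_prop
    refine (h1.comp (by fun_prop : ContDiff ℝ (⊤ : ℕ∞)
      (fun z : ℝ × Sp d × Sp d => (z.1, z.2.1)))).mul (h3.mul (h2.comp ?_))
    fun_prop
  hasCompactSupport' := by
    have hn : ((n : ℝ) + 1)⁻¹ ≠ 0 := by positivity
    have hθ : HasCompactSupport fun p : Sp d => θ (((n : ℝ) + 1)⁻¹ • p) :=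
      θ.hasCompactSupport.comp_smul hn
    let g : (ℝ × Sp d) × Sp d → ℝ × Sp d × Sp d := fun w => (w.1.1, w.1.2, w.2)
    refine HasCompactSupport.intro
      ((χ.hasCompactSupport.isCompact.prod hθ.isCompact).image (by fun_prop : Continuous g)) ?_
    intro z hz
    by_contra hne
    refine hz ⟨((z.1, z.2.1), z.2.2), ⟨subset_tsupport _ ?_, subset_tsupport _ ?_⟩, rfl⟩
    · exact fun h => hne (by simp [h])
    · exact fun h => hne (by simp [show θ (((n : ℝ) + 1)⁻¹ • z.2.2) = 0 from h])
  tsupport_subset' := fun _ _ => trivial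

/-- The distribution `m` is the `i`-th component of the first momentum moment
`∫ p F(t,x,p) dp` of `F`: the limit of `⟨F, χ(t,x) p_i θ(p/R)⟩` as `R → ∞` is `⟨m, χ⟩`, for every
cutoff function `θ ∈ C_c^∞` that equals one near the origin. -/
def HasFirstMoment {d : ℕ} (F : DistTXP d) (i : Fin d) (m : DistTX d) : Prop :=
  ∀ (χ : TestTX d) (θ : 𝓓((⊤ : Opens (Sp d)), ℝ)), (∀ᶠ p in 𝓝 (0 : Sp d), θ p = 1) →
    Tendsto (fun n : ℕ => F (momentTest χ θ i n)) atTop (𝓝 (m χ))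

/-- `∇_x V_B · ∇_p φ` at `(t, x, p)`. -/
def bohmForceTest {d : ℕ} (ε : ℝ) (ψ : ℝ → L2 d) (φ : TestTXP d) (t : ℝ) (z : Sp d × Sp d) : ℝ :=
  ∑ i : Fin d, gradBohmPotential ε (ψ t) i z.1 *
    (∂_{((0 : ℝ), (0 : Sp d), basisVec i)} φ) (t, z)

/-- The integrals defining the distribution `div_p (∇_x V_B β)` converge absolutely. -/
def BohmForceIntegrable {d : ℕ} (ε : ℝ) (ψ : ℝ → L2 d) (φ : TestTXP d) : Prop :=
  (∀ t, Integrable (bohmForceTest ε ψ φ t) (bohmianMeasure ε (ψ t))) ∧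
    Integrable fun t => ∫ z, |bohmForceTest ε ψ φ t z| ∂(bohmianMeasure ε (ψ t))

/-- The distribution `div_p (∇_x V_B β)` applied to a test function,
`- ∫ ∬ ∇_x V_B · ∇_p φ dβ(t) dt`. -/
def bohmForce {d : ℕ} (ε : ℝ) (ψ : ℝ → L2 d) (φ : TestTXP d) : ℝ :=
  - ∫ t, ∫ z, bohmForceTest ε ψ φ t z ∂(bohmianMeasure ε (ψ t))

/-! ### Limits -/

/-- `β ∈ L^∞(ℝ_t; M⁺(ℝ^d_x × ℝ^d_p))`. -/
def IsLinftyMeasure {d : ℕ} (β : ℝ → Measure (Sp d × Sp d)) : Prop :=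
  AEMeasurable β volume ∧ ∃ M : ℝ≥0∞, M < ∞ ∧ ∀ᵐ t, β t Set.univ ≤ M

/-- `βₙ → β` in `L^∞(ℝ_t; M⁺(ℝ^d_x × ℝ^d_p))` weak-*, i.e. tested against all
`g ∈ L¹(ℝ_t; C₀(ℝ^d_x × ℝ^d_p))`. -/
def TendstoWeakStar {d : ℕ} (βn : ℕ → ℝ → Measure (Sp d × Sp d))
    (β : ℝ → Measure (Sp d × Sp d)) : Prop :=
  ∀ g : ℝ → C₀(Sp d × Sp d, ℝ), Integrable g →
    Tendsto (fun n => ∫ t, ∫ z, g t z ∂(βn n t)) atTop (𝓝 (∫ t, ∫ z, g t z ∂(β t)))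

/-- `⟨ε² ∂_i√ρ ∂_j√ρ, χ⟩`. -/
def quantumStress {d : ℕ} (ε : ℝ) (ψ : ℝ → L2 d) (i j : Fin d) (χ : TestTX d) : ℝ :=
  ∫ t, ∫ x, ε ^ 2 * (weakPartial i (sqrtDensity (ψ t)) x * weakPartial j (sqrtDensity (ψ t)) x) *
    χ (t, x)

/-- `⟨J_i J_j / ρ, χ⟩`. -/
def convectiveStress {d : ℕ} (ε : ℝ) (ψ : ℝ → L2 d) (i j : Fin d) (χ : TestTX d) : ℝ :=
  ∫ t, ∫ x, current ε (ψ t) i x * current ε (ψ t) j x / density (ψ t) x * χ (t, x)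

/-- `⟨∫ p_i p_j β(t,x,dp), χ⟩`. -/
def secondMoment {d : ℕ} (β : ℝ → Measure (Sp d × Sp d)) (i j : Fin d) (χ : TestTX d) : ℝ :=
  ∫ t, ∫ z, z.2 i * z.2 j * χ (t, z.1) ∂(β t)

/-- A matrix valued distribution `T` is nonnegative: `∑ ξ_i ξ_j T_{ij} ≥ 0` for all `ξ`. -/
def IsNonnegMatrix {d : ℕ} (T : Fin d → Fin d → DistTX d) : Prop :=
  ∀ (ξ : Fin d → ℝ) (χ : TestTX d), (∀ y, 0 ≤ χ y) →
    0 ≤ ∑ i : Fin d, ∑ j : Fin d, ξ i * ξ j * T i j χ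

end Bohm

end

/-! On `{ρ > 0}` the velocity `u = J/ρ` of a regular solution obeys `∂_t ρ + div J = 0` and `ρ (∂_t
u + u·∇u) = -ρ ∇V - ρ ∇V_B`. Integrating `∂_t (ρ φ(t,x,u)) + div (J φ(t,x,u))` over space-time gives
zero. By the two equations this says `⟨div_p(∇V_B β^ε), φ⟩ = -∬ (∂_t φ + p·∇_x φ - ∇V·∇_p φ) dβ^ε
dt` (`RegSol.bohmForce_eq`). The right side tests `β^ε` against a continuous compactly supported
function, so it passes to the weak-* limit. This produces `F`, given by the same formula with `β`.

Testing `F` with `χ p_i θ(p/R)` and letting `R → ∞` yields `-∬ (p_i ∂_t χ - χ ∂_i V + ∑_j p_i p_j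
∂_j χ) dβ dt` (`TendstoWeakStar.tendsto_firstMoment`); the domination comes from the second moment
of `β`, which the energy controls. The momentum balance of the Schrödinger equation contains the
same terms for `β^ε`, except that the stress is `ε² Re (conj ∂_iψ ∂_jψ)`, which equals `J_i J_j/ρ +
ε² ∂_i√ρ ∂_j√ρ`, and a dispersive remainder of order `ε` appears (`RegSol.momentum_stress`,
`exists_dispersion_bound`). Moments of linear growth converge because second moments are uniformly
bounded; the stresses converge to `∫ p⊗p dβ + C + A` by hypothesis. Subtracting the limit balance
from the moment of `F` leaves `-div (A + C)`. The matrix `C` is nonnegative since the second moments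
`∬ (ξ·p)² χ dβ dt` are lower semicontinuous.

Two points need care. First, `∇V_B` contains third derivatives of `ψ`, while `V` is only `C¹`. It
suffices that `∂_j ∂_t ψ` stays in `L²`: then `∂_j Δψ` is read off the equation. This is propagated
from the `H³` data by a Cauchy estimate for spatial difference quotients
(`IsSol.exists_hasDirDeriv`). Derivatives in `L^p` are treated throughout as derivatives of the
translation group, and nonlinear functions of them through `hasDerivAt_integral_comp`, which
requires only quadratic growth.

Second, `u` is singular at the nodes `ρ = 0`. It is replaced by `u_δ = J/(ρ+δ)`. Since `ρ` and `|J|`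
are at most `(1+|u_δ|)(ρ+δ)` and the test function confines `u_δ` to a bounded set, every term is
bounded by the squared jet of `ψ` uniformly in `δ` (`abs_wt_mul_norm_dvel_le`). Dominated
convergence as `δ → 0` then gives both the absolute convergence of the force integrals and the
identity. -/

namespace Bohm

/-! ### Translations and directional derivatives in `L^p` -/

section Translation

variable {d : ℕ} {F : Type*} [NormedAddCommGroup F] [NormedSpace ℝ F] {p : ℝ≥0∞}
  [Fact (1 ≤ p)]

/-- Translation `f ↦ f (· + v)` as a linear isometry of `L^p`. -/
noncomputable def translate (v : Sp d) :
    Lp F p (volume : Measure (Sp d)) →ₗᵢ[ℝ] Lp F p (volume : Measure (Sp d)) :=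
  Lp.compMeasurePreservingₗᵢ ℝ (fun x => x + v) (measurePreserving_add_right volume v)

theorem coeFn_translate (v : Sp d) (f : Lp F p (volume : Measure (Sp d))) :
    translate v f =ᵐ[volume] fun x => f (x + v) :=
  Lp.coeFn_compMeasurePreserving f (measurePreserving_add_right volume v)

theorem ae_comp_add {P : Sp d → Prop} (h : ∀ᵐ x, P x) (v : Sp d) : ∀ᵐ x, P (x + v) :=
  (measurePreserving_add_right volume v).quasiMeasurePreserving.ae h

theorem translate_translate (v w : Sp d) (f : Lp F p (volume : Measure (Sp d))) :
    translate v (translate w f) = translate (v + w) f := by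
  apply Lp.ext
  filter_upwards [coeFn_translate v (translate w f), coeFn_translate (v + w) f,
    ae_comp_add (coeFn_translate w f) v] with x h1 h2 h3
  rw [h1, h2, h3, add_assoc]

@[simp]
theorem translate_zero (f : Lp F p (volume : Measure (Sp d))) :
    translate (0 : Sp d) f = f := by
  apply Lp.ext
  filter_upwards [coeFn_translate 0 f] with x h1
  rw [h1, add_zero]

theorem continuous_translate (hp : p ≠ ∞) (f : Lp F p (volume : Measure (Sp d))) :
    Continuous fun v : Sp d => translate v f := by
  have hg : Continuous fun v : Sp d => (⟨fun x => x + v, by fun_prop⟩ : C(Sp d, Sp d)) :=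
    ContinuousMap.continuous_of_continuous_uncurry _
      (show Continuous fun q : Sp d × Sp d => q.2 + q.1 by fun_prop)
  exact (continuous_const (y := f)).compMeasurePreservingLp hg
    (fun v => measurePreserving_add_right volume v) hp

/-- `g` is the derivative of `f` along `v` in the sense of `L^p`. -/
def HasDirDeriv (v : Sp d) (f g : Lp F p (volume : Measure (Sp d))) : Prop :=
  HasDerivAt (fun s : ℝ => translate (s • v) f) g 0

theorem HasDirDeriv.unique {v : Sp d} {f g h : Lp F p (volume : Measure (Sp d))}
    (hg : HasDirDeriv v f g) (hh : HasDirDeriv v f h) : g = h :=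
  HasDerivAt.unique hg hh

theorem HasDirDeriv.add {v : Sp d} {f g f' g' : Lp F p (volume : Measure (Sp d))}
    (hf : HasDirDeriv v f f') (hg : HasDirDeriv v g g') : HasDirDeriv v (f + g) (f' + g') := by
  have := HasDerivAt.add hf hg
  refine this.congr_of_eventuallyEq (Eventually.of_forall fun r => ?_)
  simp

theorem HasDirDeriv.neg {v : Sp d} {f f' : Lp F p (volume : Measure (Sp d))}
    (hf : HasDirDeriv v f f') : HasDirDeriv v (-f) (-f') := by
  have := HasDerivAt.neg hf
  refine this.congr_of_eventuallyEq (Eventually.of_forall fun r => ?_)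
  simp

theorem HasDirDeriv.sub {v : Sp d} {f g f' g' : Lp F p (volume : Measure (Sp d))}
    (hf : HasDirDeriv v f f') (hg : HasDirDeriv v g g') : HasDirDeriv v (f - g) (f' - g') := by
  simpa [sub_eq_add_neg] using hf.add hg.neg

theorem hasDirDeriv_zero (v : Sp d) :
    HasDirDeriv v (0 : Lp F p (volume : Measure (Sp d))) 0 := by
  simpa [HasDirDeriv] using hasDerivAt_const (0 : ℝ) (0 : Lp F p (volume : Measure (Sp d)))

theorem HasDirDeriv.sum {ι : Type*} (s : Finset ι) {v : Sp d}
    {f f' : ι → Lp F p (volume : Measure (Sp d))}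
    (hf : ∀ i ∈ s, HasDirDeriv v (f i) (f' i)) :
    HasDirDeriv v (∑ i ∈ s, f i) (∑ i ∈ s, f' i) := by
  classical
  induction s using Finset.induction_on with
  | empty => simpa using hasDirDeriv_zero v
  | insert a s ha ih =>
    rw [Finset.sum_insert ha, Finset.sum_insert ha]
    exact (hf a (by simp)).add (ih fun i hi => hf i (by simp [hi]))

/-- Bounded linear maps that commute with translations preserve directional derivatives. -/
theorem HasDirDeriv.map {F' : Type*} [NormedAddCommGroup F'] [NormedSpace ℝ F']
    {v : Sp d} {f f' : Lp F p (volume : Measure (Sp d))} (hf : HasDirDeriv v f f')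
    (L : Lp F p (volume : Measure (Sp d)) →L[ℝ] Lp F' p (volume : Measure (Sp d)))
    (hL : ∀ w g, L (translate w g) = translate w (L g)) : HasDirDeriv v (L f) (L f') := by
  have h := L.hasFDerivAt.comp_hasDerivAt (0 : ℝ) hf
  refine h.congr_of_eventuallyEq (Eventually.of_forall fun r => ?_)
  simp [hL]

theorem compLp_translate {F' : Type*} [NormedAddCommGroup F'] [NormedSpace ℝ F'] (T : F →L[ℝ] F')
    (w : Sp d) (g : Lp F p (volume : Measure (Sp d))) :
    T.compLp (translate w g) = translate w (T.compLp g) := by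
  apply Lp.ext
  filter_upwards [T.coeFn_compLp (translate w g), coeFn_translate w g,
    coeFn_translate w (T.compLp g), ae_comp_add (T.coeFn_compLp g) w] with x h1 h2 h3 h4
  rw [h1, h2, h3, h4]

theorem HasDirDeriv.compLp {F' : Type*} [NormedAddCommGroup F'] [NormedSpace ℝ F']
    {v : Sp d} {f f' : Lp F p (volume : Measure (Sp d))} (hf : HasDirDeriv v f f')
    (T : F →L[ℝ] F') : HasDirDeriv v (T.compLp f) (T.compLp f') :=
  hf.map (T.compLpL p volume) fun w g => compLp_translate T w g

end Translation

/-! ### Pairing with test functions -/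

section Pairing

variable {d : ℕ} {F : Type*} [NormedAddCommGroup F] [NormedSpace ℝ F] {p : ℝ≥0∞}
  [Fact (1 ≤ p)]

omit [NormedSpace ℝ F] in
theorem lp_locallyIntegrable (f : Lp F p (volume : Measure (Sp d))) :
    LocallyIntegrable f volume :=
  (Lp.memLp f).locallyIntegrable Fact.out

/-- A test function lies in every Lebesgue space, in particular in the one dual to `L^p`, so Hölder
gives boundedness. The functional carries limits and derivatives in `L^p` over to pairings. -/
theorem exists_pairing [CompleteSpace F] {φ : Sp d → ℝ} (hφ : Continuous φ)
    (hc : HasCompactSupport φ) :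
    ∃ T : Lp F p (volume : Measure (Sp d)) →L[ℝ] F, ∀ f, T f = ∫ x, φ x • f x := by
  have : Fact (1 ≤ p.conjExponent) := ⟨ENNReal.HolderConjugate.one_le (p := p.conjExponent) (q := p)⟩
  have hm : MemLp φ p.conjExponent volume := hφ.memLp_of_hasCompactSupport hc
  refine ⟨(ContinuousLinearMap.lsmul ℝ ℝ : ℝ →L[ℝ] F →L[ℝ] F).lpPairing volume p.conjExponent p
    (hm.toLp φ), fun f => ?_⟩
  rw [ContinuousLinearMap.lpPairing_eq_integral]
  refine integral_congr_ae ?_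
  filter_upwards [hm.coeFn_toLp] with x hx
  simp [hx]

theorem lp_eq_zero_of_pairing (f : Lp F p (volume : Measure (Sp d))) [CompleteSpace F]
    (h : ∀ φ : Sp d → ℝ, ContDiff ℝ (⊤ : ℕ∞) φ → HasCompactSupport φ → ∫ x, φ x • f x = 0) :
    f = 0 := by
  have := ae_eq_zero_of_integral_contDiff_smul_eq_zero (lp_locallyIntegrable f) h
  apply Lp.ext
  filter_upwards [this, Lp.coeFn_zero F p (volume : Measure (Sp d))] with x h1 h2
  rw [h1, h2]; rfl

/-- A curve in `L^p` whose pairings with test functions are differentiable, the derivative being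
given by a continuous curve, is differentiable. -/
theorem hasDerivAt_of_pairing [CompleteSpace F] {f g : ℝ → Lp F p (volume : Measure (Sp d))}
    (hg : Continuous g)
    (h : ∀ φ : Sp d → ℝ, ContDiff ℝ (⊤ : ℕ∞) φ → HasCompactSupport φ →
      ∀ t, HasDerivAt (fun t => ∫ x, φ x • f t x) (∫ x, φ x • g t x) t) (t : ℝ) :
    HasDerivAt f (g t) t := by
  -- Both sides agree at time zero, and the pairing of their difference with any test function has
  -- zero derivative. The primitive of the continuous curve `g` is differentiable in norm, and `f`
  -- inherits this.
  have key : ∀ t, f t = f 0 + ∫ s in (0 : ℝ)..t, g s := by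
    intro t
    rw [← sub_eq_zero]
    apply lp_eq_zero_of_pairing
    intro φ hφ hc
    obtain ⟨T, hT⟩ := exists_pairing (F := F) (p := p) hφ.continuous hc
    have hT' : ∀ t, HasDerivAt (fun t => T (f t - (f 0 + ∫ s in (0 : ℝ)..t, g s))) 0 t := by
      intro t
      have h1 : HasDerivAt (fun t => T (f t)) (T (g t)) t := by
        simpa only [hT] using h φ hφ hc t
      have h2 : HasDerivAt (fun t => ∫ s in (0 : ℝ)..t, g s) (g t) t :=
        intervalIntegral.integral_hasDerivAt_right (hg.intervalIntegrable _ _)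
          (hg.stronglyMeasurableAtFilter _ _) hg.continuousAt
      have h3 := T.hasFDerivAt.comp_hasDerivAt t (h2.const_add (f 0))
      have h4 := h1.sub h3
      simp only [sub_self] at h4
      refine h4.congr_of_eventuallyEq (Eventually.of_forall fun r => ?_)
      simp [map_sub]
    have hconst := is_const_of_deriv_eq_zero (fun t => (hT' t).differentiableAt)
      (fun t => (hT' t).deriv) t 0
    rw [← hT, hconst]
    simp
  have h2 : HasDerivAt (fun t => ∫ s in (0 : ℝ)..t, g s) (g t) t :=
    intervalIntegral.integral_hasDerivAt_right (hg.intervalIntegrable _ _)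
      (hg.stronglyMeasurableAtFilter _ _) hg.continuousAt
  refine (h2.const_add (f 0)).congr_of_eventuallyEq (Eventually.of_forall key)

end Pairing

end Bohm

/-! ### Weak partial derivatives and their agreement with derivatives of translates -/

namespace Bohm

section Weak

variable {d : ℕ} {F : Type*} [NormedAddCommGroup F] [NormedSpace ℝ F]

/-- A smooth compactly supported function as a test function. -/
def mkTest {φ : Sp d → ℝ} (hφ : ContDiff ℝ (⊤ : ℕ∞) φ) (hc : HasCompactSupport φ) :
    𝓓((⊤ : Opens (Sp d)), ℝ) where
  toFun := φ
  contDiff' := hφ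
  hasCompactSupport' := hc
  tsupport_subset' := fun _ _ => trivial

theorem lineDerivOp_test_apply {E : Type*} [NormedAddCommGroup E] [NormedSpace ℝ E]
    {Ω : Opens E} (φ : 𝓓(Ω, ℝ)) (v x : E) : (∂_{v} φ) x = fderiv ℝ φ x v := by
  rw [TestFunction.lineDerivOp_eq_lineDerivCLM ℝ,
    TestFunction.lineDerivCLM_apply_of_le (by simp)]
  exact (φ.contDiff.differentiable (by simp)).differentiableAt.lineDeriv_eq_fderiv

theorem hasWeakPartial_iff {i : Fin d} {f g : Sp d → F} :
    HasWeakPartial i f g ↔ LocallyIntegrable f volume ∧ LocallyIntegrable g volume ∧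
      ∀ φ : Sp d → ℝ, ContDiff ℝ (⊤ : ℕ∞) φ → HasCompactSupport φ →
        ∫ x, fderiv ℝ φ x (basisVec i) • f x = - ∫ x, φ x • g x := by
  unfold HasWeakPartial
  refine and_congr_right fun _ => and_congr_right fun _ => ⟨fun h φ hφ hc => ?_, fun h φ => ?_⟩
  · have := h (mkTest hφ hc)
    simp only [lineDerivOp_test_apply] at this
    exact this
  · simp only [lineDerivOp_test_apply]
    exact h φ φ.contDiff φ.hasCompactSupport

theorem HasWeakPartial.congr {i : Fin d} {f g f' g' : Sp d → F} (h : HasWeakPartial i f g)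
    (hf : f =ᵐ[volume] f') (hg : g =ᵐ[volume] g') : HasWeakPartial i f' g' := by
  obtain ⟨h1, h2, h3⟩ := h
  refine ⟨h1.congr hf, h2.congr hg, fun φ => ?_⟩
  have e1 : ∫ x, φ x • g x = ∫ x, φ x • g' x :=
    integral_congr_ae (hg.mono fun x hx => by simp only [hx])
  have e2 : ∫ x, (∂_{basisVec i} φ) x • f x = ∫ x, (∂_{basisVec i} φ) x • f' x :=
    integral_congr_ae (hf.mono fun x hx => by simp only [hx])
  rw [← e1, ← e2]
  exact h3 φ

theorem HasWeakPartial.unique [CompleteSpace F] {i : Fin d} {f g g' : Sp d → F}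
    (h : HasWeakPartial i f g) (h' : HasWeakPartial i f g') : g =ᵐ[volume] g' := by
  obtain ⟨_, h2, h3⟩ := hasWeakPartial_iff.1 h
  obtain ⟨_, h2', h3'⟩ := hasWeakPartial_iff.1 h'
  refine ae_eq_of_integral_contDiff_smul_eq h2 h2' fun φ hφ hc => ?_
  have := (h3 φ hφ hc).symm.trans (h3' φ hφ hc)
  exact neg_injective this

theorem HasWeakPartial.weakPartial_eq [CompleteSpace F] {i : Fin d} {f g : Sp d → F}
    (h : HasWeakPartial i f g) : weakPartial i f =ᵐ[volume] g := by
  have h' : ∃ g, HasWeakPartial i f g := ⟨g, h⟩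
  unfold weakPartial
  rw [dif_pos h']
  exact h'.choose_spec.unique h

theorem integrable_test_smul {φ : Sp d → ℝ} (hφ : Continuous φ) (hc : HasCompactSupport φ)
    {f : Sp d → F} (hf : LocallyIntegrable f volume) : Integrable (fun x => φ x • f x) :=
  hf.integrable_smul_left_of_hasCompactSupport hφ hc

theorem HasWeakPartial.sub {i : Fin d} {f g f' g' : Sp d → F}
    (h : HasWeakPartial i f f') (h' : HasWeakPartial i g g') :
    HasWeakPartial i (fun x => f x - g x) (fun x => f' x - g' x) := by
  rw [hasWeakPartial_iff] at h h' ⊢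
  obtain ⟨h1, h2, h3⟩ := h
  obtain ⟨h1', h2', h3'⟩ := h'
  refine ⟨h1.sub h1', h2.sub h2', fun φ hφ hc => ?_⟩
  have hd : Continuous fun x => fderiv ℝ φ x (basisVec i) :=
    (hφ.continuous_fderiv (by simp)).clm_apply continuous_const
  have hdc : HasCompactSupport fun x => fderiv ℝ φ x (basisVec i) := hc.fderiv_apply ℝ _
  simp only [smul_sub]
  rw [integral_sub (integrable_test_smul hd hdc h1) (integrable_test_smul hd hdc h1'),
    integral_sub (integrable_test_smul hφ.continuous hc h2)
      (integrable_test_smul hφ.continuous hc h2'), h3 φ hφ hc, h3' φ hφ hc]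
  abel

/-- Translating a test function is differentiable under the integral sign. -/
theorem hasDerivAt_integral_test_translate {φ : Sp d → ℝ} (hφ : ContDiff ℝ (⊤ : ℕ∞) φ)
    (hc : HasCompactSupport φ) (v : Sp d) {f : Sp d → F} (hf : LocallyIntegrable f volume)
    (t : ℝ) :
    HasDerivAt (fun s : ℝ => ∫ x, φ (x - s • v) • f x)
      (∫ x, (-(fderiv ℝ φ (x - t • v) v)) • f x) t := by
  -- `K` is compact and contains the supports of all translates with `|s - t| ≤ 1`, so `M ‖f‖`
  -- restricted to `K` is an integrable majorant although `f` is only locally integrable.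
  let K : Set (Sp d) := (fun q : Sp d × ℝ => q.1 + q.2 • v) '' (tsupport φ ×ˢ Metric.closedBall t 1)
  have hK : IsCompact K := (hc.isCompact.prod (isCompact_closedBall t 1)).image (by fun_prop)
  have hd : Continuous fun x => fderiv ℝ φ x v :=
    (hφ.continuous_fderiv (by simp)).clm_apply continuous_const
  have hdc : HasCompactSupport fun x => fderiv ℝ φ x v := hc.fderiv_apply ℝ _
  obtain ⟨M, hM⟩ := hd.bounded_above_of_compact_support hdc
  have hcs : ∀ s : ℝ, HasCompactSupport fun x => φ (x - s • v) := fun s =>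
    hc.comp_homeomorph (Homeomorph.subRight (s • v))
  have hdcs : ∀ s : ℝ, HasCompactSupport fun x => fderiv ℝ φ (x - s • v) v := fun s =>
    hdc.comp_homeomorph (Homeomorph.subRight (s • v))
  refine (hasDerivAt_integral_of_dominated_loc_of_deriv_le (Metric.ball_mem_nhds t one_pos)
    (F := fun s x => φ (x - s • v) • f x)
    (F' := fun s x => (-(fderiv ℝ φ (x - s • v) v)) • f x)
    (bound := K.indicator fun x => M * ‖f x‖) ?_ ?_ ?_ ?_ ?_ ?_).2
  · exact Eventually.of_forall fun s =>
      (integrable_test_smul (by fun_prop) (hcs s) hf).aestronglyMeasurable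
  · exact integrable_test_smul (by fun_prop) (hcs t) hf
  · refine (integrable_test_smul ?_ ?_ hf).aestronglyMeasurable
    · exact (hd.comp (by fun_prop)).neg
    · exact (hdcs t).neg
  · refine Eventually.of_forall fun x s hs => ?_
    by_cases hx : x ∈ K
    · rw [Set.indicator_of_mem hx, norm_smul, norm_neg]
      exact mul_le_mul_of_nonneg_right (hM _) (norm_nonneg _)
    · rw [Set.indicator_of_notMem hx]
      have h0 : fderiv ℝ φ (x - s • v) v = 0 := by
        by_contra hne
        apply hx
        refine ⟨(x - s • v, s), ⟨?_, Metric.ball_subset_closedBall hs⟩, by simp⟩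
        refine tsupport_fderiv_apply_subset ℝ v (subset_tsupport _ ?_)
        exact hne
      rw [h0]; simp
  · rw [integrable_indicator_iff hK.measurableSet]
    exact ((hf.integrableOn_isCompact hK).norm.const_mul M)
  · refine Eventually.of_forall fun x s _ => ?_
    have h1 : HasDerivAt (fun s : ℝ => x - s • v) (-v) s := by
      simpa using ((hasDerivAt_id s).smul_const v).const_sub x
    have h2 := ((hφ.differentiable (by simp)) (x - s • v)).hasFDerivAt.comp_hasDerivAt s h1
    have h3 := h2.smul_const (f x)
    simpa using h3

theorem integral_test_translate {p : ℝ≥0∞} [Fact (1 ≤ p)]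
    (f : Lp F p (volume : Measure (Sp d))) (φ : Sp d → ℝ) (w : Sp d) :
    ∫ x, φ x • translate w f x = ∫ x, φ (x - w) • f x := by
  rw [← integral_add_right_eq_self (fun x => φ (x - w) • f x) w]
  refine integral_congr_ae ?_
  filter_upwards [coeFn_translate w f] with x hx
  rw [hx]; simp

variable {p : ℝ≥0∞} [Fact (1 ≤ p)]

/-- Moving the translation onto the test function, the weak derivative identity says that every
pairing of `s ↦ f(· + s e_i)` has the pairing of the translated `g` as derivative. Translation is
strongly continuous for `p ≠ ∞`, so `hasDerivAt_of_pairing` upgrades this to a norm derivative. -/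
theorem HasWeakPartial.hasDirDeriv [CompleteSpace F] (hp : p ≠ ∞) {i : Fin d}
    {f g : Lp F p (volume : Measure (Sp d))}
    (h : HasWeakPartial i f g) : HasDirDeriv (basisVec i) f g := by
  obtain ⟨h1, h2, h3⟩ := hasWeakPartial_iff.1 h
  have := hasDerivAt_of_pairing (f := fun s : ℝ => translate (s • basisVec i) f)
    (g := fun s : ℝ => translate (s • basisVec i) g)
    ((continuous_translate hp g).comp (by fun_prop)) (fun φ hφ hc t => ?_) 0
  · simpa [HasDirDeriv] using this
  · simp only [integral_test_translate]
    have h4 := hasDerivAt_integral_test_translate hφ hc (basisVec i) h1 t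
    convert h4 using 1
    have h5 := h3 (fun x => φ (x - t • basisVec i)) (by fun_prop)
      (hc.comp_homeomorph (Homeomorph.subRight (t • basisVec i)))
    simp only [fderiv_comp_sub] at h5
    simp only [neg_smul]
    rw [integral_neg, h5, neg_neg]

/-- A bounded functional differentiates along with the curve of translates; the same derivative
computed on the test function gives the defining identity of the weak derivative. -/
theorem HasDirDeriv.hasWeakPartial [CompleteSpace F] {i : Fin d}
    {f g : Lp F p (volume : Measure (Sp d))}
    (h : HasDirDeriv (basisVec i) f g) : HasWeakPartial i f g := by
  refine hasWeakPartial_iff.2 ⟨lp_locallyIntegrable f, lp_locallyIntegrable g, fun φ hφ hc => ?_⟩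
  obtain ⟨T, hT⟩ := exists_pairing (F := F) (p := p) hφ.continuous hc
  have h1 := T.hasFDerivAt.comp_hasDerivAt (0 : ℝ) h
  have h2 := hasDerivAt_integral_test_translate hφ hc (basisVec i) (lp_locallyIntegrable f) 0
  have h3 : T ∘ (fun s : ℝ => translate (s • basisVec i) f) =
      fun s : ℝ => ∫ x, φ (x - s • basisVec i) • f x := by
    ext1 s
    rw [Function.comp, hT, integral_test_translate]
  rw [h3] at h1
  have h4 := h1.unique h2
  rw [hT] at h4
  rw [h4]
  simp [neg_smul, integral_neg]

/-- Weak derivatives of products with test functions. -/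
theorem HasWeakPartial.test_smul {i : Fin d} {f g : Sp d → F} (h : HasWeakPartial i f g)
    {η : Sp d → ℝ} (hη : ContDiff ℝ (⊤ : ℕ∞) η) (hc : HasCompactSupport η) :
    HasWeakPartial i (fun x => η x • f x)
      (fun x => η x • g x + fderiv ℝ η x (basisVec i) • f x) := by
  rw [hasWeakPartial_iff] at h ⊢
  obtain ⟨h1, h2, h3⟩ := h
  have hd : Continuous fun x => fderiv ℝ η x (basisVec i) :=
    (hη.continuous_fderiv (by simp)).clm_apply continuous_const
  have hdc : HasCompactSupport fun x => fderiv ℝ η x (basisVec i) := hc.fderiv_apply ℝ _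
  refine ⟨(integrable_test_smul hη.continuous hc h1).locallyIntegrable,
    ((integrable_test_smul hη.continuous hc h2).add
      (integrable_test_smul hd hdc h1)).locallyIntegrable, fun φ hφ hφc => ?_⟩
  have hdφ : Continuous fun x => fderiv ℝ φ x (basisVec i) :=
    (hφ.continuous_fderiv (by simp)).clm_apply continuous_const
  have h4 := h3 (fun x => φ x * η x) (hφ.mul hη) hφc.mul_right
  have h5 : ∀ x, fderiv ℝ (fun x => φ x * η x) x (basisVec i) =
      fderiv ℝ φ x (basisVec i) * η x + φ x * fderiv ℝ η x (basisVec i) := by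
    intro x
    rw [fderiv_fun_mul (hφ.differentiable (by simp) x) (hη.differentiable (by simp) x)]
    simp; ring
  simp only [h5, add_smul] at h4
  have i1 : Integrable fun x => (fderiv ℝ φ x (basisVec i) * η x) • f x :=
    integrable_test_smul (hdφ.mul hη.continuous) hc.mul_left h1
  have i2 : Integrable fun x => (φ x * fderiv ℝ η x (basisVec i)) • f x :=
    integrable_test_smul (hφ.continuous.mul hd) hφc.mul_right h1
  have i3 : Integrable fun x => (φ x * η x) • g x :=
    integrable_test_smul (hφ.continuous.mul hη.continuous) hφc.mul_right h2
  rw [integral_add i1 i2] at h4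
  simp only [smul_add, smul_smul]
  rw [integral_add i3 i2, neg_add, ← h4]
  abel

/-- If an integrable function vanishes on a set of finite measure, then so does its directional
derivative in `L¹`. -/
theorem HasDirDeriv.ae_eq_zero_on {v : Sp d} {f g : Lp F 1 (volume : Measure (Sp d))}
    (h : HasDirDeriv v f g) {A : Set (Sp d)} (hA : MeasurableSet A) (hAfin : volume A ≠ ∞)
    (hf : ∀ᵐ x, x ∈ A → f x = 0) : ∀ᵐ x, x ∈ A → g x = 0 := by
  let s : ℕ → ℝ := fun k => 1 / ((k : ℝ) + 1)
  have hs0 : ∀ k, s k ≠ 0 := fun k => by positivity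
  have hs : Tendsto s atTop (𝓝 0) := tendsto_one_div_add_atTop_nhds_zero_nat
  let A' : ℕ → Set (Sp d) := fun k => (fun x => x + s k • v) ⁻¹' A
  have hA' : ∀ k, MeasurableSet (A' k) := fun k => (measurable_add_const _) hA
  let D : ℕ → Lp F 1 (volume : Measure (Sp d)) := fun k =>
    (s k)⁻¹ • (translate (s k • v) f - f)
  have hDlim : Tendsto D atTop (𝓝 g) := by
    have := (hasDerivAt_iff_tendsto_slope_zero.1 h).comp
      (tendsto_nhdsWithin_of_tendsto_nhds_of_eventually_within s hs
        (Eventually.of_forall hs0))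
    simpa [Function.comp_def] using this
  -- The quotient vanishes where both `x` and `x + s k • v` lie in `A`. The remaining part `A \ A'
  -- k` has measure tending to zero by continuity of translations in measure, which is where finite
  -- measure enters.
  have hD0 : ∀ k, ∀ᵐ x, x ∈ A ∩ A' k → D k x = 0 := by
    intro k
    filter_upwards [Lp.coeFn_smul (s k)⁻¹ (translate (s k • v) f - f),
      Lp.coeFn_sub (translate (s k • v) f) f, coeFn_translate (s k • v) f, hf,
      ae_comp_add hf (s k • v)] with x h1 h2 h3 h4 h5 hx
    simp only [D]
    rw [h1, Pi.smul_apply, h2, Pi.sub_apply, h3, h4 hx.1, h5 hx.2]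
    simp
  have hbound : ∀ k, ∫⁻ x in A, ‖g x‖ₑ ≤
      eLpNorm (⇑(D k) - ⇑g) 1 volume + ∫⁻ x in A \ A' k, ‖g x‖ₑ := by
    intro k
    calc ∫⁻ x in A, ‖g x‖ₑ = ∫⁻ x in (A ∩ A' k) ∪ (A \ A' k), ‖g x‖ₑ := by
          rw [Set.inter_union_sdiff]
      _ ≤ (∫⁻ x in A ∩ A' k, ‖g x‖ₑ) + ∫⁻ x in A \ A' k, ‖g x‖ₑ := lintegral_union_le _ _ _
      _ ≤ _ := by
        refine add_le_add ?_ le_rfl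
        rw [eLpNorm_one_eq_lintegral_enorm]
        refine le_trans (setLIntegral_mono_ae' (hA.inter (hA' k)) ?_)
          (setLIntegral_le_lintegral _ _)
        filter_upwards [hD0 k] with x h1 hx
        rw [Pi.sub_apply, h1 hx]
        simp
  have hgi : Integrable g := L1.integrable_coeFn g
  have hz : ∫⁻ x in A, ‖g x‖ₑ = 0 := by
    have l1 : Tendsto (fun k => eLpNorm (⇑(D k) - ⇑g) 1 volume) atTop (𝓝 0) :=
      (Lp.tendsto_Lp_iff_tendsto_eLpNorm' _ _).1 hDlim
    have l2 : Tendsto (fun k => ∫⁻ x in A \ A' k, ‖g x‖ₑ) atTop (𝓝 0) := by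
      refine tendsto_setLIntegral_zero hgi.hasFiniteIntegral.ne ?_
      have hT : Tendsto (fun k => (⟨fun x => x + s k • v, by fun_prop⟩ : C(Sp d, Sp d)))
          atTop (𝓝 (⟨fun x => x + (0 : ℝ) • v, by fun_prop⟩ : C(Sp d, Sp d))) := by
        have hc : Continuous fun r : ℝ => (⟨fun x => x + r • v, by fun_prop⟩ : C(Sp d, Sp d)) :=
          ContinuousMap.continuous_of_continuous_uncurry _
            (show Continuous fun q : ℝ × Sp d => q.2 + q.1 • v by fun_prop)
        exact (hc.tendsto 0).comp hs
      have := tendsto_measure_symmDiff_preimage_nhds_zero (μ := volume) (ν := volume) hT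
        (Eventually.of_forall fun k => measurePreserving_add_right volume (s k • v))
        (measurePreserving_add_right volume ((0 : ℝ) • v)) hA.nullMeasurableSet hAfin
      refine tendsto_of_tendsto_of_tendsto_of_le_of_le tendsto_const_nhds this
        (fun _ => zero_le) fun k => measure_mono ?_
      intro x hx
      right
      refine ⟨?_, hx.2⟩
      simpa using hx.1
    have l3 := l1.add l2
    rw [add_zero] at l3
    exact le_antisymm (ge_of_tendsto' l3 hbound) zero_le
  rw [lintegral_eq_zero_iff' hgi.aestronglyMeasurable.enorm.restrict, EventuallyEq,
    ae_restrict_iff' hA] at hz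
  filter_upwards [hz] with x hx hxA
  simpa using hx hxA

/-- The weak derivative of a function vanishes almost everywhere on its zero set. -/
theorem HasWeakPartial.ae_eq_zero [CompleteSpace F] {i : Fin d} {f g : Sp d → F}
    (h : HasWeakPartial i f g) : ∀ᵐ x, f x = 0 → g x = 0 := by
  -- A strongly measurable representative makes the zero set measurable.
  wlog hm : StronglyMeasurable f generalizing f
  · have hfm := h.1.aestronglyMeasurable
    filter_upwards [this (h.congr hfm.ae_eq_mk EventuallyEq.rfl) hfm.stronglyMeasurable_mk,
      hfm.ae_eq_mk] with x h1 h2 h3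
    exact h1 (h2 ▸ h3)
  have key : ∀ n : ℕ, ∀ᵐ x, x ∈ Metric.ball (0 : Sp d) (n + 1) → f x = 0 → g x = 0 := by
    intro n
    -- The cutoff makes everything integrable. The extra term of the product rule carries a factor
    -- `f`, so at zeros of `f` in the ball, where `η = 1`, the derivative of `η f` is exactly `g`.
    let η : ContDiffBump (0 : Sp d) := ⟨n + 1, n + 2, by positivity, by linarith⟩
    have hw := h.test_smul η.contDiff η.hasCompactSupport
    have hdη : Continuous fun x => fderiv ℝ η x (basisVec i) :=
      ((η.contDiff (n := 1)).continuous_fderiv (by simp)).clm_apply continuous_const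
    have hf'm := memLp_one_iff_integrable.2
      (integrable_test_smul η.continuous η.hasCompactSupport h.1)
    have hg'm := memLp_one_iff_integrable.2
      ((integrable_test_smul η.continuous η.hasCompactSupport h.2.1).add
      (integrable_test_smul hdη (η.hasCompactSupport.fderiv_apply ℝ _) h.1))
    have hD : HasDirDeriv (basisVec i) (hf'm.toLp _) (hg'm.toLp _) :=
      (hw.congr hf'm.coeFn_toLp.symm hg'm.coeFn_toLp.symm).hasDirDeriv (by simp)
    have hA : MeasurableSet ({x | f x = 0} ∩ Metric.ball (0 : Sp d) (n + 1)) :=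
      (hm.measurableSet_eq_fun stronglyMeasurable_const).inter measurableSet_ball
    have hAfin : volume ({x | f x = 0} ∩ Metric.ball (0 : Sp d) (n + 1)) ≠ ∞ :=
      ((measure_mono Set.inter_subset_right).trans_lt measure_ball_lt_top).ne
    have hz := hD.ae_eq_zero_on hA hAfin (by
      filter_upwards [hf'm.coeFn_toLp] with x hx hxA
      rw [hx, show f x = 0 from hxA.1, smul_zero])
    filter_upwards [hz, hg'm.coeFn_toLp] with x hx h1 hxb hx0
    have h2 := hx ⟨hx0, hxb⟩
    have hx1 : η x = 1 := η.one_of_mem_closedBall (Metric.ball_subset_closedBall hxb)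
    rw [h1] at h2
    simpa [hx1, hx0] using h2
  filter_upwards [ae_all_iff.2 key] with x hx
  obtain ⟨n, hn⟩ := exists_nat_gt ‖x‖
  exact hx n (by rw [mem_ball_zero_iff]; linarith)

end Weak

end Bohm

namespace Bohm

/-! ### Limits of integrals of functions of `L²` curves -/

section Convergence

variable {X : Type*} [MeasurableSpace X] {μ : Measure X}

/-- Dominated convergence with an error in the dominating function that tends to zero. -/
theorem tendsto_integral_of_dominated_add {f : ℕ → X → ℝ} {f₀ g : X → ℝ} {e : ℕ → X → ℝ}
    (hfm : ∀ n, AEStronglyMeasurable (f n) μ) (hg : Integrable g μ)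
    (he : ∀ n, Integrable (e n) μ) (he0 : ∀ n x, 0 ≤ e n x)
    (hb : ∀ n, ∀ᵐ x ∂μ, |f n x| ≤ g x + e n x)
    (hei : Tendsto (fun n => ∫ x, e n x ∂μ) atTop (𝓝 0))
    (hea : ∀ᵐ x ∂μ, Tendsto (fun n => e n x) atTop (𝓝 0))
    (hlim : ∀ᵐ x ∂μ, Tendsto (fun n => f n x) atTop (𝓝 (f₀ x))) :
    Tendsto (fun n => ∫ x, f n x ∂μ) atTop (𝓝 (∫ x, f₀ x ∂μ)) := by
  have hf₀ : ∀ᵐ x ∂μ, |f₀ x| ≤ g x := by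
    filter_upwards [hea, hlim, ae_all_iff.2 hb] with x h1 h2 h3
    have h4 := h1.const_add (g x)
    rw [add_zero] at h4
    exact le_of_tendsto_of_tendsto' h2.abs h4 h3
  -- Truncating `f n` to `[-g, g]` brings it under ordinary dominated convergence; the part cut off
  -- is at most `e n`, whose integral tends to zero.
  let h : ℕ → X → ℝ := fun n x => max (-g x) (min (f n x) (g x))
  have hhm : ∀ n, AEStronglyMeasurable (h n) μ := fun n =>
    hg.aestronglyMeasurable.neg.sup ((hfm n).inf hg.aestronglyMeasurable)
  have hhb : ∀ n, ∀ᵐ x ∂μ, |h n x| ≤ g x := fun n => by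
    filter_upwards [hf₀] with x hx
    have : 0 ≤ g x := (abs_nonneg _).trans hx
    rw [abs_le]
    exact ⟨le_max_left _ _, max_le (by linarith) (min_le_right _ _)⟩
  have hhlim : Tendsto (fun n => ∫ x, h n x ∂μ) atTop (𝓝 (∫ x, f₀ x ∂μ)) := by
    refine tendsto_integral_of_dominated_convergence g hhm hg hhb ?_
    filter_upwards [hlim, hf₀] with x h1 h2
    have h3 : Tendsto (fun n => h n x) atTop (𝓝 (max (-g x) (min (f₀ x) (g x)))) :=
      tendsto_const_nhds.max (h1.min tendsto_const_nhds)
    rwa [min_eq_left ((le_abs_self _).trans h2), max_eq_right (abs_le.1 h2).1] at h3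
  have hhi : ∀ n, Integrable (h n) μ := fun n => hg.mono' (hhm n) (hhb n)
  have hfi : ∀ n, Integrable (f n) μ := fun n => (hg.add (he n)).mono' (hfm n) (hb n)
  have hdiff : Tendsto (fun n => ∫ x, (f n x - h n x) ∂μ) atTop (𝓝 0) := by
    refine squeeze_zero_norm (fun n => ?_) hei
    refine (norm_integral_le_integral_norm _).trans ?_
    refine integral_mono_ae ((hfi n).sub (hhi n)).norm (he n) ?_
    filter_upwards [hb n, hf₀] with x h1 h2
    have h0 : 0 ≤ g x := (abs_nonneg _).trans h2
    have h3 := he0 n x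
    rw [abs_le] at h1
    simp only [h, Real.norm_eq_abs]
    rw [abs_le]
    rcases le_total (f n x) (g x) with h4 | h4
    · rw [min_eq_left h4]
      rcases le_total (-g x) (f n x) with h5 | h5
      · rw [max_eq_right h5]; constructor <;> linarith
      · rw [max_eq_left h5]; constructor <;> linarith
    · rw [min_eq_right h4, max_eq_right (by linarith)]
      constructor <;> linarith
  have := hdiff.add hhlim
  rw [zero_add] at this
  refine this.congr fun n => ?_
  rw [integral_sub (hfi n) (hhi n)]
  ring

variable {E : Type*} [NormedAddCommGroup E] [NormedSpace ℝ E]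

omit [NormedSpace ℝ E] in
theorem integrable_norm_sq (z : Lp E 2 μ) : Integrable (fun x => ‖z x‖ ^ 2) μ := by
  simpa using (Lp.memLp z).integrable_norm_pow (by simp)

omit [NormedSpace ℝ E] in
theorem integral_norm_sq (z : Lp E 2 μ) : ∫ x, ‖z x‖ ^ 2 ∂μ = ‖z‖ ^ 2 := by
  rw [Lp.norm_def, (Lp.memLp z).eLpNorm_eq_integral_rpow_norm (by simp) (by simp)]
  have h0 : 0 ≤ ∫ x, ‖z x‖ ^ 2 ∂μ := integral_nonneg fun x => by positivity
  rw [ENNReal.toReal_ofReal (by positivity)]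
  simp only [ENNReal.toReal_ofNat, Real.rpow_ofNat]
  rw [← Real.rpow_natCast, ← Real.rpow_mul h0]
  norm_num

omit [NormedSpace ℝ E] in
theorem exists_subseq_tendsto_ae {z : ℕ → Lp E 2 μ} {z₀ : Lp E 2 μ}
    (h : Tendsto z atTop (𝓝 z₀)) :
    ∃ ns : ℕ → ℕ, StrictMono ns ∧ ∀ᵐ x ∂μ, Tendsto (fun k => z (ns k) x) atTop (𝓝 (z₀ x)) :=
  (tendstoInMeasure_of_tendsto_Lp h).exists_seq_tendsto_ae

omit [NormedSpace ℝ E] in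
theorem tendsto_integral_norm_sub_sq {z : ℕ → Lp E 2 μ} {z₀ : Lp E 2 μ}
    (h : Tendsto z atTop (𝓝 z₀)) :
    Tendsto (fun n => ∫ x, ‖(z n - z₀ : Lp E 2 μ) x‖ ^ 2 ∂μ) atTop (𝓝 0) := by
  simp only [integral_norm_sq]
  have := (tendsto_iff_norm_sub_tendsto_zero.1 h).pow 2
  simpa using this

omit [NormedSpace ℝ E] in
theorem sq_norm_le_two_mul (a b : E) : ‖a‖ ^ 2 ≤ 2 * ‖b‖ ^ 2 + 2 * ‖a - b‖ ^ 2 := by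
  have h : ‖a‖ ≤ ‖b‖ + ‖a - b‖ := norm_le_norm_add_norm_sub' a b
  nlinarith [norm_nonneg a, norm_nonneg b, norm_nonneg (a - b), sq_nonneg (‖b‖ - ‖a - b‖)]

variable {Y : Type*} [NormedAddCommGroup Y] [NormedSpace ℝ Y]

omit [NormedSpace ℝ E] [NormedSpace ℝ Y] in
/-- The integral of a continuous function with quadratic growth depends continuously on an `L²`
curve. -/
theorem continuous_integral_comp {T : Type*} [TopologicalSpace T] [FirstCountableTopology T]
    {G : Y × E → ℝ} (hG : Continuous G) {C : ℝ}
    (hC : ∀ y z, |G (y, z)| ≤ C * ‖z‖ ^ 2) {ι : T → X → Y}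
    (hι : ∀ t, AEStronglyMeasurable (ι t) μ) (hιc : ∀ x, Continuous fun t => ι t x)
    {Z : T → Lp E 2 μ} (hZ : Continuous Z) :
    Continuous fun t => ∫ x, G (ι t x, Z t x) ∂μ := by
  rw [continuous_iff_continuousAt]
  intro t₀
  refine tendsto_of_seq_tendsto fun u hu => ?_
  -- `L²` convergence gives pointwise convergence only along a subsequence, so every sequence is
  -- thinned out.
  refine tendsto_of_subseq_tendsto fun ms hms => ?_
  have hu' : Tendsto (fun n => u (ms n)) atTop (𝓝 t₀) := hu.comp hms
  have hZ' : Tendsto (fun n => Z (u (ms n))) atTop (𝓝 (Z t₀)) := (hZ.tendsto t₀).comp hu'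
  obtain ⟨ns, hns, hae⟩ := exists_subseq_tendsto_ae hZ'
  refine ⟨ns, ?_⟩
  have hu'' := hu'.comp hns.tendsto_atTop
  have hZ'' := hZ'.comp hns.tendsto_atTop
  have hC' : ∀ y z, |G (y, z)| ≤ |C| * ‖z‖ ^ 2 := fun y z =>
    (hC y z).trans (by gcongr; exact le_abs_self C)
  -- The majorant splits as `|Z|² ≤ 2|Z t₀|² + 2|Z - Z t₀|²`: a fixed integrable part, and an error
  -- that vanishes in `L¹`.
  refine tendsto_integral_of_dominated_add
    (f := fun k x => G (ι (u (ms (ns k))) x, Z (u (ms (ns k))) x))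
    (g := fun x => |C| * (2 * ‖Z t₀ x‖ ^ 2))
    (e := fun k x => |C| * (2 * ‖(Z (u (ms (ns k))) - Z t₀ : Lp E 2 μ) x‖ ^ 2))
    ?_ ?_ ?_ ?_ ?_ ?_ ?_ ?_
  · exact fun k => hG.comp_aestronglyMeasurable ((hι _).prodMk (Lp.aestronglyMeasurable _))
  · exact ((integrable_norm_sq _).const_mul 2).const_mul _
  · exact fun k => ((integrable_norm_sq _).const_mul 2).const_mul _
  · intro k x; positivity
  · intro k
    filter_upwards [Lp.coeFn_sub (Z (u (ms (ns k)))) (Z t₀)] with x hx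
    rw [hx, ← mul_add]
    refine (hC' _ _).trans ?_
    gcongr
    exact sq_norm_le_two_mul _ _
  · have := ((tendsto_integral_norm_sub_sq hZ'').const_mul 2).const_mul |C|
    simpa only [integral_const_mul, mul_zero, Function.comp_apply] using this
  · filter_upwards [hae, ae_all_iff.2 fun k => Lp.coeFn_sub (Z (u (ms (ns k)))) (Z t₀)]
      with x h1 h2
    have h3 := (((tendsto_iff_norm_sub_tendsto_zero.1 h1).pow 2).const_mul 2).const_mul |C|
    simp only [h2, Pi.sub_apply]
    simpa using h3
  · filter_upwards [hae] with x h1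
    exact (hG.tendsto _).comp ((((hιc x).tendsto t₀).comp hu'').prodMk_nhds h1)

/-- Growth of a function whose derivative grows linearly in the second variable. -/
theorem abs_sub_le_of_fderiv_le {G : Y × E → ℝ} {G' : Y × E → (Y × E →L[ℝ] ℝ)}
    (hG : ∀ q, HasFDerivAt G (G' q) q) {C : ℝ} (hC0 : 0 ≤ C)
    (hC : ∀ y z v w, |G' (y, z) (v, w)| ≤ C * (‖z‖ ^ 2 * ‖v‖ + ‖z‖ * ‖w‖)) (y v : Y) (z w : E) :
    |G (y + v, z + w) - G (y, z)| ≤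
      C * ((‖z‖ + ‖w‖) ^ 2 * ‖v‖ + (‖z‖ + ‖w‖) * ‖w‖) := by
  have hd : ∀ r : ℝ, HasDerivAt (fun r : ℝ => G ((y, z) + r • (v, w)))
      (G' ((y, z) + r • (v, w)) (v, w)) r := by
    intro r
    have h1 : HasDerivAt (fun r : ℝ => (y, z) + r • (v, w)) (v, w) r := by
      simpa using ((hasDerivAt_id r).smul_const (v, w)).const_add (y, z)
    exact (hG _).comp_hasDerivAt r h1
  have h := Convex.norm_image_sub_le_of_norm_hasDerivWithin_le (s := Set.Icc (0 : ℝ) 1)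
    (f := fun r : ℝ => G ((y, z) + r • (v, w)))
    (C := C * ((‖z‖ + ‖w‖) ^ 2 * ‖v‖ + (‖z‖ + ‖w‖) * ‖w‖))
    (fun r _ => (hd r).hasDerivWithinAt) (fun r hr => ?_) (convex_Icc 0 1)
    (Set.left_mem_Icc.2 zero_le_one) (Set.right_mem_Icc.2 zero_le_one)
  · simpa using h
  · have h1 : ‖z + r • w‖ ≤ ‖z‖ + ‖w‖ := by
      refine (norm_add_le _ _).trans ?_
      gcongr
      rw [norm_smul, Real.norm_eq_abs, abs_of_nonneg hr.1]
      exact mul_le_of_le_one_left (norm_nonneg _) hr.2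
    refine (hC (y + r • v) (z + r • w) v w).trans ?_
    gcongr

/-- Differentiation of the integral of a function of an `L²` curve. -/
theorem hasDerivAt_integral_comp {G : Y × E → ℝ} {G' : Y × E → (Y × E →L[ℝ] ℝ)}
    (hG : ∀ q, HasFDerivAt G (G' q) q) {C : ℝ}
    (hC : ∀ y z v w, |G' (y, z) (v, w)| ≤ C * (‖z‖ ^ 2 * ‖v‖ + ‖z‖ * ‖w‖))
    (hG0 : ∀ y, G (y, 0) = 0) {ι : X → Y} (hι : AEStronglyMeasurable ι μ) (v : Y)
    {Z : ℝ → Lp E 2 μ} {W : Lp E 2 μ} (hZ : HasDerivAt Z W 0) :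
    HasDerivAt (fun s => ∫ x, G (ι x + s • v, Z s x) ∂μ)
      (∫ x, G' (ι x, Z 0 x) (v, W x) ∂μ) 0 := by
  wlog hC0 : 0 ≤ C generalizing C
  · refine this (C := |C|) (fun y z v w => (hC y z v w).trans ?_) (abs_nonneg _)
    gcongr; exact le_abs_self C
  have hGc : Continuous G := continuous_iff_continuousAt.2 fun q => (hG q).continuousAt
  have hmeas : ∀ s : ℝ, AEStronglyMeasurable (fun x => G (ι x + s • v, Z s x)) μ := fun s =>
    hGc.comp_aestronglyMeasurable ((hι.add_const _).prodMk (Lp.aestronglyMeasurable _))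
  have hint : ∀ s : ℝ, Integrable (fun x => G (ι x + s • v, Z s x)) μ := fun s => by
    refine ((integrable_norm_sq (Z s)).const_mul C).mono' (hmeas s)
      (Eventually.of_forall fun x => ?_)
    have := abs_sub_le_of_fderiv_le hG hC0 hC (ι x + s • v) 0 0 (Z s x)
    simp only [add_zero, zero_add, hG0, sub_zero, norm_zero, mul_zero] at this
    rw [Real.norm_eq_abs]
    refine this.trans (le_of_eq (by ring))
  rw [hasDerivAt_iff_tendsto_slope_zero]
  refine tendsto_of_seq_tendsto fun u hu => ?_
  refine tendsto_of_subseq_tendsto fun ms hms => ?_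
  have hu1 : Tendsto (fun n => u (ms n)) atTop (𝓝[≠] 0) := hu.comp hms
  have hev : ∀ᶠ n in atTop, |u (ms n)| ≤ 1 := by
    have h1 := (tendsto_nhdsWithin_iff.1 hu1).1.abs
    rw [abs_zero] at h1
    exact h1.eventually_le_const zero_lt_one
  -- Dropping the first `N` terms makes all increments nonzero and at most one in modulus; the
  -- second fact absorbs higher powers of the increment in the majorant.
  obtain ⟨N, hN⟩ := eventually_atTop.1 (hev.and (tendsto_nhdsWithin_iff.1 hu1).2)
  let u' : ℕ → ℝ := fun n => u (ms (n + N))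
  have hu' : Tendsto u' atTop (𝓝[≠] 0) := hu1.comp (tendsto_add_atTop_nat N)
  have hu'0 : ∀ n, u' n ≠ 0 := fun n => (hN (n + N) (by omega)).2
  have hu'1 : ∀ n, |u' n| ≤ 1 := fun n => (hN (n + N) (by omega)).1
  let D : ℕ → Lp E 2 μ := fun n => (u' n)⁻¹ • (Z (u' n) - Z 0)
  have hD : Tendsto D atTop (𝓝 W) := by
    have := (hasDerivAt_iff_tendsto_slope_zero.1 hZ).comp hu'
    simpa [Function.comp_def] using this
  obtain ⟨ns, hns, hae⟩ := exists_subseq_tendsto_ae hD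
  have hDs : Tendsto (fun k => D (ns k)) atTop (𝓝 W) := hD.comp hns.tendsto_atTop
  refine ⟨fun k => ns k + N, ?_⟩
  have hs0 : Tendsto (fun k => u' (ns k)) atTop (𝓝 0) :=
    ((tendsto_nhdsWithin_iff.1 hu').1).comp hns.tendsto_atTop
  have hZD : ∀ n, ∀ᵐ x ∂μ, Z (u' n) x = Z 0 x + u' n • D n x := by
    intro n
    filter_upwards [Lp.coeFn_smul (u' n)⁻¹ (Z (u' n) - Z 0), Lp.coeFn_sub (Z (u' n)) (Z 0)]
      with x h1 h2
    simp only [D]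
    rw [h1, Pi.smul_apply, h2, Pi.sub_apply, smul_smul, mul_inv_cancel₀ (hu'0 n), one_smul]
    abel
  have hmain := tendsto_integral_of_dominated_add
    (f := fun k x => (u' (ns k))⁻¹ * (G (ι x + u' (ns k) • v, Z (u' (ns k)) x) - G (ι x, Z 0 x)))
    (f₀ := fun x => G' (ι x, Z 0 x) (v, W x))
    (g := fun x => C * (2 * ‖v‖ + 1) * (‖Z 0 x‖ ^ 2) + C * (2 * ‖v‖ + 2) * (2 * ‖W x‖ ^ 2))
    (e := fun k x => C * (2 * ‖v‖ + 2) * (2 * ‖(D (ns k) - W : Lp E 2 μ) x‖ ^ 2))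
    (μ := μ) ?_ ?_ ?_ ?_ ?_ ?_ ?_ ?_
  · refine hmain.congr fun k => ?_
    rw [integral_const_mul, integral_sub (hint _) (by simpa using hint 0)]
    simp [u']
  · intro k
    have h0 := hmeas 0
    simp only [zero_smul, add_zero] at h0
    exact ((hmeas _).sub h0).const_mul _
  · exact ((integrable_norm_sq _).const_mul _).add (((integrable_norm_sq _).const_mul 2).const_mul _)
  · exact fun k => ((integrable_norm_sq _).const_mul 2).const_mul _
  · intro k x; positivity
  · intro k
    filter_upwards [hZD (ns k), Lp.coeFn_sub (D (ns k)) W] with x h1 h2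
    rw [h1, h2, Pi.sub_apply, abs_mul, abs_inv]
    have hpos : 0 < |u' (ns k)| := abs_pos.2 (hu'0 _)
    have h3 := abs_sub_le_of_fderiv_le hG hC0 hC (ι x) (u' (ns k) • v) (Z 0 x)
      (u' (ns k) • D (ns k) x)
    rw [norm_smul, norm_smul, Real.norm_eq_abs] at h3
    rw [inv_mul_le_iff₀ hpos]
    refine h3.trans ?_
    -- One factor `r` cancels against the difference quotient, and the remaining ones are estimated
    -- by `r ≤ 1`.
    set r := |u' (ns k)| with hr
    have hr1 : r ≤ 1 := hu'1 _
    set a := ‖Z 0 x‖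
    set b := ‖D (ns k) x‖ with hb
    have ha0 : 0 ≤ a := norm_nonneg _
    have hb0 : 0 ≤ b := norm_nonneg _
    have hv0 : 0 ≤ ‖v‖ := norm_nonneg _
    have hb2 : b ^ 2 ≤ 2 * ‖W x‖ ^ 2 + 2 * ‖D (ns k) x - W x‖ ^ 2 := sq_norm_le_two_mul _ _
    have hrb : a + r * b ≤ a + b := by nlinarith
    have hrb0 : 0 ≤ a + r * b := by positivity
    calc C * ((a + r * b) ^ 2 * (r * ‖v‖) + (a + r * b) * (r * b))
        ≤ C * ((a + b) ^ 2 * (r * ‖v‖) + (a + b) * (r * b)) := by gcongr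
      _ = r * (C * ((a + b) ^ 2 * ‖v‖ + (a + b) * b)) := by ring
      _ ≤ r * (C * ((2 * a ^ 2 + 2 * b ^ 2) * ‖v‖ + (a ^ 2 + 2 * b ^ 2))) := by
          gcongr
          · nlinarith [sq_nonneg (a - b)]
          · nlinarith [sq_nonneg (a - b)]
      _ = r * (C * (2 * ‖v‖ + 1) * a ^ 2 + C * (2 * ‖v‖ + 2) * b ^ 2) := by ring
      _ ≤ r * (C * (2 * ‖v‖ + 1) * a ^ 2 + C * (2 * ‖v‖ + 2) *
            (2 * ‖W x‖ ^ 2 + 2 * ‖D (ns k) x - W x‖ ^ 2)) := by gcongr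
      _ = _ := by ring
  · have := ((tendsto_integral_norm_sub_sq hDs).const_mul 2).const_mul (C * (2 * ‖v‖ + 2))
    simpa only [integral_const_mul, mul_zero] using this
  · filter_upwards [hae, ae_all_iff.2 fun k => Lp.coeFn_sub (D (ns k)) W] with x h1 h2
    have h3 := (((tendsto_iff_norm_sub_tendsto_zero.1 h1).pow 2).const_mul 2).const_mul
      (C * (2 * ‖v‖ + 2))
    simp only [h2, Pi.sub_apply]
    simpa using h3
  · filter_upwards [hae, ae_all_iff.2 hZD] with x h1 h2
    -- Pointwise chain rule along a sequence: the increment of `(ι, Z)` divided by `u'` converges to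
    -- `(v, W x)` for almost every `x`.
    have h3 := (hG (ι x, Z 0 x)).hasFDerivWithinAt (s := Set.univ)
    have h4 := h3.lim (l := atTop) (c := fun k => (u' (ns k))⁻¹)
      (d := fun k => (u' (ns k) • v, u' (ns k) • D (ns k) x)) (v := (v, W x))
      ?_ (Eventually.of_forall fun _ => Set.mem_univ _) ?_
    · simpa [h2] using h4
    · have : Tendsto (fun k => (u' (ns k) • v, u' (ns k) • D (ns k) x)) atTop
          (𝓝 ((0 : ℝ) • v, (0 : ℝ) • W x)) :=
        (hs0.smul tendsto_const_nhds).prodMk_nhds (hs0.smul h1)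
      rw [zero_smul, zero_smul] at this
      exact this
    · have : Tendsto (fun k => (v, D (ns k) x)) atTop (𝓝 (v, W x)) :=
        tendsto_const_nhds.prodMk_nhds h1
      refine this.congr fun k => ?_
      simp [smul_smul, inv_mul_cancel₀ (hu'0 (ns k))]

/-- Integration by parts: the integral of the derivative of `x ↦ G (ι x, Z x)` along `v`
vanishes. -/
theorem integral_fderiv_comp_eq_zero {d : ℕ} {G : Y × E → ℝ} {G' : Y × E → (Y × E →L[ℝ] ℝ)}
    (hG : ∀ q, HasFDerivAt G (G' q) q) {C : ℝ}
    (hC : ∀ y z v w, |G' (y, z) (v, w)| ≤ C * (‖z‖ ^ 2 * ‖v‖ + ‖z‖ * ‖w‖))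
    (hG0 : ∀ y, G (y, 0) = 0) {ι : Sp d → Y} (hι : Continuous ι) {v : Sp d} {v' : Y}
    (hιv : ∀ x (s : ℝ), ι (x + s • v) = ι x + s • v')
    {Z W : Lp E 2 (volume : Measure (Sp d))} (hZ : HasDirDeriv v Z W) :
    ∫ x, G' (ι x, Z x) (v', W x) = 0 := by
  have h := hasDerivAt_integral_comp hG hC hG0 hι.aestronglyMeasurable v' hZ
  -- Translation invariance of Lebesgue measure: the integral does not depend on `s`, so the
  -- derivative given by differentiation under the integral is zero.
  have hconst : (fun s : ℝ => ∫ x, G (ι x + s • v', translate (s • v) Z x)) =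
      fun _ => ∫ x, G (ι x, Z x) := by
    ext1 s
    rw [← integral_add_right_eq_self (fun x => G (ι x, Z x)) (s • v)]
    refine integral_congr_ae ?_
    filter_upwards [coeFn_translate (s • v) Z] with x hx
    rw [hx, hιv]
  rw [hconst] at h
  have h2 := h.unique (hasDerivAt_const (0 : ℝ) _)
  simpa using h2

end Convergence

end Bohm

namespace Bohm

variable {d : ℕ}

/-! ### Sobolev spaces and directional derivatives in `L²` -/

theorem hasDirDeriv_of_lineDerivOp_eq {i : Fin d} {f g : L2 d}
    (h : ∂_{(basisVec i : Sp d)} (f : TemperedDistribution (Sp d) ℂ) =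
      (g : TemperedDistribution (Sp d) ℂ)) : HasDirDeriv (basisVec i) f g := by
  refine HasWeakPartial.hasDirDeriv (by simp) (hasWeakPartial_iff.2
    ⟨lp_locallyIntegrable f, lp_locallyIntegrable g, fun φ hφ hc => ?_⟩)
  have hc' : HasCompactSupport fun x => (φ x : ℂ) := hc.comp_left (g := Complex.ofReal) rfl
  have hφ' : ContDiff ℝ (⊤ : ℕ∞) fun x => (φ x : ℂ) := Complex.ofRealCLM.contDiff.comp hφ
  have h1 := congrArg (fun T : TemperedDistribution (Sp d) ℂ => T (hc'.toSchwartzMap hφ')) h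
  simp only [TemperedDistribution.lineDerivOp_apply_apply, Lp.toTemperedDistribution_apply] at h1
  have h2 : ∀ x, (-∂_{(basisVec i : Sp d)} (hc'.toSchwartzMap hφ')) x =
      -((fderiv ℝ φ x (basisVec i) : ℝ) : ℂ) := by
    intro x
    rw [neg_apply, SchwartzMap.lineDerivOp_apply_eq_fderiv]
    congr 1
    have h3 := (Complex.ofRealCLM.hasFDerivAt (x := φ x)).comp x
      (hφ.differentiable (by simp) x).hasFDerivAt
    exact DFunLike.congr_fun h3.fderiv (basisVec i)
  have h4 : ∀ x, (hc'.toSchwartzMap hφ') x = (φ x : ℂ) := fun x => rfl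
  simp only [h2, h4, neg_smul] at h1
  rw [integral_neg] at h1
  simp only [Complex.coe_smul] at h1
  rw [← h1, neg_neg]

/-- Differentiation lowers the Sobolev order by one; as the new order is still nonnegative, the
distributional derivative is an `L²` function. -/
theorem MemH.exists_hasDirDeriv {s : ℝ} (hs : 1 ≤ s) {f : L2 d} (hf : MemH s f) (i : Fin d) :
    ∃ g : L2 d, MemH (s - 1) g ∧ HasDirDeriv (basisVec i) f g := by
  have h1 : TemperedDistribution.MemSobolev (s - 1) 2
      (∂_{(basisVec i : Sp d)} (f : TemperedDistribution (Sp d) ℂ)) :=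
    TemperedDistribution.MemSobolev.lineDerivOp hf
  obtain ⟨g, hg⟩ := TemperedDistribution.memSobolev_zero_iff.1
    (TemperedDistribution.MemSobolev.mono (by linarith) h1)
  exact ⟨g, by rw [MemH, ← hg]; exact h1, hasDirDeriv_of_lineDerivOp_eq hg⟩

/-- The inner product of `L²` is invariant under translations. -/
theorem inner_translate (v : Sp d) (f g : L2 d) :
    inner ℂ (translate v f) (translate v g) = inner ℂ f g := by
  rw [L2.inner_def, L2.inner_def,
    ← integral_add_right_eq_self (fun x => inner ℂ (f x) (g x)) v]
  refine integral_congr_ae ?_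
  filter_upwards [coeFn_translate v f, coeFn_translate v g] with x h1 h2
  rw [h1, h2]

/-- Integration by parts without cutoffs: the inner product of the translates is constant in the
translation parameter, and the product rule at zero gives the identity. -/
theorem HasDirDeriv.inner_add_inner {v : Sp d} {f f' g g' : L2 d} (hf : HasDirDeriv v f f')
    (hg : HasDirDeriv v g g') : inner ℂ f' g + inner ℂ f g' = 0 := by
  have h1 := HasDerivAt.inner ℂ hf hg
  simp only [inner_translate, zero_smul, translate_zero] at h1
  have h2 := h1.unique (hasDerivAt_const (0 : ℝ) _)
  rw [add_comm]; exact h2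

theorem translate_smul (v : Sp d) (c : ℂ) (f : L2 d) :
    translate v (c • f) = c • translate v f := by
  apply Lp.ext
  filter_upwards [coeFn_translate v (c • f), coeFn_translate v f,
    Lp.coeFn_smul c (translate v f), ae_comp_add (Lp.coeFn_smul c f) v]
    with x h1 h2 h3 h4
  simp only [Pi.smul_apply] at h3 h4 ⊢
  rw [h1, h4, h3, h2]

theorem HasDirDeriv.smul {v : Sp d} {f f' : L2 d} (hf : HasDirDeriv v f f') (c : ℂ) :
    HasDirDeriv v (c • f) (c • f') := by
  have h := HasDerivAt.const_smul c hf
  exact h.congr_of_eventuallyEq (Eventually.of_forall fun r => translate_smul _ _ _)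

/-- The difference quotient of `f` along `v`. -/
noncomputable def diffQuot (v : Sp d) (s : ℝ) : L2 d →L[ℝ] L2 d :=
  s⁻¹ • ((translate (s • v)).toContinuousLinearMap - ContinuousLinearMap.id ℝ (L2 d))

theorem diffQuot_apply (v : Sp d) (s : ℝ) (f : L2 d) :
    diffQuot v s f = s⁻¹ • (translate (s • v) f - f) := rfl

theorem diffQuot_smul (v : Sp d) (s : ℝ) (c : ℂ) (f : L2 d) :
    diffQuot v s (c • f) = c • diffQuot v s f := by
  rw [diffQuot_apply, diffQuot_apply, translate_smul, ← smul_sub, smul_comm]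

theorem hasDirDeriv_iff_tendsto {v : Sp d} {f g : L2 d} :
    HasDirDeriv v f g ↔ Tendsto (fun s => diffQuot v s f) (𝓝[≠] 0) (𝓝 g) := by
  rw [HasDirDeriv, hasDerivAt_iff_tendsto_slope_zero]
  simp [diffQuot_apply]

theorem HasDirDeriv.diffQuot {w v : Sp d} {f f' : L2 d} (hf : HasDirDeriv w f f') (s : ℝ) :
    HasDirDeriv w (Bohm.diffQuot v s f) (Bohm.diffQuot v s f') :=
  hf.map (Bohm.diffQuot v s) fun u g => by
    simp only [diffQuot_apply, map_smul, map_sub, translate_translate, add_comm]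

theorem inner_diffQuot (v : Sp d) (s : ℝ) (f g : L2 d) :
    inner ℂ (diffQuot v s f) g = - inner ℂ f (diffQuot v (-s) g) := by
  have h1 : inner ℂ (translate (s • v) f) g = inner ℂ f (translate (-s • v) g) := by
    rw [← inner_translate (-s • v), translate_translate]
    simp
  simp only [diffQuot_apply, inner_smul_left_eq_smul, inner_smul_right_eq_smul, inner_sub_left,
    inner_sub_right, h1]
  rw [inv_neg, neg_smul s⁻¹, neg_neg]

theorem tendsto_neg_nhdsNE : Tendsto (fun s : ℝ => -s) (𝓝[≠] 0) (𝓝[≠] 0) := by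
  refine tendsto_nhdsWithin_iff.2 ⟨?_, ?_⟩
  · have : Tendsto (fun s : ℝ => -s) (𝓝 0) (𝓝 (-0)) := tendsto_id.neg
    rw [neg_zero] at this
    exact this.mono_left nhdsWithin_le_nhds
  · filter_upwards [self_mem_nhdsWithin] with s hs
    simpa using hs

/-- Mixed derivatives commute. -/
theorem hasDirDeriv_comm {i j : Fin d} {f a b aj bi : L2 d} (ha : HasDirDeriv (basisVec i) f a)
    (hb : HasDirDeriv (basisVec j) f b) (haj : HasDirDeriv (basisVec j) a aj)
    (hbi : HasDirDeriv (basisVec i) b bi) : aj = bi := by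
  obtain ⟨_, _, ha'⟩ := hasWeakPartial_iff.1 ha.hasWeakPartial
  obtain ⟨_, _, hb'⟩ := hasWeakPartial_iff.1 hb.hasWeakPartial
  obtain ⟨_, l1, haj'⟩ := hasWeakPartial_iff.1 haj.hasWeakPartial
  obtain ⟨_, l2, hbi'⟩ := hasWeakPartial_iff.1 hbi.hasWeakPartial
  apply Lp.ext
  refine ae_eq_of_integral_contDiff_smul_eq l1 l2 fun φ hφ hc => ?_
  have hd : ∀ k : Fin d, ContDiff ℝ (⊤ : ℕ∞) fun x => fderiv ℝ φ x (basisVec k) := fun k =>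
    (hφ.fderiv_right (by simp)).clm_apply contDiff_const
  have hdc : ∀ k : Fin d, HasCompactSupport fun x => fderiv ℝ φ x (basisVec k) := fun k =>
    hc.fderiv_apply ℝ _
  have e1 := ha' _ (hd j) (hdc j)
  have e2 := hb' _ (hd i) (hdc i)
  have hsymm : ∀ x, fderiv ℝ (fun x => fderiv ℝ φ x (basisVec j)) x (basisVec i) =
      fderiv ℝ (fun x => fderiv ℝ φ x (basisVec i)) x (basisVec j) := by
    intro x
    have hdd : DifferentiableAt ℝ (fderiv ℝ φ) x :=
      ((hφ.fderiv_right (m := (⊤ : ℕ∞)) (by simp)).differentiable (by simp)) x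
    have hs : IsSymmSndFDerivAt ℝ φ x := (hφ.contDiffAt).isSymmSndFDerivAt (by
      rw [minSmoothness_of_isRCLikeNormedField]; exact ENat.LEInfty.out)
    rw [fderiv_clm_apply hdd (by fun_prop), fderiv_clm_apply hdd (by fun_prop)]
    simpa using hs (basisVec i) (basisVec j)
  simp only [hsymm] at e1
  have e3 := haj' φ hφ hc
  have e4 := hbi' φ hφ hc
  rw [← neg_inj, ← e3, ← e4]
  rw [← neg_inj, ← e1, ← e2]

/-- The second derivatives are controlled by the Laplacian. -/
theorem norm_second_deriv_le {f : L2 d} {b : Fin d → L2 d} {c : Fin d → Fin d → L2 d}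
    (hb : ∀ j, HasDirDeriv (basisVec j) f (b j))
    (hc : ∀ k j, HasDirDeriv (basisVec k) (b j) (c k j)) (k j : Fin d) :
    ‖c k j‖ ≤ ‖∑ i, c i i‖ := by
  have hsymm : ∀ k j, c k j = c j k := fun k j => hasDirDeriv_comm (hb j) (hb k) (hc k j) (hc j k)
  -- Two integrations by parts turn `⟨∂_k∂_k f, ∂_j∂_j f⟩` into `‖∂_k∂_j f‖²`. Third derivatives are
  -- not available, so one of them is carried out on difference quotients and the step size is sent
  -- to zero afterwards.
  have key : ∀ k j, inner ℂ (c k k) (c j j) = ((‖c k j‖ ^ 2 : ℝ) : ℂ) := by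
    intro k j
    have h1 : ∀ s : ℝ, inner ℂ (diffQuot (basisVec k) s (b k)) (c j j) =
        inner ℂ (c j k) (diffQuot (basisVec k) (-s) (b j)) := by
      intro s
      have := ((hc j k).diffQuot (v := basisVec k) s).inner_add_inner (hc j j)
      rw [inner_diffQuot] at this
      linear_combination this
    have h2 : Tendsto (fun s => inner ℂ (diffQuot (basisVec k) s (b k)) (c j j)) (𝓝[≠] 0)
        (𝓝 (inner ℂ (c k k) (c j j))) :=
      (hasDirDeriv_iff_tendsto.1 (hc k k)).inner tendsto_const_nhds
    have h3 : Tendsto (fun s => inner ℂ (c j k) (diffQuot (basisVec k) (-s) (b j))) (𝓝[≠] 0)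
        (𝓝 (inner ℂ (c j k) (c k j))) :=
      tendsto_const_nhds.inner ((hasDirDeriv_iff_tendsto.1 (hc k j)).comp tendsto_neg_nhdsNE)
    simp only [h1] at h2
    rw [tendsto_nhds_unique h2 h3, hsymm j k, inner_self_eq_norm_sq_to_K]
    simp
  -- Summing over `k` and `j` shows that the square of the `L²` norm of the Laplacian is the sum of
  -- those of all second derivatives.
  have hsum : ‖∑ i, c i i‖ ^ 2 = ∑ k, ∑ j, ‖c k j‖ ^ 2 := by
    have h := inner_self_eq_norm_sq_to_K (𝕜 := ℂ) (∑ i, c i i)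
    simp only [sum_inner, inner_sum, key] at h
    apply Complex.ofReal_injective
    rw [Complex.ofReal_pow]
    refine h.symm.trans ?_
    push_cast
    exact Finset.sum_congr rfl fun k _ => Finset.sum_congr rfl fun j _ => by
      rw [hsymm]
  refine le_of_sq_le_sq ?_ (norm_nonneg _)
  rw [hsum]
  calc ‖c k j‖ ^ 2 ≤ ∑ j, ‖c k j‖ ^ 2 :=
        Finset.single_le_sum (f := fun j => ‖c k j‖ ^ 2) (fun j _ => sq_nonneg ‖c k j‖)
          (Finset.mem_univ j)
    _ ≤ _ := Finset.single_le_sum (f := fun k => ∑ j, ‖c k j‖ ^ 2)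
          (fun k _ => Finset.sum_nonneg fun j _ => sq_nonneg ‖c k j‖) (Finset.mem_univ k)

/-! ### Multiplication operators -/

open BoundedContinuousFunction in
theorem mul_memLp (V : Sp d →ᵇ ℝ) (f : L2 d) :
    MemLp (fun x => (V x : ℂ) * f x) 2 volume := by
  refine (Lp.memLp f).of_le_mul (c := ‖V‖) ?_ (Eventually.of_forall fun x => ?_)
  · exact (Complex.continuous_ofReal.comp V.continuous).aestronglyMeasurable.mul
      (Lp.aestronglyMeasurable f)
  · rw [norm_mul, Complex.norm_real]
    gcongr
    exact V.norm_coe_le_norm x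

open BoundedContinuousFunction in
/-- Multiplication by a bounded continuous function on `L²`. -/
noncomputable def mulOp (V : Sp d →ᵇ ℝ) : L2 d →L[ℝ] L2 d :=
  LinearMap.mkContinuous
    { toFun := fun f => (mul_memLp V f).toLp _
      map_add' := fun f g => by
        apply Lp.ext
        filter_upwards [(mul_memLp V (f + g)).coeFn_toLp, (mul_memLp V f).coeFn_toLp,
          (mul_memLp V g).coeFn_toLp, Lp.coeFn_add f g,
          Lp.coeFn_add ((mul_memLp V f).toLp _) ((mul_memLp V g).toLp _)] with x h1 h2 h3 h4 h5
        rw [h1, h5, Pi.add_apply, h2, h3, h4, Pi.add_apply, mul_add]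
      map_smul' := fun c f => by
        apply Lp.ext
        filter_upwards [(mul_memLp V (c • f)).coeFn_toLp, (mul_memLp V f).coeFn_toLp,
          Lp.coeFn_smul c f, Lp.coeFn_smul c ((mul_memLp V f).toLp _)] with x h1 h2 h3 h4
        simp only [RingHom.id_apply]
        rw [h1, h4, Pi.smul_apply, h2, h3, Pi.smul_apply, mul_smul_comm] }
    ‖V‖ fun f => by
      refine Lp.norm_le_mul_norm_of_ae_le_mul ?_
      filter_upwards [(mul_memLp V f).coeFn_toLp] with x hx
      simp only [LinearMap.coe_mk, AddHom.coe_mk]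
      rw [hx, norm_mul, Complex.norm_real]
      gcongr
      exact V.norm_coe_le_norm x

open BoundedContinuousFunction

theorem coeFn_mulOp (V : Sp d →ᵇ ℝ) (f : L2 d) :
    mulOp V f =ᵐ[volume] fun x => (V x : ℂ) * f x :=
  (mul_memLp V f).coeFn_toLp

theorem norm_mulOp_le (V : Sp d →ᵇ ℝ) (f : L2 d) : ‖mulOp V f‖ ≤ ‖V‖ * ‖f‖ :=
  (mulOp V).le_of_opNorm_le (LinearMap.mkContinuous_norm_le _ (norm_nonneg _) _) f

theorem inner_mulOp (V : Sp d →ᵇ ℝ) (f g : L2 d) :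
    inner ℂ (mulOp V f) g = inner ℂ f (mulOp V g) := by
  rw [L2.inner_def, L2.inner_def]
  refine integral_congr_ae ?_
  filter_upwards [coeFn_mulOp V f, coeFn_mulOp V g] with x h1 h2
  rw [h1, h2]
  simp only [RCLike.inner_apply, map_mul, Complex.conj_ofReal]
  ring

/-- Multiplication operators converge strongly if the multipliers converge pointwise and
boundedly. -/
theorem tendsto_mulOp {α : Type*} {l : Filter α} [l.IsCountablyGenerated] {V : α → Sp d →ᵇ ℝ}
    {W : Sp d →ᵇ ℝ} {M : ℝ} (hM : ∀ a, ‖V a‖ ≤ M)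
    (h : ∀ x, Tendsto (fun a => V a x) l (𝓝 (W x))) (f : L2 d) :
    Tendsto (fun a => mulOp (V a) f) l (𝓝 (mulOp W f)) := by
  rw [tendsto_iff_norm_sub_tendsto_zero]
  have h1 : Tendsto (fun a => ‖mulOp (V a) f - mulOp W f‖ ^ 2) l (𝓝 0) := by
    have h2 : ∀ a, ‖mulOp (V a) f - mulOp W f‖ ^ 2 =
        ∫ x, |V a x - W x| ^ 2 * ‖f x‖ ^ 2 := by
      intro a
      rw [← integral_norm_sq]
      refine integral_congr_ae ?_
      filter_upwards [Lp.coeFn_sub (mulOp (V a) f) (mulOp W f), coeFn_mulOp (V a) f,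
        coeFn_mulOp W f] with x e1 e2 e3
      rw [e1, Pi.sub_apply, e2, e3, ← sub_mul, ← Complex.ofReal_sub, norm_mul, Complex.norm_real,
        mul_pow, Real.norm_eq_abs]
    simp only [h2]
    have h3 := tendsto_integral_filter_of_dominated_convergence (μ := (volume : Measure (Sp d)))
      (l := l) (F := fun a x => |V a x - W x| ^ 2 * ‖f x‖ ^ 2) (f := fun _ => 0)
      (fun x => (M + ‖W‖) ^ 2 * ‖f x‖ ^ 2) ?_ ?_ ?_ ?_
    · simpa using h3
    · refine Eventually.of_forall fun a => ?_
      exact (((V a).continuous.sub W.continuous).abs.pow 2).aestronglyMeasurable.mul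
        (integrable_norm_sq f).aestronglyMeasurable
    · refine Eventually.of_forall fun a => Eventually.of_forall fun x => ?_
      rw [norm_mul, norm_pow, norm_pow, norm_norm, Real.norm_eq_abs, abs_abs]
      gcongr
      calc |V a x - W x| ≤ |V a x| + |W x| := abs_sub _ _
        _ ≤ M + ‖W‖ := add_le_add (((V a).norm_coe_le_norm x).trans (hM a)) (W.norm_coe_le_norm x)
    · exact (integrable_norm_sq f).const_mul _
    · refine Eventually.of_forall fun x => ?_
      have h4 := (((h x).sub_const (W x)).abs.pow 2).mul_const (‖f x‖ ^ 2)
      simpa using h4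
  have h5 := h1.sqrt
  simpa using h5

end Bohm

namespace Bohm

open BoundedContinuousFunction

variable {d : ℕ}

/-! ### The Hamiltonian -/

theorem HasDirDeriv.real_smul {v : Sp d} {f f' : L2 d} (hf : HasDirDeriv v f f') (c : ℝ) :
    HasDirDeriv v (c • f) (c • f') :=
  hf.map (c • ContinuousLinearMap.id ℝ (L2 d)) fun w g => by simp

/-- `w = -(ε²/2) Δv + V v`. -/
def HasHam (V : Sp d →ᵇ ℝ) (ε : ℝ) (v w : L2 d) : Prop :=
  ∃ b c : Fin d → L2 d, (∀ j, HasDirDeriv (basisVec j) v (b j)) ∧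
    (∀ j, HasDirDeriv (basisVec j) (b j) (c j)) ∧
    w = (-(ε ^ 2 / 2)) • ∑ j, c j + mulOp V v

theorem HasHam.sub {V : Sp d →ᵇ ℝ} {ε : ℝ} {v w v' w' : L2 d} (h : HasHam V ε v w)
    (h' : HasHam V ε v' w') : HasHam V ε (v - v') (w - w') := by
  obtain ⟨b, c, hb, hc, rfl⟩ := h
  obtain ⟨b', c', hb', hc', rfl⟩ := h'
  refine ⟨fun j => b j - b' j, fun j => c j - c' j, fun j => (hb j).sub (hb' j),
    fun j => (hc j).sub (hc' j), ?_⟩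
  rw [Finset.sum_sub_distrib, smul_sub, map_sub]
  abel

theorem HasHam.real_smul {V : Sp d →ᵇ ℝ} {ε : ℝ} {v w : L2 d} (h : HasHam V ε v w) (r : ℝ) :
    HasHam V ε (r • v) (r • w) := by
  obtain ⟨b, c, hb, hc, rfl⟩ := h
  refine ⟨fun j => r • b j, fun j => r • c j, fun j => (hb j).real_smul r,
    fun j => (hc j).real_smul r, ?_⟩
  rw [← Finset.smul_sum, smul_add, map_smul, smul_comm r]

/-- The difference quotient of a potential. -/
noncomputable def diffQuotPot (V : Sp d →ᵇ ℝ) (v : Sp d) (s : ℝ) : Sp d →ᵇ ℝ :=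
  s⁻¹ • (V.compContinuous ⟨fun x => x + s • v, by fun_prop⟩ - V)

theorem diffQuotPot_apply (V : Sp d →ᵇ ℝ) (v : Sp d) (s : ℝ) (x : Sp d) :
    diffQuotPot V v s x = s⁻¹ * (V (x + s • v) - V x) := rfl

theorem norm_diffQuotPot_le {V : Sp d →ᵇ ℝ} {M : ℝ} (hM : ∀ x y, |V x - V y| ≤ M * ‖x - y‖)
    {v : Sp d} (hv : ‖v‖ = 1) (s : ℝ) : ‖diffQuotPot V v s‖ ≤ M := by
  have hM0 : 0 ≤ M := by
    have := (abs_nonneg _).trans (hM v 0)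
    simpa [hv] using this
  refine (BoundedContinuousFunction.norm_le hM0).2 fun x => ?_
  rw [diffQuotPot_apply, norm_mul, norm_inv, Real.norm_eq_abs, Real.norm_eq_abs]
  rcases eq_or_ne s 0 with rfl | hs
  · simpa using hM0
  · have hs' : 0 < |s| := abs_pos.2 hs
    rw [inv_mul_le_iff₀ hs']
    refine (hM _ _).trans (le_of_eq ?_)
    rw [add_sub_cancel_left, norm_smul, hv, Real.norm_eq_abs]
    ring

/-- The commutator of the difference quotient with a potential. -/
noncomputable def commPot (V : Sp d →ᵇ ℝ) (v : Sp d) (s : ℝ) : L2 d →L[ℝ] L2 d :=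
  (mulOp (diffQuotPot V v s)).comp (translate (s • v)).toContinuousLinearMap

theorem commPot_apply (V : Sp d →ᵇ ℝ) (v : Sp d) (s : ℝ) (f : L2 d) :
    commPot V v s f = mulOp (diffQuotPot V v s) (translate (s • v) f) := rfl

/-- Discrete Leibniz rule: the difference quotient falls either on `f`, or on `V` with `f`
translated. -/
theorem diffQuot_mulOp (V : Sp d →ᵇ ℝ) (v : Sp d) (s : ℝ) (f : L2 d) :
    diffQuot v s (mulOp V f) = mulOp V (diffQuot v s f) + commPot V v s f := by
  apply Lp.ext
  rw [diffQuot_apply, diffQuot_apply, commPot_apply]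
  filter_upwards [Lp.coeFn_smul s⁻¹ (translate (s • v) (mulOp V f) - mulOp V f),
    Lp.coeFn_sub (translate (s • v) (mulOp V f)) (mulOp V f), coeFn_translate (s • v) (mulOp V f),
    coeFn_mulOp V f, ae_comp_add (coeFn_mulOp V f) (s • v),
    Lp.coeFn_add (mulOp V (s⁻¹ • (translate (s • v) f - f)))
      (mulOp (diffQuotPot V v s) (translate (s • v) f)),
    coeFn_mulOp V (s⁻¹ • (translate (s • v) f - f)),
    coeFn_mulOp (diffQuotPot V v s) (translate (s • v) f),
    Lp.coeFn_smul s⁻¹ (translate (s • v) f - f), Lp.coeFn_sub (translate (s • v) f) f,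
    coeFn_translate (s • v) f] with x h1 h2 h3 h4 h5 h6 h7 h8 h9 h10 h11
  rw [h1, Pi.smul_apply, h2, Pi.sub_apply, h3, h4, h5, h6, Pi.add_apply, h7, h8, h9, Pi.smul_apply,
    h10, Pi.sub_apply, h11, diffQuotPot_apply]
  simp only [Complex.real_smul]
  push_cast
  ring

theorem norm_commPot_le {V : Sp d →ᵇ ℝ} {M : ℝ} (hM : ∀ x y, |V x - V y| ≤ M * ‖x - y‖)
    {v : Sp d} (hv : ‖v‖ = 1) (s : ℝ) (f : L2 d) : ‖commPot V v s f‖ ≤ M * ‖f‖ := by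
  rw [commPot_apply]
  refine (norm_mulOp_le _ _).trans ?_
  rw [LinearIsometry.norm_map]
  gcongr
  exact norm_diffQuotPot_le hM hv s

/-- `V` is Lipschitz, so its difference quotients are uniformly bounded multipliers that converge
pointwise; this gives strong convergence by dominated convergence. The translation acting on `f` is
removed by its strong continuity. -/
theorem tendsto_commPot {V W : Sp d →ᵇ ℝ} {M : ℝ} (hM : ∀ x y, |V x - V y| ≤ M * ‖x - y‖)
    {v : Sp d} (hv : ‖v‖ = 1)
    (hW : ∀ x, Tendsto (fun s => diffQuotPot V v s x) (𝓝[≠] 0) (𝓝 (W x))) (f : L2 d) :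
    Tendsto (fun s => commPot V v s f) (𝓝[≠] 0) (𝓝 (mulOp W f)) := by
  have h1 := tendsto_mulOp (l := 𝓝[≠] (0 : ℝ)) (norm_diffQuotPot_le hM hv) hW f
  have h2 : Tendsto (fun s => commPot V v s f - mulOp (diffQuotPot V v s) f) (𝓝[≠] 0) (𝓝 0) := by
    have h3 : Tendsto (fun s : ℝ => M * ‖translate (s • v) f - f‖) (𝓝[≠] 0) (𝓝 0) := by
      have h4 : Continuous fun s : ℝ => M * ‖translate (s • v) f - f‖ :=
        (((continuous_translate (by simp) f).comp
          (by fun_prop : Continuous fun s : ℝ => s • v)).sub continuous_const).norm.const_mul M |>.congr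
          fun _ => rfl
      have h5 := h4.tendsto 0
      simp only [zero_smul, translate_zero, sub_self, norm_zero, mul_zero] at h5
      exact h5.mono_left nhdsWithin_le_nhds
    refine squeeze_zero_norm (fun s => ?_) h3
    rw [commPot_apply, ← map_sub]
    refine (norm_mulOp_le _ _).trans ?_
    gcongr
    exact norm_diffQuotPot_le hM hv s
  have h3 := h2.add h1
  rw [zero_add] at h3
  exact h3.congr fun s => by abel

theorem HasDirDeriv.mulOp {V W : Sp d →ᵇ ℝ} {M : ℝ} (hM : ∀ x y, |V x - V y| ≤ M * ‖x - y‖)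
    {v : Sp d} (hv : ‖v‖ = 1)
    (hW : ∀ x, Tendsto (fun s => diffQuotPot V v s x) (𝓝[≠] 0) (𝓝 (W x))) {f f' : L2 d}
    (hf : HasDirDeriv v f f') :
    HasDirDeriv v (Bohm.mulOp V f) (Bohm.mulOp V f' + Bohm.mulOp W f) := by
  rw [hasDirDeriv_iff_tendsto] at hf ⊢
  simp only [diffQuot_mulOp]
  exact (((Bohm.mulOp V).continuous.tendsto _).comp hf).add (tendsto_commPot hM hv hW f)

theorem HasHam.diffQuot {V : Sp d →ᵇ ℝ} {ε : ℝ} {u w : L2 d} (h : HasHam V ε u w) (v : Sp d)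
    (s : ℝ) : HasHam V ε (Bohm.diffQuot v s u) (Bohm.diffQuot v s w - commPot V v s u) := by
  obtain ⟨b, c, hb, hc, rfl⟩ := h
  refine ⟨fun j => Bohm.diffQuot v s (b j), fun j => Bohm.diffQuot v s (c j),
    fun j => (hb j).diffQuot s, fun j => (hc j).diffQuot s, ?_⟩
  rw [map_add, map_smul, diffQuot_mulOp, map_sum]
  abel

/-- The Hamiltonian is symmetric. -/
theorem HasHam.inner_comm {V : Sp d →ᵇ ℝ} {ε : ℝ} {v w v' w' : L2 d} (h : HasHam V ε v w)
    (h' : HasHam V ε v' w') : inner ℂ w v' = inner ℂ v w' := by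
  obtain ⟨b, c, hb, hc, rfl⟩ := h
  obtain ⟨b', c', hb', hc', rfl⟩ := h'
  have key : ∀ j, inner ℂ (c j) v' = inner ℂ v (c' j) := by
    intro j
    have h1 := (hc j).inner_add_inner (hb' j)
    have h2 := (hb j).inner_add_inner (hc' j)
    linear_combination h1 - h2
  simp only [inner_add_left, inner_add_right, inner_smul_left_eq_smul, inner_smul_right_eq_smul,
    sum_inner, inner_sum, key, inner_mulOp]

/-! ### Conservation laws and energy estimates -/

/-- `u` solves `i ε u' = H u + r`. -/
def IsSol (V : Sp d →ᵇ ℝ) (ε : ℝ) (u u' r : ℝ → L2 d) : Prop :=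
  ∀ t, HasDerivAt u (u' t) t ∧ HasHam V ε (u t) ((Complex.I * ε) • u' t - r t)

/-- Symmetry of the Hamiltonian makes the time derivative of the inner product vanish. Applying this
to a solution and its own time difference quotients gives conservation of energy later on. -/
theorem IsSol.inner_eq {V : Sp d →ᵇ ℝ} {ε : ℝ} (hε : ε ≠ 0) {u u' v v' : ℝ → L2 d}
    (hu : IsSol V ε u u' 0) (hv : IsSol V ε v v' 0) (t : ℝ) :
    inner ℂ (u t) (v t) = inner ℂ (u 0) (v 0) := by
  have hd : ∀ t, HasDerivAt (fun t => inner ℂ (u t) (v t)) 0 t := by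
    intro t
    have h1 := HasDerivAt.inner ℂ (hu t).1 (hv t).1
    have h2 := (hu t).2.inner_comm (hv t).2
    simp only [Pi.zero_apply, sub_zero, inner_smul_left, inner_smul_right, map_mul, Complex.conj_I,
      Complex.conj_ofReal] at h2
    have h3 : (Complex.I * (ε : ℂ)) * (inner ℂ (u t) (v' t) + inner ℂ (u' t) (v t)) = 0 := by
      linear_combination -h2
    have h4 : Complex.I * (ε : ℂ) ≠ 0 := mul_ne_zero Complex.I_ne_zero (by exact_mod_cast hε)
    rwa [(mul_eq_zero.1 h3).resolve_left h4] at h1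
  exact is_const_of_deriv_eq_zero (fun t => (hd t).differentiableAt) (fun t => (hd t).deriv) t 0

theorem IsSol.norm_eq {V : Sp d →ᵇ ℝ} {ε : ℝ} (hε : ε ≠ 0) {u u' : ℝ → L2 d}
    (hu : IsSol V ε u u' 0) (t : ℝ) : ‖u t‖ = ‖u 0‖ := by
  have h := hu.inner_eq hε hu t
  rw [inner_self_eq_norm_sq_to_K, inner_self_eq_norm_sq_to_K] at h
  have h' : ‖u t‖ ^ 2 = ‖u 0‖ ^ 2 := by exact_mod_cast h
  exact (pow_left_inj₀ (norm_nonneg _) (norm_nonneg _) two_ne_zero).1 h'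

/-- If `(a²)' ≤ K a b`, then `a` grows at most by `K ∫ b`. -/
theorem le_add_integral_of_deriv_sq_le {a b : ℝ → ℝ} {N' : ℝ → ℂ} {K : ℝ} (hK : 0 ≤ K)
    (ha : Continuous a) (ha0 : ∀ t, 0 ≤ a t) (hb : Continuous b) (hb0 : ∀ t, 0 ≤ b t)
    (hN' : Continuous N') (hd : ∀ t, HasDerivAt (fun t => ((a t ^ 2 : ℝ) : ℂ)) (N' t) t)
    (hbd : ∀ t, ‖N' t‖ ≤ K * (a t * b t)) {T t : ℝ} (ht : t ∈ Set.Icc (-T) T) :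
    a t ≤ a 0 + K * ∫ s in Set.Icc (-T) T, b s := by
  -- At a maximum point `tm` of `a` the hypothesis integrates to `a(tm)² - a(0)² ≤ K a(tm) ∫ b`,
  -- which forces `a(tm) ≤ a(0) + K ∫ b`. Working with `a²` avoids differentiating a norm at its
  -- zeros.
  obtain ⟨tm, htm, hmax⟩ := isCompact_Icc.exists_isMaxOn ⟨t, ht⟩ ha.continuousOn
  have hI0 : 0 ≤ ∫ s in Set.Icc (-T) T, b s := integral_nonneg hb0
  have h0 : (0 : ℝ) ∈ Set.Icc (-T) T := by
    have := ht.1.trans ht.2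
    constructor <;> linarith
  have hint := intervalIntegral.integral_eq_sub_of_hasDerivAt (a := 0) (b := tm)
    (fun t _ => hd t) (hN'.intervalIntegrable _ _)
  have hsub : Set.uIoc 0 tm ⊆ Set.Icc (-T) T :=
    Set.uIoc_subset_uIcc.trans (Set.OrdConnected.uIcc_subset inferInstance h0 htm)
  have hmain : ‖((a tm ^ 2 : ℝ) : ℂ) - ((a 0 ^ 2 : ℝ) : ℂ)‖ ≤
      K * (a tm * ∫ s in Set.Icc (-T) T, b s) := by
    rw [← hint]
    refine (intervalIntegral.norm_integral_le_integral_norm_uIoc).trans ?_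
    have e1 : ∫ s in Set.uIoc 0 tm, ‖N' s‖ ≤ ∫ s in Set.uIoc 0 tm, K * (a tm * b s) := by
      refine setIntegral_mono_on ?_ ?_ measurableSet_uIoc fun s hs => (hbd s).trans ?_
      · exact (hN'.norm.integrableOn_Icc (a := -T) (b := T)).mono_set hsub
      · have hc : Continuous fun s => K * (a tm * b s) := by fun_prop
        exact (hc.integrableOn_Icc (a := -T) (b := T)).mono_set hsub
      · have h1 : a s ≤ a tm := hmax (hsub hs)
        have h2 := hb0 s
        gcongr
    refine e1.trans ?_
    rw [integral_const_mul, integral_const_mul]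
    have e2 : ∫ s in Set.uIoc 0 tm, b s ≤ ∫ s in Set.Icc (-T) T, b s :=
      setIntegral_mono_set hb.integrableOn_Icc (Eventually.of_forall hb0) hsub.eventuallyLE
    have h2 := ha0 tm
    gcongr
  rw [← Complex.ofReal_sub, Complex.norm_real] at hmain
  have hmain' := (le_abs_self _).trans hmain
  have hmfin : a tm ≤ a 0 + K * ∫ s in Set.Icc (-T) T, b s := by
    by_contra hcon
    push Not at hcon
    have hA : 0 ≤ K * ∫ s in Set.Icc (-T) T, b s := by positivity
    have hu0 := ha0 0
    rw [mul_left_comm] at hmain'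
    nlinarith
  exact (hmax ht).trans hmfin

/-- The symmetric Hamiltonian drops out of `iε d/dt ‖u‖²`, leaving `⟨u, r⟩ - ⟨r, u⟩`; Cauchy–Schwarz
does the rest. -/
theorem IsSol.norm_deriv_le {V : Sp d →ᵇ ℝ} {ε : ℝ} (hε : 0 < ε) {u u' r : ℝ → L2 d}
    (hu : IsSol V ε u u' r) (t : ℝ) :
    ‖inner ℂ (u t) (u' t) + inner ℂ (u' t) (u t)‖ ≤ 2 / ε * (‖u t‖ * ‖r t‖) := by
  have h2 := (hu t).2.inner_comm (hu t).2
  simp only [inner_sub_left, inner_sub_right, inner_smul_left, inner_smul_right, map_mul,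
    Complex.conj_I, Complex.conj_ofReal] at h2
  have h3 : (Complex.I * (ε : ℂ)) * (inner ℂ (u t) (u' t) + inner ℂ (u' t) (u t)) =
      inner ℂ (u t) (r t) - inner ℂ (r t) (u t) := by
    linear_combination -h2
  have h4 := congrArg norm h3
  rw [norm_mul, norm_mul, Complex.norm_I, one_mul, Complex.norm_real, Real.norm_eq_abs,
    abs_of_pos hε] at h4
  have h5 : ‖inner ℂ (u t) (r t) - inner ℂ (r t) (u t)‖ ≤ 2 * (‖u t‖ * ‖r t‖) := by
    refine (norm_sub_le _ _).trans ?_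
    have e1 := norm_inner_le_norm (𝕜 := ℂ) (u t) (r t)
    have e2 := norm_inner_le_norm (𝕜 := ℂ) (r t) (u t)
    linarith [mul_comm ‖u t‖ ‖r t‖]
  rw [div_mul_eq_mul_div, le_div_iff₀ hε, mul_comm]
  linarith

theorem IsSol.norm_le {V : Sp d →ᵇ ℝ} {ε : ℝ} (hε : 0 < ε) {u u' r : ℝ → L2 d}
    (hu : IsSol V ε u u' r) (hu' : Continuous u') (hr : Continuous r) {T t : ℝ}
    (ht : t ∈ Set.Icc (-T) T) :
    ‖u t‖ ≤ ‖u 0‖ + 2 / ε * ∫ s in Set.Icc (-T) T, ‖r s‖ := by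
  have huc : Continuous u := continuous_iff_continuousAt.2 fun t => (hu t).1.continuousAt
  refine le_add_integral_of_deriv_sq_le (a := fun t => ‖u t‖) (b := fun t => ‖r t‖) (by positivity)
    huc.norm (fun _ => norm_nonneg _) hr.norm (fun _ => norm_nonneg _)
    ((huc.inner hu').add (hu'.inner huc) :
      Continuous fun t => inner ℂ (u t) (u' t) + inner ℂ (u' t) (u t))
    (fun t => ?_) (hu.norm_deriv_le hε) ht
  refine (HasDerivAt.inner ℂ (hu t).1 (hu t).1).congr_of_eventuallyEq
    (Eventually.of_forall fun s => ?_)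
  simp only
  rw [inner_self_eq_norm_sq_to_K, Complex.ofReal_pow]
  rfl

/-- The Hamiltonian does not depend on time, so time difference quotients solve the equation
exactly, without a source. They stand in for `u'`, whose own time derivative is not available. -/
theorem IsSol.timeDiff {V : Sp d →ᵇ ℝ} {ε : ℝ} {u u' : ℝ → L2 d} (hu : IsSol V ε u u' 0)
    (h : ℝ) : IsSol V ε (fun t => h⁻¹ • (u (t + h) - u t)) (fun t => h⁻¹ • (u' (t + h) - u' t))
      0 := by
  intro t
  refine ⟨(((hu (t + h)).1.comp_add_const t h).sub (hu t).1).const_smul h⁻¹, ?_⟩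
  have := ((hu (t + h)).2.sub (hu t).2).real_smul h⁻¹
  convert this using 1
  simp only [Pi.zero_apply, sub_zero]
  rw [← smul_sub, smul_comm]

/-- Only the potential fails to commute with translations, and the resulting source is bounded
uniformly in `s` by the Lipschitz constant of `V`. -/
theorem IsSol.spaceDiff {V : Sp d →ᵇ ℝ} {ε : ℝ} {u u' : ℝ → L2 d} (hu : IsSol V ε u u' 0)
    (v : Sp d) (s : ℝ) : IsSol V ε (fun t => diffQuot v s (u t)) (fun t => diffQuot v s (u' t))
      (fun t => commPot V v s (u t)) := by
  intro t
  refine ⟨(diffQuot v s).hasFDerivAt.comp_hasDerivAt t (hu t).1, ?_⟩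
  have := (hu t).2.diffQuot v s
  convert this using 2
  simp only [Pi.zero_apply, sub_zero]
  rw [diffQuot_smul]

theorem IsSol.sub {V : Sp d →ᵇ ℝ} {ε : ℝ} {u u' r v v' q : ℝ → L2 d} (hu : IsSol V ε u u' r)
    (hv : IsSol V ε v v' q) : IsSol V ε (fun t => u t - v t) (fun t => u' t - v' t)
      (fun t => r t - q t) := by
  intro t
  refine ⟨(hu t).1.sub (hv t).1, ?_⟩
  have := (hu t).2.sub (hv t).2
  convert this using 1
  rw [smul_sub, sub_sub_sub_comm]

end Bohm

namespace Bohm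

open BoundedContinuousFunction

variable {d : ℕ}

/-! ### Propagation of regularity -/

theorem tendsto_timeDiff {u u' : ℝ → L2 d} {t : ℝ} (h : HasDerivAt u (u' t) t) :
    Tendsto (fun n : ℕ => (1 / ((n : ℝ) + 1))⁻¹ • (u (t + 1 / ((n : ℝ) + 1)) - u t)) atTop
      (𝓝 (u' t)) := by
  refine (hasDerivAt_iff_tendsto_slope_zero.1 h).comp
    (tendsto_nhdsWithin_of_tendsto_nhds_of_eventually_within _
      tendsto_one_div_add_atTop_nhds_zero_nat (Eventually.of_forall fun n => ?_))
  have : (0 : ℝ) < 1 / ((n : ℝ) + 1) := by positivity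
  exact this.ne'

/-- A difference quotient estimate for the time derivative of a solution. -/
theorem IsSol.norm_diffQuot_sub_le {V : Sp d →ᵇ ℝ} {M : ℝ}
    (hM : ∀ x y, |V x - V y| ≤ M * ‖x - y‖) {ε : ℝ} (hε : 0 < ε) {u u' : ℝ → L2 d}
    (hu : IsSol V ε u u' 0) (hu' : Continuous u') {v : Sp d} (hv : ‖v‖ = 1) (s s' : ℝ) {T t : ℝ}
    (ht : t ∈ Set.Icc (-T) T) :
    ‖diffQuot v s (u' t) - diffQuot v s' (u' t)‖ ≤
      ‖diffQuot v s (u' 0) - diffQuot v s' (u' 0)‖ +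
        2 / ε * ∫ r in Set.Icc (-T) T, ‖commPot V v s (u' r) - commPot V v s' (u' r)‖ := by
  have huc : Continuous u := continuous_iff_continuousAt.2 fun t => (hu t).1.continuousAt
  -- The energy estimate would need `u'` to be a classical solution. It is applied instead to the
  -- time difference quotients `w n`, which are, and then `n → ∞`.
  let h : ℕ → ℝ := fun n => 1 / ((n : ℝ) + 1)
  let w : ℕ → ℝ → L2 d := fun n t => (h n)⁻¹ • (u (t + h n) - u t)
  have hw : ∀ n, IsSol V ε (w n) (fun t => (h n)⁻¹ • (u' (t + h n) - u' t)) 0 := fun n =>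
    hu.timeDiff (h n)
  have hwlim : ∀ t, Tendsto (fun n => w n t) atTop (𝓝 (u' t)) := fun t =>
    tendsto_timeDiff (hu t).1
  have hwc : ∀ n, Continuous (w n) := fun n => by fun_prop
  have hest : ∀ n, ‖diffQuot v s (w n t) - diffQuot v s' (w n t)‖ ≤
      ‖diffQuot v s (w n 0) - diffQuot v s' (w n 0)‖ +
        2 / ε * ∫ r in Set.Icc (-T) T, ‖commPot V v s (w n r) - commPot V v s' (w n r)‖ := fun n =>
    (((hw n).spaceDiff v s).sub ((hw n).spaceDiff v s')).norm_le hε (by fun_prop) (by fun_prop) ht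
  have hl : ∀ t, Tendsto (fun n => ‖diffQuot v s (w n t) - diffQuot v s' (w n t)‖) atTop
      (𝓝 ‖diffQuot v s (u' t) - diffQuot v s' (u' t)‖) := fun t =>
    ((((diffQuot v s).continuous.tendsto _).comp (hwlim t)).sub
      (((diffQuot v s').continuous.tendsto _).comp (hwlim t))).norm
  -- The norms of the `w n` are conserved in time, so a bound at time zero dominates the source
  -- terms at all times.
  obtain ⟨B, hB⟩ := (hwlim 0).norm.bddAbove_range
  have hB' : ∀ n, ‖w n 0‖ ≤ B := fun n => hB ⟨n, rfl⟩
  have hint : Tendsto (fun n => ∫ r in Set.Icc (-T) T,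
      ‖commPot V v s (w n r) - commPot V v s' (w n r)‖) atTop
      (𝓝 (∫ r in Set.Icc (-T) T, ‖commPot V v s (u' r) - commPot V v s' (u' r)‖)) := by
    refine tendsto_integral_of_dominated_convergence (fun _ => M * B + M * B) (fun n => ?_) ?_
      (fun n => Eventually.of_forall fun r => ?_) (Eventually.of_forall fun r => ?_)
    · have hwn := hwc n
      exact (by fun_prop : Continuous fun r =>
        ‖commPot V v s (w n r) - commPot V v s' (w n r)‖).aestronglyMeasurable
    · exact integrable_const _
    · rw [norm_norm]
      have hM0 : 0 ≤ M := by
        have := (abs_nonneg _).trans (hM v 0)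
        simpa [hv] using this
      have hwb : ‖w n r‖ ≤ B := ((hw n).norm_eq hε.ne' r).le.trans (hB' n)
      refine (norm_sub_le _ _).trans (add_le_add ?_ ?_)
      · exact (norm_commPot_le hM hv s _).trans (by gcongr)
      · exact (norm_commPot_le hM hv s' _).trans (by gcongr)
    · exact ((((commPot V v s).continuous.tendsto _).comp (hwlim r)).sub
        (((commPot V v s').continuous.tendsto _).comp (hwlim r))).norm
  exact le_of_tendsto_of_tendsto' (hl t) ((hl 0).add (hint.const_mul _)) hest

/-- If the time derivative of a solution is differentiable along `v` initially, then it is so at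
all times. -/
theorem IsSol.exists_hasDirDeriv {V W : Sp d →ᵇ ℝ} {M : ℝ}
    (hM : ∀ x y, |V x - V y| ≤ M * ‖x - y‖) {ε : ℝ} (hε : 0 < ε) {u u' : ℝ → L2 d}
    (hu : IsSol V ε u u' 0) (hu' : Continuous u') {v : Sp d} (hv : ‖v‖ = 1)
    (hW : ∀ x, Tendsto (fun s => diffQuotPot V v s x) (𝓝[≠] 0) (𝓝 (W x))) {b₀ : L2 d}
    (hb₀ : HasDirDeriv v (u' 0) b₀) :
    ∃ b : ℝ → L2 d, Continuous b ∧ ∀ t, HasDirDeriv v (u' t) (b t) := by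
  have hM0 : 0 ≤ M := by
    have := (abs_nonneg _).trans (hM v 0)
    simpa [hv] using this
  -- `α T s` measures the distance of the data and of the commutator from their limits as `s → 0`;
  -- it controls the Cauchy differences uniformly for `|t| ≤ T`.
  let α : ℝ → ℝ → ℝ := fun T s => ‖diffQuot v s (u' 0) - b₀‖ +
    2 / ε * ∫ r in Set.Icc (-T) T, ‖commPot V v s (u' r) - mulOp W (u' r)‖
  have hα : ∀ T, Tendsto (α T) (𝓝[≠] 0) (𝓝 0) := by
    intro T
    have h1 := (hasDirDeriv_iff_tendsto.1 hb₀).sub_const b₀ |>.norm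
    rw [sub_self, norm_zero] at h1
    obtain ⟨B, hB⟩ := (isCompact_Icc (a := -T) (b := T)).exists_bound_of_continuousOn
      hu'.continuousOn
    have h2 : Tendsto (fun s => ∫ r in Set.Icc (-T) T,
        ‖commPot V v s (u' r) - mulOp W (u' r)‖) (𝓝[≠] 0) (𝓝 (∫ r in Set.Icc (-T) T, 0)) := by
      refine tendsto_integral_filter_of_dominated_convergence (fun _ => M * B + ‖W‖ * B)
        (Eventually.of_forall fun s => ?_) (Eventually.of_forall fun s => ?_)
        (integrable_const _) (Eventually.of_forall fun r => ?_)
      · exact (by fun_prop : Continuous fun r =>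
          ‖commPot V v s (u' r) - mulOp W (u' r)‖).aestronglyMeasurable
      · filter_upwards [ae_restrict_mem measurableSet_Icc] with r hr
        rw [norm_norm]
        have hb := hB r hr
        refine (norm_sub_le _ _).trans (add_le_add ?_ ?_)
        · exact (norm_commPot_le hM hv s _).trans (by gcongr)
        · exact (norm_mulOp_le _ _).trans (by gcongr)
      · have h3 := ((tendsto_commPot hM hv hW (u' r)).sub_const (mulOp W (u' r))).norm
        rwa [sub_self, norm_zero] at h3
    have h3 := h1.add (h2.const_mul (2 / ε))
    simpa [α] using h3
  have hest : ∀ T t, t ∈ Set.Icc (-T) T → ∀ s s',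
      ‖diffQuot v s (u' t) - diffQuot v s' (u' t)‖ ≤ α T s + α T s' := by
    intro T t ht s s'
    refine (hu.norm_diffQuot_sub_le hM hε hu' hv s s' ht).trans ?_
    have e1 : ‖diffQuot v s (u' 0) - diffQuot v s' (u' 0)‖ ≤
        ‖diffQuot v s (u' 0) - b₀‖ + ‖diffQuot v s' (u' 0) - b₀‖ := by
      rw [norm_sub_rev (diffQuot v s' (u' 0)) b₀]
      exact norm_sub_le_norm_sub_add_norm_sub _ _ _
    have hc : ∀ s, Continuous fun r => ‖commPot V v s (u' r) - mulOp W (u' r)‖ := fun s => by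
      fun_prop
    have hc' : Continuous fun r => ‖commPot V v s (u' r) - commPot V v s' (u' r)‖ := by
      fun_prop
    have e2 : ∫ r in Set.Icc (-T) T, ‖commPot V v s (u' r) - commPot V v s' (u' r)‖ ≤
        (∫ r in Set.Icc (-T) T, ‖commPot V v s (u' r) - mulOp W (u' r)‖) +
          ∫ r in Set.Icc (-T) T, ‖commPot V v s' (u' r) - mulOp W (u' r)‖ := by
      rw [← integral_add (hc s).integrableOn_Icc (hc s').integrableOn_Icc]
      refine integral_mono hc'.integrableOn_Icc
        ((hc s).integrableOn_Icc.add (hc s').integrableOn_Icc) fun r => ?_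
      simp only
      rw [norm_sub_rev (commPot V v s' (u' r)) (mulOp W (u' r))]
      exact norm_sub_le_norm_sub_add_norm_sub _ _ _
    have e3 : 2 / ε * ∫ r in Set.Icc (-T) T, ‖commPot V v s (u' r) - commPot V v s' (u' r)‖ ≤
        2 / ε * ((∫ r in Set.Icc (-T) T, ‖commPot V v s (u' r) - mulOp W (u' r)‖) +
          ∫ r in Set.Icc (-T) T, ‖commPot V v s' (u' r) - mulOp W (u' r)‖) := by gcongr
    simp only [α]
    linarith
  -- The difference quotients of `u' t` are Cauchy as `s → 0`, and `L²` is complete.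
  have hlim : ∀ t, ∃ b, Tendsto (fun s => diffQuot v s (u' t)) (𝓝[≠] 0) (𝓝 b) := by
    intro t
    rw [← cauchy_map_iff_exists_tendsto, Metric.cauchy_iff]
    refine ⟨inferInstance, fun η hη => ?_⟩
    have h1 : ∀ᶠ s in 𝓝[≠] 0, α |t| s < η / 2 := (hα |t|).eventually_lt_const (half_pos hη)
    refine ⟨(fun s => diffQuot v s (u' t)) '' {s | α |t| s < η / 2}, image_mem_map h1, ?_⟩
    rintro _ ⟨s, hs, rfl⟩ _ ⟨s', hs', rfl⟩
    rw [dist_eq_norm]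
    have h2 := hest |t| t ⟨neg_abs_le t, le_abs_self t⟩ s s'
    simp only [Set.mem_ofPred_eq] at hs hs'
    linarith
  choose b hb using hlim
  refine ⟨b, ?_, fun t => hasDirDeriv_iff_tendsto.2 (hb t)⟩
  -- The convergence is uniform on bounded time intervals, so the limit `b` inherits continuity from
  -- the difference quotients.
  have hunif : ∀ T t, t ∈ Set.Icc (-T) T → ∀ s, ‖b t - diffQuot v s (u' t)‖ ≤ α T s := by
    intro T t ht s
    have h1 : Tendsto (fun s' => ‖diffQuot v s' (u' t) - diffQuot v s (u' t)‖) (𝓝[≠] 0)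
        (𝓝 ‖b t - diffQuot v s (u' t)‖) := ((hb t).sub_const _).norm
    have h2 : Tendsto (fun s' => α T s' + α T s) (𝓝[≠] 0) (𝓝 (0 + α T s)) :=
      (hα T).add_const _
    rw [zero_add] at h2
    exact le_of_tendsto_of_tendsto' h1 h2 fun s' => hest T t ht s' s
  have hon : ∀ T : ℝ, ContinuousOn b (Set.Icc (-T) T) := by
    intro T
    refine TendstoUniformlyOn.continuousOn (F := fun s t => diffQuot v s (u' t))
      (p := 𝓝[≠] (0 : ℝ)) ?_ ?_
    · rw [Metric.tendstoUniformlyOn_iff]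
      intro η hη
      filter_upwards [(hα T).eventually_lt_const hη] with s hs t ht
      rw [dist_eq_norm]
      exact (hunif T t ht s).trans_lt hs
    · exact (Eventually.of_forall fun s => by fun_prop : ∀ᶠ s in 𝓝[≠] (0 : ℝ), _).frequently
  rw [continuous_iff_continuousAt]
  intro t
  exact (hon (|t| + 1)).continuousAt (Icc_mem_nhds (by linarith [neg_abs_le t])
    (by linarith [le_abs_self t]))

end Bohm

/-! ### Regularity of solutions with `H³` data; conservation of mass and energy -/

namespace Bohm

open BoundedContinuousFunction

variable {d : ℕ}

/-- A solution of the Schrödinger equation together with its derivatives: `ψ'` is the time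
derivative, `b`, `c` are the first and second space derivatives of `ψ`, and `b'` are the space
derivatives of `ψ'`. -/
structure RegSol (V : Sp d → ℝ) (ε : ℝ) (ψ ψ' : ℝ → L2 d) (b b' : Fin d → ℝ → L2 d)
    (c : Fin d → Fin d → ℝ → L2 d) : Prop where
  hasDerivAt : ∀ t, HasDerivAt ψ (ψ' t) t
  continuous' : Continuous ψ'
  dir : ∀ j t, HasDirDeriv (basisVec j) (ψ t) (b j t)
  dir₂ : ∀ k j t, HasDirDeriv (basisVec k) (b j t) (c k j t)
  dir' : ∀ j t, HasDirDeriv (basisVec j) (ψ' t) (b' j t)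
  hasDerivAt_b : ∀ j t, HasDerivAt (b j) (b' j t) t
  continuous_b' : ∀ j, Continuous (b' j)
  continuous_c : ∀ k j, Continuous (c k j)
  symm : ∀ k j t, c k j t = c j k t
  eq : ∀ t, ∀ᵐ x, Complex.I * ε * ψ' t x =
    -((ε : ℂ) ^ 2 / 2) * (∑ k, c k k t x) + V x * ψ t x
  lap : ∀ j t, ∃ m : L2 d, HasDirDeriv (basisVec j) (∑ k, c k k t) m ∧
    ∀ᵐ x, Complex.I * ε * b' j t x = -((ε : ℂ) ^ 2 / 2) * m x + V x * b j t x +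
      (fderiv ℝ V x (basisVec j) : ℝ) * ψ t x

theorem coeFn_sum {ι : Type*} (s : Finset ι) (f : ι → L2 d) :
    (∑ i ∈ s, f i : L2 d) =ᵐ[volume] fun x => ∑ i ∈ s, f i x := by
  classical
  induction s using Finset.induction_on with
  | empty =>
    filter_upwards [Lp.coeFn_zero ℂ 2 (volume : Measure (Sp d))] with x hx
    simp
  | insert a s ha ih =>
    rw [Finset.sum_insert ha]
    filter_upwards [ih, Lp.coeFn_add (f a) (∑ i ∈ s, f i)] with x h1 h2
    rw [h2, Pi.add_apply, h1, Finset.sum_insert ha]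

theorem norm_basisVec (j : Fin d) : ‖(basisVec j : Sp d)‖ = 1 := by
  simp [basisVec]

namespace IsC1Bounded

variable {V : Sp d → ℝ} (hV : IsC1Bounded V)
include hV

theorem exists_bounds : ∃ M : ℝ, 0 ≤ M ∧ (∀ x, |V x| ≤ M) ∧ (∀ x, ‖fderiv ℝ V x‖ ≤ M) ∧
    ∀ x y, |V x - V y| ≤ M * ‖x - y‖ := by
  obtain ⟨hc, M, hM⟩ := hV
  refine ⟨M, (abs_nonneg _).trans (hM 0).1, fun x => (hM x).1, fun x => (hM x).2, fun x y => ?_⟩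
  have := Convex.norm_image_sub_le_of_norm_fderiv_le (𝕜 := ℝ) (s := Set.univ) (f := V) (C := M)
    (fun x _ => (hc.differentiable (by simp)) x) (fun x _ => (hM x).2) convex_univ
    (Set.mem_univ y) (Set.mem_univ x)
  simpa using this

theorem continuous_fderiv_apply (v : Sp d) : Continuous fun x => fderiv ℝ V x v :=
  (hV.1.continuous_fderiv (by simp)).clm_apply continuous_const

theorem exists_bcf : ∃ V' : Sp d →ᵇ ℝ, ∀ x, V' x = V x := by
  obtain ⟨M, _, hM, _⟩ := hV.exists_bounds
  exact ⟨BoundedContinuousFunction.ofNormedAddCommGroup V hV.1.continuous M hM, fun x => rfl⟩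

theorem exists_bcf_fderiv (j : Fin d) : ∃ W : Sp d →ᵇ ℝ, ∀ x, W x = fderiv ℝ V x (basisVec j) := by
  obtain ⟨M, _, _, hM, _⟩ := hV.exists_bounds
  refine ⟨BoundedContinuousFunction.ofNormedAddCommGroup (fun x => fderiv ℝ V x (basisVec j))
    (hV.continuous_fderiv_apply _) M fun x => ?_, fun x => rfl⟩
  refine ((fderiv ℝ V x).le_opNorm _).trans ?_
  rw [norm_basisVec, mul_one]
  exact hM x

end IsC1Bounded

theorem tendsto_diffQuotPot {V : Sp d → ℝ} (hV : IsC1Bounded V) {V' W : Sp d →ᵇ ℝ} {v : Sp d}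
    (hV' : ∀ x, V' x = V x) (hW : ∀ x, W x = fderiv ℝ V x v) (x : Sp d) :
    Tendsto (fun s => diffQuotPot V' v s x) (𝓝[≠] 0) (𝓝 (W x)) := by
  have h1 := ((hV.1.differentiable (by simp)) x).hasFDerivAt.hasLineDerivAt v
  have h2 := hasLineDerivAt_iff_tendsto_slope_zero.1 h1
  simp only [diffQuotPot_apply, hV', hW]
  simpa using h2

theorem IsSchrodingerSolution.isSol {V : Sp d → ℝ} {V' : Sp d →ᵇ ℝ}
    (hV' : ∀ x, V' x = V x) {ε : ℝ} {ψ₀ : L2 d} {ψ : ℝ → L2 d}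
    (hψ : IsSchrodingerSolution V ε ψ₀ ψ) : IsSol V' ε ψ (deriv ψ) 0 := by
  intro t
  refine ⟨((hψ.contDiff.differentiable (by simp)) t).hasDerivAt, ?_⟩
  choose b hb1 hb using fun j => (hψ.memH2 t).exists_hasDirDeriv (by norm_num) j
  choose c _ hc using fun j => (hb1 j).exists_hasDirDeriv (by norm_num) j
  refine ⟨b, c, hb, hc, ?_⟩
  have hwp : ∀ j, weakPartial j (weakPartial j (ψ t)) =ᵐ[volume] c j := fun j =>
    ((hc j).hasWeakPartial.congr (hb j).hasWeakPartial.weakPartial_eq.symm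
      EventuallyEq.rfl).weakPartial_eq
  apply Lp.ext
  simp only [Pi.zero_apply, sub_zero]
  filter_upwards [Lp.coeFn_smul (Complex.I * (ε : ℂ)) (deriv ψ t),
    Lp.coeFn_add ((-(ε ^ 2 / 2)) • ∑ j, c j) (mulOp V' (ψ t)),
    Lp.coeFn_smul (-(ε ^ 2 / 2)) (∑ j, c j), coeFn_sum Finset.univ c, coeFn_mulOp V' (ψ t),
    hψ.equation t, ae_all_iff.2 hwp] with x h1 h2 h3 h4 h5 h6 h7
  rw [h1, Pi.smul_apply, smul_eq_mul, h6, h2, Pi.add_apply, h3, Pi.smul_apply, h4, h5, hV']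
  simp only [h7, Complex.real_smul]
  push_cast
  ring

/-- A solution with initial data in `H³` is regular. -/
theorem IsSchrodingerSolution.exists_regSol {V : Sp d → ℝ} (hV : IsC1Bounded V) {ε : ℝ}
    (hε : 0 < ε) {ψ₀ : L2 d} (hψ₀ : MemH 3 ψ₀) {ψ : ℝ → L2 d}
    (hψ : IsSchrodingerSolution V ε ψ₀ ψ) :
    ∃ ψ' b b' c, RegSol V ε ψ ψ' b b' c := by
  obtain ⟨V', hV'⟩ := hV.exists_bcf
  choose W hW using hV.exists_bcf_fderiv
  obtain ⟨M, _, _, _, hM⟩ := hV.exists_bounds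
  have hM' : ∀ x y, |V' x - V' y| ≤ M * ‖x - y‖ := fun x y => by rw [hV', hV']; exact hM x y
  have hWlim := fun j => tendsto_diffQuotPot hV hV' (hW j)
  have hsol := hψ.isSol hV'
  have hψ'c : Continuous (deriv ψ) := hψ.contDiff.continuous_deriv (by simp)
  have hε' : (Complex.I * (ε : ℂ)) ≠ 0 :=
    mul_ne_zero Complex.I_ne_zero (by exact_mod_cast hε.ne')
  choose b hb1 hb using fun j t => (hψ.memH2 t).exists_hasDirDeriv (by norm_num) j
  choose c _ hc using fun k j t => (hb1 j t).exists_hasDirDeriv (by norm_num) k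
  have hham : ∀ t, (Complex.I * (ε : ℂ)) • deriv ψ t =
      (-(ε ^ 2 / 2)) • ∑ k, c k k t + mulOp V' (ψ t) := by
    intro t
    obtain ⟨b₁, c₁, hb₁, hc₁, h⟩ := (hsol t).2
    rw [Pi.zero_apply, sub_zero] at h
    have e1 : ∀ j, b₁ j = b j t := fun j => (hb₁ j).unique (hb j t)
    have e2 : ∀ j, c₁ j = c j j t := fun j => (hc₁ j).unique (by rw [e1]; exact hc j j t)
    rw [h]
    simp only [e2]
  -- The only use of the `H³` hypothesis: `ψ'(0) = (iε)⁻¹ H ψ₀` is differentiable in `L²`, because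
  -- the third derivatives of `ψ₀` and the first derivatives of `V ψ₀` are square integrable.
  have hinit : ∀ j, ∃ b₀, HasDirDeriv (basisVec j) (deriv ψ 0) b₀ := by
    intro j
    choose b₁ hb₁1 hb₁ using fun j => hψ₀.exists_hasDirDeriv (by norm_num) j
    choose c₁ hc₁1 hc₁ using fun k => (hb₁1 k).exists_hasDirDeriv (by norm_num) k
    choose m _ hm using fun k => (hc₁1 k).exists_hasDirDeriv (by norm_num) j
    have e1 : ∀ j, b₁ j = b j 0 := fun j => (hb₁ j).unique (by
      have := hb j 0
      rwa [hψ.initial] at this)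
    have e2 : ∀ j, c₁ j = c j j 0 := fun j => (hc₁ j).unique (by rw [e1]; exact hc j j 0)
    have h1 := ((HasDirDeriv.sum Finset.univ fun k _ => hm k).real_smul (-(ε ^ 2 / 2))).add
      ((hb j 0).mulOp hM' (norm_basisVec j) (hWlim j))
    simp only [e2] at h1
    rw [← hham 0] at h1
    have h2 := h1.smul (Complex.I * (ε : ℂ))⁻¹
    rw [smul_smul, inv_mul_cancel₀ hε', one_smul] at h2
    exact ⟨_, h2⟩
  have hreg := fun j => hsol.exists_hasDirDeriv hM' hε hψ'c (norm_basisVec j) (hWlim j)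
    (hinit j).choose_spec
  choose b' hb'c hb' using hreg
  -- The equation expresses `Δψ` through `ψ'` and `Vψ`, both continuous in time.
  have hlapc : Continuous fun t => ∑ k, c k k t := by
    have h1 : ∀ t, ∑ k, c k k t = (-(2 / ε ^ 2)) • ((Complex.I * (ε : ℂ)) • deriv ψ t -
        mulOp V' (ψ t)) := by
      intro t
      rw [hham, add_sub_cancel_right, smul_smul]
      have : -(2 / ε ^ 2) * -(ε ^ 2 / 2) = 1 := by field_simp
      rw [this, one_smul]
    simp only [h1]
    have := hψ.contDiff.continuous
    fun_prop
  refine ⟨deriv ψ, b, b', c, fun t => (hsol t).1, hψ'c, hb, hc, fun j t => hb' j t, ?_, hb'c, ?_,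
    fun k j t => hasDirDeriv_comm (hb j t) (hb k t) (hc k j t) (hc j k t), ?_, ?_⟩
  · intro j t
    -- Tested against a smooth function, `b j` is `ψ` paired with a derivative of the test function,
    -- and this can be differentiated in time.
    refine hasDerivAt_of_pairing (hb'c j) (fun φ hφ hcs t => ?_) t
    have hd : Continuous fun x => fderiv ℝ φ x (basisVec j) :=
      (hφ.continuous_fderiv (by simp)).clm_apply continuous_const
    obtain ⟨T, hT⟩ := exists_pairing (F := ℂ) (p := 2) hd (hcs.fderiv_apply ℝ _)
    have e1 : ∀ t, ∫ x, φ x • b j t x = -T (ψ t) := fun t => by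
      rw [hT, (hasWeakPartial_iff.1 (hb j t).hasWeakPartial).2.2 φ hφ hcs, neg_neg]
    have e2 : ∫ x, φ x • b' j t x = -T (deriv ψ t) := by
      rw [hT, (hasWeakPartial_iff.1 (hb' j t).hasWeakPartial).2.2 φ hφ hcs, neg_neg]
    simp only [e1, e2]
    exact (T.hasFDerivAt.comp_hasDerivAt t (hsol t).1).neg
  · intro k j
    rw [continuous_iff_continuousAt]
    intro t
    have h1 : Tendsto (fun s => ‖(∑ i, c i i s) - ∑ i, c i i t‖) (𝓝 t) (𝓝 0) :=
      tendsto_iff_norm_sub_tendsto_zero.1 (hlapc.tendsto t)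
    -- Continuity of all second derivatives reduces to that of the Laplacian, by the elliptic
    -- estimate applied to `ψ s - ψ t`.
    refine tendsto_iff_norm_sub_tendsto_zero.2 (squeeze_zero (fun _ => norm_nonneg _)
      (fun s => ?_) h1)
    have h2 := norm_second_deriv_le (f := ψ s - ψ t) (b := fun j => b j s - b j t)
      (c := fun k j => c k j s - c k j t) (fun j => (hb j s).sub (hb j t))
      (fun k j => (hc k j s).sub (hc k j t)) k j
    rwa [Finset.sum_sub_distrib] at h2
  · intro t
    have h0 := hham t
    filter_upwards [Lp.coeFn_smul (Complex.I * (ε : ℂ)) (deriv ψ t),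
      Lp.coeFn_add ((-(ε ^ 2 / 2)) • ∑ j, c j j t) (mulOp V' (ψ t)),
      Lp.coeFn_smul (-(ε ^ 2 / 2)) (∑ j, c j j t), coeFn_sum Finset.univ fun j => c j j t,
      coeFn_mulOp V' (ψ t)] with x h1 h2 h3 h4 h5
    rw [h0, h2, Pi.add_apply, h3, Pi.smul_apply, h4, h5, hV', Pi.smul_apply, smul_eq_mul,
      Complex.real_smul] at h1
    rw [← h1]
    push_cast
    ring
  · intro j t
    -- The differentiated equation solved for `∂_j Δψ`; this is where the third derivatives of `ψ`
    -- come from.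
    let m : L2 d := (-(2 / ε ^ 2)) • ((Complex.I * (ε : ℂ)) • b' j t -
      (mulOp V' (b j t) + mulOp (W j) (ψ t)))
    have hm : (Complex.I * (ε : ℂ)) • b' j t =
        (-(ε ^ 2 / 2)) • m + (mulOp V' (b j t) + mulOp (W j) (ψ t)) := by
      simp only [m]
      rw [smul_smul]
      have : -(ε ^ 2 / 2) * -(2 / ε ^ 2) = 1 := by field_simp
      rw [this, one_smul, sub_add_cancel]
    refine ⟨m, ?_, ?_⟩
    · have h1 : ∑ k, c k k t = (-(2 / ε ^ 2)) • ((Complex.I * (ε : ℂ)) • deriv ψ t -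
          mulOp V' (ψ t)) := by
        rw [hham, add_sub_cancel_right, smul_smul]
        have : -(2 / ε ^ 2) * -(ε ^ 2 / 2) = 1 := by field_simp
        rw [this, one_smul]
      rw [h1]
      exact (((hb' j t).smul _).sub
        ((hb j t).mulOp hM' (norm_basisVec j) (hWlim j))).real_smul _
    · filter_upwards [Lp.coeFn_smul (Complex.I * (ε : ℂ)) (b' j t),
        Lp.coeFn_add ((-(ε ^ 2 / 2)) • m) (mulOp V' (b j t) + mulOp (W j) (ψ t)),
        Lp.coeFn_smul (-(ε ^ 2 / 2)) m, Lp.coeFn_add (mulOp V' (b j t)) (mulOp (W j) (ψ t)),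
        coeFn_mulOp V' (b j t), coeFn_mulOp (W j) (ψ t)] with x h1 h2 h3 h4 h5 h6
      rw [hm, h2, Pi.add_apply, h3, Pi.smul_apply, h4, Pi.add_apply, h5, h6, hV', hW,
        Pi.smul_apply, smul_eq_mul, Complex.real_smul] at h1
      rw [← h1]
      push_cast
      ring

/-- Conservation of mass. -/
theorem IsSchrodingerSolution.norm_eq {V : Sp d → ℝ} (hV : IsC1Bounded V) {ε : ℝ}
    (hε : 0 < ε) {ψ₀ : L2 d} {ψ : ℝ → L2 d} (hψ : IsSchrodingerSolution V ε ψ₀ ψ) (t : ℝ) :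
    ‖ψ t‖ = ‖ψ₀‖ := by
  obtain ⟨V', hV'⟩ := hV.exists_bcf
  rw [(hψ.isSol hV').norm_eq hε.ne' t, hψ.initial]

/-- Conservation of energy. -/
theorem IsSchrodingerSolution.energy_eq {V : Sp d → ℝ} (hV : IsC1Bounded V) {ε : ℝ}
    (hε : 0 < ε) {ψ₀ : L2 d} {ψ : ℝ → L2 d} (hψ : IsSchrodingerSolution V ε ψ₀ ψ) (t : ℝ) :
    energy V ε (ψ t) = energy V ε ψ₀ := by
  obtain ⟨V', hV'⟩ := hV.exists_bcf
  have hsol := hψ.isSol hV'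
  -- Each quotient `(ψ(t+h) - ψ(t))/h` is a solution, so its inner product with `ψ(t)` is conserved;
  -- let `h → 0`. The energy is the inner product of `iεψ' = Hψ` with `ψ`.
  have h1 : ∀ t, inner ℂ (deriv ψ t) (ψ t) = inner ℂ (deriv ψ 0) (ψ 0) := by
    intro t
    have h2 : ∀ t, Tendsto (fun n : ℕ => inner ℂ
        ((1 / ((n : ℝ) + 1))⁻¹ • (ψ (t + 1 / ((n : ℝ) + 1)) - ψ t)) (ψ t)) atTop
        (𝓝 (inner ℂ (deriv ψ t) (ψ t))) := fun t =>
      (tendsto_timeDiff (hsol t).1).inner tendsto_const_nhds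
    refine tendsto_nhds_unique (h2 t) ((h2 0).congr fun n => ?_)
    exact ((hsol.timeDiff (1 / ((n : ℝ) + 1))).inner_eq hε.ne' hsol t).symm
  have h2 : ∀ t, ((energy V ε (ψ t) : ℝ) : ℂ) =
      inner ℂ ((Complex.I * (ε : ℂ)) • deriv ψ t) (ψ t) := by
    intro t
    obtain ⟨b, c, hb, hc, h⟩ := (hsol t).2
    rw [Pi.zero_apply, sub_zero] at h
    rw [h, inner_add_left, inner_smul_left_eq_smul, sum_inner]
    have e1 : ∀ j, inner ℂ (c j) (ψ t) = -((∫ x, ‖b j x‖ ^ 2 : ℝ) : ℂ) := by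
      intro j
      have h3 := (hc j).inner_add_inner (hb j)
      rw [inner_self_eq_norm_sq_to_K] at h3
      rw [integral_norm_sq]
      push_cast
      exact eq_neg_of_add_eq_zero_left h3
    have e2 : inner ℂ (mulOp V' (ψ t)) (ψ t) = ((∫ x, V x * ‖ψ t x‖ ^ 2 : ℝ) : ℂ) := by
      rw [L2.inner_def, ← integral_complex_ofReal]
      refine integral_congr_ae ?_
      filter_upwards [coeFn_mulOp V' (ψ t)] with x hx
      rw [hx, hV', RCLike.inner_apply, map_mul, Complex.conj_ofReal, mul_left_comm,
        RCLike.mul_conj]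
      push_cast
      rfl
    have e3 : ∫ x, ∑ j, ‖weakPartial j (ψ t) x‖ ^ 2 = ∑ j, ∫ x, ‖b j x‖ ^ 2 := by
      rw [← integral_finsetSum _ fun j _ => integrable_norm_sq (b j)]
      refine integral_congr_ae ?_
      filter_upwards [ae_all_iff.2 fun j => (hb j).hasWeakPartial.weakPartial_eq] with x hx
      simp only [hx]
    rw [e2, energy, e3]
    simp only [e1]
    rw [Finset.sum_neg_distrib, Complex.real_smul]
    push_cast
    ring
  apply Complex.ofReal_injective
  rw [h2 t, ← hψ.initial, h2 0, inner_smul_left, inner_smul_left, h1 t]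

end Bohm

namespace Bohm

/-! ### Tuples of `L²` functions -/

section Tuple

variable {d : ℕ} {ι : Type*} [Fintype ι] [DecidableEq ι]

/-- The `L²` function with values in `ι → ℂ` with given components. -/
noncomputable def tuple (f : ι → L2 d) : Lp (ι → ℂ) 2 (volume : Measure (Sp d)) :=
  ∑ i, (ContinuousLinearMap.single ℝ (fun _ : ι => ℂ) i).compLp (f i)

theorem coeFn_tuple (f : ι → L2 d) : ∀ᵐ x, ∀ i, tuple f x i = f i x := by
  have h1 : tuple f =ᵐ[volume]
      fun x => ∑ i, (ContinuousLinearMap.single ℝ (fun _ : ι => ℂ) i).compLp (f i) x := by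
    unfold tuple
    generalize (Finset.univ : Finset ι) = s
    induction s using Finset.induction_on with
    | empty =>
      filter_upwards [Lp.coeFn_zero (ι → ℂ) 2 (volume : Measure (Sp d))] with x hx
      simp
    | insert a s ha ih =>
      rw [Finset.sum_insert ha]
      filter_upwards [Lp.coeFn_add ((ContinuousLinearMap.single ℝ (fun _ : ι => ℂ) a).compLp (f a))
        (∑ i ∈ s, (ContinuousLinearMap.single ℝ (fun _ : ι => ℂ) i).compLp (f i)), ih] with x h1 h2
      rw [h1, Pi.add_apply, h2, Finset.sum_insert ha]
  have h2 : ∀ᵐ x, ∀ i, (ContinuousLinearMap.single ℝ (fun _ : ι => ℂ) i).compLp (f i) x =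
      ContinuousLinearMap.single ℝ (fun _ : ι => ℂ) i (f i x) :=
    ae_all_iff.2 fun i => ContinuousLinearMap.coeFn_compLp _ _
  filter_upwards [h1, h2] with x h1 h2 i
  rw [h1, Finset.sum_congr rfl fun j _ => h2 j, Finset.sum_apply]
  simp [Pi.single_apply]

theorem HasDirDeriv.tuple {v : Sp d} {f g : ι → L2 d} (h : ∀ i, HasDirDeriv v (f i) (g i)) :
    HasDirDeriv v (tuple f) (tuple g) :=
  HasDirDeriv.sum _ fun i _ => (h i).compLp _

theorem continuous_tuple {T : Type*} [TopologicalSpace T] {f : ι → T → L2 d}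
    (h : ∀ i, Continuous (f i)) : Continuous fun t => tuple fun i => f i t :=
  continuous_finsetSum _ fun i _ =>
    ((ContinuousLinearMap.single ℝ (fun _ : ι => ℂ) i).compLpL 2 volume).continuous.comp (h i)

theorem hasDerivAt_tuple {f : ι → ℝ → L2 d} {g : ι → L2 d} {t : ℝ}
    (h : ∀ i, HasDerivAt (f i) (g i) t) :
    HasDerivAt (fun t => tuple fun i => f i t) (tuple g) t :=
  HasDerivAt.fun_sum fun i _ =>
    ((ContinuousLinearMap.single ℝ (fun _ : ι => ℂ) i).compLpL 2 volume).hasFDerivAt.comp_hasDerivAt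
      t (h i)

end Tuple

/-! ### Chain rule for weak derivatives -/

section ChainRule

variable {d : ℕ} {E : Type*} [NormedAddCommGroup E] [NormedSpace ℝ E]

omit [NormedSpace ℝ E] in
theorem integrable_norm_mul_norm {X : Type*} [MeasurableSpace X] {μ : Measure X}
    (z w : Lp E 2 μ) : Integrable (fun x => ‖z x‖ * ‖w x‖) μ := by
  refine ((integrable_norm_sq z).add (integrable_norm_sq w)).mono'
    ((Lp.aestronglyMeasurable z).norm.mul (Lp.aestronglyMeasurable w).norm) ?_
  filter_upwards with x
  rw [Real.norm_of_nonneg (by positivity), Pi.add_apply]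
  nlinarith [sq_nonneg (‖z x‖ - ‖w x‖), sq_nonneg (‖z x‖ + ‖w x‖)]

theorem aestronglyMeasurable_clm_apply {X : Type*} [MeasurableSpace X] {μ : Measure X}
    {q' : E → (E →L[ℝ] ℝ)} (hq' : Continuous q') (z w : Lp E 2 μ) :
    AEStronglyMeasurable (fun x => q' (z x) (w x)) μ :=
  isBoundedBilinearMap_apply.continuous.comp_aestronglyMeasurable
    ((hq'.comp_aestronglyMeasurable (Lp.aestronglyMeasurable z)).prodMk
      (Lp.aestronglyMeasurable w))

/-- This is `integral_fderiv_comp_eq_zero` for `χ(x) q(Z(x))`: the growth bounds on `q` and `q'` are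
those required there, and the two terms of the product rule are the two sides of the weak derivative
identity. -/
theorem hasWeakPartial_comp {q : E → ℝ} {q' : E → (E →L[ℝ] ℝ)} (hq : ∀ z, HasFDerivAt q (q' z) z)
    (hq' : Continuous q') {C : ℝ} (hC : ∀ z, |q z| ≤ C * ‖z‖ ^ 2) (hC' : ∀ z, ‖q' z‖ ≤ C * ‖z‖)
    {i : Fin d} {Z W : Lp E 2 (volume : Measure (Sp d))} (hZ : HasDirDeriv (basisVec i) Z W) :
    HasWeakPartial i (fun x => q (Z x)) (fun x => q' (Z x) (W x)) := by
  have hqc : Continuous q := continuous_iff_continuousAt.2 fun z => (hq z).continuousAt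
  have hi1 : Integrable fun x => q (Z x) := by
    refine ((integrable_norm_sq Z).const_mul C).mono'
      (hqc.comp_aestronglyMeasurable (Lp.aestronglyMeasurable Z)) ?_
    filter_upwards with x using hC _
  have hi2 : Integrable fun x => q' (Z x) (W x) := by
    refine ((integrable_norm_mul_norm Z W).const_mul C).mono'
      (aestronglyMeasurable_clm_apply hq' Z W) ?_
    filter_upwards with x
    calc ‖q' (Z x) (W x)‖ ≤ ‖q' (Z x)‖ * ‖W x‖ := (q' (Z x)).le_opNorm _
      _ ≤ C * ‖Z x‖ * ‖W x‖ := by gcongr; exact hC' _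
      _ = _ := by ring
  rw [hasWeakPartial_iff]
  refine ⟨hi1.locallyIntegrable, hi2.locallyIntegrable, fun χ hχ hχc => ?_⟩
  have hχ' : Continuous (fderiv ℝ χ) := hχ.continuous_fderiv (by simp)
  obtain ⟨M₁, hM₁⟩ := hχc.exists_bound_of_continuous hχ.continuous
  obtain ⟨M₂, hM₂⟩ := (hχc.fderiv ℝ).exists_bound_of_continuous hχ'
  have key := integral_fderiv_comp_eq_zero (d := d) (E := E) (Y := Sp d)
    (G := fun y => χ y.1 * q y.2)
    (G' := fun y => χ y.1 • (q' y.2).comp (ContinuousLinearMap.snd ℝ (Sp d) E) +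
      q y.2 • (fderiv ℝ χ y.1).comp (ContinuousLinearMap.fst ℝ (Sp d) E))
    (fun y => by
      exact (((hχ.differentiable (by simp)) y.1).hasFDerivAt.comp y hasFDerivAt_fst).mul
        ((hq y.2).comp y hasFDerivAt_snd))
    (C := |C| * (|M₁| + |M₂|)) (fun y z v w => by
      have h1 := hM₁ y
      have h2 : |fderiv ℝ χ y v| ≤ M₂ * ‖v‖ :=
        ((fderiv ℝ χ y).le_opNorm v).trans (by gcongr; exact hM₂ y)
      have h3 : |q' z w| ≤ C * ‖z‖ * ‖w‖ := ((q' z).le_opNorm w).trans (by gcongr; exact hC' z)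
      have h4 := hC z
      simp only [_root_.add_apply, _root_.smul_apply,
        ContinuousLinearMap.comp_apply, ContinuousLinearMap.coe_snd', ContinuousLinearMap.coe_fst',
        smul_eq_mul]
      rw [Real.norm_eq_abs] at h1
      have e1 : |χ y * q' z w| ≤ |M₁| * (|C| * ‖z‖ * ‖w‖) := by
        rw [abs_mul]
        have : |q' z w| ≤ |C| * ‖z‖ * ‖w‖ := h3.trans (by gcongr; exact le_abs_self C)
        exact mul_le_mul (h1.trans (le_abs_self _)) this (abs_nonneg _) (abs_nonneg _)
      have e2 : |q z * fderiv ℝ χ y v| ≤ |C| * ‖z‖ ^ 2 * (|M₂| * ‖v‖) := by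
        rw [abs_mul]
        have a1 : |q z| ≤ |C| * ‖z‖ ^ 2 := h4.trans (by gcongr; exact le_abs_self C)
        have a2 : |fderiv ℝ χ y v| ≤ |M₂| * ‖v‖ := h2.trans (by gcongr; exact le_abs_self _)
        exact mul_le_mul a1 a2 (abs_nonneg _) (by positivity)
      refine (abs_add_le _ _).trans ((add_le_add e1 e2).trans ?_)
      have p1 : 0 ≤ |C| * |M₂| * (‖z‖ * ‖w‖) := by positivity
      have p2 : 0 ≤ |C| * |M₁| * (‖z‖ ^ 2 * ‖v‖) := by positivity
      linarith)
    (fun y => by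
      have : q 0 = 0 := by simpa using hC 0
      simp [this])
    (ι := fun x => x) continuous_id (v := basisVec i) (v' := basisVec i) (fun x s => rfl) hZ
  simp only [_root_.add_apply, _root_.smul_apply,
        ContinuousLinearMap.comp_apply, ContinuousLinearMap.coe_snd', ContinuousLinearMap.coe_fst',
        smul_eq_mul] at key ⊢
  have j1 : Integrable fun x => χ x * q' (Z x) (W x) :=
    integrable_test_smul hχ.continuous hχc hi2.locallyIntegrable
  have j2 : Integrable fun x => q (Z x) * fderiv ℝ χ x (basisVec i) := by
    have := integrable_test_smul (hχ'.clm_apply continuous_const)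
      (hχc.fderiv_apply ℝ (basisVec i)) hi1.locallyIntegrable
    simpa [mul_comm] using this
  rw [integral_add j1 j2] at key
  rw [show (fun x => fderiv ℝ χ x (basisVec i) * q (Z x)) =
    fun x => q (Z x) * fderiv ℝ χ x (basisVec i) from funext fun x => mul_comm _ _]
  linarith

end ChainRule

/-! ### Weak derivatives on subsets -/

section PartialOn

variable {d : ℕ} {S : Set (Sp d)} {i : Fin d} {f f' g g' : Sp d → ℝ}

/-- Where a piece of one covering and a piece of the other both equal `f`, their difference
vanishes, hence so does its weak derivative almost everywhere. Only countably many pairs of pieces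
occur. -/
theorem HasPartialOn.unique (h : HasPartialOn S i f g) (h' : HasPartialOn S i f g') :
    ∀ᵐ x, x ∈ S → g x = g' x := by
  obtain ⟨fn, gn, hn, hc⟩ := h
  obtain ⟨fn', gn', hn', hc'⟩ := h'
  have hz : ∀ᵐ x, ∀ n m, fn n x - fn' m x = 0 → gn n x - gn' m x = 0 :=
    ae_all_iff.2 fun n => ae_all_iff.2 fun m => ((hn n).sub (hn' m)).ae_eq_zero
  filter_upwards [hz, hc, hc'] with x hz hc hc' hx
  obtain ⟨n, h1, h2⟩ := hc hx
  obtain ⟨m, h3, h4⟩ := hc' hx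
  have := hz n m (by rw [← h1, ← h3, sub_self])
  rw [h2, h4]
  linarith

theorem HasPartialOn.congr (h : HasPartialOn S i f g) (hf : ∀ᵐ x, x ∈ S → f x = f' x)
    (hg : ∀ᵐ x, x ∈ S → g x = g' x) : HasPartialOn S i f' g' := by
  obtain ⟨fn, gn, hn, hc⟩ := h
  refine ⟨fn, gn, hn, ?_⟩
  filter_upwards [hc, hf, hg] with x hc hf hg hx
  obtain ⟨n, h1, h2⟩ := hc hx
  exact ⟨n, by rw [← hf hx, h1], by rw [← hg hx, h2]⟩

theorem HasPartialOn.partialOn_eq (h : HasPartialOn S i f g) :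
    ∀ᵐ x, x ∈ S → partialOn S i f x = g x := by
  have hex : ∃ g, HasPartialOn S i f g := ⟨g, h⟩
  have : HasPartialOn S i f (partialOn S i f) := by
    rw [partialOn, dif_pos hex]
    exact hex.choose_spec
  exact this.unique h

/-- `Q` is localised by countably many bump functions whose supports lie in `U`. Each product is
`C¹` on the whole space, so the global chain rule applies, and it coincides with `Q` near the points
where the bump is one. This handles quotients that blow up at the boundary of `U`. -/
theorem hasPartialOn_comp {E : Type*} [NormedAddCommGroup E] [NormedSpace ℝ E]
    [FiniteDimensional ℝ E] {U : Set E} (hU : IsOpen U) (h0 : (0 : E) ∉ U) {Q : E → ℝ}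
    (hQ : ContDiffOn ℝ 1 Q U) {Z W : Lp E 2 (volume : Measure (Sp d))}
    (hZ : HasDirDeriv (basisVec i) Z W) :
    HasPartialOn {x | Z x ∈ U} i (fun x => Q (Z x)) (fun x => fderiv ℝ Q (Z x) (W x)) := by
  have hr : ∀ z : E, ∃ r : ℝ, 0 < r ∧ (z ∈ U → Metric.closedBall z (2 * r) ⊆ U) := by
    intro z
    by_cases hz : z ∈ U
    · obtain ⟨r, hr, h⟩ := Metric.nhds_basis_closedBall.mem_iff.1 (hU.mem_nhds hz)
      exact ⟨r / 2, by positivity, fun _ => by simpa [mul_div_cancel₀] using h⟩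
    · exact ⟨1, one_pos, fun h => absurd h hz⟩
  choose r hr0 hrU using hr
  -- Lindelöf: countably many of the inner balls, on which the bumps equal one, cover `U`.
  obtain ⟨t, htU, htc, hcov⟩ := countable_cover_nhdsWithin (s := U)
    (f := fun z => Metric.ball z (r z))
    fun z hz => mem_nhdsWithin_of_mem_nhds (Metric.ball_mem_nhds z (hr0 z))
  by_cases hne : t.Nonempty
  swap
  · rw [Set.not_nonempty_iff_eq_empty.1 hne] at hcov
    have hUe : U = ∅ := by simpa using hcov
    refine ⟨fun _ _ => 0, fun _ _ => 0, fun n => ?_, by simp [hUe]⟩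
    rw [hasWeakPartial_iff]
    refine ⟨(integrable_zero _ _ _).locallyIntegrable, (integrable_zero _ _ _).locallyIntegrable, ?_⟩
    simp
  obtain ⟨e, rfl⟩ := htc.exists_eq_range hne
  let bump : ∀ n, ContDiffBump (e n) := fun n =>
    ⟨r (e n), 2 * r (e n), hr0 _, by linarith [hr0 (e n)]⟩
  have hsub : ∀ n, tsupport (bump n) ⊆ U := fun n => by
    rw [(bump n).tsupport_eq]
    exact hrU _ (htU ⟨n, rfl⟩)
  have hsm : ∀ n, ContDiff ℝ 1 fun z => bump n z * Q z := by
    intro n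
    rw [contDiff_iff_contDiffAt]
    intro z
    by_cases hz : z ∈ tsupport (bump n)
    · exact (bump n).contDiffAt.mul (hQ.contDiffAt (hU.mem_nhds (hsub n hz)))
    · have : (fun z => bump n z * Q z) =ᶠ[𝓝 z] fun _ => 0 := by
        filter_upwards [notMem_tsupport_iff_eventuallyEq.1 hz] with y hy
        simp [hy]
      exact contDiffAt_const.congr_of_eventuallyEq this
  have hcs : ∀ n, HasCompactSupport fun z => bump n z * Q z :=
    fun n => (bump n).hasCompactSupport.mul_right
  have hts : ∀ n, tsupport (fun z => bump n z * Q z) ⊆ U := fun n =>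
    (tsupport_mul_subset_left).trans (hsub n)
  refine ⟨fun n x => bump n (Z x) * Q (Z x),
    fun n x => fderiv ℝ (fun z => bump n z * Q z) (Z x) (W x), fun n => ?_, ?_⟩
  · set q : E → ℝ := fun z => bump n z * Q z with hq
    have hq'c : Continuous (fderiv ℝ q) := (hsm n).continuous_fderiv one_ne_zero
    obtain ⟨M₁, hM₁⟩ := (hcs n).exists_bound_of_continuous (hsm n).continuous
    obtain ⟨M₂, hM₂⟩ := ((hcs n).fderiv ℝ).exists_bound_of_continuous hq'c
    -- The localised function vanishes near `0`. A bounded function that vanishes for `‖z‖ < δ` is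
    -- at most a constant times `‖z‖²`, and its bounded derivative at most a constant times `‖z‖`.
    obtain ⟨δ, hδ, hball⟩ := Metric.nhds_basis_ball.mem_iff.1
      ((isClosed_tsupport q).isOpen_compl.mem_nhds fun h => h0 (hts n h))
    have hzero : ∀ z, ‖z‖ < δ → q z = 0 ∧ fderiv ℝ q z = 0 := by
      intro z hz
      have hzt : z ∉ tsupport q := hball (by simpa using hz)
      exact ⟨image_eq_zero_of_notMem_tsupport hzt,
        image_eq_zero_of_notMem_tsupport fun h => hzt (tsupport_fderiv_subset ℝ h)⟩
    have hM₁0 : 0 ≤ M₁ := (norm_nonneg _).trans (hM₁ 0)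
    have hM₂0 : 0 ≤ M₂ := (norm_nonneg _).trans (hM₂ 0)
    refine hasWeakPartial_comp (fun z => ((hsm n).differentiable one_ne_zero z).hasFDerivAt)
      hq'c (C := M₁ / δ ^ 2 + M₂ / δ) (fun z => ?_) (fun z => ?_) hZ
    · rcases lt_or_ge ‖z‖ δ with hz | hz
      · change |q z| ≤ _
        rw [(hzero z hz).1, abs_zero]; positivity
      · have h1 : 1 ≤ ‖z‖ ^ 2 / δ ^ 2 := by
          rw [one_le_div (by positivity)]; gcongr
        calc |q z| ≤ M₁ := hM₁ z
          _ ≤ M₁ * (‖z‖ ^ 2 / δ ^ 2) := le_mul_of_one_le_right hM₁0 h1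
          _ = M₁ / δ ^ 2 * ‖z‖ ^ 2 := by ring
          _ ≤ _ := by gcongr; exact le_add_of_nonneg_right (by positivity)
    · rcases lt_or_ge ‖z‖ δ with hz | hz
      · rw [(hzero z hz).2, norm_zero]; positivity
      · have h1 : 1 ≤ ‖z‖ / δ := by rwa [one_le_div hδ]
        calc ‖fderiv ℝ q z‖ ≤ M₂ := hM₂ z
          _ ≤ M₂ * (‖z‖ / δ) := le_mul_of_one_le_right hM₂0 h1
          _ = M₂ / δ * ‖z‖ := by ring
          _ ≤ _ := by gcongr; exact le_add_of_nonneg_left (by positivity)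
  · filter_upwards with x hx
    obtain ⟨z, ⟨⟨n, rfl⟩, hz⟩⟩ := Set.mem_iUnion₂.1 (hcov hx)
    have h1 : (fun z => bump n z * Q z) =ᶠ[𝓝 (Z x)] Q := by
      filter_upwards [(bump n).eventuallyEq_one_of_mem_ball hz] with y hy
      rw [hy]; simp
    exact ⟨n, h1.eq_of_nhds.symm, by rw [h1.fderiv_eq]⟩

end PartialOn

end Bohm

namespace Bohm

/-! ### The Bohm potential in terms of logarithmic derivatives -/

section Curves

variable {A B : ℝ → ℂ} {a' b' : ℂ} {s : ℝ}

theorem hasDerivAt_re {f : ℝ → ℂ} {f' : ℂ} (h : HasDerivAt f f' s) :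
    HasDerivAt (fun s => (f s).re) f'.re s :=
  Complex.reCLM.hasFDerivAt.comp_hasDerivAt s h

theorem hasDerivAt_im {f : ℝ → ℂ} {f' : ℂ} (h : HasDerivAt f f' s) :
    HasDerivAt (fun s => (f s).im) f'.im s :=
  Complex.imCLM.hasFDerivAt.comp_hasDerivAt s h

/-- The logarithmic derivative of the modulus is the real part of the logarithmic derivative of the
curve; in this form the later algebra happens in quotients by `ψ`. -/
theorem hasDerivAt_norm_curve (hA : HasDerivAt A a' s) (h0 : A s ≠ 0) :
    HasDerivAt (fun s => ‖A s‖) (‖A s‖ * (a' / A s).re) s := by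
  have h1 := hA.norm_sq.sqrt (by positivity)
  have h2 : (fun s => Real.sqrt (‖A s‖ ^ 2)) = fun s => ‖A s‖ :=
    funext fun s => Real.sqrt_sq (norm_nonneg _)
  rw [h2, Real.sqrt_sq (norm_nonneg _)] at h1
  convert h1 using 1
  have hn : ‖A s‖ ≠ 0 := by simpa
  have hsq : ‖A s‖ ^ 2 = Complex.normSq (A s) := (Complex.normSq_eq_norm_sq _).symm
  have e : (a' / A s).re * ‖A s‖ ^ 2 = inner ℝ (A s) a' := by
    rw [hsq, Complex.div_re, Complex.inner]
    have : Complex.normSq (A s) ≠ 0 := by simpa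
    field_simp
    simp [Complex.mul_re]
  rw [← e]
  field_simp

theorem hasDerivAt_div_curve (hA : HasDerivAt A a' s) (hB : HasDerivAt B b' s) (h0 : A s ≠ 0) :
    HasDerivAt (fun s => B s / A s) (b' / A s - (B s / A s) * (a' / A s)) s := by
  refine (hB.fun_div hA h0).congr_deriv ?_
  field_simp

end Curves

section Potential

variable {d : ℕ}

/-- Index type for the components `a`, `Δa`, `∂_j a`. -/
abbrev Jet (d : ℕ) : Type := Option (Option (Fin d))

theorem isOpen_jet : IsOpen {z : Jet d → ℂ | z none ≠ 0} :=
  isOpen_ne_fun (continuous_apply none) continuous_const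

theorem contDiffOn_div (k : Jet d) :
    ContDiffOn ℝ 1 (fun z : Jet d → ℂ => z k / z none) {z | z none ≠ 0} := by
  intro z hz
  refine ContDiffAt.contDiffWithinAt ?_
  simp only [div_eq_mul_inv]
  exact (contDiff_apply ℝ ℂ k).contDiffAt.mul
    ((contDiff_apply ℝ ℂ (none : Jet d)).contDiffAt.inv hz)

theorem contDiffOn_re_div (k : Jet d) :
    ContDiffOn ℝ 1 (fun z : Jet d → ℂ => (z k / z none).re) {z | z none ≠ 0} :=
  Complex.reCLM.contDiff.comp_contDiffOn (contDiffOn_div k)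

theorem contDiffOn_im_div (k : Jet d) :
    ContDiffOn ℝ 1 (fun z : Jet d → ℂ => (z k / z none).im) {z | z none ≠ 0} :=
  Complex.imCLM.contDiff.comp_contDiffOn (contDiffOn_div k)

theorem contDiffOn_norm_jet :
    ContDiffOn ℝ 1 (fun z : Jet d → ℂ => ‖z none‖) {z | z none ≠ 0} :=
  fun _ hz => ((contDiff_apply ℝ ℂ (none : Jet d)).contDiffAt.norm ℝ hz).contDiffWithinAt

theorem fderiv_eq_of_hasDerivAt {E : Type*} [NormedAddCommGroup E] [NormedSpace ℝ E]
    {U : Set E} (hU : IsOpen U) {Q : E → ℝ} (hQ : ContDiffOn ℝ 1 Q U) {z w : E} (hz : z ∈ U)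
    {D : ℝ} (h : HasDerivAt (fun s : ℝ => Q (z + s • w)) D 0) : fderiv ℝ Q z w = D := by
  have h1 : DifferentiableAt ℝ Q z :=
    (hQ.contDiffAt (hU.mem_nhds hz)).differentiableAt one_ne_zero
  rw [← h1.lineDeriv_eq_fderiv]
  exact HasLineDerivAt.lineDeriv h

theorem hasDerivAt_line (z w : Jet d → ℂ) (k : Jet d) :
    HasDerivAt (fun s : ℝ => (z + s • w) k) (w k) 0 := by
  have : HasDerivAt (fun s : ℝ => z k + s • w k) ((1 : ℝ) • w k) 0 :=
    ((hasDerivAt_id (0 : ℝ)).smul_const (w k)).const_add _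
  simpa using this

/-- `-(ε²/2) (Re (Δa/a) + ∑ Im (∂_j a/a)²)`. -/
noncomputable def jetPotential (ε : ℝ) (z : Jet d → ℂ) : ℝ :=
  -(ε ^ 2 / 2) * ((z (some none) / z none).re +
    ∑ j, (z (some (some j)) / z none).im ^ 2)

/-- The derivative of `jetPotential` in the direction `w`. -/
noncomputable def jetPotentialDeriv (ε : ℝ) (z w : Jet d → ℂ) : ℝ :=
  -(ε ^ 2 / 2) *
    ((w (some none) / z none - (z (some none) / z none) * (w none / z none)).re +
    ∑ j, 2 * (z (some (some j)) / z none).im *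
      (w (some (some j)) / z none - (z (some (some j)) / z none) * (w none / z none)).im)

theorem contDiffOn_jetPotential (ε : ℝ) :
    ContDiffOn ℝ 1 (jetPotential (d := d) ε) {z | z none ≠ 0} :=
  contDiffOn_const.mul ((contDiffOn_re_div _).add
    (ContDiffOn.sum fun _ _ => (contDiffOn_im_div _).pow 2))

theorem hasDerivAt_quot {z w : Jet d → ℂ} (hz : z none ≠ 0) (k : Jet d) :
    HasDerivAt (fun s : ℝ => (z + s • w) k / (z + s • w) none)
      (w k / z none - (z k / z none) * (w none / z none)) 0 := by
  simpa using hasDerivAt_div_curve (hasDerivAt_line z w none) (hasDerivAt_line z w k)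
    (by simpa using hz)

theorem fderiv_jetPotential (ε : ℝ) {z w : Jet d → ℂ} (hz : z none ≠ 0) :
    fderiv ℝ (jetPotential ε) z w = jetPotentialDeriv ε z w := by
  refine fderiv_eq_of_hasDerivAt isOpen_jet (contDiffOn_jetPotential ε) hz ?_
  refine HasDerivAt.const_mul _ (HasDerivAt.add (hasDerivAt_re (hasDerivAt_quot hz _)) ?_)
  refine HasDerivAt.fun_sum fun j _ => ?_
  simpa using (hasDerivAt_im (hasDerivAt_quot (w := w) hz (some (some j)))).fun_pow 2

theorem fderiv_norm_jet {z w : Jet d → ℂ} (hz : z none ≠ 0) :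
    fderiv ℝ (fun z : Jet d → ℂ => ‖z none‖) z w = ‖z none‖ * (w none / z none).re := by
  refine fderiv_eq_of_hasDerivAt isOpen_jet contDiffOn_norm_jet hz ?_
  simpa using hasDerivAt_norm_curve (hasDerivAt_line z w none) (by simpa using hz)

theorem fderiv_norm_mul_re {z w : Jet d → ℂ} (hz : z none ≠ 0) (k : Jet d) :
    fderiv ℝ (fun z : Jet d → ℂ => ‖z none‖ * (z k / z none).re) z w =
      ‖z none‖ * ((w none / z none).re * (z k / z none).re +
        (w k / z none - (z k / z none) * (w none / z none)).re) := by
  refine fderiv_eq_of_hasDerivAt isOpen_jet (contDiffOn_norm_jet.mul (contDiffOn_re_div k)) hz ?_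
  have h := (hasDerivAt_norm_curve (hasDerivAt_line z w none) (by simpa using hz)).mul
    (hasDerivAt_re (hasDerivAt_quot (w := w) hz k))
  refine h.congr_deriv ?_
  simp only [zero_smul, add_zero]
  ring

variable {ψ : L2 d} {b : Fin d → L2 d} {c : Fin d → Fin d → L2 d} {m : Fin d → L2 d}

/-- The components `ψ`, `Δψ`, `∂_j ψ`, from the first and second derivatives. -/
noncomputable def jetOf (ψ : L2 d) (b : Fin d → L2 d) (l : L2 d) : Jet d → L2 d
  | none => ψ
  | some none => l
  | some (some j) => b j

theorem mem_posSet {f : Sp d → ℂ} {x : Sp d} : x ∈ posSet f ↔ f x ≠ 0 := by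
  change 0 < ‖f x‖ ^ 2 ↔ f x ≠ 0
  rw [sq_pos_iff, norm_ne_zero_iff]

theorem sqrtDensity_eq (f : Sp d → ℂ) (x : Sp d) : sqrtDensity f x = ‖f x‖ :=
  Real.sqrt_sq (norm_nonneg _)

theorem HasPartialOn.mono {S T : Set (Sp d)} {i : Fin d} {f g : Sp d → ℝ}
    (h : HasPartialOn S i f g) (hST : ∀ᵐ x, x ∈ T → x ∈ S) : HasPartialOn T i f g := by
  obtain ⟨fn, gn, hn, hc⟩ := h
  refine ⟨fn, gn, hn, ?_⟩
  filter_upwards [hc, hST] with x hc hx hT using hc (hx hT)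

variable (hb : ∀ j, HasDirDeriv (basisVec j) ψ (b j))
  (hc : ∀ k j, HasDirDeriv (basisVec k) (b j) (c k j))
  (hm : ∀ j, HasDirDeriv (basisVec j) (∑ k, c k k) (m j))
include hb hc hm

theorem hasDirDeriv_jetOf (i : Fin d) :
    HasDirDeriv (basisVec i) (tuple (jetOf ψ b (∑ k, c k k)))
      (tuple (jetOf (b i) (c i) (m i))) := by
  refine HasDirDeriv.tuple fun k => ?_
  rcases k with _ | _ | j
  · exact hb i
  · exact hm i
  · exact hc i j

/-- The jet avoids `ψ = 0` exactly on the positivity set, so the localised chain rule applies to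
every `C¹` function of `ψ`, `Δψ` and `∇ψ` defined there. -/
theorem hasPartialOn_jet (i : Fin d) {Q : (Jet d → ℂ) → ℝ}
    (hQ : ContDiffOn ℝ 1 Q {z | z none ≠ 0}) :
    HasPartialOn (posSet ψ) i (fun x => Q (fun k => jetOf ψ b (∑ k, c k k) k x))
      (fun x => fderiv ℝ Q (fun k => jetOf ψ b (∑ k, c k k) k x)
        (fun k => jetOf (b i) (c i) (m i) k x)) := by
  have h := hasPartialOn_comp isOpen_jet (by simp) hQ (hasDirDeriv_jetOf hb hc hm i)
  have h1 : ∀ᵐ x, tuple (jetOf ψ b (∑ k, c k k)) x = fun k => jetOf ψ b (∑ k, c k k) k x := by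
    filter_upwards [coeFn_tuple (jetOf ψ b (∑ k, c k k))] with x hx using funext hx
  have h2 : ∀ᵐ x, tuple (jetOf (b i) (c i) (m i)) x = fun k => jetOf (b i) (c i) (m i) k x := by
    filter_upwards [coeFn_tuple (jetOf (b i) (c i) (m i))] with x hx using funext hx
  refine (h.mono ?_).congr ?_ ?_
  · filter_upwards [h1] with x hx hp
    rw [hx]
    exact mem_posSet.1 hp
  · filter_upwards [h1] with x hx _
    rw [hx]
  · filter_upwards [h1, h2] with x hx hx2 _
    rw [hx, hx2]

theorem partialOn_sqrtDensity (i : Fin d) :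
    ∀ᵐ x, x ∈ posSet ψ →
      partialOn (posSet ψ) i (sqrtDensity ψ) x = ‖ψ x‖ * (b i x / ψ x).re := by
  have h := hasPartialOn_jet hb hc hm i contDiffOn_norm_jet
  have h' := (h.congr (f' := sqrtDensity ψ) (ae_of_all _ fun x _ => (sqrtDensity_eq _ _).symm)
    (ae_of_all _ fun x hx => fderiv_norm_jet (mem_posSet.1 hx))).partialOn_eq
  exact h'

/-- With `a = ∂_iψ/ψ`, differentiating `|ψ| Re a` produces `|ψ| ((Re a)² + Re (∂_i∂_iψ/ψ - a²))`,
and `(Re a)² - Re a² = (Im a)²`. -/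
theorem partialOn_partialOn_sqrtDensity (i : Fin d) :
    ∀ᵐ x, x ∈ posSet ψ →
      partialOn (posSet ψ) i (partialOn (posSet ψ) i (sqrtDensity ψ)) x =
        ‖ψ x‖ * ((c i i x / ψ x).re + (b i x / ψ x).im ^ 2) := by
  have h := hasPartialOn_jet hb hc hm i
    (contDiffOn_norm_jet.mul (contDiffOn_re_div (some (some i))))
  refine (h.congr (f' := partialOn (posSet ψ) i (sqrtDensity ψ)) ?_
    (ae_of_all _ fun x hx => ?_)).partialOn_eq
  · filter_upwards [partialOn_sqrtDensity hb hc hm i] with x hx hp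
    rw [hx hp]; rfl
  · rw [fderiv_norm_mul_re (mem_posSet.1 hx)]
    simp only [jetOf]
    rw [Complex.sub_re, Complex.mul_re]
    ring

theorem bohmPotential_eq (ε : ℝ) :
    ∀ᵐ x, x ∈ posSet ψ →
      bohmPotential ε ψ x = jetPotential ε (fun k => jetOf ψ b (∑ k, c k k) k x) := by
  have h := ae_all_iff.2 fun i => partialOn_partialOn_sqrtDensity hb hc hm i
  filter_upwards [h, coeFn_sum Finset.univ fun k => c k k] with x hx hs hp
  rw [bohmPotential, jetPotential, Finset.sum_congr rfl fun i _ => hx i hp, sqrtDensity_eq]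
  have hn : ‖ψ x‖ ≠ 0 := by simpa using mem_posSet.1 hp
  simp only [jetOf]
  rw [hs, ← Finset.mul_sum, mul_div_cancel_left₀ _ hn, Finset.sum_add_distrib, Finset.sum_div,
    Complex.re_sum]

/-- Because the Laplacian is a jet component of its own, the only third derivative entering is `∂_j
Δψ`, which is the one that the equation provides. -/
theorem gradBohmPotential_eq (ε : ℝ) (j : Fin d) :
    ∀ᵐ x, x ∈ posSet ψ →
      gradBohmPotential ε ψ j x = jetPotentialDeriv ε (fun k => jetOf ψ b (∑ k, c k k) k x)
        (fun k => jetOf (b j) (c j) (m j) k x) := by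
  have h := hasPartialOn_jet hb hc hm j (contDiffOn_jetPotential ε)
  refine (h.congr (f' := bohmPotential ε ψ) ?_ (ae_of_all _ fun x hx => ?_)).partialOn_eq
  · filter_upwards [bohmPotential_eq hb hc hm ε] with x hx hp
    rw [hx hp]
  · exact fderiv_jetPotential ε (mem_posSet.1 hx)

end Potential

end Bohm

namespace Bohm

/-! ### The weak gradient of the square root of the density -/

section Modulus

variable {d : ℕ}

theorem hasFDerivAt_sqrt_norm_sq_add {δ : ℝ} (hδ : 0 < δ) (z : ℂ) :
    HasFDerivAt (fun z : ℂ => Real.sqrt (‖z‖ ^ 2 + δ) - Real.sqrt δ)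
      ((Real.sqrt (‖z‖ ^ 2 + δ))⁻¹ • innerSL ℝ z) z := by
  have h1 := (((hasStrictFDerivAt_norm_sq z).hasFDerivAt.add_const δ).sqrt
    (by positivity)).sub_const (Real.sqrt δ)
  refine h1.congr_fderiv ?_
  have : Real.sqrt (‖z‖ ^ 2 + δ) ≠ 0 := by positivity
  ext w
  all_goals
    simp
    field_simp

/-- The first bound gives the quadratic growth needed by the chain rule for fixed `δ`; the second
does not depend on `δ` and serves as majorant when `δ → 0`. -/
theorem abs_sqrt_sub_le {s δ : ℝ} (hs : 0 ≤ s) (hδ : 0 < δ) :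
    |Real.sqrt (s + δ) - Real.sqrt δ| ≤ (Real.sqrt δ)⁻¹ * s ∧
      |Real.sqrt (s + δ) - Real.sqrt δ| ≤ Real.sqrt s := by
  have h0 : 0 < Real.sqrt δ := Real.sqrt_pos.2 hδ
  have h1 : Real.sqrt δ ≤ Real.sqrt (s + δ) := Real.sqrt_le_sqrt (by linarith)
  have e1 := Real.sq_sqrt (show 0 ≤ s + δ by positivity)
  have e2 := Real.sq_sqrt hδ.le
  have e3 := Real.sq_sqrt hs
  rw [abs_of_nonneg (by linarith)]
  constructor
  · rw [← div_eq_inv_mul, le_div_iff₀ h0]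
    nlinarith
  · have := Real.sqrt_nonneg s
    by_contra hlt
    push Not at hlt
    nlinarith

/-- The real inner product divided by the modulus, i.e. the derivative of the modulus. -/
theorem HasDirDeriv.hasWeakPartial_norm {i : Fin d} {ψ b : L2 d}
    (h : HasDirDeriv (basisVec i) ψ b) :
    HasWeakPartial i (fun x => ‖ψ x‖) (fun x => inner ℝ (ψ x) (b x) / ‖ψ x‖) := by
  -- The modulus is not differentiable at the origin; it is approximated by `√(|ψ|² + δ) - √δ`,
  -- where subtracting `√δ` keeps the functions integrable.
  set δ : ℕ → ℝ := fun n => 1 / ((n : ℝ) + 1) with hδdef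
  have hδ : ∀ n, 0 < δ n := fun n => by positivity
  have hδ0 : Tendsto δ atTop (𝓝 0) := tendsto_one_div_add_atTop_nhds_zero_nat
  have hw : ∀ n, HasWeakPartial i (fun x => Real.sqrt (‖ψ x‖ ^ 2 + δ n) - Real.sqrt (δ n))
      (fun x => ((Real.sqrt (‖ψ x‖ ^ 2 + δ n))⁻¹ • innerSL ℝ (ψ x)) (b x)) := by
    intro n
    refine hasWeakPartial_comp (q := fun z : ℂ => Real.sqrt (‖z‖ ^ 2 + δ n) - Real.sqrt (δ n))
      (q' := fun z => (Real.sqrt (‖z‖ ^ 2 + δ n))⁻¹ • innerSL ℝ z)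
      (hasFDerivAt_sqrt_norm_sq_add (hδ n)) ?_ (C := (Real.sqrt (δ n))⁻¹) (fun z => ?_)
      (fun z => ?_) h
    · have hc : Continuous fun z : ℂ => Real.sqrt (‖z‖ ^ 2 + δ n) := by fun_prop
      refine Continuous.smul (hc.inv₀ fun z => ?_) (innerSL ℝ (E := ℂ)).continuous
      have := hδ n
      positivity
    · exact (abs_sqrt_sub_le (by positivity) (hδ n)).1
    · rw [norm_smul, innerSL_apply_norm, Real.norm_of_nonneg (by positivity)]
      gcongr
      exact le_add_of_nonneg_left (by positivity)
  have hl1 : LocallyIntegrable (fun x => ‖ψ x‖) :=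
    fun x => (lp_locallyIntegrable ψ x).norm
  have hb0 : LocallyIntegrable (fun x => ‖b x‖) :=
    fun x => (lp_locallyIntegrable b x).norm
  have hbd : ∀ (z w : ℂ), |inner ℝ z w / ‖z‖| ≤ ‖w‖ := by
    intro z w
    rw [abs_div, abs_norm]
    rcases eq_or_ne z 0 with rfl | hz
    · simp
    · rw [div_le_iff₀ (by simpa using hz), mul_comm]
      exact abs_real_inner_le_norm z w
  have hl2 : LocallyIntegrable (fun x => inner ℝ (ψ x) (b x) / ‖ψ x‖) := by
    refine hb0.mono ?_ (ae_of_all _ fun x => by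
      rw [Real.norm_eq_abs, norm_norm]; exact hbd (ψ x) (b x))
    have h1 : AEMeasurable (fun x => inner ℝ (ψ x) (b x)) :=
      ((Lp.aestronglyMeasurable ψ).inner (Lp.aestronglyMeasurable b)).aemeasurable
    exact (h1.div (Lp.aestronglyMeasurable ψ).norm.aemeasurable).aestronglyMeasurable
  rw [hasWeakPartial_iff]
  refine ⟨hl1, hl2, fun χ hχ hχc => ?_⟩
  have hχ' : Continuous fun x => fderiv ℝ χ x (basisVec i) :=
    (hχ.continuous_fderiv (by simp)).clm_apply continuous_const
  have hχ'c : HasCompactSupport fun x => fderiv ℝ χ x (basisVec i) := hχc.fderiv_apply ℝ _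
  have L1 : Tendsto (fun n => ∫ x, fderiv ℝ χ x (basisVec i) •
      (Real.sqrt (‖ψ x‖ ^ 2 + δ n) - Real.sqrt (δ n))) atTop
      (𝓝 (∫ x, fderiv ℝ χ x (basisVec i) • ‖ψ x‖)) := by
    refine tendsto_integral_of_dominated_convergence
      (fun x => ‖fderiv ℝ χ x (basisVec i) • ‖ψ x‖‖)
      (fun n => (integrable_test_smul hχ' hχ'c (hw n).1).aestronglyMeasurable)
      (integrable_test_smul hχ' hχ'c hl1).norm (fun n => ae_of_all _ fun x => ?_)
      (ae_of_all _ fun x => ?_)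
    · rw [norm_smul, norm_smul, norm_norm]
      gcongr
      simpa using (abs_sqrt_sub_le (sq_nonneg ‖ψ x‖) (hδ n)).2
    · refine Tendsto.const_smul ?_ _
      have : Continuous fun s : ℝ => Real.sqrt (‖ψ x‖ ^ 2 + s) - Real.sqrt s := by fun_prop
      have h2 := (this.tendsto 0).comp hδ0
      simp only [add_zero, Real.sqrt_zero, sub_zero, Real.sqrt_sq (norm_nonneg _)] at h2
      exact h2
  have L2 : Tendsto (fun n => ∫ x, χ x •
      ((Real.sqrt (‖ψ x‖ ^ 2 + δ n))⁻¹ • innerSL ℝ (ψ x)) (b x)) atTop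
      (𝓝 (∫ x, χ x • (inner ℝ (ψ x) (b x) / ‖ψ x‖))) := by
    refine tendsto_integral_of_dominated_convergence
      (fun x => ‖χ x • ‖b x‖‖)
      (fun n => (integrable_test_smul hχ.continuous hχc (hw n).2.1).aestronglyMeasurable)
      (integrable_test_smul hχ.continuous hχc hb0).norm (fun n => ae_of_all _ fun x => ?_)
      (ae_of_all _ fun x => ?_)
    · rw [norm_smul, norm_smul, norm_norm]
      gcongr
      refine (((Real.sqrt (‖ψ x‖ ^ 2 + δ n))⁻¹ • innerSL ℝ (ψ x)).le_opNorm _).trans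
        (mul_le_of_le_one_left (norm_nonneg _) ?_)
      rw [norm_smul, innerSL_apply_norm, Real.norm_of_nonneg (by positivity),
        ← div_eq_inv_mul]
      have := hδ n
      refine div_le_one_of_le₀ (Real.le_sqrt_of_sq_le (by linarith)) (by positivity)
    · refine Tendsto.const_smul ?_ _
      rcases eq_or_ne (ψ x) 0 with h0 | h0
      · simp [h0]
      · have : ContinuousAt (fun s : ℝ => (Real.sqrt (‖ψ x‖ ^ 2 + s))⁻¹ * inner ℝ (ψ x) (b x)) 0 := by
          refine ContinuousAt.mul (ContinuousAt.inv₀ (by fun_prop) ?_) continuousAt_const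
          simpa using h0
        have h2 := this.tendsto.comp hδ0
        simp only [add_zero, Real.sqrt_sq (norm_nonneg _)] at h2
        rw [div_eq_inv_mul]
        exact h2
  have L3 := L2.neg
  refine tendsto_nhds_unique L1 (L3.congr fun n => ?_)
  exact (((hasWeakPartial_iff.1 (hw n)).2.2 χ hχ hχc)).symm

theorem HasDirDeriv.weakPartial_sqrtDensity {i : Fin d} {ψ b : L2 d}
    (h : HasDirDeriv (basisVec i) ψ b) :
    ∀ᵐ x, weakPartial i (sqrtDensity ψ) x = inner ℝ (ψ x) (b x) / ‖ψ x‖ :=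
  (h.hasWeakPartial_norm.congr (ae_of_all _ fun x => (sqrtDensity_eq ψ x).symm)
    EventuallyEq.rfl).weakPartial_eq

theorem HasDirDeriv.weakPartial_eq {i : Fin d} {ψ b : L2 d}
    (h : HasDirDeriv (basisVec i) ψ b) : weakPartial i ψ =ᵐ[volume] b :=
  h.hasWeakPartial.weakPartial_eq

theorem HasDirDeriv.current_eq {i : Fin d} {ψ b : L2 d}
    (h : HasDirDeriv (basisVec i) ψ b) (ε : ℝ) :
    ∀ᵐ x, current ε ψ i x = ε * ((starRingEnd ℂ) (ψ x) * b x).im := by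
  filter_upwards [h.weakPartial_eq] with x hx
  rw [current, hx]

theorem HasDirDeriv.ae_zero {i : Fin d} {ψ b : L2 d} (h : HasDirDeriv (basisVec i) ψ b) :
    ∀ᵐ x, ψ x = 0 → b x = 0 :=
  h.hasWeakPartial.ae_eq_zero

/-- `ε² Re (conj b_i b_j) = J_i J_j / ρ + ε² ∂_i√ρ ∂_j√ρ` almost everywhere. -/
theorem ae_stress_eq {ψ : L2 d} {b : Fin d → L2 d} (hb : ∀ j, HasDirDeriv (basisVec j) ψ (b j))
    (ε : ℝ) (i j : Fin d) :
    ∀ᵐ x, current ε ψ i x * current ε ψ j x / density ψ x +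
      ε ^ 2 * (weakPartial i (sqrtDensity ψ) x * weakPartial j (sqrtDensity ψ) x) =
      ε ^ 2 * ((starRingEnd ℂ) (b i x) * b j x).re := by
  filter_upwards [(hb i).current_eq ε, (hb j).current_eq ε, (hb i).weakPartial_sqrtDensity,
    (hb j).weakPartial_sqrtDensity, (hb i).ae_zero] with x h1 h2 h3 h4 h5
  rw [h1, h2, h3, h4, density]
  -- At nodes the left side is zero by the convention on division by zero; the right side is zero
  -- because the weak gradient of `ψ` vanishes almost everywhere on the zero set of `ψ`.
  rcases eq_or_ne (ψ x) 0 with h0 | h0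
  · simp [h5 h0, h0]
  · have hn : ‖ψ x‖ ≠ 0 := by simpa using h0
    have hsq : ‖ψ x‖ ^ 2 = (ψ x).re ^ 2 + (ψ x).im ^ 2 := by
      rw [← Complex.normSq_eq_norm_sq, Complex.normSq_apply]; ring
    rw [div_mul_div_comm, ← pow_two, mul_div_assoc', ← add_div, div_eq_iff (by positivity),
      hsq]
    simp only [Complex.inner, Complex.mul_im, Complex.mul_re, Complex.conj_re, Complex.conj_im]
    ring

end Modulus

end Bohm

namespace Bohm

/-! ### Regularised velocity field -/

section Velocity

variable {d : ℕ}

/-- Values of a wave function and its gradient. -/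
abbrev St (d : ℕ) : Type := Option (Fin d) → ℂ

/-- The density of a state. -/
noncomputable def rho (z : St d) : ℝ := ‖z none‖ ^ 2

/-- The current of a state. -/
noncomputable def mom (ε : ℝ) (z : St d) : Sp d :=
  WithLp.toLp 2 fun j => ε * ((starRingEnd ℂ) (z none) * z (some j)).im

/-- The derivative of `rho`. -/
noncomputable def drho (z w : St d) : ℝ := 2 * ((starRingEnd ℂ) (z none) * w none).re

/-- The derivative of `mom`. -/
noncomputable def dmom (ε : ℝ) (z w : St d) : Sp d :=
  WithLp.toLp 2 fun j => ε *
    ((starRingEnd ℂ) (w none) * z (some j) + (starRingEnd ℂ) (z none) * w (some j)).im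

/-- The regularised velocity `J / (ρ + δ)`. -/
noncomputable def vel (ε δ : ℝ) (z : St d) : Sp d := (rho z + δ)⁻¹ • mom ε z

/-- The derivative of `vel`. -/
noncomputable def dvel (ε δ : ℝ) (z w : St d) : Sp d :=
  (rho z + δ)⁻¹ • (dmom ε z w - drho z w • vel ε δ z)

/-- The density and the components of the current, as the components of a space-time vector. -/
noncomputable def wt (ε : ℝ) : Option (Fin d) → St d → ℝ
  | none, z => rho z
  | some k, z => mom ε z k

/-- The derivative of `wt`. -/
noncomputable def dwt (ε : ℝ) : Option (Fin d) → St d → St d → ℝ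
  | none, z, w => drho z w
  | some k, z, w => dmom ε z w k

theorem rho_nonneg (z : St d) : 0 ≤ rho z := by unfold rho; positivity

theorem norm_le_sum_abs (x : Sp d) : ‖x‖ ≤ ∑ j, |x j| := by
  have h : x = ∑ j, x j • (basisVec j : Sp d) := by
    ext i
    simp [Finset.sum_apply, Pi.single_apply]
  calc ‖x‖ = ‖∑ j, x j • (basisVec j : Sp d)‖ := by rw [← h]
    _ ≤ ∑ j, ‖x j • (basisVec j : Sp d)‖ := norm_sum_le _ _
    _ = _ := by simp [norm_smul]

theorem norm_le_of_forall_abs_le {x : Sp d} {C : ℝ} (h : ∀ j, |x j| ≤ C) : ‖x‖ ≤ d * C := by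
  refine (norm_le_sum_abs x).trans ((Finset.sum_le_sum fun j _ => h j).trans ?_)
  simp

theorem abs_apply_le_norm (x : Sp d) (j : Fin d) : |x j| ≤ ‖x‖ :=
  PiLp.norm_apply_le x j

/-- A common bound for the quadratic expressions. -/
noncomputable def quadConst (d : ℕ) (ε : ℝ) : ℝ := 2 + 2 * |ε| + d * (2 * |ε|)

theorem quadConst_nonneg (d : ℕ) (ε : ℝ) : 0 ≤ quadConst d ε := by
  unfold quadConst; positivity

theorem abs_conj_mul_im_le (a b : ℂ) : |((starRingEnd ℂ) a * b).im| ≤ ‖a‖ * ‖b‖ := by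
  simpa using Complex.abs_im_le_norm ((starRingEnd ℂ) a * b)

theorem abs_conj_mul_re_le (a b : ℂ) : |((starRingEnd ℂ) a * b).re| ≤ ‖a‖ * ‖b‖ := by
  simpa using Complex.abs_re_le_norm ((starRingEnd ℂ) a * b)

theorem abs_mom_le (ε : ℝ) (z : St d) (j : Fin d) :
    |mom ε z j| ≤ |ε| * (‖z none‖ * ‖z (some j)‖) := by
  simp only [mom]
  rw [abs_mul]
  gcongr
  exact abs_conj_mul_im_le _ _

theorem abs_dmom_le (ε : ℝ) (z w : St d) (j : Fin d) :
    |dmom ε z w j| ≤ 2 * |ε| * (‖z‖ * ‖w‖) := by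
  simp only [dmom]
  rw [abs_mul, Complex.add_im]
  have h1 := abs_conj_mul_im_le (w none) (z (some j))
  have h2 := abs_conj_mul_im_le (z none) (w (some j))
  have h3 : ‖w none‖ * ‖z (some j)‖ ≤ ‖w‖ * ‖z‖ := by
    gcongr
    exacts [norm_le_pi_norm w none, norm_le_pi_norm z (some j)]
  have h4 : ‖z none‖ * ‖w (some j)‖ ≤ ‖z‖ * ‖w‖ := by
    gcongr
    exacts [norm_le_pi_norm z none, norm_le_pi_norm w (some j)]
  calc _ ≤ |ε| * (‖w‖ * ‖z‖ + ‖z‖ * ‖w‖) := by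
        gcongr
        exact (abs_add_le _ _).trans (add_le_add (h1.trans h3) (h2.trans h4))
    _ = _ := by ring

theorem norm_dmom_le (ε : ℝ) (z w : St d) : ‖dmom ε z w‖ ≤ quadConst d ε * (‖z‖ * ‖w‖) := by
  refine (norm_le_of_forall_abs_le (abs_dmom_le ε z w)).trans ?_
  rw [← mul_assoc]
  gcongr
  unfold quadConst
  linarith [abs_nonneg ε]

theorem abs_drho_le (ε : ℝ) (z w : St d) : |drho z w| ≤ quadConst d ε * (‖z‖ * ‖w‖) := by
  have h1 := abs_conj_mul_re_le (z none) (w none)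
  have h2 : ‖z none‖ * ‖w none‖ ≤ ‖z‖ * ‖w‖ := by
    gcongr
    exacts [norm_le_pi_norm z none, norm_le_pi_norm w none]
  have h3 : (2 : ℝ) ≤ quadConst d ε := by
    unfold quadConst
    have : (0 : ℝ) ≤ d * (2 * |ε|) := by positivity
    linarith [abs_nonneg ε]
  unfold drho
  rw [abs_mul, abs_two]
  gcongr
  exact h1.trans h2

theorem abs_wt_le (ε : ℝ) (s : Option (Fin d)) (z : St d) :
    |wt ε s z| ≤ quadConst d ε * ‖z‖ ^ 2 := by
  have h3 : (1 : ℝ) ≤ quadConst d ε ∧ |ε| ≤ quadConst d ε := by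
    unfold quadConst
    have : (0 : ℝ) ≤ d * (2 * |ε|) := by positivity
    constructor <;> linarith [abs_nonneg ε]
  rcases s with _ | k
  · simp only [wt]
    rw [abs_of_nonneg (rho_nonneg z), rho]
    calc ‖z none‖ ^ 2 ≤ ‖z‖ ^ 2 := by gcongr; exact norm_le_pi_norm z none
      _ ≤ _ := le_mul_of_one_le_left (by positivity) h3.1
  · simp only [wt]
    refine (abs_mom_le ε z k).trans ?_
    rw [pow_two]
    gcongr
    exacts [quadConst_nonneg d ε, h3.2, norm_le_pi_norm z none, norm_le_pi_norm z (some k)]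

theorem abs_dwt_le (ε : ℝ) (s : Option (Fin d)) (z w : St d) :
    |dwt ε s z w| ≤ quadConst d ε * (‖z‖ * ‖w‖) := by
  rcases s with _ | k
  · exact abs_drho_le ε z w
  · exact (abs_apply_le_norm _ k).trans (norm_dmom_le ε z w)

theorem mom_eq {δ : ℝ} (hδ : 0 < δ) (ε : ℝ) (z : St d) :
    mom ε z = (rho z + δ) • vel ε δ z := by
  have : rho z + δ ≠ 0 := by have := rho_nonneg z; positivity
  rw [vel, smul_smul, mul_inv_cancel₀ this, one_smul]

/-- Since `J = (ρ + δ) u_δ`, density and current carry a factor `ρ + δ` that compensates the `(ρ +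
δ)⁻¹` in the derivative of `u_δ`. -/
theorem abs_wt_le_vel {δ : ℝ} (hδ : 0 < δ) (ε : ℝ) (s : Option (Fin d)) (z : St d) :
    |wt ε s z| ≤ (1 + ‖vel ε δ z‖) * (rho z + δ) := by
  have h0 := rho_nonneg z
  rcases s with _ | k
  · simp only [wt]
    rw [abs_of_nonneg h0]
    nlinarith [norm_nonneg (vel ε δ z), mul_nonneg (norm_nonneg (vel ε δ z)) h0]
  · simp only [wt]
    rw [mom_eq hδ ε z, PiLp.smul_apply, smul_eq_mul, abs_mul, abs_of_pos (by positivity), mul_comm]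
    gcongr
    linarith [abs_apply_le_norm (vel ε δ z) k]

/-- The factors `ρ + δ` and `(ρ + δ)⁻¹` cancel, so the bound is free of `δ` and survives at the
nodes. This is what makes the limit `δ → 0` possible. -/
theorem abs_wt_mul_norm_dvel_le {δ : ℝ} (hδ : 0 < δ) (ε : ℝ) (s : Option (Fin d)) (z w : St d)
    {R : ℝ} (hR : ‖vel ε δ z‖ ≤ R) :
    |wt ε s z| * ‖dvel ε δ z w‖ ≤ (1 + R) ^ 2 * quadConst d ε * (‖z‖ * ‖w‖) := by
  have h0 := rho_nonneg z
  have hpos : 0 < rho z + δ := by positivity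
  have hR0 : 0 ≤ R := (norm_nonneg _).trans hR
  have hK := quadConst_nonneg d ε
  have h1 : ‖dmom ε z w - drho z w • vel ε δ z‖ ≤ quadConst d ε * (‖z‖ * ‖w‖) * (1 + R) := by
    refine (norm_sub_le _ _).trans ?_
    rw [norm_smul, Real.norm_eq_abs, mul_add, mul_one]
    exact add_le_add (norm_dmom_le ε z w)
      (mul_le_mul (abs_drho_le ε z w) hR (norm_nonneg _) (by positivity))
  calc |wt ε s z| * ‖dvel ε δ z w‖
      ≤ ((1 + R) * (rho z + δ)) *
        ((rho z + δ)⁻¹ * (quadConst d ε * (‖z‖ * ‖w‖) * (1 + R))) := by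
        rw [dvel, norm_smul, Real.norm_of_nonneg (by positivity)]
        have := abs_wt_le_vel hδ ε s z
        gcongr
        exact this.trans (by gcongr)
    _ = _ := by field_simp

theorem hasDerivAt_st_line (z w : St d) (k : Option (Fin d)) :
    HasDerivAt (fun s : ℝ => (z + s • w) k) (w k) 0 := by
  have : HasDerivAt (fun s : ℝ => z k + s • w k) ((1 : ℝ) • w k) 0 :=
    ((hasDerivAt_id (0 : ℝ)).smul_const (w k)).const_add _
  simpa using this

theorem hasDerivAt_conj_mul {A B : ℝ → ℂ} {a' b' : ℂ} {s : ℝ} (hA : HasDerivAt A a' s)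
    (hB : HasDerivAt B b' s) :
    HasDerivAt (fun s => (starRingEnd ℂ) (A s) * B s)
      ((starRingEnd ℂ) a' * B s + (starRingEnd ℂ) (A s) * b') s :=
  HasDerivAt.fun_mul (Complex.conjCLE.hasFDerivAt.comp_hasDerivAt s hA) hB

theorem hasDerivAt_rho_line (z w : St d) :
    HasDerivAt (fun s : ℝ => rho (z + s • w)) (drho z w) 0 := by
  have h := (hasDerivAt_st_line z w none).norm_sq
  refine h.congr_deriv ?_
  rw [drho, Complex.inner]
  simp [mul_comm]

theorem hasDerivAt_mom_line (ε : ℝ) (z w : St d) (j : Fin d) :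
    HasDerivAt (fun s : ℝ => mom ε (z + s • w) j) (dmom ε z w j) 0 := by
  have h := (hasDerivAt_im (hasDerivAt_conj_mul (hasDerivAt_st_line z w none)
    (hasDerivAt_st_line z w (some j)))).const_mul ε
  simpa [mom, dmom] using h

theorem hasDerivAt_wt_line (ε : ℝ) (s : Option (Fin d)) (z w : St d) :
    HasDerivAt (fun r : ℝ => wt ε s (z + r • w)) (dwt ε s z w) 0 := by
  rcases s with _ | k
  · exact hasDerivAt_rho_line z w
  · exact hasDerivAt_mom_line ε z w k

theorem hasDerivAt_sp {f : ℝ → Sp d} {f' : Sp d} {s : ℝ}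
    (h : ∀ j, HasDerivAt (fun s => f s j) (f' j) s) : HasDerivAt f f' s := by
  have h1 : HasDerivAt (fun s => WithLp.ofLp (f s)) (WithLp.ofLp f') s := hasDerivAt_pi.2 h
  exact (PiLp.continuousLinearEquiv 2 ℝ fun _ : Fin d => ℝ).symm.hasFDerivAt.comp_hasDerivAt s h1

theorem hasDerivAt_vel_line {δ : ℝ} (hδ : 0 < δ) (ε : ℝ) (z w : St d) :
    HasDerivAt (fun s : ℝ => vel ε δ (z + s • w)) (dvel ε δ z w) 0 := by
  have hpos : rho z + δ ≠ 0 := by have := rho_nonneg z; positivity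
  have h1 : HasDerivAt (fun s : ℝ => (rho (z + s • w) + δ)⁻¹)
      (-drho z w / (rho z + δ) ^ 2) 0 := by
    simpa using ((hasDerivAt_rho_line z w).add_const δ).fun_inv (by simpa using hpos)
  have h2 : HasDerivAt (fun s : ℝ => mom ε (z + s • w)) (dmom ε z w) 0 :=
    hasDerivAt_sp (hasDerivAt_mom_line ε z w)
  refine (h1.fun_smul h2).congr_deriv ?_
  simp only [zero_smul, add_zero]
  rw [dvel, smul_sub, smul_smul, vel, smul_smul, sub_eq_add_neg, ← neg_smul]
  congr 2
  field_simp

theorem contDiff_rho : ContDiff ℝ (⊤ : ℕ∞) (rho (d := d)) :=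
  (contDiff_apply ℝ ℂ (none : Option (Fin d))).norm_sq ℝ

theorem contDiff_mom (ε : ℝ) : ContDiff ℝ (⊤ : ℕ∞) (mom (d := d) ε) := by
  rw [contDiff_euclidean]
  intro j
  refine contDiff_const.mul (Complex.imCLM.contDiff.comp (ContDiff.mul ?_ ?_))
  · exact Complex.conjCLE.contDiff.comp (contDiff_apply ℝ ℂ (none : Option (Fin d)))
  · exact contDiff_apply ℝ ℂ (some j)

theorem contDiff_wt (ε : ℝ) (s : Option (Fin d)) : ContDiff ℝ (⊤ : ℕ∞) (wt ε s) := by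
  rcases s with _ | k
  · exact contDiff_rho
  · exact contDiff_euclidean.1 (contDiff_mom ε) k

theorem contDiff_vel {δ : ℝ} (hδ : 0 < δ) (ε : ℝ) :
    ContDiff ℝ (⊤ : ℕ∞) (vel (d := d) ε δ) := by
  refine ContDiff.smul (ContDiff.inv (contDiff_rho.add contDiff_const) fun z => ?_) (contDiff_mom ε)
  have := rho_nonneg z
  positivity

theorem continuous_dmom (ε : ℝ) : Continuous fun q : St d × St d => dmom ε q.1 q.2 := by
  unfold dmom
  fun_prop

theorem continuous_drho : Continuous fun q : St d × St d => drho q.1 q.2 := by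
  unfold drho
  fun_prop

theorem continuous_dvel {δ : ℝ} (hδ : 0 < δ) (ε : ℝ) :
    Continuous fun q : St d × St d => dvel ε δ q.1 q.2 := by
  have h1 : Continuous fun q : St d × St d => rho q.1 := contDiff_rho.continuous.comp continuous_fst
  refine Continuous.smul (Continuous.inv₀ (h1.add continuous_const) fun q => ?_)
    ((continuous_dmom ε).sub (continuous_drho.smul
      ((contDiff_vel hδ ε).continuous.comp continuous_fst)))
  have := rho_nonneg q.1
  exact (show 0 < rho q.1 + δ by positivity).ne'

variable {Φ : ℝ × Sp d × Sp d → ℝ}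

/-- The function `h_s(z) Φ(t, x, u_δ(z))`. -/
noncomputable def wtTest (ε δ : ℝ) (Φ : ℝ × Sp d × Sp d → ℝ) (s : Option (Fin d))
    (q : (ℝ × Sp d) × St d) : ℝ := wt ε s q.2 * Φ (q.1.1, q.1.2, vel ε δ q.2)

theorem contDiff_wtTest {δ : ℝ} (hδ : 0 < δ) (ε : ℝ) (hΦ : ContDiff ℝ (⊤ : ℕ∞) Φ)
    (s : Option (Fin d)) : ContDiff ℝ (⊤ : ℕ∞) (wtTest ε δ Φ s) := by
  refine ((contDiff_wt ε s).comp contDiff_snd).mul (hΦ.comp ?_)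
  exact (contDiff_fst.comp contDiff_fst).prodMk ((contDiff_snd.comp contDiff_fst).prodMk
    ((contDiff_vel hδ ε).comp contDiff_snd))

theorem fderiv_wtTest {δ : ℝ} (hδ : 0 < δ) (ε : ℝ) (hΦ : ContDiff ℝ (⊤ : ℕ∞) Φ)
    (s : Option (Fin d)) (y v : ℝ × Sp d) (z w : St d) :
    fderiv ℝ (wtTest ε δ Φ s) (y, z) (v, w) = dwt ε s z w * Φ (y.1, y.2, vel ε δ z) +
      wt ε s z * fderiv ℝ Φ (y.1, y.2, vel ε δ z) (v.1, v.2, dvel ε δ z w) := by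
  have h1 : DifferentiableAt ℝ (wtTest ε δ Φ s) (y, z) :=
    (contDiff_wtTest hδ ε hΦ s).differentiable (by simp) _
  rw [← h1.lineDeriv_eq_fderiv]
  refine HasLineDerivAt.lineDeriv ?_
  have a1 : HasDerivAt (fun r : ℝ => y.1 + r * v.1) v.1 0 := by
    simpa using ((hasDerivAt_id (0 : ℝ)).mul_const v.1).const_add y.1
  have a2 : HasDerivAt (fun r : ℝ => y.2 + r • v.2) v.2 0 := by
    simpa using ((hasDerivAt_id (0 : ℝ)).smul_const v.2).const_add y.2
  have a3 := a1.prodMk (a2.prodMk (hasDerivAt_vel_line hδ ε z w))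
  have a4 : HasDerivAt (fun r : ℝ => Φ (y.1 + r * v.1, y.2 + r • v.2, vel ε δ (z + r • w)))
      (fderiv ℝ Φ (y.1, y.2, vel ε δ z) (v.1, v.2, dvel ε δ z w)) 0 := by
    refine HasFDerivAt.comp_hasDerivAt_of_eq (0 : ℝ)
      ((hΦ.differentiable (by simp)) (y.1, y.2, vel ε δ z)).hasFDerivAt a3 ?_
    simp
  have a5 := (hasDerivAt_wt_line ε s z w).fun_mul a4
  simpa [HasLineDerivAt, wtTest] using a5

theorem exists_bounds_test (hΦ : ContDiff ℝ (⊤ : ℕ∞) Φ) (hc : HasCompactSupport Φ) :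
    ∃ M R : ℝ, 0 ≤ M ∧ 0 ≤ R ∧ (∀ q, |Φ q| ≤ M) ∧ (∀ q, ‖fderiv ℝ Φ q‖ ≤ M) ∧
      ∀ q, R < ‖q‖ → Φ q = 0 ∧ fderiv ℝ Φ q = 0 := by
  obtain ⟨M₁, hM₁⟩ := hc.exists_bound_of_continuous hΦ.continuous
  obtain ⟨M₂, hM₂⟩ := (hc.fderiv ℝ).exists_bound_of_continuous (hΦ.continuous_fderiv (by simp))
  obtain ⟨R, hR⟩ := hc.isCompact.isBounded.exists_norm_le
  refine ⟨|M₁| + |M₂|, |R|, by positivity, by positivity, fun q => ?_, fun q => ?_, fun q hq => ?_⟩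
  · exact (hM₁ q).trans ((le_abs_self _).trans (le_add_of_nonneg_right (abs_nonneg _)))
  · exact (hM₂ q).trans ((le_abs_self _).trans (le_add_of_nonneg_left (abs_nonneg _)))
  · have hqt : q ∉ tsupport Φ := fun h => absurd ((hR q h).trans (le_abs_self R)) (not_le.2 hq)
    exact ⟨image_eq_zero_of_notMem_tsupport hqt,
      image_eq_zero_of_notMem_tsupport fun h => hqt (tsupport_fderiv_subset ℝ h)⟩

/-- Bound on the velocity part of the derivative, uniform in `δ`. -/
theorem exists_bound_fderiv_dvel (ε : ℝ) (hΦ : ContDiff ℝ (⊤ : ℕ∞) Φ)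
    (hc : HasCompactSupport Φ) :
    ∃ C : ℝ, 0 ≤ C ∧ ∀ (δ : ℝ), 0 < δ → ∀ (s : Option (Fin d)) (y : ℝ × Sp d) (z w : St d),
      |wt ε s z * fderiv ℝ Φ (y.1, y.2, vel ε δ z) (0, 0, dvel ε δ z w)| ≤ C * (‖z‖ * ‖w‖) := by
  obtain ⟨M, R, hM0, hR0, hM, hM', hR⟩ := exists_bounds_test hΦ hc
  have hK := quadConst_nonneg d ε
  refine ⟨M * ((1 + R) ^ 2 * quadConst d ε), by positivity, fun δ hδ s y z w => ?_⟩
  -- Beyond radius `R` the derivative of `Φ` vanishes; inside, the regularised velocity is bounded,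
  -- as the weighted estimate requires.
  rcases lt_or_ge R ‖vel ε δ z‖ with h | h
  · have : R < ‖((y.1, y.2, vel ε δ z) : ℝ × Sp d × Sp d)‖ :=
      h.trans_le ((norm_snd_le (y.2, vel ε δ z)).trans (norm_snd_le (y.1, y.2, vel ε δ z)))
    rw [(hR _ this).2]
    simp only [_root_.zero_apply, mul_zero, abs_zero]
    positivity
  · have h1 : |fderiv ℝ Φ (y.1, y.2, vel ε δ z) (0, 0, dvel ε δ z w)| ≤ M * ‖dvel ε δ z w‖ := by
      refine ((fderiv ℝ Φ _).le_opNorm _).trans ?_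
      have : ‖((0, 0, dvel ε δ z w) : ℝ × Sp d × Sp d)‖ = ‖dvel ε δ z w‖ := by
        simp [Prod.norm_def]
      rw [this]
      gcongr
      exact hM' _
    calc _ ≤ |wt ε s z| * (M * ‖dvel ε δ z w‖) := by rw [abs_mul]; gcongr
      _ = M * (|wt ε s z| * ‖dvel ε δ z w‖) := by ring
      _ ≤ M * ((1 + R) ^ 2 * quadConst d ε * (‖z‖ * ‖w‖)) := by
        exact mul_le_mul_of_nonneg_left (abs_wt_mul_norm_dvel_le hδ ε s z w h) hM0
      _ = _ := by ring

/-- The growth condition under which integrals along the `L²` curve may be differentiated in time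
and integrated by parts in space. -/
theorem exists_bound_fderiv_wtTest {δ : ℝ} (hδ : 0 < δ) (ε : ℝ) (hΦ : ContDiff ℝ (⊤ : ℕ∞) Φ)
    (hc : HasCompactSupport Φ) :
    ∃ C : ℝ, ∀ (s : Option (Fin d)) (y : ℝ × Sp d) (z : St d) (v : ℝ × Sp d) (w : St d),
      |fderiv ℝ (wtTest ε δ Φ s) (y, z) (v, w)| ≤ C * (‖z‖ ^ 2 * ‖v‖ + ‖z‖ * ‖w‖) := by
  obtain ⟨M, R, hM0, hR0, hM, hM', hR⟩ := exists_bounds_test hΦ hc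
  obtain ⟨C, hC0, hC⟩ := exists_bound_fderiv_dvel ε hΦ hc
  have hK := quadConst_nonneg d ε
  refine ⟨quadConst d ε * M + C, fun s y z v w => ?_⟩
  rw [fderiv_wtTest hδ ε hΦ]
  have e : ((v.1, v.2, dvel ε δ z w) : ℝ × Sp d × Sp d) =
      (v.1, v.2, 0) + (0, 0, dvel ε δ z w) := by simp
  rw [e, map_add, mul_add]
  have h1 : |dwt ε s z w * Φ (y.1, y.2, vel ε δ z)| ≤ quadConst d ε * (‖z‖ * ‖w‖) * M := by
    rw [abs_mul]
    exact mul_le_mul (abs_dwt_le ε s z w) (hM _) (abs_nonneg _) (by positivity)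
  have h2 : |wt ε s z * fderiv ℝ Φ (y.1, y.2, vel ε δ z) (v.1, v.2, 0)| ≤
      quadConst d ε * ‖z‖ ^ 2 * (M * ‖v‖) := by
    rw [abs_mul]
    refine mul_le_mul (abs_wt_le ε s z) ?_ (abs_nonneg _) (by positivity)
    refine ((fderiv ℝ Φ _).le_opNorm _).trans ?_
    have : ‖((v.1, v.2, 0) : ℝ × Sp d × Sp d)‖ = ‖v‖ := by
      simp [Prod.norm_def]
    rw [this]
    gcongr
    exact hM' _
  have h3 := hC δ hδ s y z w
  refine (abs_add_le _ _).trans ((add_le_add h1 ((abs_add_le _ _).trans (add_le_add h2 h3))).trans ?_)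
  have : 0 ≤ C * (‖z‖ ^ 2 * ‖v‖) := by positivity
  linarith

end Velocity

end Bohm

namespace Bohm

/-! ### Limits of space-time integrals along an `L²` curve -/

section SpaceTime

variable {d : ℕ} {E : Type*} [NormedAddCommGroup E] [NormedSpace ℝ E]

omit [NormedSpace ℝ E] in
theorem integrable_of_quadratic {K : (ℝ × Sp d) × E → ℝ} (hK : Continuous K) {C : ℝ}
    (hC : ∀ y z, |K (y, z)| ≤ C * ‖z‖ ^ 2) (z : Lp E 2 (volume : Measure (Sp d))) (t : ℝ) :
    Integrable fun x => K ((t, x), z x) := by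
  refine ((integrable_norm_sq z).const_mul C).mono' ?_ (ae_of_all _ fun x => hC _ _)
  refine hK.comp_aestronglyMeasurable (AEStronglyMeasurable.prodMk ?_ (Lp.aestronglyMeasurable z))
  exact (by fun_prop : Continuous fun x : Sp d => (t, x)).aestronglyMeasurable

theorem integrable_indicator_Icc {g : ℝ → ℝ} (hg : Continuous g) (T : ℝ) :
    Integrable ((Set.Icc (-T) T).indicator g) :=
  (integrable_indicator_iff measurableSet_Icc).2 (hg.continuousOn.integrableOn_compact isCompact_Icc)

-- Dominated convergence twice: in `x` with majorant `C ‖Z t x‖²`, then in `t` with majorant `|C| ‖Z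
-- t‖²` on `[-T, T]`. The approximants are continuous so that their slice integrals are continuous
-- in `t`; measurability of the limit follows, although `K₀` itself may be discontinuous.
omit [NormedSpace ℝ E] in
theorem spaceTime_limit_signed {K : ℕ → (ℝ × Sp d) × E → ℝ} {K₀ : (ℝ × Sp d) × E → ℝ}
    (hK : ∀ n, Continuous (K n)) {C : ℝ} (hC : ∀ n y z, |K n (y, z)| ≤ C * ‖z‖ ^ 2)
    (hlim : ∀ y z, Tendsto (fun n => K n (y, z)) atTop (𝓝 (K₀ (y, z)))) {T : ℝ}
    (hT : ∀ n (y : ℝ × Sp d) z, T < |y.1| → K n (y, z) = 0)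
    {Z : ℝ → Lp E 2 (volume : Measure (Sp d))} (hZ : Continuous Z) :
    (∀ t, Integrable fun x => K₀ ((t, x), Z t x)) ∧
      Integrable (fun t => ∫ x, K₀ ((t, x), Z t x)) ∧
      Tendsto (fun n => ∫ t, ∫ x, K n ((t, x), Z t x)) atTop
        (𝓝 (∫ t, ∫ x, K₀ ((t, x), Z t x))) := by
  have hi : ∀ n t, Integrable fun x => K n ((t, x), Z t x) :=
    fun n t => integrable_of_quadratic (hK n) (hC n) (Z t) t
  have hb : ∀ y z, |K₀ (y, z)| ≤ C * ‖z‖ ^ 2 := fun y z =>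
    le_of_tendsto (hlim y z).abs (Eventually.of_forall fun n => hC n y z)
  have hi0 : ∀ t, Integrable fun x => K₀ ((t, x), Z t x) := fun t =>
    ((integrable_norm_sq (Z t)).const_mul C).mono'
      (aestronglyMeasurable_of_tendsto_ae atTop (fun n => (hi n t).aestronglyMeasurable)
        (ae_of_all _ fun x => hlim _ _)) (ae_of_all _ fun x => hb _ _)
  have hpt : ∀ t, Tendsto (fun n => ∫ x, K n ((t, x), Z t x)) atTop
      (𝓝 (∫ x, K₀ ((t, x), Z t x))) := fun t =>
    tendsto_integral_of_dominated_convergence (fun x => C * ‖Z t x‖ ^ 2)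
      (fun n => (hi n t).aestronglyMeasurable) ((integrable_norm_sq (Z t)).const_mul C)
      (fun n => ae_of_all _ fun x => hC n _ _) (ae_of_all _ fun x => hlim _ _)
  have hcont : ∀ n, Continuous fun t => ∫ x, K n ((t, x), Z t x) := fun n =>
    continuous_integral_comp (hK n) (hC n) (ι := fun t x => (t, x))
      (fun t => (by fun_prop : Continuous fun x : Sp d => (t, x)).aestronglyMeasurable)
      (fun x => by fun_prop) hZ
  have hB : Integrable ((Set.Icc (-T) T).indicator fun t => |C| * ‖Z t‖ ^ 2) :=
    integrable_indicator_Icc (by fun_prop) T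
  have hbd : ∀ n t, ‖∫ x, K n ((t, x), Z t x)‖ ≤
      (Set.Icc (-T) T).indicator (fun t => |C| * ‖Z t‖ ^ 2) t := by
    intro n t
    by_cases ht : t ∈ Set.Icc (-T) T
    · rw [Set.indicator_of_mem ht, ← integral_norm_sq, ← integral_const_mul]
      refine norm_integral_le_of_norm_le ((integrable_norm_sq (Z t)).const_mul _)
        (ae_of_all _ fun x => (hC n _ _).trans ?_)
      gcongr
      exact le_abs_self C
    · have : T < |t| := by
        by_contra h
        push Not at h
        exact ht (abs_le.1 h)
      simp only [fun x => hT n (t, x) (Z t x) this, integral_zero, norm_zero]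
      rw [Set.indicator_of_notMem ht]
  have hlimt := tendsto_integral_of_dominated_convergence
    ((Set.Icc (-T) T).indicator fun t => |C| * ‖Z t‖ ^ 2)
    (fun n => (hcont n).aestronglyMeasurable) hB (fun n => ae_of_all _ fun t => hbd n t)
    (ae_of_all _ fun t => hpt t)
  refine ⟨hi0, hB.mono' (aestronglyMeasurable_of_tendsto_ae atTop
    (fun n => (hcont n).aestronglyMeasurable) (ae_of_all _ hpt)) (ae_of_all _ fun t => ?_), hlimt⟩
  exact le_of_tendsto (hpt t).norm (Eventually.of_forall fun n => hbd n t)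

omit [NormedSpace ℝ E] in
theorem spaceTime_limit_abs {K : ℕ → (ℝ × Sp d) × E → ℝ} {K₀ : (ℝ × Sp d) × E → ℝ}
    (hK : ∀ n, Continuous (K n)) {C : ℝ} (hC : ∀ n y z, |K n (y, z)| ≤ C * ‖z‖ ^ 2)
    (hlim : ∀ y z, Tendsto (fun n => K n (y, z)) atTop (𝓝 (K₀ (y, z)))) {T : ℝ}
    (hT : ∀ n (y : ℝ × Sp d) z, T < |y.1| → K n (y, z) = 0)
    {Z : ℝ → Lp E 2 (volume : Measure (Sp d))} (hZ : Continuous Z) :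
    Integrable fun t => ∫ x, |K₀ ((t, x), Z t x)| :=
  (spaceTime_limit_signed (K := fun n q => |K n q|) (K₀ := fun q => |K₀ q|)
    (fun n => (hK n).abs) (C := C) (fun n y z => by rw [abs_abs]; exact hC n y z)
    (fun y z => (hlim y z).abs) (T := T) (fun n y z h => by rw [hT n y z h, abs_zero]) hZ).2.1

end SpaceTime

/-! ### The Bohmian measure as an image measure -/

section PushForward

variable {d : ℕ}

/-- The family consisting of a function and its partial derivatives. -/
def stOf (ψ : L2 d) (b : Fin d → L2 d) : Option (Fin d) → L2 d
  | none => ψ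
  | some j => b j

variable {ψ : L2 d} {b : Fin d → L2 d} (hb : ∀ j, HasDirDeriv (basisVec j) ψ (b j)) (ε : ℝ)

include hb in
theorem velocity_eq :
    ∀ᵐ x, velocity ε ψ x = vel ε 0 fun r => stOf ψ b r x := by
  filter_upwards [ae_all_iff.2 fun j => (hb j).current_eq ε] with x hx
  ext j
  simp only [velocity, vel, mom, rho, stOf, PiLp.smul_apply, smul_eq_mul, add_zero]
  rw [hx j, density, div_eq_inv_mul]

theorem measurable_vel (ε δ : ℝ) : Measurable (vel (d := d) ε δ) :=
  ((contDiff_rho.continuous.add continuous_const).measurable.inv).smul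
    (contDiff_mom ε).continuous.measurable

theorem aemeasurable_stOf (ψ : L2 d) (b : Fin d → L2 d) :
    AEMeasurable (fun x r => stOf ψ b r x) :=
  aemeasurable_pi_iff.2 fun r => (Lp.aestronglyMeasurable (stOf ψ b r)).aemeasurable

include hb in
theorem aemeasurable_velocity : AEMeasurable (velocity ε ψ) :=
  ((measurable_vel ε 0).comp_aemeasurable (aemeasurable_stOf ψ b)).congr
    ((velocity_eq hb ε).mono fun _ h => h.symm)

theorem aemeasurable_density (ψ : L2 d) : AEMeasurable (density ψ) :=
  (Lp.aestronglyMeasurable ψ).norm.aemeasurable.pow_const 2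

include hb in
theorem aemeasurable_graph : AEMeasurable (fun x => (x, velocity ε ψ x))
    ((volume : Measure (Sp d)).withDensity fun x => ENNReal.ofReal (density ψ x)) :=
  (aemeasurable_id.prodMk (aemeasurable_velocity hb ε)).mono_ac (withDensity_absolutelyContinuous _ _)

-- The first marginal is `ρ dx`, which does not charge `{ρ = 0}`, so the values of the Bohm
-- potential at nodes are irrelevant.
include hb in
theorem ae_bohmianMeasure_fst {P : Sp d → Prop} (h : ∀ᵐ x, x ∈ posSet ψ → P x) :
    ∀ᵐ z ∂(bohmianMeasure ε ψ), P z.1 := by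
  have h1 : ∀ᵐ x ∂((volume : Measure (Sp d)).withDensity fun x => ENNReal.ofReal (density ψ x)),
      P x := by
    rw [ae_withDensity_iff' (aemeasurable_density ψ).ennreal_ofReal]
    filter_upwards [h] with x hx h0
    exact hx (ENNReal.ofReal_pos.1 (pos_iff_ne_zero.2 h0))
  have hq : Measure.QuasiMeasurePreserving Prod.fst (bohmianMeasure ε ψ)
      ((volume : Measure (Sp d)).withDensity fun x => ENNReal.ofReal (density ψ x)) := by
    refine ⟨measurable_fst, ?_⟩
    rw [bohmianMeasure, AEMeasurable.map_map_of_aemeasurable measurable_fst.aemeasurable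
      (aemeasurable_graph hb ε)]
    change Measure.map id _ ≪ _
    rw [Measure.map_id]
  exact hq.ae h1

include hb in
theorem integrable_bohmianMeasure_iff {f : Sp d × Sp d → ℝ}
    (hf : AEStronglyMeasurable f (bohmianMeasure ε ψ)) :
    Integrable f (bohmianMeasure ε ψ) ↔
      Integrable fun x => density ψ x * f (x, velocity ε ψ x) := by
  rw [bohmianMeasure] at hf ⊢
  rw [integrable_map_measure hf (aemeasurable_graph hb ε),
    integrable_withDensity_iff_integrable_smul₀' (aemeasurable_density ψ).ennreal_ofReal
      (ae_of_all _ fun _ => ENNReal.ofReal_lt_top)]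
  refine integrable_congr (ae_of_all _ fun x => ?_)
  simp only [Function.comp, smul_eq_mul]
  rw [ENNReal.toReal_ofReal (by unfold density; positivity)]

include hb in
theorem integral_bohmianMeasure {f : Sp d × Sp d → ℝ}
    (hf : AEStronglyMeasurable f (bohmianMeasure ε ψ)) :
    ∫ z, f z ∂(bohmianMeasure ε ψ) = ∫ x, density ψ x * f (x, velocity ε ψ x) := by
  rw [bohmianMeasure] at hf ⊢
  rw [integral_map (aemeasurable_graph hb ε) hf,
    integral_withDensity_eq_integral_toReal_smul₀ (aemeasurable_density ψ).ennreal_ofReal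
      (ae_of_all _ fun _ => ENNReal.ofReal_lt_top)]
  refine integral_congr_ae (ae_of_all _ fun x => ?_)
  simp only [smul_eq_mul]
  rw [ENNReal.toReal_ofReal (by unfold density; positivity)]

end PushForward

/-! ### The full jet of a regular solution -/

section FullJet

variable {d : ℕ}

/-- Index type for a wave function, its gradient, and all time and space derivatives of these. -/
abbrev FJ (d : ℕ) : Type := Option (Option (Fin d)) × Option (Fin d)

/-- The components of the full jet. -/
def fullJet (ψ ψ' : ℝ → L2 d) (b b' : Fin d → ℝ → L2 d) (c : Fin d → Fin d → ℝ → L2 d)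
    (t : ℝ) : FJ d → L2 d
  | (none, r) => stOf (ψ t) (fun j => b j t) r
  | (some none, r) => stOf (ψ' t) (fun j => b' j t) r
  | (some (some k), r) => stOf (b k t) (fun j => c k j t) r

/-- A component of a point of the full jet space. -/
def part (q : Option (Option (Fin d))) (ζ : FJ d → ℂ) : St d := fun r => ζ (q, r)

theorem continuous_part (q : Option (Option (Fin d))) : Continuous (part (d := d) q) :=
  continuous_pi fun _ => continuous_apply _

theorem norm_part_le (q : Option (Option (Fin d))) (ζ : FJ d → ℂ) : ‖part q ζ‖ ≤ ‖ζ‖ :=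
  (pi_norm_le_iff_of_nonneg (norm_nonneg _)).2 fun r => norm_le_pi_norm ζ (q, r)

variable {V : Sp d → ℝ} {ε : ℝ} {ψ ψ' : ℝ → L2 d} {b b' : Fin d → ℝ → L2 d}
  {c : Fin d → Fin d → ℝ → L2 d}

theorem RegSol.continuous_fullJet (h : RegSol V ε ψ ψ' b b' c) :
    Continuous fun t => tuple (fullJet ψ ψ' b b' c t) := by
  refine continuous_tuple (f := fun i t => fullJet ψ ψ' b b' c t i) fun i => ?_
  rcases i with ⟨_ | _ | k, _ | j⟩
  · exact continuous_iff_continuousAt.2 fun t => (h.hasDerivAt t).continuousAt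
  · exact continuous_iff_continuousAt.2 fun t => (h.hasDerivAt_b j t).continuousAt
  · exact h.continuous'
  · exact h.continuous_b' j
  · exact continuous_iff_continuousAt.2 fun t => (h.hasDerivAt_b k t).continuousAt
  · exact h.continuous_c k j

theorem part_fullJet (t : ℝ) :
    ∀ᵐ x, (part none (tuple (fullJet ψ ψ' b b' c t) x) =
        fun r => stOf (ψ t) (fun j => b j t) r x) ∧
      (part (some none) (tuple (fullJet ψ ψ' b b' c t) x) =
        fun r => stOf (ψ' t) (fun j => b' j t) r x) ∧
      ∀ k, part (some (some k)) (tuple (fullJet ψ ψ' b b' c t) x) =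
        fun r => stOf (b k t) (fun j => c k j t) r x := by
  filter_upwards [coeFn_tuple (fullJet ψ ψ' b b' c t)] with x hx
  exact ⟨funext fun r => hx _, funext fun r => hx _, fun k => funext fun r => hx _⟩

end FullJet

end Bohm

namespace Bohm

/-! ### Moments of the Bohmian measure -/

section Moments

variable {d : ℕ}

theorem norm_mom_sq_le (ε : ℝ) (z : St d) : ‖mom ε z‖ ^ 2 ≤ (d * |ε|) ^ 2 * (rho z * ‖z‖ ^ 2) := by
  have h : ‖mom ε z‖ ≤ d * (|ε| * (‖z none‖ * ‖z‖)) := by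
    refine norm_le_of_forall_abs_le fun j => (abs_mom_le ε z j).trans ?_
    gcongr
    exact norm_le_pi_norm z (some j)
  calc ‖mom ε z‖ ^ 2 ≤ (d * (|ε| * (‖z none‖ * ‖z‖))) ^ 2 := by gcongr
    _ = _ := by rw [rho]; ring

/-- `|J|²` is bounded by `ρ` times the squared jet, so the kinetic energy density `ρ|u_δ|²` stays
bounded even for `δ = 0`. -/
theorem rho_mul_norm_vel_sq_le {δ : ℝ} (hδ : 0 ≤ δ) (ε : ℝ) (z : St d) :
    rho z * ‖vel ε δ z‖ ^ 2 ≤ (d * |ε|) ^ 2 * ‖z‖ ^ 2 := by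
  have h0 := rho_nonneg z
  rcases h0.eq_or_lt with h | h
  · rw [← h, zero_mul]; positivity
  have hpos : 0 < rho z + δ := by positivity
  rw [vel, norm_smul, Real.norm_of_nonneg (by positivity), mul_pow, inv_pow]
  have h1 := norm_mom_sq_le ε z
  have h2 : rho z ^ 2 ≤ (rho z + δ) ^ 2 := by gcongr; linarith
  rw [← mul_assoc, ← div_eq_mul_inv, div_mul_eq_mul_div, div_le_iff₀ (by positivity)]
  calc rho z * ‖mom ε z‖ ^ 2 ≤ rho z * ((d * |ε|) ^ 2 * (rho z * ‖z‖ ^ 2)) := by gcongr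
    _ = ((d * |ε|) ^ 2 * ‖z‖ ^ 2) * rho z ^ 2 := by ring
    _ ≤ _ := by gcongr

theorem rho_le (z : St d) : rho z ≤ ‖z‖ ^ 2 := by
  unfold rho; gcongr; exact norm_le_pi_norm z none

theorem rho_eq_zero {z : St d} (h : rho z = 0) : z none = 0 := by
  simpa [rho] using h

theorem tendsto_vel {δ : ℕ → ℝ} (hδ : Tendsto δ atTop (𝓝 0)) (ε : ℝ) {z : St d} (hz : rho z ≠ 0) :
    Tendsto (fun n => vel ε (δ n) z) atTop (𝓝 (vel ε 0 z)) := by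
  have h : ContinuousAt (fun δ : ℝ => vel ε δ z) 0 := by
    have h1 : ContinuousAt (fun δ : ℝ => (rho z + δ)⁻¹) 0 :=
      ContinuousAt.inv₀ (by fun_prop) (by simpa using hz)
    exact h1.smul continuousAt_const
  exact h.tendsto.comp hδ

theorem tendsto_dvel {δ : ℕ → ℝ} (hδ : Tendsto δ atTop (𝓝 0)) (ε : ℝ) {z : St d}
    (hz : rho z ≠ 0) (w : St d) :
    Tendsto (fun n => dvel ε (δ n) z w) atTop (𝓝 (dvel ε 0 z w)) := by
  have h : ContinuousAt (fun δ : ℝ => (rho z + δ)⁻¹) 0 :=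
    ContinuousAt.inv₀ (by fun_prop) (by simpa using hz)
  exact (h.tendsto.comp hδ).smul (tendsto_const_nhds.sub (tendsto_const_nhds.smul
    (tendsto_vel hδ ε hz)))

variable {V : Sp d → ℝ} {ε : ℝ} {ψ ψ' : ℝ → L2 d} {b b' : Fin d → ℝ → L2 d}
  {c : Fin d → Fin d → ℝ → L2 d}

theorem RegSol.density_velocity (h : RegSol V ε ψ ψ' b b' c) (t : ℝ) :
    ∀ᵐ x, density (ψ t) x = rho (part none (tuple (fullJet ψ ψ' b b' c t) x)) ∧
      velocity ε (ψ t) x = vel ε 0 (part none (tuple (fullJet ψ ψ' b b' c t) x)) := by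
  filter_upwards [velocity_eq (b := fun j => b j t) (fun j => h.dir j t) ε,
    part_fullJet (ψ := ψ) (ψ' := ψ') (b := b) (b' := b') (c := c) t] with x h1 h2
  rw [h1, h2.1]
  exact ⟨rfl, rfl⟩

/-- The unregularised velocity is discontinuous at nodes, so the integrand is obtained as a limit of
continuous ones with `u_δ`; at a node the factor `ρ` makes them all vanish. Quadratic growth in `p`
is affordable because `ρ|u|²` is controlled by the jet. -/
theorem RegSol.moment (h : RegSol V ε ψ ψ' b b' c) {Θ : ℝ × Sp d × Sp d → ℝ}
    (hΘ : Continuous Θ) {C T : ℝ} (hC : ∀ t x p, |Θ (t, x, p)| ≤ C * (1 + ‖p‖ ^ 2))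
    (hT : ∀ t x p, T < |t| → Θ (t, x, p) = 0) :
    (∀ t, Integrable (fun z => Θ (t, z)) (bohmianMeasure ε (ψ t))) ∧
      (Integrable fun t => ∫ z, Θ (t, z) ∂(bohmianMeasure ε (ψ t))) ∧
      ∀ t, ∫ z, Θ (t, z) ∂(bohmianMeasure ε (ψ t)) =
        ∫ x, rho (part none (tuple (fullJet ψ ψ' b b' c t) x)) *
          Θ (t, x, vel ε 0 (part none (tuple (fullJet ψ ψ' b b' c t) x))) := by
  set δ : ℕ → ℝ := fun n => 1 / ((n : ℝ) + 1) with hδdef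
  have hδ : ∀ n, 0 < δ n := fun n => by positivity
  have hδ0 : Tendsto δ atTop (𝓝 0) := tendsto_one_div_add_atTop_nhds_zero_nat
  have hC0 : 0 ≤ C := by
    have := (abs_nonneg _).trans (hC 0 0 0)
    simpa using this
  obtain ⟨k1, k2, -⟩ := spaceTime_limit_signed
    (K := fun n q => rho (part none q.2) * Θ (q.1.1, q.1.2, vel ε (δ n) (part none q.2)))
    (K₀ := fun q => rho (part none q.2) * Θ (q.1.1, q.1.2, vel ε 0 (part none q.2)))
    (C := C * (1 + (d * |ε|) ^ 2)) (T := T)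
    (fun n => by
      have h1 : Continuous fun q : (ℝ × Sp d) × (FJ d → ℂ) => part none q.2 :=
        (continuous_part none).comp continuous_snd
      have h2 := (contDiff_vel (d := d) (hδ n) ε).continuous.comp h1
      exact (contDiff_rho.continuous.comp h1).mul (hΘ.comp (by fun_prop)))
    (fun n y z => by
      have h0 := rho_nonneg (part none z)
      have h1 := rho_mul_norm_vel_sq_le (hδ n).le ε (part none z)
      have h2 := rho_le (part none z)
      have h3 : ‖part none z‖ ^ 2 ≤ ‖z‖ ^ 2 := by gcongr; exact norm_part_le none z
      rw [abs_mul, abs_of_nonneg h0]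
      calc _ ≤ rho (part none z) * (C * (1 + ‖vel ε (δ n) (part none z)‖ ^ 2)) := by
            gcongr; exact hC _ _ _
        _ = C * (rho (part none z) + rho (part none z) * ‖vel ε (δ n) (part none z)‖ ^ 2) := by
            ring
        _ ≤ C * (‖z‖ ^ 2 + (d * |ε|) ^ 2 * ‖z‖ ^ 2) := by
            refine mul_le_mul_of_nonneg_left (add_le_add (h2.trans h3) (h1.trans ?_)) hC0
            exact mul_le_mul_of_nonneg_left h3 (by positivity)
        _ = _ := by ring)
    (fun y z => by
      by_cases hz : rho (part none z) = 0
      · simp [hz]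
      · exact ((hΘ.tendsto _).comp (tendsto_const_nhds.prodMk_nhds
          (tendsto_const_nhds.prodMk_nhds (tendsto_vel hδ0 ε hz)))).const_mul _)
    (fun n y z hy => by simp [hT _ _ _ hy]) h.continuous_fullJet
  have hdv := h.density_velocity
  have hm : ∀ t, AEStronglyMeasurable (fun z => Θ (t, z)) (bohmianMeasure ε (ψ t)) := fun t =>
    (hΘ.comp (by fun_prop : Continuous fun z : Sp d × Sp d => (t, z))).aestronglyMeasurable
  have hd : ∀ j t, HasDirDeriv (basisVec j) (ψ t) (b j t) := h.dir
  have e1 : ∀ t, (fun x => density (ψ t) x * Θ (t, x, velocity ε (ψ t) x)) =ᵐ[volume]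
      fun x => rho (part none (tuple (fullJet ψ ψ' b b' c t) x)) *
          Θ (t, x, vel ε 0 (part none (tuple (fullJet ψ ψ' b b' c t) x))) := by
    intro t
    filter_upwards [hdv t] with x hx
    rw [hx.1, hx.2]
  have e2 : ∀ t, ∫ z, Θ (t, z) ∂(bohmianMeasure ε (ψ t)) =
        ∫ x, rho (part none (tuple (fullJet ψ ψ' b b' c t) x)) *
          Θ (t, x, vel ε 0 (part none (tuple (fullJet ψ ψ' b b' c t) x))) := fun t => by
    rw [integral_bohmianMeasure (fun j => hd j t) ε (hm t)]
    exact integral_congr_ae (e1 t)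
  refine ⟨fun t => ?_, ?_, e2⟩
  · rw [integrable_bohmianMeasure_iff (fun j => hd j t) ε (hm t)]
    exact (k1 t).congr (e1 t).symm
  · simp only [e2]
    exact k2

end Moments

/-! ### The equation of motion on the set where the density is positive -/

section Pointwise

variable {d : ℕ}

theorem conj_mul_eq {a : ℂ} (ha : a ≠ 0) (w : ℂ) :
    (starRingEnd ℂ) a * w = ((‖a‖ ^ 2 : ℝ) : ℂ) * (w / a) := by
  have h : (starRingEnd ℂ) a * a = ((‖a‖ ^ 2 : ℝ) : ℂ) := by
    rw [mul_comm, Complex.mul_conj, Complex.normSq_eq_norm_sq]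
  rw [← h]
  field_simp

theorem mom_apply_eq {z : St d} (hz : z none ≠ 0) (ε : ℝ) (k : Fin d) :
    mom ε z k = rho z * (ε * (z (some k) / z none).im) := by
  simp only [mom]
  rw [conj_mul_eq hz, Complex.im_ofReal_mul, rho]
  ring

theorem vel_apply_eq {z : St d} (hz : z none ≠ 0) (ε : ℝ) (k : Fin d) :
    vel ε 0 z k = ε * (z (some k) / z none).im := by
  have h : rho z ≠ 0 := fun h => hz (rho_eq_zero h)
  rw [vel, PiLp.smul_apply, mom_apply_eq hz, add_zero, smul_eq_mul, inv_mul_cancel_left₀ h]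

/-- Away from nodes `u_k = ε Im (∂_kψ/ψ)`, and its derivative follows from the quotient rule. This
puts the acceleration in the same variables as `∇V_B`. -/
theorem dvel_apply_eq {z : St d} (hz : z none ≠ 0) (ε : ℝ) (w : St d) (k : Fin d) :
    dvel ε 0 z w k =
      ε * (w (some k) / z none - z (some k) / z none * (w none / z none)).im := by
  have h : rho z ≠ 0 := fun h => hz (rho_eq_zero h)
  have h1 : drho z w = rho z * (2 * (w none / z none).re) := by
    rw [drho, conj_mul_eq hz, Complex.re_ofReal_mul, rho]; ring
  have h2 : dmom ε z w k = rho z * (ε * ((w (some k) / z none).im +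
      ((starRingEnd ℂ) (w none / z none) * (z (some k) / z none)).im)) := by
    have e : (starRingEnd ℂ) (w none) * z (some k) = ((‖z none‖ ^ 2 : ℝ) : ℂ) *
        ((starRingEnd ℂ) (w none / z none) * (z (some k) / z none)) := by
      have hc : (starRingEnd ℂ) (z none) ≠ 0 := by simpa using hz
      rw [← Complex.normSq_eq_norm_sq, ← Complex.mul_conj, map_div₀]
      field_simp
    simp only [dmom]
    rw [e, conj_mul_eq hz, Complex.add_im, Complex.im_ofReal_mul, Complex.im_ofReal_mul, rho]
    ring
  rw [dvel, PiLp.smul_apply, PiLp.sub_apply, PiLp.smul_apply, h2, h1, vel_apply_eq hz, add_zero,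
    smul_eq_mul, smul_eq_mul, mul_assoc (rho z), ← mul_sub, inv_mul_cancel_left₀ h]
  simp only [Complex.sub_im, Complex.mul_im, Complex.conj_re, Complex.conj_im]
  ring

/-- The equation `ρ (∂_t u + u · ∇u) + ρ ∇V = - ρ ∇V_B`. -/
theorem sum_wt_mul_dvel {z : St d} (hz : z none ≠ 0) {ε v vj : ℝ} {l m : ℂ}
    {w : Option (Fin d) → St d} {j : Fin d}
    (hw0 : Complex.I * ε * w none none = -((ε : ℂ) ^ 2 / 2) * l + v * z none)
    (hwj : Complex.I * ε * w none (some j) =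
      -((ε : ℂ) ^ 2 / 2) * m + v * z (some j) + vj * z none)
    (hwk : ∀ k, w (some k) none = z (some k)) {g : ℝ}
    (hg : g = -(ε ^ 2 / 2) * ((m / z none - l / z none * (z (some j) / z none)).re +
      ∑ k, 2 * (z (some k) / z none).im *
        (w (some k) (some j) / z none - z (some k) / z none * (z (some j) / z none)).im)) :
    ∑ s, wt ε s z * dvel ε 0 z (w s) j + rho z * vj = -(rho z * g) := by
  rw [Fintype.sum_option]
  simp only [wt, dvel_apply_eq hz, mom_apply_eq hz, hwk]
  -- `e0` and `e1` are the equations for `ψ` and `∂_jψ` divided by `ψ`.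
  have e0 : (ε : ℂ) * (w none none / z none) =
      Complex.I * (((ε ^ 2 / 2 : ℝ) : ℂ) * (l / z none) - v) := by
    have : (ε : ℂ) * w none none = -Complex.I * (-((ε : ℂ) ^ 2 / 2) * l + v * z none) := by
      rw [← hw0]
      linear_combination ((ε : ℂ) * w none none) * Complex.I_mul_I
    rw [mul_div_assoc', this]
    push_cast
    field_simp
    ring
  have e1 : (ε : ℂ) * (w none (some j) / z none) =
      Complex.I * (((ε ^ 2 / 2 : ℝ) : ℂ) * (m / z none) - v * (z (some j) / z none) - vj) := by
    have : (ε : ℂ) * w none (some j) =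
        -Complex.I * (-((ε : ℂ) ^ 2 / 2) * m + v * z (some j) + vj * z none) := by
      rw [← hwj]
      linear_combination ((ε : ℂ) * w none (some j)) * Complex.I_mul_I
    rw [mul_div_assoc', this]
    push_cast
    field_simp
    ring
  -- The factor `i` exchanges imaginary and real parts. The potential cancels and only its
  -- derivative `vj` remains.
  have e2 : ε * (w none (some j) / z none - z (some j) / z none * (w none none / z none)).im =
      ε ^ 2 / 2 * (m / z none - l / z none * (z (some j) / z none)).re - vj := by
    rw [← Complex.im_ofReal_mul, mul_sub, e1,
      show (ε : ℂ) * (z (some j) / z none * (w none none / z none)) =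
        z (some j) / z none * ((ε : ℂ) * (w none none / z none)) by ring, e0,
      show Complex.I * (((ε ^ 2 / 2 : ℝ) : ℂ) * (m / z none) - v * (z (some j) / z none) - vj) -
        z (some j) / z none * (Complex.I * (((ε ^ 2 / 2 : ℝ) : ℂ) * (l / z none) - v)) =
        Complex.I * (((ε ^ 2 / 2 : ℝ) : ℂ) * (m / z none - l / z none * (z (some j) / z none)) -
          vj) by ring, Complex.I_mul_im, Complex.sub_re, Complex.re_ofReal_mul, Complex.ofReal_re]
  rw [e2, hg, mul_add (-(ε ^ 2 / 2)), Finset.mul_sum, mul_sub, add_right_comm, sub_add_cancel,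
    mul_add, neg_add, Finset.mul_sum, ← Finset.sum_neg_distrib]
  congr 1
  · ring
  · refine Finset.sum_congr rfl fun k _ => ?_
    rw [show z (some j) / z none * (z (some k) / z none) =
      z (some k) / z none * (z (some j) / z none) from mul_comm _ _]
    ring

end Pointwise

end Bohm

namespace Bohm

/-! ### The Bohm equation in weak form -/

section Force

variable {d : ℕ}

/-- The gradient of the potential. -/
noncomputable def gradPot (V : Sp d → ℝ) (x : Sp d) : Sp d :=
  WithLp.toLp 2 fun j => fderiv ℝ V x (basisVec j)

/-- The acceleration part of the transport of a test function along the regularised velocity. -/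
noncomputable def forceN (ε δ : ℝ) (Φ : ℝ × Sp d × Sp d → ℝ) (q : (ℝ × Sp d) × (FJ d → ℂ)) : ℝ :=
  ∑ s, wt ε s (part none q.2) * fderiv ℝ Φ (q.1.1, q.1.2, vel ε δ (part none q.2))
    (0, 0, dvel ε δ (part none q.2) (part (some s) q.2))

/-- The part of the transport of a test function that comes from its space-time dependence. -/
noncomputable def forceP (ε δ : ℝ) (Φ : ℝ × Sp d × Sp d → ℝ) (q : (ℝ × Sp d) × (FJ d → ℂ)) : ℝ :=
  fderiv ℝ Φ (q.1.1, q.1.2, vel ε δ (part none q.2)) (rho (part none q.2), mom ε (part none q.2), 0)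

/-- The contribution of the external force. -/
noncomputable def forceV (V : Sp d → ℝ) (ε δ : ℝ) (Φ : ℝ × Sp d × Sp d → ℝ)
    (q : (ℝ × Sp d) × (FJ d → ℂ)) : ℝ :=
  rho (part none q.2) * fderiv ℝ Φ (q.1.1, q.1.2, vel ε δ (part none q.2)) (0, 0, gradPot V q.1.2)

/-- The unit vectors of space-time. -/
noncomputable def stVec : Option (Fin d) → ℝ × Sp d
  | none => (1, 0)
  | some k => (0, basisVec k)

theorem sp_eq_sum (x : Sp d) : x = ∑ j, x j • (basisVec j : Sp d) := by
  ext i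
  simp [Finset.sum_apply, Pi.single_apply]

theorem fderiv_momentum_eq_sum (L : ℝ × Sp d × Sp d →L[ℝ] ℝ) (p : Sp d) :
    L (0, 0, p) = ∑ i, p i * L (0, 0, basisVec i) := by
  have h : ((0, 0, p) : ℝ × Sp d × Sp d) = ∑ i, p i • ((0, 0, basisVec i) : ℝ × Sp d × Sp d) := by
    have hs := sp_eq_sum p
    refine Prod.ext ?_ (Prod.ext ?_ ?_)
    · simp [Prod.fst_sum]
    · simp [Prod.fst_sum, Prod.snd_sum]
    · simpa [Prod.snd_sum] using hs
  rw [h, map_sum]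
  simp only [map_smul, smul_eq_mul]

theorem sum_wt_smul_stVec (L : ℝ × Sp d × Sp d →L[ℝ] ℝ) (ε : ℝ) (z : St d) :
    ∑ s, wt ε s z * L ((stVec s).1, (stVec s).2, 0) = L (rho z, mom ε z, 0) := by
  have h : ((rho z, mom ε z, 0) : ℝ × Sp d × Sp d) =
      ∑ s, wt ε s z • (((stVec s).1, (stVec s).2, 0) : ℝ × Sp d × Sp d) := by
    rw [Fintype.sum_option]
    have hs := sp_eq_sum (mom ε z)
    refine Prod.ext ?_ (Prod.ext ?_ ?_)
    · simp [Prod.fst_sum, stVec, wt]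
    · simpa [Prod.fst_sum, Prod.snd_sum, stVec, wt] using hs
    · simp [Prod.snd_sum, stVec, wt]
  rw [h, map_sum]
  simp only [map_smul, smul_eq_mul]

theorem wt_eq_zero {z : St d} (hz : rho z = 0) (ε : ℝ) (s : Option (Fin d)) : wt ε s z = 0 := by
  rcases s with _ | k
  · exact hz
  · simp [wt, mom, rho_eq_zero hz]

theorem mom_eq_zero {z : St d} (hz : rho z = 0) (ε : ℝ) : mom ε z = 0 := by
  ext k
  exact wt_eq_zero hz ε (some k)

variable {Φ : ℝ × Sp d × Sp d → ℝ} (hΦ : ContDiff ℝ (⊤ : ℕ∞) Φ) (ε : ℝ)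

include hΦ in
theorem continuous_fderiv_vel {δ : ℝ} (hδ : 0 < δ) :
    Continuous fun q : (ℝ × Sp d) × (FJ d → ℂ) =>
      fderiv ℝ Φ (q.1.1, q.1.2, vel ε δ (part none q.2)) := by
  have h1 : Continuous fun q : (ℝ × Sp d) × (FJ d → ℂ) => part none q.2 :=
    (continuous_part none).comp continuous_snd
  have h2 := (contDiff_vel (d := d) hδ ε).continuous.comp h1
  exact (hΦ.continuous_fderiv (by simp)).comp (by fun_prop)

include hΦ in
theorem continuous_forceN {δ : ℝ} (hδ : 0 < δ) : Continuous (forceN ε δ Φ) := by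
  have h1 : ∀ r, Continuous fun q : (ℝ × Sp d) × (FJ d → ℂ) => part r q.2 := fun r =>
    (continuous_part r).comp continuous_snd
  refine continuous_finsetSum _ fun s _ => ((contDiff_wt ε s).continuous.comp (h1 none)).mul
    ((continuous_fderiv_vel hΦ ε hδ).clm_apply ?_)
  have h2 := (continuous_dvel (d := d) hδ ε).comp ((h1 none).prodMk (h1 (some s)))
  fun_prop

include hΦ in
theorem continuous_forceP {δ : ℝ} (hδ : 0 < δ) : Continuous (forceP ε δ Φ) := by
  have h1 : ∀ r, Continuous fun q : (ℝ × Sp d) × (FJ d → ℂ) => part r q.2 := fun r =>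
    (continuous_part r).comp continuous_snd
  have h2 := contDiff_rho.continuous.comp (h1 none)
  have h3 := (contDiff_mom ε).continuous.comp (h1 none)
  exact (continuous_fderiv_vel hΦ ε hδ).clm_apply (by fun_prop)

theorem continuous_gradPot {V : Sp d → ℝ} (hV : IsC1Bounded V) : Continuous (gradPot V) := by
  have : ∀ j : Fin d, Continuous fun x => fderiv ℝ V x (basisVec j) :=
    fun j => hV.continuous_fderiv_apply _
  unfold gradPot
  fun_prop

include hΦ in
theorem continuous_forceV {V : Sp d → ℝ} (hV : IsC1Bounded V) {δ : ℝ} (hδ : 0 < δ) :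
    Continuous (forceV V ε δ Φ) := by
  have h1 : Continuous fun q : (ℝ × Sp d) × (FJ d → ℂ) => part none q.2 :=
    (continuous_part none).comp continuous_snd
  have h2 := (continuous_gradPot hV).comp
    (by fun_prop : Continuous fun q : (ℝ × Sp d) × (FJ d → ℂ) => q.1.2)
  exact (contDiff_rho.continuous.comp h1).mul
    ((continuous_fderiv_vel hΦ ε hδ).clm_apply (by fun_prop))

theorem norm_gradPot_le {V : Sp d → ℝ} {M : ℝ} (hM : ∀ x, ‖fderiv ℝ V x‖ ≤ M) (x : Sp d) :
    ‖gradPot V x‖ ≤ d * M := by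
  refine norm_le_of_forall_abs_le fun j => ?_
  calc |fderiv ℝ V x (basisVec j)| ≤ ‖fderiv ℝ V x‖ * ‖(basisVec j : Sp d)‖ :=
        (fderiv ℝ V x).le_opNorm _
    _ ≤ M := by rw [norm_basisVec, mul_one]; exact hM x

/-- Uniform in `δ > 0`, hence a majorant for the limit `δ → 0` of the acceleration term. -/
theorem exists_bound_forceN (hΦ : ContDiff ℝ (⊤ : ℕ∞) Φ) (hc : HasCompactSupport Φ) :
    ∃ C : ℝ, ∀ δ, 0 < δ → ∀ y (ζ : FJ d → ℂ), |forceN ε δ Φ (y, ζ)| ≤ C * ‖ζ‖ ^ 2 := by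
  obtain ⟨C, hC0, hC⟩ := exists_bound_fderiv_dvel ε hΦ hc
  refine ⟨(d + 1) * C, fun δ hδ y ζ => ?_⟩
  have h : ∀ s : Option (Fin d), |wt ε s (part none ζ) *
      fderiv ℝ Φ (y.1, y.2, vel ε δ (part none ζ))
        (0, 0, dvel ε δ (part none ζ) (part (some s) ζ))| ≤ C * ‖ζ‖ ^ 2 := by
    intro s
    refine (hC δ hδ s y (part none ζ) (part (some s) ζ)).trans ?_
    rw [pow_two]
    gcongr
    exacts [norm_part_le _ ζ, norm_part_le _ ζ]
  refine (Finset.abs_sum_le_sum_abs _ _).trans ((Finset.sum_le_sum fun s _ => h s).trans ?_)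
  simp
  linarith

theorem exists_bound_forceP (hΦ : ContDiff ℝ (⊤ : ℕ∞) Φ) (hc : HasCompactSupport Φ) :
    ∃ C : ℝ, ∀ δ y (ζ : FJ d → ℂ), |forceP ε δ Φ (y, ζ)| ≤ C * ‖ζ‖ ^ 2 := by
  obtain ⟨M, R, hM0, hR0, hM, hM', hR⟩ := exists_bounds_test hΦ hc
  have hK := quadConst_nonneg d ε
  refine ⟨M * (quadConst d ε + d * quadConst d ε), fun δ y ζ => ?_⟩
  have h3 : ‖part none ζ‖ ^ 2 ≤ ‖ζ‖ ^ 2 := by gcongr; exact norm_part_le none ζ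
  have h1 : |rho (part none ζ)| ≤ quadConst d ε * ‖ζ‖ ^ 2 :=
    (abs_wt_le ε none (part none ζ)).trans (mul_le_mul_of_nonneg_left h3 hK)
  have h2 : ‖mom ε (part none ζ)‖ ≤ d * (quadConst d ε * ‖ζ‖ ^ 2) :=
    norm_le_of_forall_abs_le fun k =>
      (abs_wt_le ε (some k) (part none ζ)).trans (mul_le_mul_of_nonneg_left h3 hK)
  refine ((fderiv ℝ Φ _).le_opNorm _).trans ?_
  have h4 : ‖((rho (part none ζ), mom ε (part none ζ), 0) : ℝ × Sp d × Sp d)‖ ≤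
      (quadConst d ε + d * quadConst d ε) * ‖ζ‖ ^ 2 := by
    have e0 : 0 ≤ quadConst d ε * ‖ζ‖ ^ 2 := by positivity
    have e1 : 0 ≤ d * (quadConst d ε * ‖ζ‖ ^ 2) := by positivity
    rw [Prod.norm_def, Prod.norm_def]
    refine max_le ?_ (max_le ?_ ?_)
    · rw [Real.norm_eq_abs]; linarith
    · simp only; linarith
    · simp only [norm_zero]; linarith
  rw [mul_assoc]
  exact mul_le_mul (hM' _) h4 (norm_nonneg _) hM0

theorem exists_bound_forceV {V : Sp d → ℝ} (hV : IsC1Bounded V) (hΦ : ContDiff ℝ (⊤ : ℕ∞) Φ)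
    (hc : HasCompactSupport Φ) :
    ∃ C : ℝ, ∀ δ y (ζ : FJ d → ℂ), |forceV V ε δ Φ (y, ζ)| ≤ C * ‖ζ‖ ^ 2 := by
  obtain ⟨M, R, hM0, hR0, hM, hM', hR⟩ := exists_bounds_test hΦ hc
  obtain ⟨M₁, hM₁0, -, hM₁, -⟩ := hV.exists_bounds
  have hK := quadConst_nonneg d ε
  refine ⟨M * (d * M₁), fun δ y ζ => ?_⟩
  have h3 : rho (part none ζ) ≤ ‖ζ‖ ^ 2 :=
    (rho_le _).trans (by gcongr; exact norm_part_le none ζ)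
  have h4 : |fderiv ℝ Φ (y.1, y.2, vel ε δ (part none ζ)) (0, 0, gradPot V y.2)| ≤
      M * (d * M₁) := by
    refine ((fderiv ℝ Φ _).le_opNorm _).trans (mul_le_mul (hM' _) ?_ (norm_nonneg _) hM0)
    have : ‖((0, 0, gradPot V y.2) : ℝ × Sp d × Sp d)‖ = ‖gradPot V y.2‖ := by
      simp [Prod.norm_def]
    rw [this]
    exact norm_gradPot_le hM₁ _
  unfold forceV
  rw [abs_mul, abs_of_nonneg (rho_nonneg _), mul_comm]
  exact mul_le_mul h4 h3 (rho_nonneg _) (by positivity)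

include hΦ in
theorem tendsto_fderiv_vel {δ : ℕ → ℝ} (hδ : Tendsto δ atTop (𝓝 0)) (y : ℝ × Sp d) {z : St d}
    (hz : rho z ≠ 0) :
    Tendsto (fun n => fderiv ℝ Φ (y.1, y.2, vel ε (δ n) z)) atTop
      (𝓝 (fderiv ℝ Φ (y.1, y.2, vel ε 0 z))) :=
  ((hΦ.continuous_fderiv (by simp)).tendsto _).comp (tendsto_const_nhds.prodMk_nhds
    (tendsto_const_nhds.prodMk_nhds (tendsto_vel hδ ε hz)))

theorem tendsto_clm_apply {α E : Type*} [NormedAddCommGroup E] [NormedSpace ℝ E] {l : Filter α}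
    {L : α → E →L[ℝ] ℝ} {L₀ : E →L[ℝ] ℝ} {v : α → E} {v₀ : E} (hL : Tendsto L l (𝓝 L₀))
    (hv : Tendsto v l (𝓝 v₀)) : Tendsto (fun a => L a (v a)) l (𝓝 (L₀ v₀)) :=
  (isBoundedBilinearMap_apply.continuous.tendsto (L₀, v₀)).comp (hL.prodMk_nhds hv)

-- At a node all weights vanish for every `δ`, so the discontinuity of the limiting velocity does no
-- harm; elsewhere `u_δ` and its derivative converge.
include hΦ in
theorem tendsto_forceN {δ : ℕ → ℝ} (hδ : Tendsto δ atTop (𝓝 0)) (y : ℝ × Sp d) (ζ : FJ d → ℂ) :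
    Tendsto (fun n => forceN ε (δ n) Φ (y, ζ)) atTop (𝓝 (forceN ε 0 Φ (y, ζ))) := by
  refine tendsto_finsetSum _ fun s _ => ?_
  by_cases hz : rho (part none ζ) = 0
  · simp [wt_eq_zero hz]
  · refine Tendsto.const_mul _ (tendsto_clm_apply (tendsto_fderiv_vel hΦ ε hδ y hz) ?_)
    exact tendsto_const_nhds.prodMk_nhds
      (tendsto_const_nhds.prodMk_nhds (tendsto_dvel hδ ε hz _))

include hΦ in
theorem tendsto_forceP {δ : ℕ → ℝ} (hδ : Tendsto δ atTop (𝓝 0)) (y : ℝ × Sp d) (ζ : FJ d → ℂ) :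
    Tendsto (fun n => forceP ε (δ n) Φ (y, ζ)) atTop (𝓝 (forceP ε 0 Φ (y, ζ))) := by
  unfold forceP
  by_cases hz : rho (part none ζ) = 0
  · have : ∀ L : ℝ × Sp d × Sp d →L[ℝ] ℝ, L (0, 0, 0) = 0 := fun L => L.map_zero
    simp [hz, mom_eq_zero hz, this]
  · exact tendsto_clm_apply (tendsto_fderiv_vel hΦ ε hδ y hz) tendsto_const_nhds

include hΦ in
theorem tendsto_forceV (V : Sp d → ℝ) {δ : ℕ → ℝ} (hδ : Tendsto δ atTop (𝓝 0)) (y : ℝ × Sp d)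
    (ζ : FJ d → ℂ) :
    Tendsto (fun n => forceV V ε (δ n) Φ (y, ζ)) atTop (𝓝 (forceV V ε 0 Φ (y, ζ))) := by
  unfold forceV
  by_cases hz : rho (part none ζ) = 0
  · simp [hz]
  · exact (tendsto_clm_apply (tendsto_fderiv_vel hΦ ε hδ y hz) tendsto_const_nhds).const_mul _

theorem norm_fst_le' (y : ℝ × Sp d) (p : Sp d) : |y.1| ≤ ‖((y.1, y.2, p) : ℝ × Sp d × Sp d)‖ :=
  norm_fst_le (y.1, y.2, p)

variable {V : Sp d → ℝ} {ψ ψ' : ℝ → L2 d} {b b' : Fin d → ℝ → L2 d}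
  {c : Fin d → Fin d → ℝ → L2 d}

variable {ε}

/-- The continuity equation as a pointwise identity: multiply the Schrödinger equation by `conj ψ`
and take imaginary parts. The terms with `V` and `|∂_kψ|²` are real and drop out. -/
theorem conservation_identity (hε : ε ≠ 0) {z : St d} {w : Option (Fin d) → St d} {v : ℝ}
    (hw0 : Complex.I * ε * w none none =
      -((ε : ℂ) ^ 2 / 2) * (∑ k, w (some k) (some k)) + v * z none)
    (hwk : ∀ k, w (some k) none = z (some k)) : ∑ s, dwt ε s z (w s) = 0 := by
  rw [Fintype.sum_option]
  simp only [dwt, drho, dmom, hwk]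
  have h1 : ∀ k, ε * ((starRingEnd ℂ) (z (some k)) * z (some k) +
      (starRingEnd ℂ) (z none) * w (some k) (some k)).im =
      ε * ((starRingEnd ℂ) (z none) * w (some k) (some k)).im := by
    intro k
    rw [Complex.add_im, mul_comm ((starRingEnd ℂ) (z (some k))), Complex.mul_conj,
      Complex.ofReal_im, zero_add]
  rw [Finset.sum_congr rfl fun k _ => h1 k, ← Finset.mul_sum, ← Complex.im_sum, ← Finset.mul_sum]
  have h2 := congrArg (fun u => ((starRingEnd ℂ) (z none) * u).im) hw0
  have e1 : (starRingEnd ℂ) (z none) * (Complex.I * ε * w none none) =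
      Complex.I * ((ε : ℂ) * ((starRingEnd ℂ) (z none) * w none none)) := by ring
  have e2 : (starRingEnd ℂ) (z none) *
      (-((ε : ℂ) ^ 2 / 2) * (∑ k, w (some k) (some k)) + v * z none) =
      ((-(ε ^ 2 / 2) : ℝ) : ℂ) * ((starRingEnd ℂ) (z none) * ∑ k, w (some k) (some k)) +
        ((v * Complex.normSq (z none) : ℝ) : ℂ) := by
    push_cast
    rw [← Complex.mul_conj]
    ring
  rw [e1, e2, Complex.I_mul_im, Complex.re_ofReal_mul, Complex.add_im, Complex.im_ofReal_mul,
    Complex.ofReal_im, add_zero] at h2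
  have h3 : ε * (2 * ((starRingEnd ℂ) (z none) * w none none).re +
      ε * ((starRingEnd ℂ) (z none) * ∑ k, w (some k) (some k)).im) = 0 := by
    linear_combination 2 * h2
  exact (mul_eq_zero.1 h3).resolve_left hε

-- By the continuity equation, no derivative falls on the weights `ρ` and `J`; what remains is the
-- derivative of `Φ` through `u_δ` and through its explicit dependence on `(t, x)`.
include hΦ in
theorem sum_fderiv_wtTest {δ : ℝ} (hδ : 0 < δ) (y : ℝ × Sp d) (ζ : FJ d → ℂ)
    (h0 : ∑ s, dwt ε s (part none ζ) (part (some s) ζ) = 0) :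
    ∑ s, fderiv ℝ (wtTest ε δ Φ s) (y, part none ζ) (stVec s, part (some s) ζ) =
      forceN ε δ Φ (y, ζ) + forceP ε δ Φ (y, ζ) := by
  have h : ∀ s : Option (Fin d),
      fderiv ℝ (wtTest ε δ Φ s) (y, part none ζ) (stVec s, part (some s) ζ) =
      dwt ε s (part none ζ) (part (some s) ζ) * Φ (y.1, y.2, vel ε δ (part none ζ)) +
      (wt ε s (part none ζ) * fderiv ℝ Φ (y.1, y.2, vel ε δ (part none ζ))
        (0, 0, dvel ε δ (part none ζ) (part (some s) ζ)) +
      wt ε s (part none ζ) * fderiv ℝ Φ (y.1, y.2, vel ε δ (part none ζ))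
        ((stVec s).1, (stVec s).2, 0)) := by
    intro s
    rw [fderiv_wtTest hδ ε hΦ, ← mul_add, ← map_add]
    simp
  rw [Finset.sum_congr rfl fun s _ => h s, Finset.sum_add_distrib, ← Finset.sum_mul, h0, zero_mul,
    zero_add, Finset.sum_add_distrib, sum_wt_smul_stVec]
  rfl

-- The integrand is the space-time divergence of `(ρΦ, JΦ)` evaluated at `u_δ`. Its spatial part
-- integrates to zero in `x`; the rest is the time derivative of a compactly supported function.
include hΦ in
theorem RegSol.integral_force_eq_zero (h : RegSol V ε ψ ψ' b b' c) (hε : ε ≠ 0)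
    (hc : HasCompactSupport Φ) {δ : ℝ} (hδ : 0 < δ) :
    ∫ t, ∫ x, (forceN ε δ Φ ((t, x), tuple (fullJet ψ ψ' b b' c t) x) +
      forceP ε δ Φ ((t, x), tuple (fullJet ψ ψ' b b' c t) x)) = 0 := by
  obtain ⟨M, R, hM0, hR0, hM, hM', hR⟩ := exists_bounds_test hΦ hc
  obtain ⟨C₁, hC₁⟩ := exists_bound_forceN ε hΦ hc
  obtain ⟨C₂, hC₂⟩ := exists_bound_forceP ε hΦ hc
  obtain ⟨C₃, hC₃⟩ := exists_bound_fderiv_wtTest hδ ε hΦ hc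
  set Z : ℝ → Lp (FJ d → ℂ) 2 (volume : Measure (Sp d)) :=
    fun t => tuple (fullJet ψ ψ' b b' c t) with hZdef
  set Zs : ℝ → Lp (St d) 2 (volume : Measure (Sp d)) :=
    fun t => tuple (stOf (ψ t) fun j => b j t) with hZs
  set W : Option (Fin d) → ℝ → Lp (St d) 2 (volume : Measure (Sp d)) := fun s t =>
    tuple fun r => fullJet ψ ψ' b b' c t (some s, r) with hW
  have hZsx : ∀ t, ∀ᵐ x, Zs t x = part none (Z t x) := fun t => by
    filter_upwards [coeFn_tuple (stOf (ψ t) fun j => b j t),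
      coeFn_tuple (fullJet ψ ψ' b b' c t)] with x h1 h2
    funext r
    rw [h1 r, part, h2]
    rfl
  have hWx : ∀ s t, ∀ᵐ x, W s t x = part (some s) (Z t x) := fun s t => by
    filter_upwards [coeFn_tuple (fun r => fullJet ψ ψ' b b' c t (some s, r)),
      coeFn_tuple (fullJet ψ ψ' b b' c t)] with x h1 h2
    funext r
    rw [h1 r, part, h2]
  have hdt : ∀ t, HasDerivAt Zs (W none t) t := fun t =>
    hasDerivAt_tuple (f := fun r t => stOf (ψ t) (fun j => b j t) r) fun r => by
      rcases r with _ | j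
      · exact h.hasDerivAt t
      · exact h.hasDerivAt_b j t
  have hdx : ∀ k t, HasDirDeriv (basisVec k) (Zs t) (W (some k) t) := fun k t =>
    HasDirDeriv.tuple fun r => by
      rcases r with _ | j
      · exact h.dir k t
      · exact h.dir₂ k j t
  have hG : ∀ s q, HasFDerivAt (wtTest ε δ Φ s) (fderiv ℝ (wtTest ε δ Φ s) q) q := fun s q =>
    ((contDiff_wtTest hδ ε hΦ s).differentiable (by simp) q).hasFDerivAt
  have hwt0 : ∀ s : Option (Fin d), wt ε s (0 : St d) = 0 := fun s => by
    have := abs_wt_le ε s (0 : St d)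
    simpa using this
  have hG0 : ∀ s y, wtTest ε δ Φ s (y, 0) = 0 := fun s y => by
    simp [wtTest, hwt0]
  -- `F` is `∫ ρ Φ(t, x, u_δ) dx`. Adding spatial divergences with zero integral turns its
  -- derivative into `D`.
  set F : ℝ → ℝ := fun t => ∫ x, wtTest ε δ Φ none ((t, x), Zs t x) with hF
  set D : ℝ → ℝ := fun t => ∫ x, (forceN ε δ Φ ((t, x), Z t x) +
      forceP ε δ Φ ((t, x), Z t x)) with hD
  have hcont : ∀ t : ℝ, Continuous fun x : Sp d => (t, x) := fun t => by fun_prop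
  have hint : ∀ s t v, Integrable fun x =>
      fderiv ℝ (wtTest ε δ Φ s) ((t, x), Zs t x) (v, W s t x) := by
    intro s t v
    refine Integrable.mono' (((integrable_norm_sq (Zs t)).mul_const ‖v‖).const_mul C₃ |>.add
      ((integrable_norm_mul_norm (Zs t) (W s t)).const_mul C₃)) ?_ (ae_of_all _ fun x => ?_)
    · have hfc : Continuous (fderiv ℝ (wtTest ε δ Φ s)) :=
        (contDiff_wtTest hδ ε hΦ s).continuous_fderiv (by simp)
      exact isBoundedBilinearMap_apply.continuous.comp_aestronglyMeasurable
        ((hfc.comp_aestronglyMeasurable ((hcont t).aestronglyMeasurable.prodMk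
          (Lp.aestronglyMeasurable (Zs t)))).prodMk
          (aestronglyMeasurable_const.prodMk (Lp.aestronglyMeasurable (W s t))))
    · refine (hC₃ s (t, x) (Zs t x) v (W s t x)).trans (le_of_eq ?_)
      simp only [Pi.add_apply]
      ring
  have hspace : ∀ k t, ∫ x, fderiv ℝ (wtTest ε δ Φ (some k)) ((t, x), Zs t x)
      (stVec (some k), W (some k) t x) = 0 := fun k t =>
    integral_fderiv_comp_eq_zero (hG (some k)) (hC₃ (some k)) (hG0 (some k)) (hcont t)
      (v := basisVec k) (v' := stVec (some k)) (fun x s => by simp [stVec]) (hdx k t)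
  have hsum0 : ∀ t, ∀ᵐ x, ∑ s, dwt ε s (part none (Z t x)) (part (some s) (Z t x)) = 0 := fun t => by
    filter_upwards [h.eq t, part_fullJet (ψ := ψ) (ψ' := ψ') (b := b) (b' := b') (c := c) t]
      with x h1 h2
    refine conservation_identity hε (v := V x) ?_ fun k => ?_
    · rw [h2.2.1, h2.1]
      have h3 : ∀ k, part (some (some k)) (Z t x) (some k) = c k k t x :=
        fun k => congrFun (h2.2.2 k) (some k)
      simp only [h3]
      exact h1
    · rw [h2.2.2, h2.1]
      rfl
  have hFD : ∀ t, HasDerivAt F (D t) t := by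
    intro t
    have h1 := hasDerivAt_integral_comp (hG none) (hC₃ none) (hG0 none)
      (ι := fun x => (t, x)) (hcont t).aestronglyMeasurable (stVec none) (Z := fun s => Zs (t + s))
      (W := W none t) (by
        have := hdt t
        exact HasDerivAt.comp_const_add (f := Zs) t 0 (by simpa using this))
    have h2 : HasDerivAt F (∫ x, fderiv ℝ (wtTest ε δ Φ none) ((t, x), Zs t x)
        (stVec none, W none t x)) t := by
      have h3 : HasDerivAt (fun s => ∫ x, wtTest ε δ Φ none ((t, x) + s • stVec none, Zs (t + s) x))
          (∫ x, fderiv ℝ (wtTest ε δ Φ none) ((t, x), Zs t x) (stVec none, W none t x)) (t - t) := by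
        simpa only [sub_self, add_zero] using h1
      have h4 := HasDerivAt.comp_sub_const t t h3
      refine h4.congr_of_eventuallyEq (Eventually.of_forall fun s => ?_)
      simp [hF, stVec]
    convert h2 using 1
    have h5 : ∫ x, ∑ s, fderiv ℝ (wtTest ε δ Φ s) ((t, x), Zs t x) (stVec s, W s t x) =
        ∫ x, fderiv ℝ (wtTest ε δ Φ none) ((t, x), Zs t x) (stVec none, W none t x) := by
      rw [integral_finsetSum _ fun s _ => hint s t _, Fintype.sum_option]
      simp [hspace]
    rw [← h5]
    refine integral_congr_ae ?_
    filter_upwards [hsum0 t, hZsx t, ae_all_iff.2 fun s => hWx s t] with x h6 h7 h8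
    simp only [h7, h8]
    exact (sum_fderiv_wtTest hΦ hδ (t, x) (Z t x) h6).symm
  have hZc : Continuous Z := h.continuous_fullJet
  have hDc : Continuous D := continuous_integral_comp (C := C₁ + C₂)
    (G := fun q => forceN ε δ Φ q + forceP ε δ Φ q)
    ((continuous_forceN hΦ ε hδ).add (continuous_forceP hΦ ε hδ))
    (fun y z => by
      rw [add_mul]
      exact (abs_add_le _ _).trans (add_le_add (hC₁ δ hδ y z) (hC₂ δ y z)))
    (ι := fun t x => (t, x)) (fun t => (hcont t).aestronglyMeasurable) (fun x => by fun_prop) hZc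
  have hvan : ∀ (y : ℝ × Sp d) p, R < |y.1| →
      Φ (y.1, y.2, p) = 0 ∧ fderiv ℝ Φ (y.1, y.2, p) = 0 :=
    fun y p hy => hR _ (hy.trans_le (norm_fst_le' y p))
  have hF0 : ∀ t, R < |t| → F t = 0 := fun t ht => by
    simp only [hF, wtTest]
    simp [fun x p => (hvan (t, x) p ht).1]
  have hD0 : ∀ t, R < |t| → D t = 0 := fun t ht => by
    simp only [hD, forceN, forceP]
    simp [fun x p => (hvan (t, x) p ht).2]
  have hcs : ∀ g : ℝ → ℝ, (∀ t, R < |t| → g t = 0) → HasCompactSupport g := fun g hg =>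
    HasCompactSupport.intro (isCompact_Icc (a := -R) (b := R)) fun t ht => hg t (by
      by_contra hlt
      push Not at hlt
      exact ht (abs_le.1 hlt))
  have hFc : Continuous F := continuous_iff_continuousAt.2 fun t => (hFD t).continuousAt
  exact integral_eq_zero_of_hasDerivAt_of_integrable hFD
    (hDc.integrable_of_hasCompactSupport (hcs D hD0))
    (hFc.integrable_of_hasCompactSupport (hcs F hF0))

end Force

end Bohm

/-! ### The force distribution expressed through transport of test functions -/

namespace Bohm

section ForceEquation

variable {d : ℕ} {V : Sp d → ℝ} {ε : ℝ} {ψ ψ' : ℝ → L2 d} {b b' : Fin d → ℝ → L2 d}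
  {c : Fin d → Fin d → ℝ → L2 d}

/-- `∂_t φ + p · ∇_x φ - ∇V · ∇_p φ`. -/
noncomputable def transportTest (V : Sp d → ℝ) (φ : ℝ × Sp d × Sp d → ℝ)
    (q : ℝ × Sp d × Sp d) : ℝ := fderiv ℝ φ q (1, q.2.2, -gradPot V q.2.1)

theorem continuous_transportTest (hV : IsC1Bounded V) {φ : ℝ × Sp d × Sp d → ℝ}
    (hφ : ContDiff ℝ (⊤ : ℕ∞) φ) : Continuous (transportTest V φ) := by
  have h := (continuous_gradPot hV).comp (by fun_prop : Continuous fun q : ℝ × Sp d × Sp d => q.2.1)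
  exact (hφ.continuous_fderiv (by simp)).clm_apply
    (continuous_const.prodMk ((by fun_prop : Continuous fun q : ℝ × Sp d × Sp d => q.2.2).prodMk
      h.neg))

theorem measurable_jetPotentialDeriv (ε : ℝ) :
    Measurable fun q : (Jet d → ℂ) × (Jet d → ℂ) => jetPotentialDeriv ε q.1 q.2 := by
  have h1 : ∀ k, Measurable fun q : (Jet d → ℂ) × (Jet d → ℂ) => q.1 k := fun k =>
    (measurable_pi_apply k).comp measurable_fst
  have h2 : ∀ k, Measurable fun q : (Jet d → ℂ) × (Jet d → ℂ) => q.2 k := fun k =>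
    (measurable_pi_apply k).comp measurable_snd
  have h3 : ∀ k, Measurable fun q : (Jet d → ℂ) × (Jet d → ℂ) =>
      q.2 k / q.1 none - q.1 k / q.1 none * (q.2 none / q.1 none) := fun k =>
    ((h2 k).div (h1 none)).sub (((h1 k).div (h1 none)).mul ((h2 none).div (h1 none)))
  refine measurable_const.mul ((Complex.measurable_re.comp (h3 _)).add
    (Finset.measurable_sum _ fun j _ => ?_))
  exact ((Complex.measurable_im.comp ((h1 _).div (h1 none))).const_mul 2).mul
    (Complex.measurable_im.comp (h3 _))

theorem aemeasurable_family {ι : Type*} [Countable ι] (f : ι → L2 d) :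
    AEMeasurable (fun x i => f i x) :=
  aemeasurable_pi_iff.2 fun i => (Lp.aestronglyMeasurable (f i)).aemeasurable

theorem aemeasurable_jetPotentialDeriv (ε : ℝ) (f g : Jet d → L2 d) :
    AEMeasurable fun x => jetPotentialDeriv ε (fun k => f k x) (fun k => g k x) :=
  Measurable.comp_aemeasurable (g := fun q : (Jet d → ℂ) × (Jet d → ℂ) => jetPotentialDeriv ε q.1 q.2)
    (f := fun x => ((fun k => f k x), fun k => g k x)) (measurable_jetPotentialDeriv ε)
    ((aemeasurable_family f).prodMk (aemeasurable_family g))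

theorem RegSol.gradBohmPotential_ae (h : RegSol V ε ψ ψ' b b' c) (j : Fin d) (t : ℝ) :
    ∃ m : L2 d, (∀ᵐ x, Complex.I * ε * b' j t x = -((ε : ℂ) ^ 2 / 2) * m x + V x * b j t x +
        (fderiv ℝ V x (basisVec j) : ℝ) * ψ t x) ∧
      (∀ᵐ x, x ∈ posSet (ψ t) → gradBohmPotential ε (ψ t) j x =
        jetPotentialDeriv ε (fun k => jetOf (ψ t) (fun j => b j t) (∑ k, c k k t) k x)
          (fun k => jetOf (b j t) (fun k => c j k t) m k x)) := by
  choose m hm hm' using fun j => h.lap j t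
  exact ⟨m j, hm' j, gradBohmPotential_eq (c := fun k j => c k j t) (fun j => h.dir j t)
    (fun k j => h.dir₂ k j t) hm ε j⟩

/-- The gradient of the Bohm potential is a chosen representative; almost everywhere for the Bohmian
measure it equals a measurable function of the jet. -/
theorem RegSol.aestronglyMeasurable_bohmForceTest (h : RegSol V ε ψ ψ' b b' c) (φ : TestTXP d)
    (t : ℝ) : AEStronglyMeasurable (bohmForceTest ε ψ φ t) (bohmianMeasure ε (ψ t)) := by
  unfold bohmForceTest
  refine Finset.aestronglyMeasurable_fun_sum _ fun j _ => AEStronglyMeasurable.mul ?_ ?_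
  · obtain ⟨m, -, hm⟩ := h.gradBohmPotential_ae j t
    set g : Sp d → ℝ := fun x => jetPotentialDeriv ε
      (fun k => jetOf (ψ t) (fun j => b j t) (∑ k, c k k t) k x)
      (fun k => jetOf (b j t) (fun k => c j k t) m k x) with hg
    have hgm : AEMeasurable g := aemeasurable_jetPotentialDeriv ε _ _
    have h1 : ∀ᵐ z ∂(bohmianMeasure ε (ψ t)), gradBohmPotential ε (ψ t) j z.1 = hgm.mk g z.1 := by
      refine ae_bohmianMeasure_fst (fun j => h.dir j t) ε
        (P := fun x => gradBohmPotential ε (ψ t) j x = hgm.mk g x) ?_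
      filter_upwards [hm, hgm.ae_eq_mk] with x h1 h2 h3
      rw [h1 h3, ← h2]
    exact (hgm.measurable_mk.comp measurable_fst).aestronglyMeasurable.congr
      (h1.mono fun z hz => hz.symm)
  · have hc : Continuous fun z : Sp d × Sp d =>
        (∂_{((0 : ℝ), (0 : Sp d), basisVec j)} φ) (t, z) :=
      (∂_{((0 : ℝ), (0 : Sp d), basisVec j)} φ).continuous.comp (by fun_prop)
    exact hc.aestronglyMeasurable

/-- The equation of motion multiplied by `∇_pφ`: the acceleration term at `δ = 0` and the external
force together cancel the Bohm force. The right side is defined by jets and is bounded near nodes by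
the estimates above. -/
theorem RegSol.force_pointwise (h : RegSol V ε ψ ψ' b b' c) (φ : TestTXP d) (t : ℝ) :
    ∀ᵐ x, density (ψ t) x * bohmForceTest ε ψ φ t (x, velocity ε (ψ t) x) =
      -(forceN ε 0 φ ((t, x), tuple (fullJet ψ ψ' b b' c t) x) +
        forceV V ε 0 φ ((t, x), tuple (fullJet ψ ψ' b b' c t) x)) := by
  choose m hm hg using fun j => h.gradBohmPotential_ae j t
  filter_upwards [h.density_velocity t, part_fullJet (ψ := ψ) (ψ' := ψ') (b := b) (b' := b')
    (c := c) t, h.eq t, ae_all_iff.2 hm, ae_all_iff.2 hg,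
    coeFn_sum Finset.univ fun k => c k k t] with x hdv hp heq hm hg hs
  set ζ := tuple (fullJet ψ ψ' b b' c t) x with hζ
  rw [hdv.1, hdv.2]
  by_cases hz : rho (part none ζ) = 0
  -- At a node every term carries a vanishing weight.
  · simp [forceN, forceV, hz, wt_eq_zero hz]
  have hz0 : part none ζ none ≠ 0 := fun h0 => hz (by simp [rho, h0])
  have hpos : x ∈ posSet (ψ t) := by
    rw [posSet, Set.mem_ofPred_eq, hdv.1]
    exact (rho_nonneg _).lt_of_ne (Ne.symm hz)
  have hkey : ∀ j, ∑ s, wt ε s (part none ζ) * dvel ε 0 (part none ζ) (part (some s) ζ) j +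
      rho (part none ζ) * fderiv ℝ V x (basisVec j) =
      -(rho (part none ζ) * gradBohmPotential ε (ψ t) j x) := by
    intro j
    refine sum_wt_mul_dvel hz0 (v := V x) (l := ∑ k, c k k t x) (m := m j x) ?_ ?_ ?_ ?_
    · rw [hp.2.1, hp.1]; exact heq
    · rw [hp.2.1, hp.1]; exact hm j
    · intro k; rw [hp.2.2, hp.1]; rfl
    · rw [hg j hpos, hp.1]
      -- The acceleration contains `∂_k∂_jψ` and the gradient of the potential `∂_j∂_kψ`; symmetry
      -- of second derivatives identifies them.
      have h3 : ∀ k, part (some (some k)) ζ (some j) = c j k t x := fun k => by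
        rw [hp.2.2]
        change c k j t x = _
        rw [h.symm]
      simp only [h3, jetPotentialDeriv, jetOf, stOf, hs]
  have hd : ∀ j, (∂_{((0 : ℝ), (0 : Sp d), basisVec j)} φ) (t, x, vel ε 0 (part none ζ)) =
      fderiv ℝ φ (t, x, vel ε 0 (part none ζ)) (0, 0, basisVec j) :=
    fun j => lineDerivOp_test_apply φ _ _
  simp only [forceN, forceV, bohmForceTest, hd]
  rw [Finset.mul_sum, fderiv_momentum_eq_sum _ (gradPot V x), Finset.mul_sum]
  simp only [fun s => fderiv_momentum_eq_sum (fderiv ℝ φ (t, x, vel ε 0 (part none ζ)))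
    (dvel ε 0 (part none ζ) (part (some s) ζ)), Finset.mul_sum]
  rw [Finset.sum_comm, ← Finset.sum_add_distrib, ← Finset.sum_neg_distrib]
  refine Finset.sum_congr rfl fun j _ => ?_
  have := hkey j
  simp only [← mul_assoc, ← Finset.sum_mul]
  rw [← add_mul]
  change _ = -((_ + rho (part none ζ) * fderiv ℝ V x (basisVec j)) * _)
  rw [this]
  ring

/-- The force is `-(forceN + forceV)` pointwise, which is integrable, while `forceN + forceP`
integrates to zero in the limit `δ → 0`. Eliminating the acceleration leaves only the transport of
`φ`, in which no derivative of the Bohm potential occurs. -/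
theorem RegSol.bohmForce_eq (h : RegSol V ε ψ ψ' b b' c) (hV : IsC1Bounded V) (hε : ε ≠ 0)
    (φ : TestTXP d) :
    BohmForceIntegrable ε ψ φ ∧
      bohmForce ε ψ φ = -∫ t, ∫ z, transportTest V φ (t, z) ∂(bohmianMeasure ε (ψ t)) := by
  have hφ : ContDiff ℝ (⊤ : ℕ∞) φ := φ.contDiff
  have hφc : HasCompactSupport φ := φ.hasCompactSupport
  set δ : ℕ → ℝ := fun n => 1 / ((n : ℝ) + 1) with hδdef
  have hδ : ∀ n, 0 < δ n := fun n => by positivity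
  have hδ0 : Tendsto δ atTop (𝓝 0) := tendsto_one_div_add_atTop_nhds_zero_nat
  obtain ⟨M, R, hM0, hR0, hM, hM', hR⟩ := exists_bounds_test hφ hφc
  obtain ⟨C₁, hC₁⟩ := exists_bound_forceN ε hφ hφc
  obtain ⟨C₂, hC₂⟩ := exists_bound_forceP ε hφ hφc
  obtain ⟨C₃, hC₃⟩ := exists_bound_forceV ε hV hφ hφc
  have hvan : ∀ (y : ℝ × Sp d) p, R < |y.1| → fderiv ℝ φ (y.1, y.2, p) = 0 :=
    fun y p hy => (hR _ (hy.trans_le (norm_fst_le' y p))).2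
  have hZ := h.continuous_fullJet
  have c1 : ∀ n, Continuous fun q => forceN ε (δ n) φ q + forceV V ε (δ n) φ q := fun n =>
    (continuous_forceN hφ ε (hδ n)).add (continuous_forceV hφ ε hV (hδ n))
  have c2 : ∀ n (y : ℝ × Sp d) (z : FJ d → ℂ), |forceN ε (δ n) φ (y, z) +
      forceV V ε (δ n) φ (y, z)| ≤ (C₁ + C₃) * ‖z‖ ^ 2 := fun n y z => by
    rw [add_mul]
    exact (abs_add_le _ _).trans (add_le_add (hC₁ _ (hδ n) y z) (hC₃ _ y z))
  have c3 : ∀ y z, Tendsto (fun n => forceN ε (δ n) φ (y, z) + forceV V ε (δ n) φ (y, z)) atTop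
      (𝓝 (forceN ε 0 φ (y, z) + forceV V ε 0 φ (y, z))) := fun y z =>
    (tendsto_forceN hφ ε hδ0 y z).add (tendsto_forceV hφ ε V hδ0 y z)
  have c4 : ∀ n (y : ℝ × Sp d) z, R < |y.1| →
      forceN ε (δ n) φ (y, z) + forceV V ε (δ n) φ (y, z) = 0 := fun n y z hy => by
    simp [forceN, forceV, hvan y _ hy]
  obtain ⟨n1, n2, -⟩ := spaceTime_limit_signed
    (K₀ := fun q => forceN ε 0 φ q + forceV V ε 0 φ q) c1 c2 c3 c4 hZ
  have n3 := spaceTime_limit_abs (K₀ := fun q => forceN ε 0 φ q + forceV V ε 0 φ q) c1 c2 c3 c4 hZ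
  obtain ⟨p1, p2, p3⟩ := spaceTime_limit_signed
    (K := fun n q => forceN ε (δ n) φ q + forceP ε (δ n) φ q)
    (K₀ := fun q => forceN ε 0 φ q + forceP ε 0 φ q) (C := C₁ + C₂) (T := R)
    (fun n => (continuous_forceN hφ ε (hδ n)).add (continuous_forceP hφ ε (hδ n)))
    (fun n y z => by
      rw [add_mul]
      exact (abs_add_le _ _).trans (add_le_add (hC₁ _ (hδ n) y z) (hC₂ _ y z)))
    (fun y z => (tendsto_forceN hφ ε hδ0 y z).add (tendsto_forceP hφ ε hδ0 y z))
    (fun n y z hy => by simp [forceN, forceP, hvan y _ hy]) hZ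
  -- The regularised integrals are all zero, hence so is their limit.
  simp only [fun n => h.integral_force_eq_zero hφ hε hφc (hδ n)] at p3
  have p4 := tendsto_nhds_unique tendsto_const_nhds p3
  obtain ⟨M₁, hM₁0, -, hM₁, -⟩ := hV.exists_bounds
  have hΘb : ∀ t x p, |transportTest V φ (t, x, p)| ≤
      M * (1 + R + d * M₁) * (1 + ‖p‖ ^ 2) := by
    intro t x p
    rcases lt_or_ge R ‖((t, x, p) : ℝ × Sp d × Sp d)‖ with hlt | hle
    · rw [transportTest, (hR _ hlt).2, _root_.zero_apply, abs_zero]; positivity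
    · have hp : ‖p‖ ≤ R := ((norm_snd_le (x, p)).trans (norm_snd_le (t, x, p))).trans hle
      refine ((fderiv ℝ φ _).le_opNorm _).trans ?_
      have h1 : ‖((1, p, -gradPot V x) : ℝ × Sp d × Sp d)‖ ≤ 1 + R + d * M₁ := by
        have := norm_gradPot_le hM₁ x
        have e0 : (0 : ℝ) ≤ d * M₁ := by positivity
        rw [Prod.norm_def, Prod.norm_def]
        refine max_le ?_ (max_le ?_ ?_)
        · simp only [norm_one]; linarith
        · simp only; linarith
        · simp only [norm_neg]; linarith
      calc _ ≤ M * (1 + R + d * M₁) := mul_le_mul (hM' _) h1 (norm_nonneg _) hM0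
        _ ≤ _ := le_mul_of_one_le_right (by positivity) (by nlinarith [sq_nonneg ‖p‖])
  obtain ⟨m1, m2, m3⟩ := h.moment (continuous_transportTest hV hφ) (T := R) hΘb (fun t x p ht => by
    rw [transportTest, hvan (t, x) p ht, _root_.zero_apply])
  -- Since `J = ρ u` also at nodes, the transported test function is `forceP - forceV`. It is
  -- written as a difference of two sums containing `forceN` because these are the combinations
  -- already shown to be integrable.
  have hrho : ∀ t x (ζ : FJ d → ℂ), rho (part none ζ) *
      transportTest V φ (t, x, vel ε 0 (part none ζ)) =
      (forceN ε 0 φ ((t, x), ζ) + forceP ε 0 φ ((t, x), ζ)) -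
        (forceN ε 0 φ ((t, x), ζ) + forceV V ε 0 φ ((t, x), ζ)) := by
    intro t x ζ
    have hmom : mom ε (part none ζ) = rho (part none ζ) • vel ε 0 (part none ζ) := by
      by_cases hz : rho (part none ζ) = 0
      · rw [hz, zero_smul, mom_eq_zero hz]
      · rw [vel, add_zero, smul_smul, mul_inv_cancel₀ hz, one_smul]
    rw [add_sub_add_left_eq_sub, transportTest, forceP, forceV, ← smul_eq_mul, ← smul_eq_mul,
      ← map_smul, ← map_smul, ← map_sub, hmom]
    simp
  have hm := h.aestronglyMeasurable_bohmForceTest φ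
  have hdir : ∀ t j, HasDirDeriv (basisVec j) (ψ t) (b j t) := fun t j => h.dir j t
  have e1 : ∀ t, ∫ z, bohmForceTest ε ψ φ t z ∂(bohmianMeasure ε (ψ t)) =
      -∫ x, (forceN ε 0 φ ((t, x), tuple (fullJet ψ ψ' b b' c t) x) +
        forceV V ε 0 φ ((t, x), tuple (fullJet ψ ψ' b b' c t) x)) := fun t => by
    rw [integral_bohmianMeasure (hdir t) ε (hm t), integral_congr_ae (h.force_pointwise φ t),
      integral_neg]
  have e2 : ∀ t, ∫ z, |bohmForceTest ε ψ φ t z| ∂(bohmianMeasure ε (ψ t)) =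
      ∫ x, |forceN ε 0 φ ((t, x), tuple (fullJet ψ ψ' b b' c t) x) +
        forceV V ε 0 φ ((t, x), tuple (fullJet ψ ψ' b b' c t) x)| := fun t => by
    have e3 := integral_bohmianMeasure (hdir t) ε (hm t).norm
    simp only [Real.norm_eq_abs] at e3
    rw [e3]
    refine integral_congr_ae ?_
    filter_upwards [h.force_pointwise φ t] with x hx
    rw [← abs_neg (forceN _ _ _ _ + _), ← hx, abs_mul,
      abs_of_nonneg (show 0 ≤ density (ψ t) x by unfold density; positivity)]
  refine ⟨⟨fun t => ?_, ?_⟩, ?_⟩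
  · rw [integrable_bohmianMeasure_iff (hdir t) ε (hm t)]
    exact (n1 t).neg.congr ((h.force_pointwise φ t).mono fun x hx => hx.symm)
  · simp only [e2]
    exact n3
  · rw [bohmForce]
    congr 1
    simp only [e1, m3, hrho]
    rw [integral_neg, integral_congr_ae (ae_of_all _ fun t => integral_sub (p1 t) (n1 t)),
      integral_sub p2 n2, ← p4, zero_sub]

end ForceEquation

end Bohm

namespace Bohm

/-! ### Weighted pairings and integration by parts -/

section Pairing

variable {d : ℕ}

/-- The weighted pairing `∫ η Re (conj f g)`. -/
noncomputable def pairR (η : Sp d → ℝ) (f g : L2 d) : ℝ :=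
  ∫ x, η x * ((starRingEnd ℂ) (f x) * g x).re

theorem integrable_pairR {η : Sp d → ℝ} (hη : Continuous η) {C : ℝ} (hC : ∀ x, |η x| ≤ C)
    (f g : L2 d) : Integrable fun x => η x * ((starRingEnd ℂ) (f x) * g x).re := by
  refine ((integrable_norm_mul_norm f g).const_mul C).mono' ?_ (ae_of_all _ fun x => ?_)
  · have h1 : AEStronglyMeasurable (fun x => (starRingEnd ℂ) (f x) * g x) volume :=
      (Complex.continuous_conj.comp_aestronglyMeasurable (Lp.aestronglyMeasurable f)).mul
        (Lp.aestronglyMeasurable g)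
    exact hη.aestronglyMeasurable.mul (Complex.continuous_re.comp_aestronglyMeasurable h1)
  · rw [Real.norm_eq_abs, abs_mul]
    exact mul_le_mul (hC x) (abs_conj_mul_re_le _ _) (abs_nonneg _) ((abs_nonneg _).trans (hC x))

theorem abs_pairR_le {η : Sp d → ℝ} {C : ℝ} (hC : ∀ x, |η x| ≤ C) (f g : L2 d) :
    |pairR η f g| ≤ C * (‖f‖ ^ 2 + ‖g‖ ^ 2) := by
  have h := integral_add (integrable_norm_sq f) (integrable_norm_sq g)
  rw [integral_norm_sq f, integral_norm_sq g] at h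
  rw [← h, ← integral_const_mul, ← Real.norm_eq_abs, pairR]
  refine norm_integral_le_of_norm_le
    (((integrable_norm_sq f).add (integrable_norm_sq g)).const_mul C) (ae_of_all _ fun x => ?_)
  rw [Real.norm_eq_abs, abs_mul]
  refine mul_le_mul (hC x) ((abs_conj_mul_re_le _ _).trans ?_) (abs_nonneg _)
    ((abs_nonneg _).trans (hC x))
  nlinarith [sq_nonneg (‖f x‖ - ‖g x‖), sq_nonneg (‖f x‖), sq_nonneg (‖g x‖)]

theorem pairR_comm (η : Sp d → ℝ) (f g : L2 d) : pairR η f g = pairR η g f := by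
  unfold pairR
  congr 1
  ext x
  simp only [Complex.mul_re, Complex.conj_re, Complex.conj_im]
  ring

theorem pairR_sum {η : Sp d → ℝ} (hη : Continuous η) {C : ℝ} (hC : ∀ x, |η x| ≤ C) (f : L2 d)
    {ι : Type*} (s : Finset ι) (g : ι → L2 d) :
    pairR η f (∑ k ∈ s, g k) = ∑ k ∈ s, pairR η f (g k) := by
  unfold pairR
  rw [← integral_finsetSum _ fun k _ => integrable_pairR hη hC f (g k)]
  refine integral_congr_ae ?_
  filter_upwards [coeFn_sum s g] with x hx
  rw [hx, Finset.mul_sum, Complex.re_sum, Finset.mul_sum]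

/-- Translation invariance of the inner product combined with the Leibniz rule for the multiplier
`η`. -/
theorem pairR_ibp {η : Sp d → ℝ} (hη : IsC1Bounded η) (k : Fin d) {f f' g g' : L2 d}
    (hf : HasDirDeriv (basisVec k) f f') (hg : HasDirDeriv (basisVec k) g g') :
    pairR η f' g + pairR η f g' + pairR (fun x => fderiv ℝ η x (basisVec k)) f g = 0 := by
  obtain ⟨V, hV⟩ := hη.exists_bcf
  obtain ⟨W, hW⟩ := hη.exists_bcf_fderiv k
  obtain ⟨M, hM0, -, -, hM⟩ := hη.exists_bounds
  have hre : ∀ (U : BoundedContinuousFunction (Sp d) ℝ) (f g : L2 d),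
      (inner ℂ f (mulOp U g)).re = pairR (fun x => U x) f g := by
    intro U f g
    rw [L2.inner_def]
    have h1 := integral_re (𝕜 := ℂ) (L2.integrable_inner f (mulOp U g) (𝕜 := ℂ))
    refine h1.symm.trans (integral_congr_ae ?_)
    filter_upwards [coeFn_mulOp U g] with x hx
    rw [hx, RCLike.inner_apply]
    simp only [RCLike.re_eq_complex_re, Complex.mul_re, Complex.conj_re, Complex.conj_im,
      Complex.mul_im, Complex.ofReal_re, Complex.ofReal_im]
    ring
  have h := (hf.inner_add_inner (hg.mulOp (V := V) (W := W) (M := M)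
    (fun x y => by rw [hV, hV]; exact hM x y) (norm_basisVec k)
    (tendsto_diffQuotPot hη hV hW)))
  rw [inner_add_right] at h
  have h2 := congrArg Complex.re h
  rw [Complex.add_re, Complex.add_re, hre, hre, hre, Complex.zero_re] at h2
  have e1 : (fun x => V x) = η := funext hV
  have e2 : (fun x => W x) = fun x => fderiv ℝ η x (basisVec k) := funext hW
  rw [e1, e2] at h2
  linarith

theorem isC1Bounded_of_compactSupport {η : Sp d → ℝ} (hη : ContDiff ℝ (⊤ : ℕ∞) η)
    (hc : HasCompactSupport η) : IsC1Bounded η := by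
  obtain ⟨M₁, hM₁⟩ := hc.exists_bound_of_continuous hη.continuous
  obtain ⟨M₂, hM₂⟩ := (hc.fderiv ℝ).exists_bound_of_continuous (hη.continuous_fderiv (by simp))
  exact ⟨hη.of_le (by exact_mod_cast le_top), max M₁ M₂, fun x =>
    ⟨(hM₁ x).trans (le_max_left _ _), (hM₂ x).trans (le_max_right _ _)⟩⟩

variable {ψ : L2 d} {b : Fin d → L2 d} {c : Fin d → Fin d → L2 d} {m : Fin d → L2 d}

/-- The divergence form of the dispersive term in the momentum balance. -/
theorem pairR_dispersion (hb : ∀ j, HasDirDeriv (basisVec j) ψ (b j))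
    (hc : ∀ k j, HasDirDeriv (basisVec k) (b j) (c k j)) (hs : ∀ k j, c k j = c j k)
    (hm : ∀ j, HasDirDeriv (basisVec j) (∑ k, c k k) (m j)) {η : Sp d → ℝ}
    (hη : IsC1Bounded η) (i : Fin d)
    (hηi : IsC1Bounded fun x => fderiv ℝ η x (basisVec i)) :
    pairR η ψ (m i) - pairR η (∑ k, c k k) (b i) =
      2 * (∑ k, pairR (fun x => fderiv ℝ η x (basisVec k)) (b i) (b k)) +
      ∑ k, pairR (fun x => fderiv ℝ (fun x => fderiv ℝ η x (basisVec i)) x (basisVec k)) ψ (b k) := by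
  obtain ⟨C, -, hC, -⟩ := hη.exists_bounds
  obtain ⟨C', -, hC', -⟩ := hηi.exists_bounds
  have h1 := pairR_ibp hη i (hb i) (hm i)
  have h2 : pairR η (b i) (∑ k, c k k) = ∑ k, pairR η (b i) (c k k) :=
    pairR_sum hη.1.continuous hC _ _ _
  have h3 : pairR (fun x => fderiv ℝ η x (basisVec i)) ψ (∑ k, c k k) =
      ∑ k, pairR (fun x => fderiv ℝ η x (basisVec i)) ψ (c k k) :=
    pairR_sum hηi.1.continuous hC' _ _ _
  -- Three integrations by parts: `a1` moves `∂_k` off the second derivative, `a2` recognises `2 Re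
  -- (conj ∂_kψ ∂_i∂_kψ)` as `∂_i |∂_kψ|²`, and `a3` eliminates the resulting `|∂_kψ|²` term.
  have h4 : ∀ k, 2 * pairR η (b i) (c k k) +
      pairR (fun x => fderiv ℝ η x (basisVec i)) ψ (c k k) =
      -(2 * pairR (fun x => fderiv ℝ η x (basisVec k)) (b i) (b k) +
        pairR (fun x => fderiv ℝ (fun x => fderiv ℝ η x (basisVec i)) x (basisVec k)) ψ (b k)) := by
    intro k
    have a1 := pairR_ibp hη k (hc k i) (hc k k)
    have a2 := pairR_ibp hη i (hc i k) (hc i k)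
    have a3 := pairR_ibp hηi k (hb k) (hc k k)
    rw [pairR_comm η (b k) (c i k), ← hs k i] at a2
    linarith
  have h5 := Finset.sum_congr rfl fun k (_ : k ∈ Finset.univ) => h4 k
  rw [Finset.sum_add_distrib, Finset.sum_neg_distrib, Finset.sum_add_distrib, ← Finset.mul_sum,
    ← Finset.mul_sum] at h5
  rw [pairR_comm η (∑ k, c k k)]
  linarith

/-- Weighted pairings depend continuously on time. -/
theorem continuous_pairR {χ : ℝ × Sp d → ℝ} (hχ : Continuous χ) {C : ℝ} (hC : ∀ y, |χ y| ≤ C)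
    {f g : ℝ → L2 d} (hf : Continuous f) (hg : Continuous g) :
    Continuous fun t => pairR (fun x => χ (t, x)) (f t) (g t) := by
  have hZ : Continuous fun t => tuple (fun r : Bool => cond r (f t) (g t)) :=
    continuous_tuple (f := fun (r : Bool) t => cond r (f t) (g t)) fun r => by
      cases r
      exacts [hg, hf]
  have h := continuous_integral_comp (X := Sp d) (μ := volume) (Y := ℝ × Sp d)
    (G := fun q : (ℝ × Sp d) × (Bool → ℂ) =>
      χ q.1 * ((starRingEnd ℂ) (q.2 true) * q.2 false).re) (by fun_prop) (C := C)
    (fun y z => by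
      rw [abs_mul, pow_two]
      refine mul_le_mul (hC y) ((abs_conj_mul_re_le _ _).trans ?_) (abs_nonneg _)
        ((abs_nonneg _).trans (hC y))
      gcongr
      exacts [norm_le_pi_norm z true, norm_le_pi_norm z false])
    (ι := fun t x => (t, x))
    (fun t => (by fun_prop : Continuous fun x : Sp d => (t, x)).aestronglyMeasurable)
    (fun x => by fun_prop) hZ
  refine h.congr fun t => integral_congr_ae ?_
  filter_upwards [coeFn_tuple (fun r : Bool => cond r (f t) (g t))] with x hx
  rw [hx true, hx false]
  rfl

end Pairing

end Bohm

namespace Bohm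

/-! ### The momentum balance -/

section Momentum

variable {d : ℕ} {V : Sp d → ℝ} {ε : ℝ} {ψ ψ' : ℝ → L2 d} {b b' : Fin d → ℝ → L2 d}
  {c : Fin d → Fin d → ℝ → L2 d}

/-- Bounds and time support of a test function on space-time. -/
theorem exists_bound_testTX (χ : TestTX d) :
    ∃ M R : ℝ, 0 ≤ M ∧ 0 ≤ R ∧ (∀ y, |χ y| ≤ M) ∧ (∀ y, ‖fderiv ℝ χ y‖ ≤ M) ∧
      ∀ y, R < ‖y‖ → χ y = 0 := by
  have hχ : ContDiff ℝ (⊤ : ℕ∞) χ := χ.contDiff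
  have hc : HasCompactSupport χ := χ.hasCompactSupport
  obtain ⟨M₁, hM₁⟩ := hc.exists_bound_of_continuous hχ.continuous
  obtain ⟨M₂, hM₂⟩ := (hc.fderiv ℝ).exists_bound_of_continuous (hχ.continuous_fderiv (by simp))
  obtain ⟨R, hR⟩ := hc.isCompact.isBounded.exists_norm_le
  refine ⟨|M₁| + |M₂|, |R|, by positivity, by positivity, fun q => ?_, fun q => ?_, fun q hq => ?_⟩
  · exact (hM₁ q).trans ((le_abs_self _).trans (le_add_of_nonneg_right (abs_nonneg _)))
  · exact (hM₂ q).trans ((le_abs_self _).trans (le_add_of_nonneg_left (abs_nonneg _)))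
  · exact image_eq_zero_of_notMem_tsupport fun h =>
      absurd ((hR q h).trans (le_abs_self R)) (not_le.2 hq)

theorem abs_fst_le (t : ℝ) (x : Sp d) : |t| ≤ ‖((t, x) : ℝ × Sp d)‖ := norm_fst_le (t, x)

theorem contDiff_slice (χ : TestTX d) (t : ℝ) : ContDiff ℝ (⊤ : ℕ∞) fun x => χ (t, x) := by
  have hχ : ContDiff ℝ (⊤ : ℕ∞) χ := χ.contDiff
  exact hχ.comp (contDiff_const.prodMk contDiff_id)

theorem isC1Bounded_slice (χ : TestTX d) (t : ℝ) : IsC1Bounded fun x => χ (t, x) := by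
  refine isC1Bounded_of_compactSupport (contDiff_slice χ t) ?_
  have hc : HasCompactSupport χ := χ.hasCompactSupport
  refine HasCompactSupport.intro (hc.isCompact.image continuous_snd) fun x hx => ?_
  by_contra h
  exact hx ⟨(t, x), subset_tsupport _ h, rfl⟩

theorem fderiv_slice (χ : TestTX d) (t : ℝ) (k : Fin d) (x : Sp d) :
    fderiv ℝ (fun x => χ (t, x)) x (basisVec k) = (∂_{((0 : ℝ), basisVec k)} χ) (t, x) := by
  have hχ : ContDiff ℝ (⊤ : ℕ∞) χ := χ.contDiff
  rw [lineDerivOp_test_apply]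
  have h1 : HasFDerivAt (fun x : Sp d => ((t, x) : ℝ × Sp d))
      (ContinuousLinearMap.inr ℝ ℝ (Sp d)) x := by
    have := (hasFDerivAt_const (𝕜 := ℝ) t x).prodMk (hasFDerivAt_id x)
    exact this
  have h2 := ((hχ.differentiable (by simp)) (t, x)).hasFDerivAt.comp x h1
  have h3 : HasFDerivAt (fun x => χ (t, x)) ((fderiv ℝ χ (t, x)).comp
    (ContinuousLinearMap.inr ℝ ℝ (Sp d))) x := h2
  rw [h3.fderiv]
  rfl

/-- The momentum density tested against `∂_t χ`, together with the external force. -/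
noncomputable def momentumTest (V : Sp d → ℝ) (χ : TestTX d) (i : Fin d)
    (q : ℝ × Sp d × Sp d) : ℝ :=
  (∂_{((1 : ℝ), (0 : Sp d))} χ) (q.1, q.2.1) * q.2.2 i - gradPot V q.2.1 i * χ (q.1, q.2.1)

theorem continuous_momentumTest (hV : IsC1Bounded V) (χ : TestTX d) (i : Fin d) :
    Continuous (momentumTest V χ i) := by
  have h1 := (∂_{((1 : ℝ), (0 : Sp d))} χ).continuous
  have h2 := χ.continuous
  have h3 : Continuous fun x => gradPot V x i := hV.continuous_fderiv_apply _
  have h4 : Continuous fun q : ℝ × Sp d × Sp d => (q.1, q.2.1) := by fun_prop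
  have h5 : Continuous fun q : ℝ × Sp d × Sp d => q.2.2 i := by fun_prop
  exact ((h1.comp h4).mul h5).sub ((h3.comp (by fun_prop)).mul (h2.comp h4))

theorem exists_bound_momentumTest (hV : IsC1Bounded V) (χ : TestTX d) (i : Fin d) :
    ∃ C T : ℝ, 0 ≤ C ∧ (∀ t x p, |momentumTest V χ i (t, x, p)| ≤ C * (1 + ‖p‖)) ∧
      ∀ t x p, T < ‖((t, x) : ℝ × Sp d)‖ → momentumTest V χ i (t, x, p) = 0 := by
  obtain ⟨M, R, hM0, hR0, hM, -, hR⟩ := exists_bound_testTX χ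
  obtain ⟨M', R', hM0', hR0', hM', -, hR'⟩ := exists_bound_testTX (∂_{((1 : ℝ), (0 : Sp d))} χ)
  obtain ⟨M₁, hM₁0, -, hM₁, -⟩ := hV.exists_bounds
  refine ⟨M' + d * M₁ * M, max R R', by positivity, fun t x p => ?_, fun t x p ht => ?_⟩
  · have h1 : |(∂_{((1 : ℝ), (0 : Sp d))} χ) (t, x) * p i| ≤ M' * ‖p‖ := by
      rw [abs_mul]
      exact mul_le_mul (hM' _) (abs_apply_le_norm p i) (abs_nonneg _) hM0'
    have h2 : |gradPot V x i * χ (t, x)| ≤ d * M₁ * M := by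
      rw [abs_mul]
      exact mul_le_mul ((abs_apply_le_norm _ i).trans (norm_gradPot_le hM₁ x)) (hM _)
        (abs_nonneg _) (by positivity)
    refine (abs_sub _ _).trans ((add_le_add h1 h2).trans ?_)
    have e1 : 0 ≤ d * M₁ * M * ‖p‖ := by positivity
    linarith
  · simp only [momentumTest]
    rw [hR _ ((le_max_left R R').trans_lt ht), hR' _ ((le_max_right R R').trans_lt ht)]
    ring

theorem one_add_le_sq (r : ℝ) : 1 + r ≤ 2 * (1 + r ^ 2) := by nlinarith [sq_nonneg (r - 1)]

theorem RegSol.moment_momentumTest (h : RegSol V ε ψ ψ' b b' c) (hV : IsC1Bounded V)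
    (χ : TestTX d) (i : Fin d) :
    (∀ t, Integrable (fun z => momentumTest V χ i (t, z)) (bohmianMeasure ε (ψ t))) ∧
      (Integrable fun t => ∫ z, momentumTest V χ i (t, z) ∂(bohmianMeasure ε (ψ t))) ∧
      ∀ t, ∫ z, momentumTest V χ i (t, z) ∂(bohmianMeasure ε (ψ t)) =
        ∫ x, rho (part none (tuple (fullJet ψ ψ' b b' c t) x)) *
          momentumTest V χ i (t, x, vel ε 0 (part none (tuple (fullJet ψ ψ' b b' c t) x))) := by
  obtain ⟨C, T, hC0, hC, hT⟩ := exists_bound_momentumTest hV χ i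
  refine h.moment (continuous_momentumTest hV χ i) (C := 2 * C) (T := T) (fun t x p => ?_)
    (fun t x p ht => hT t x p (ht.trans_le (abs_fst_le t x)))
  calc _ ≤ C * (1 + ‖p‖) := hC t x p
    _ ≤ C * (2 * (1 + ‖p‖ ^ 2)) := mul_le_mul_of_nonneg_left (one_add_le_sq _) hC0
    _ = _ := by ring

/-- The time derivative of the current of a solution. -/
theorem dmom_eq_of_equation {a a' bi bi' l m : ℂ} {ε v vi : ℝ}
    (h0 : Complex.I * ε * a' = -((ε : ℂ) ^ 2 / 2) * l + v * a)
    (h1 : Complex.I * ε * bi' = -((ε : ℂ) ^ 2 / 2) * m + v * bi + vi * a) :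
    ε * ((starRingEnd ℂ) a' * bi + (starRingEnd ℂ) a * bi').im =
      ε ^ 2 / 2 * (((starRingEnd ℂ) a * m).re - ((starRingEnd ℂ) l * bi).re) - vi * ‖a‖ ^ 2 := by
  have e0r := congrArg Complex.re h0
  have e0i := congrArg Complex.im h0
  have e1r := congrArg Complex.re h1
  have e1i := congrArg Complex.im h1
  have hsq : ‖a‖ ^ 2 = a.re ^ 2 + a.im ^ 2 := by
    rw [← Complex.normSq_eq_norm_sq, Complex.normSq_apply]; ring
  have hs : ((ε : ℂ) ^ 2 / 2) = ((ε ^ 2 / 2 : ℝ) : ℂ) := by push_cast; rfl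
  rw [hs] at e0r e0i e1r e1i
  rw [hsq]
  simp only [Complex.add_re, Complex.add_im, Complex.mul_re, Complex.mul_im, Complex.neg_re,
    Complex.neg_im, Complex.I_re, Complex.I_im, Complex.ofReal_re, Complex.ofReal_im,
    Complex.conj_re, Complex.conj_im] at *
  linear_combination bi.re * e0r + bi.im * e0i - a.re * e1r - a.im * e1i

/-- The integrand is the time derivative of `∫ χ J_i dx`, which has compact support in time. The
dispersive part of `∂_t J_i` is put in divergence form by `pairR_dispersion`. -/
theorem RegSol.momentum_balance (h : RegSol V ε ψ ψ' b b' c) (hV : IsC1Bounded V)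
    (χ : TestTX d) (i : Fin d) :
    ∫ t, ((∫ z, momentumTest V χ i (t, z) ∂(bohmianMeasure ε (ψ t))) +
      (ε ^ 2 * (∑ k, pairR (fun x => (∂_{((0 : ℝ), basisVec k)} χ) (t, x)) (b i t) (b k t)) +
      ε ^ 2 / 2 * ∑ k, pairR (fun x => (∂_{((0 : ℝ), basisVec k)}
        (∂_{((0 : ℝ), basisVec i)} χ)) (t, x)) (ψ t) (b k t))) = 0 := by
  have hχ : ContDiff ℝ (⊤ : ℕ∞) χ := χ.contDiff
  obtain ⟨M, R, hM0, hR0, hM, hM', hR⟩ := exists_bound_testTX χ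
  have hK := quadConst_nonneg d ε
  set G : (ℝ × Sp d) × St d → ℝ := fun q => χ q.1 * wt ε (some i) q.2 with hGdef
  have hGc : ContDiff ℝ (⊤ : ℕ∞) G :=
    (hχ.comp contDiff_fst).mul ((contDiff_wt ε (some i)).comp contDiff_snd)
  have hG : ∀ q, HasFDerivAt G (fderiv ℝ G q) q := fun q =>
    (hGc.differentiable (by simp) q).hasFDerivAt
  have hG' : ∀ y z v w, fderiv ℝ G (y, z) (v, w) =
      fderiv ℝ χ y v * wt ε (some i) z + χ y * dwt ε (some i) z w := by
    intro y z v w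
    rw [← (hGc.differentiable (by simp) (y, z)).lineDeriv_eq_fderiv]
    refine HasLineDerivAt.lineDeriv ?_
    have a1 : HasDerivAt (fun r : ℝ => χ (y + r • v)) (fderiv ℝ χ y v) 0 :=
      ((hχ.differentiable (by simp) y).hasFDerivAt).hasLineDerivAt v
    have a2 := a1.fun_mul (hasDerivAt_wt_line ε (some i) z w)
    simpa [HasLineDerivAt, hGdef] using a2
  have hC : ∀ y z v w, |fderiv ℝ G (y, z) (v, w)| ≤
      (M * quadConst d ε) * (‖z‖ ^ 2 * ‖v‖ + ‖z‖ * ‖w‖) := by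
    intro y z v w
    rw [hG']
    have h1 : |fderiv ℝ χ y v * wt ε (some i) z| ≤ M * ‖v‖ * (quadConst d ε * ‖z‖ ^ 2) := by
      rw [abs_mul]
      refine mul_le_mul (((fderiv ℝ χ y).le_opNorm v).trans ?_) (abs_wt_le ε _ z) (abs_nonneg _)
        (by positivity)
      gcongr
      exact hM' y
    have h2 : |χ y * dwt ε (some i) z w| ≤ M * (quadConst d ε * (‖z‖ * ‖w‖)) := by
      rw [abs_mul]
      exact mul_le_mul (hM y) (abs_dwt_le ε _ z w) (abs_nonneg _) hM0
    refine (abs_add_le _ _).trans ((add_le_add h1 h2).trans (le_of_eq ?_))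
    ring
  have hwt0 : wt ε (some i) (0 : St d) = 0 := wt_eq_zero (by simp [rho]) ε _
  set Zs : ℝ → Lp (St d) 2 (volume : Measure (Sp d)) :=
    fun t => tuple (stOf (ψ t) fun j => b j t) with hZs
  set W : ℝ → Lp (St d) 2 (volume : Measure (Sp d)) :=
    fun t => tuple (stOf (ψ' t) fun j => b' j t) with hW
  have hdt : ∀ t, HasDerivAt Zs (W t) t := fun t =>
    hasDerivAt_tuple (f := fun r t => stOf (ψ t) (fun j => b j t) r) fun r => by
      rcases r with _ | j
      · exact h.hasDerivAt t
      · exact h.hasDerivAt_b j t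
  have hcont : ∀ t : ℝ, Continuous fun x : Sp d => (t, x) := fun t => by fun_prop
  set F : ℝ → ℝ := fun t => ∫ x, G ((t, x), Zs t x) with hF
  obtain ⟨m1, m2, m3⟩ := h.moment_momentumTest hV χ i
  have hFD : ∀ t, HasDerivAt F ((∫ z, momentumTest V χ i (t, z) ∂(bohmianMeasure ε (ψ t))) +
      (ε ^ 2 * (∑ k, pairR (fun x => (∂_{((0 : ℝ), basisVec k)} χ) (t, x)) (b i t) (b k t)) +
      ε ^ 2 / 2 * ∑ k, pairR (fun x => (∂_{((0 : ℝ), basisVec k)}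
        (∂_{((0 : ℝ), basisVec i)} χ)) (t, x)) (ψ t) (b k t))) t := by
    intro t
    have h1 := hasDerivAt_integral_comp hG hC (fun y => by simp [hGdef, hwt0])
      (ι := fun x => (t, x)) (hcont t).aestronglyMeasurable ((1 : ℝ), (0 : Sp d))
      (Z := fun s => Zs (t + s)) (W := W t) (by
        have := hdt t
        exact HasDerivAt.comp_const_add (f := Zs) t 0 (by simpa using this))
    have h2 : HasDerivAt F (∫ x, fderiv ℝ G ((t, x), Zs t x) ((1, 0), W t x)) t := by
      have h3 : HasDerivAt (fun s => ∫ x, G ((t, x) + s • ((1 : ℝ), (0 : Sp d)), Zs (t + s) x))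
          (∫ x, fderiv ℝ G ((t, x), Zs t x) ((1, 0), W t x)) (t - t) := by
        simpa only [sub_self, add_zero] using h1
      have h4 := HasDerivAt.comp_sub_const t t h3
      refine h4.congr_of_eventuallyEq (Eventually.of_forall fun s => ?_)
      simp [hF]
    refine h2.congr_deriv ?_
    choose m hm hm' using fun j => h.lap j t
    have hχt := isC1Bounded_slice χ t
    have hχi : IsC1Bounded fun x => fderiv ℝ (fun x => χ (t, x)) x (basisVec i) := by
      simp only [fderiv_slice]
      exact isC1Bounded_slice _ t
    have hdisp := pairR_dispersion (c := fun k j => c k j t) (fun j => h.dir j t)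
      (fun k j => h.dir₂ k j t) (fun k j => h.symm k j t) hm hχt i hχi
    simp only [fderiv_slice] at hdisp
    obtain ⟨B, -, hB, -⟩ := hχt.exists_bounds
    have hi1 := integrable_pairR hχt.1.continuous hB (ψ t) (m i)
    have hi2 := integrable_pairR hχt.1.continuous hB (∑ k, c k k t) (b i t)
    have hi3 : Integrable fun x => rho (part none (tuple (fullJet ψ ψ' b b' c t) x)) *
        momentumTest V χ i (t, x, vel ε 0 (part none (tuple (fullJet ψ ψ' b b' c t) x))) := by
      have hi4 := (integrable_bohmianMeasure_iff (fun j => h.dir j t) ε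
        (m1 t).aestronglyMeasurable).1 (m1 t)
      refine hi4.congr ?_
      filter_upwards [h.density_velocity t] with x hx
      rw [hx.1, hx.2]
    have hi5 : Integrable fun x => χ (t, x) * ((starRingEnd ℂ) (ψ t x) * m i x).re -
        χ (t, x) * ((starRingEnd ℂ) ((∑ k, c k k t : L2 d) x) * b i t x).re := hi1.sub hi2
    -- The derivative of `χ J_i` splits into the momentum and force terms seen by the Bohmian
    -- measure, and the dispersive terms `Re (conj ψ ∂_iΔψ) - Re (conj Δψ ∂_iψ)`.
    have key : ∫ x, fderiv ℝ G ((t, x), Zs t x) ((1, 0), W t x) =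
        ∫ x, (rho (part none (tuple (fullJet ψ ψ' b b' c t) x)) *
          momentumTest V χ i (t, x, vel ε 0 (part none (tuple (fullJet ψ ψ' b b' c t) x))) +
          ε ^ 2 / 2 * (χ (t, x) * ((starRingEnd ℂ) (ψ t x) * m i x).re -
            χ (t, x) * ((starRingEnd ℂ) ((∑ k, c k k t : L2 d) x) * b i t x).re)) := by
      refine integral_congr_ae ?_
      filter_upwards [part_fullJet (ψ := ψ) (ψ' := ψ') (b := b) (b' := b') (c := c) t, h.eq t, hm' i,
        coeFn_sum Finset.univ fun k => c k k t, coeFn_tuple (stOf (ψ t) fun j => b j t),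
        coeFn_tuple (stOf (ψ' t) fun j => b' j t)] with x hp heq hmi hs hz hw
      have hz' : Zs t x = part none (tuple (fullJet ψ ψ' b b' c t) x) := by
        rw [hp.1]; exact funext hz
      have hw' : W t x = fun r => stOf (ψ' t) (fun j => b' j t) r x := funext hw
      rw [hG', hw', hz']
      set z := part none (tuple (fullJet ψ ψ' b b' c t) x) with hzdef
      have hmom : rho z * vel ε 0 z i = mom ε z i := by
        by_cases hz : rho z = 0
        · rw [hz, zero_mul, mom_eq_zero hz]; rfl
        · rw [vel, add_zero, PiLp.smul_apply, smul_eq_mul, mul_inv_cancel_left₀ hz]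
      have hd := dmom_eq_of_equation (l := (∑ k, c k k t : L2 d) x) (by rw [hs]; exact heq) hmi
      have hdw : dwt ε (some i) z (fun r => stOf (ψ' t) (fun j => b' j t) r x) =
          ε ^ 2 / 2 * (((starRingEnd ℂ) (ψ t x) * m i x).re -
            ((starRingEnd ℂ) ((∑ k, c k k t : L2 d) x) * b i t x).re) -
            fderiv ℝ V x (basisVec i) * rho z := by
        rw [hp.1]
        exact hd
      rw [hdw]
      simp only [momentumTest, wt]
      rw [← hmom, lineDerivOp_test_apply]
      simp only [gradPot]
      ring
    rw [key, integral_add hi3 (hi5.const_mul _), integral_const_mul,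
      integral_sub hi1 hi2, ← m3 t]
    change _ + ε ^ 2 / 2 * (pairR _ _ _ - pairR _ _ _) = _
    rw [hdisp]
    ring
  have hcs : ∀ g : ℝ → ℝ, (∀ t, R < |t| → g t = 0) → HasCompactSupport g := fun g hg =>
    HasCompactSupport.intro (isCompact_Icc (a := -R) (b := R)) fun t ht => hg t (by
      by_contra hlt
      push Not at hlt
      exact ht (abs_le.1 hlt))
  have hFc : Continuous F := continuous_iff_continuousAt.2 fun t => (hFD t).continuousAt
  have hψc : Continuous ψ := continuous_iff_continuousAt.2 fun t => (h.hasDerivAt t).continuousAt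
  have hbc : ∀ j, Continuous (b j) := fun j =>
    continuous_iff_continuousAt.2 fun t => (h.hasDerivAt_b j t).continuousAt
  have hpi : ∀ (η : TestTX d) {f g : ℝ → L2 d}, Continuous f → Continuous g →
      Integrable fun t => pairR (fun x => η (t, x)) (f t) (g t) := by
    intro η f g hf hg
    obtain ⟨M, T, -, -, hM, -, hT⟩ := exists_bound_testTX η
    refine (continuous_pairR (χ := η) η.continuous hM hf hg).integrable_of_hasCompactSupport ?_
    refine HasCompactSupport.intro (isCompact_Icc (a := -T) (b := T)) fun t ht => ?_
    have : T < |t| := by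
      by_contra hlt
      push Not at hlt
      exact ht (abs_le.1 hlt)
    simp [pairR, fun x => hT (t, x) (this.trans_le (abs_fst_le t x))]
  refine integral_eq_zero_of_hasDerivAt_of_integrable hFD (m2.add (Integrable.add ?_ ?_))
    (hFc.integrable_of_hasCompactSupport (hcs F fun t ht => ?_))
  · exact (integrable_finsetSum _ fun k _ => hpi _ (hbc i) (hbc k)).const_mul _
  · exact (integrable_finsetSum _ fun k _ => hpi _ hψc (hbc k)).const_mul _
  · simp [hF, hGdef, fun x => hR (t, x) (ht.trans_le (abs_fst_le t x))]

end Momentum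

end Bohm

namespace Bohm

/-! ### Stress tensors, mass and kinetic energy -/

section Stress

variable {d : ℕ} {V : Sp d → ℝ} {ε : ℝ} {ψ ψ' : ℝ → L2 d} {b b' : Fin d → ℝ → L2 d}
  {c : Fin d → Fin d → ℝ → L2 d}

/-- The second moment test function `p_i p_j χ(t, x)`. -/
noncomputable def stressTest (χ : TestTX d) (i j : Fin d) (q : ℝ × Sp d × Sp d) : ℝ :=
  q.2.2 i * q.2.2 j * χ (q.1, q.2.1)

theorem continuous_stressTest (χ : TestTX d) (i j : Fin d) : Continuous (stressTest χ i j) := by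
  have h2 := χ.continuous
  have h4 : Continuous fun q : ℝ × Sp d × Sp d => (q.1, q.2.1) := by fun_prop
  exact Continuous.mul (by fun_prop) (h2.comp h4)

theorem exists_bound_stressTest (χ : TestTX d) (i j : Fin d) :
    ∃ C T : ℝ, 0 ≤ C ∧ (∀ t x p, |stressTest χ i j (t, x, p)| ≤ C * (1 + ‖p‖ ^ 2)) ∧
      ∀ t x p, T < ‖((t, x) : ℝ × Sp d)‖ → stressTest χ i j (t, x, p) = 0 := by
  obtain ⟨M, R, hM0, hR0, hM, -, hR⟩ := exists_bound_testTX χ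
  refine ⟨M, R, hM0, fun t x p => ?_, fun t x p ht => ?_⟩
  · simp only [stressTest]
    rw [abs_mul, abs_mul, mul_comm]
    refine mul_le_mul (hM _) ?_ (by positivity) hM0
    nlinarith [mul_le_mul (abs_apply_le_norm p i) (abs_apply_le_norm p j) (abs_nonneg _)
      (norm_nonneg p)]
  · simp only [stressTest]
    rw [hR _ ht, mul_zero]

theorem RegSol.moment_stressTest (h : RegSol V ε ψ ψ' b b' c) (χ : TestTX d) (i j : Fin d) :
    (∀ t, Integrable (fun z => stressTest χ i j (t, z)) (bohmianMeasure ε (ψ t))) ∧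
      (Integrable fun t => ∫ z, stressTest χ i j (t, z) ∂(bohmianMeasure ε (ψ t))) := by
  obtain ⟨C, T, hC0, hC, hT⟩ := exists_bound_stressTest χ i j
  obtain ⟨h1, h2, -⟩ := h.moment (continuous_stressTest χ i j) hC (T := T)
    (fun t x p ht => hT t x p (ht.trans_le (abs_fst_le t x)))
  exact ⟨h1, h2⟩

theorem density_mul_velocity (f : Sp d → ℂ) (i j : Fin d) (x : Sp d) (r : ℝ) :
    density f x * (velocity ε f x i * velocity ε f x j * r) =
      current ε f i x * current ε f j x / density f x * r := by
  simp only [velocity]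
  rcases eq_or_ne (density f x) 0 with h | h
  · simp [h]
  · field_simp

theorem RegSol.stress_slice (h : RegSol V ε ψ ψ' b b' c) (χ : TestTX d) (i j : Fin d) (t : ℝ) :
    Integrable (fun x => current ε (ψ t) i x * current ε (ψ t) j x / density (ψ t) x *
        χ (t, x)) ∧
      ∫ z, stressTest χ i j (t, z) ∂(bohmianMeasure ε (ψ t)) =
        ∫ x, current ε (ψ t) i x * current ε (ψ t) j x / density (ψ t) x * χ (t, x) := by
  have h1 := (h.moment_stressTest χ i j).1 t
  have hd : ∀ j, HasDirDeriv (basisVec j) (ψ t) (b j t) := fun j => h.dir j t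
  have h2 := (integrable_bohmianMeasure_iff hd ε h1.aestronglyMeasurable).1 h1
  have h3 := integral_bohmianMeasure hd ε h1.aestronglyMeasurable
  simp only [stressTest, density_mul_velocity] at h2 h3 ⊢
  exact ⟨h2, h3⟩

theorem RegSol.convectiveStress_eq (h : RegSol V ε ψ ψ' b b' c) (χ : TestTX d) (i j : Fin d) :
    convectiveStress ε ψ i j χ =
      ∫ t, ∫ z, stressTest χ i j (t, z) ∂(bohmianMeasure ε (ψ t)) := by
  unfold convectiveStress
  simp only [fun t => (h.stress_slice χ i j t).2]

theorem RegSol.continuous_ψ (h : RegSol V ε ψ ψ' b b' c) : Continuous ψ :=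
  continuous_iff_continuousAt.2 fun t => (h.hasDerivAt t).continuousAt

theorem RegSol.continuous_b (h : RegSol V ε ψ ψ' b b' c) (j : Fin d) : Continuous (b j) :=
  continuous_iff_continuousAt.2 fun t => (h.hasDerivAt_b j t).continuousAt

theorem integrable_pairR_time (χ : TestTX d) {f g : ℝ → L2 d} (hf : Continuous f)
    (hg : Continuous g) : Integrable fun t => pairR (fun x => χ (t, x)) (f t) (g t) := by
  obtain ⟨M, T, -, -, hM, -, hT⟩ := exists_bound_testTX χ
  refine (continuous_pairR (χ := χ) χ.continuous hM hf hg).integrable_of_hasCompactSupport ?_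
  refine HasCompactSupport.intro (isCompact_Icc (a := -T) (b := T)) fun t ht => ?_
  have : T < |t| := by
    by_contra hlt
    push Not at hlt
    exact ht (abs_le.1 hlt)
  simp [pairR, fun x => hT (t, x) (this.trans_le (abs_fst_le t x))]

/-- Integrated form of the pointwise splitting of `ε² Re (conj ∂_iψ ∂_jψ)` into its phase and
amplitude parts. -/
theorem RegSol.total_stress (h : RegSol V ε ψ ψ' b b' c) (χ : TestTX d) (i j : Fin d) :
    ∫ t, ε ^ 2 * pairR (fun x => χ (t, x)) (b i t) (b j t) =
      convectiveStress ε ψ i j χ + quantumStress ε ψ i j χ := by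
  have h1 := (h.moment_stressTest χ i j).2
  simp only [fun t => (h.stress_slice χ i j t).2] at h1
  have h2 := (integrable_pairR_time χ (h.continuous_b i) (h.continuous_b j)).const_mul (ε ^ 2)
  have hslice : ∀ t, ε ^ 2 * pairR (fun x => χ (t, x)) (b i t) (b j t) =
      (∫ x, current ε (ψ t) i x * current ε (ψ t) j x / density (ψ t) x * χ (t, x)) +
      ∫ x, ε ^ 2 * (weakPartial i (sqrtDensity (ψ t)) x * weakPartial j (sqrtDensity (ψ t)) x) *
        χ (t, x) := by
    intro t
    obtain ⟨B, -, hB, -⟩ := (isC1Bounded_slice χ t).exists_bounds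
    have e0 := (h.stress_slice χ i j t).1
    have e1 := (integrable_pairR (isC1Bounded_slice χ t).1.continuous hB (b i t)
      (b j t)).const_mul (ε ^ 2)
    have e3 : (fun x => ε ^ 2 * (χ (t, x) * ((starRingEnd ℂ) (b i t x) * b j t x).re) -
        current ε (ψ t) i x * current ε (ψ t) j x / density (ψ t) x * χ (t, x)) =ᵐ[volume]
        fun x => ε ^ 2 * (weakPartial i (sqrtDensity (ψ t)) x *
          weakPartial j (sqrtDensity (ψ t)) x) * χ (t, x) := by
      filter_upwards [ae_stress_eq (b := fun j => b j t) (fun j => h.dir j t) ε i j] with x hx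
      linear_combination (-χ (t, x)) * hx
    rw [← integral_congr_ae e3, integral_sub e1 e0, integral_const_mul, pairR]
    ring
  have h3 : Integrable fun t => ∫ x, ε ^ 2 * (weakPartial i (sqrtDensity (ψ t)) x *
      weakPartial j (sqrtDensity (ψ t)) x) * χ (t, x) := by
    -- Integrability in time of the quantum stress is inherited from the total and the convective
    -- stress.
    refine (h2.sub h1).congr (ae_of_all _ fun t => ?_)
    simp only [Pi.sub_apply]
    rw [hslice t]
    ring
  simp only [hslice]
  rw [integral_add h1 h3]
  rfl

/-- The form in which the balance passes to the limit. In the last term one factor `ε` stays with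
`∂_kψ`, since `ε ∂_kψ` is bounded in `L²`, and the factor `ε/2` in front makes the term vanish. -/
theorem RegSol.momentum_stress (h : RegSol V ε ψ ψ' b b' c) (hV : IsC1Bounded V)
    (χ : TestTX d) (i : Fin d) :
    (∫ t, ∫ z, momentumTest V χ i (t, z) ∂(bohmianMeasure ε (ψ t))) +
      ∑ k, (convectiveStress ε ψ i k (∂_{((0 : ℝ), basisVec k)} χ) +
        quantumStress ε ψ i k (∂_{((0 : ℝ), basisVec k)} χ)) +
      ∑ k, ε / 2 * ∫ t, ε * pairR (fun x => (∂_{((0 : ℝ), basisVec k)}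
        (∂_{((0 : ℝ), basisVec i)} χ)) (t, x)) (ψ t) (b k t) = 0 := by
  have h0 := h.momentum_balance hV χ i
  have h1 := (h.moment_momentumTest hV χ i).2.1
  have h2 : ∀ k, Integrable fun t =>
      pairR (fun x => (∂_{((0 : ℝ), basisVec k)} χ) (t, x)) (b i t) (b k t) := fun k =>
    integrable_pairR_time _ (h.continuous_b i) (h.continuous_b k)
  have h3 : ∀ k, Integrable fun t => pairR (fun x => (∂_{((0 : ℝ), basisVec k)}
      (∂_{((0 : ℝ), basisVec i)} χ)) (t, x)) (ψ t) (b k t) := fun k =>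
    integrable_pairR_time _ h.continuous_ψ (h.continuous_b k)
  have i1 : Integrable fun t => ε ^ 2 * ∑ k,
      pairR (fun x => (∂_{((0 : ℝ), basisVec k)} χ) (t, x)) (b i t) (b k t) :=
    (integrable_finsetSum _ fun k _ => h2 k).const_mul _
  have i2 : Integrable fun t => ε ^ 2 / 2 * ∑ k, pairR (fun x => (∂_{((0 : ℝ), basisVec k)}
      (∂_{((0 : ℝ), basisVec i)} χ)) (t, x)) (ψ t) (b k t) :=
    (integrable_finsetSum _ fun k _ => h3 k).const_mul _
  have i3 : Integrable fun t => ε ^ 2 * (∑ k,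
      pairR (fun x => (∂_{((0 : ℝ), basisVec k)} χ) (t, x)) (b i t) (b k t)) +
      ε ^ 2 / 2 * ∑ k, pairR (fun x => (∂_{((0 : ℝ), basisVec k)}
      (∂_{((0 : ℝ), basisVec i)} χ)) (t, x)) (ψ t) (b k t) := i1.add i2
  rw [integral_add h1 i3, integral_add i1 i2, integral_const_mul, integral_const_mul,
    integral_finsetSum _ fun k _ => h2 k, integral_finsetSum _ fun k _ => h3 k, Finset.mul_sum,
    Finset.mul_sum] at h0
  simp only [← h.total_stress, integral_const_mul]
  refine Eq.trans ?_ h0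
  rw [add_assoc]
  congr 2
  exact Finset.sum_congr rfl fun k _ => by ring

theorem pairR_smul (η : Sp d → ℝ) (f g : L2 d) (r : ℝ) :
    pairR η f (r • g) = r * pairR η f g := by
  unfold pairR
  rw [← integral_const_mul]
  refine integral_congr_ae ?_
  filter_upwards [Lp.coeFn_smul r g] with x hx
  rw [hx, Pi.smul_apply, Complex.real_smul, mul_left_comm, Complex.re_ofReal_mul]
  ring

theorem bohmianMeasure_univ {ψ : L2 d} {b : Fin d → L2 d}
    (hb : ∀ j, HasDirDeriv (basisVec j) ψ (b j)) (ε : ℝ) :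
    bohmianMeasure ε ψ Set.univ = ENNReal.ofReal (‖ψ‖ ^ 2) := by
  rw [bohmianMeasure, Measure.map_apply_of_aemeasurable (aemeasurable_graph hb ε) MeasurableSet.univ,
    Set.preimage_univ, withDensity_apply _ MeasurableSet.univ, Measure.restrict_univ]
  change ∫⁻ x, ENNReal.ofReal (‖ψ x‖ ^ 2) = _
  rw [← ofReal_integral_eq_lintegral_ofReal (integrable_norm_sq ψ)
      (ae_of_all _ fun x => by positivity), integral_norm_sq]

/-- The kinetic energy bounds the second moment of the Bohmian measure. -/
theorem second_moment_bohmianMeasure {ψ : L2 d} {b : Fin d → L2 d}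
    (hb : ∀ j, HasDirDeriv (basisVec j) ψ (b j)) (ε : ℝ) :
    Integrable (fun z : Sp d × Sp d => ‖z.2‖ ^ 2) (bohmianMeasure ε ψ) ∧
      ∫ z, ‖z.2‖ ^ 2 ∂(bohmianMeasure ε ψ) ≤ ε ^ 2 * ∑ j, ‖b j‖ ^ 2 := by
  have hm : AEStronglyMeasurable (fun z : Sp d × Sp d => ‖z.2‖ ^ 2) (bohmianMeasure ε ψ) :=
    (by fun_prop : Continuous fun z : Sp d × Sp d => ‖z.2‖ ^ 2).aestronglyMeasurable
  have hi : Integrable fun x => ε ^ 2 * ∑ j, ‖b j x‖ ^ 2 :=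
    (integrable_finsetSum _ fun j _ => integrable_norm_sq (b j)).const_mul _
  have hbd : ∀ᵐ x, density ψ x * ‖velocity ε ψ x‖ ^ 2 ≤ ε ^ 2 * ∑ j, ‖b j x‖ ^ 2 := by
    filter_upwards [ae_all_iff.2 fun j => (hb j).current_eq ε] with x hx
    rw [EuclideanSpace.norm_sq_eq, Finset.mul_sum, Finset.mul_sum]
    refine Finset.sum_le_sum fun j _ => ?_
    simp only [velocity, density, hx]
    rcases eq_or_ne (ψ x) 0 with h0 | h0
    · rw [h0]; simp; positivity
    · have hn : 0 < ‖ψ x‖ := norm_pos_iff.2 h0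
      rw [Real.norm_eq_abs, sq_abs, div_pow, mul_pow, mul_div_assoc', div_le_iff₀ (by positivity)]
      have h1 := abs_conj_mul_im_le (ψ x) (b j x)
      have h2 : ((starRingEnd ℂ) (ψ x) * b j x).im ^ 2 ≤ (‖ψ x‖ * ‖b j x‖) ^ 2 := by
        rw [← sq_abs]; gcongr
      calc _ ≤ ‖ψ x‖ ^ 2 * (ε ^ 2 * (‖ψ x‖ * ‖b j x‖) ^ 2) := by gcongr
        _ = _ := by ring
  have hint : Integrable fun x => density ψ x * ‖velocity ε ψ x‖ ^ 2 := by
    refine hi.mono' ?_ (hbd.mono fun x hx => ?_)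
    · exact ((aemeasurable_density ψ).mul
        ((aemeasurable_velocity hb ε).norm.pow_const 2)).aestronglyMeasurable
    · rw [Real.norm_of_nonneg (by unfold density; positivity)]
      exact hx
  refine ⟨(integrable_bohmianMeasure_iff hb ε hm).2 hint, ?_⟩
  rw [integral_bohmianMeasure hb ε hm]
  refine (integral_mono_ae hint hi hbd).trans (le_of_eq ?_)
  rw [integral_const_mul, integral_finsetSum _ fun j _ => integrable_norm_sq (b j)]
  simp only [integral_norm_sq]

/-- The potential energy of a normalised state is at least `-M`, so an upper bound on the energy
bounds the kinetic part. -/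
theorem kinetic_le {ψ : L2 d} {b : Fin d → L2 d} (hb : ∀ j, HasDirDeriv (basisVec j) ψ (b j))
    {M K : ℝ} (hM : ∀ x, |V x| ≤ M) (hψ : ‖ψ‖ = 1) (hE : energy V ε ψ ≤ K) :
    ε ^ 2 * ∑ j, ‖b j‖ ^ 2 ≤ 2 * (K + M) := by
  have h1 : ∫ x, ∑ i : Fin d, ‖weakPartial i ψ x‖ ^ 2 = ∑ j, ‖b j‖ ^ 2 := by
    have : (fun x => ∑ i : Fin d, ‖weakPartial i ψ x‖ ^ 2) =ᵐ[volume]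
        fun x => ∑ i : Fin d, ‖b i x‖ ^ 2 := by
      filter_upwards [ae_all_iff.2 fun j => (hb j).weakPartial_eq] with x hx
      simp only [hx]
    rw [integral_congr_ae this, integral_finsetSum _ fun j _ => integrable_norm_sq (b j)]
    simp only [integral_norm_sq]
  have h2 : |∫ x, V x * ‖ψ x‖ ^ 2| ≤ M := by
    have h3 : ∫ x, M * ‖ψ x‖ ^ 2 = M := by
      rw [integral_const_mul, integral_norm_sq, hψ]; ring
    rw [← h3, ← Real.norm_eq_abs]
    refine norm_integral_le_of_norm_le ((integrable_norm_sq ψ).const_mul M)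
      (ae_of_all _ fun x => ?_)
    rw [Real.norm_eq_abs, abs_mul, abs_of_nonneg (by positivity : (0 : ℝ) ≤ ‖ψ x‖ ^ 2)]
    gcongr
    exact hM x
  rw [energy, h1] at hE
  have := (abs_le.1 h2).1
  linarith

end Stress

end Bohm

namespace Bohm

/-! ### Uniform moment bounds -/

section MomentBounds

variable {d : ℕ} {V : Sp d → ℝ} {ε : ℝ} {ψ ψ' : ℝ → L2 d} {b b' : Fin d → ℝ → L2 d}
  {c : Fin d → Fin d → ℝ → L2 d}

/-- A curve of probability measures on phase space whose second momentum moments are at most `K`,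
and which can be tested against continuous functions of quadratic growth in the momentum that are
supported in a bounded time interval. -/
structure MomentBounded (μ : ℝ → Measure (Sp d × Sp d)) (K : ℝ) : Prop where
  univ_eq : ∀ t, μ t Set.univ = 1
  integrable_sq : ∀ t, Integrable (fun z : Sp d × Sp d => ‖z.2‖ ^ 2) (μ t)
  integral_sq_le : ∀ t, ∫ z, ‖z.2‖ ^ 2 ∂(μ t) ≤ K
  integrable : ∀ {Θ : ℝ × Sp d × Sp d → ℝ}, Continuous Θ → ∀ {C T : ℝ},
    (∀ t x p, |Θ (t, x, p)| ≤ C * (1 + ‖p‖ ^ 2)) → (∀ t x p, T < |t| → Θ (t, x, p) = 0) →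
    Integrable fun t => ∫ z, Θ (t, z) ∂(μ t)

theorem RegSol.momentBounded (h : RegSol V ε ψ ψ' b b' c) {K M : ℝ} (hM : ∀ x, |V x| ≤ M)
    (hψ : ∀ t, ‖ψ t‖ = 1) (hE : ∀ t, energy V ε (ψ t) ≤ K) :
    MomentBounded (fun t => bohmianMeasure ε (ψ t)) (2 * (K + M)) where
  univ_eq t := by
    rw [bohmianMeasure_univ (b := fun j => b j t) (fun j => h.dir j t), hψ]
    simp
  integrable_sq t := (second_moment_bohmianMeasure (b := fun j => b j t) (fun j => h.dir j t) ε).1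
  integral_sq_le t :=
    (second_moment_bohmianMeasure (b := fun j => b j t) (fun j => h.dir j t) ε).2.trans
      (kinetic_le (b := fun j => b j t) (fun j => h.dir j t) hM (hψ t) (hE t))
  integrable hΘ _ _ hC hT := (h.moment hΘ hC hT).2.1

/-- The dispersive correction in the momentum balance is of order `ε`. -/
theorem exists_dispersion_bound (χ : TestTX d) (K : ℝ) :
    ∃ D : ℝ, ∀ ε : ℝ, 0 ≤ ε → ∀ ψ b : ℝ → L2 d, (∀ t, ‖ψ t‖ = 1) →
      (∀ t, ε ^ 2 * ‖b t‖ ^ 2 ≤ K) →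
      |ε / 2 * ∫ t, ε * pairR (fun x => χ (t, x)) (ψ t) (b t)| ≤ D * ε := by
  obtain ⟨M, T, hM0, -, hM, -, hT⟩ := exists_bound_testTX χ
  -- At each time the pairing of `ψ` with `εb` is at most `M(‖ψ‖² + ‖εb‖²) ≤ M(1 + K)`; the
  -- denominator `2` comes from the prefactor `ε/2`.
  refine ⟨(∫ t, (Set.Icc (-T) T).indicator (fun _ => M * (1 + K)) t) / 2,
    fun ε hε ψ b hψ hb => ?_⟩
  have hI : |∫ t, ε * pairR (fun x => χ (t, x)) (ψ t) (b t)| ≤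
      ∫ t, (Set.Icc (-T) T).indicator (fun _ => M * (1 + K)) t := by
    rw [← Real.norm_eq_abs]
    refine norm_integral_le_of_norm_le
      ((integrableOn_const (by simp)).integrable_indicator measurableSet_Icc)
      (ae_of_all _ fun t => ?_)
    by_cases ht : t ∈ Set.Icc (-T) T
    · rw [Set.indicator_of_mem ht, ← pairR_smul, Real.norm_eq_abs]
      refine (abs_pairR_le (fun x => hM _) _ _).trans ?_
      rw [hψ, norm_smul, mul_pow, Real.norm_eq_abs, sq_abs, one_pow]
      have := hb t
      gcongr
    · rw [Set.indicator_of_notMem ht]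
      have : T < |t| := by
        by_contra hlt
        push Not at hlt
        exact ht (abs_le.1 hlt)
      simp [pairR, fun x => hT (t, x) (this.trans_le (abs_fst_le t x))]
  rw [abs_mul, abs_of_nonneg (by positivity : 0 ≤ ε / 2)]
  calc _ ≤ ε / 2 * ∫ t, (Set.Icc (-T) T).indicator (fun _ => M * (1 + K)) t := by gcongr
    _ = _ := by ring

end MomentBounds

end Bohm

namespace Bohm

/-! ### The limit measure on time and phase space -/

section SpaceTime

variable {d : ℕ} {β : ℝ → Measure (Sp d × Sp d)} {B : Measure (ℝ × Sp d × Sp d)}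

/-- `B` is a version of the measure `β(t, dx, dp) dt`. -/
structure IsSpaceTimeMeasure (β : ℝ → Measure (Sp d × Sp d))
    (B : Measure (ℝ × Sp d × Sp d)) : Prop where
  locallyFinite : IsLocallyFiniteMeasure B
  integral_eq : ∀ {f : ℝ × Sp d × Sp d → ℝ}, Integrable f B →
    ∫ q, f q ∂B = ∫ t, ∫ z, f (t, z) ∂(β t)

/-- After a change on a null set of times, `β` becomes a finite kernel; composing it with Lebesgue
measure in time gives a measure finite on bounded time slabs. -/
theorem IsLinftyMeasure.exists_spaceTime (hβ : IsLinftyMeasure β) :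
    ∃ B, IsSpaceTimeMeasure β B := by
  obtain ⟨hm, M, hM, hle⟩ := hβ
  classical
  have hs : MeasurableSet {t | hm.mk β t Set.univ ≤ M} :=
    measurableSet_le ((Measure.measurable_coe MeasurableSet.univ).comp hm.measurable_mk)
      measurable_const
  -- Where the mass bound fails, on a null set, the measure is set to zero, so that the bound holds
  -- at every time.
  let κ : ProbabilityTheory.Kernel ℝ (Sp d × Sp d) :=
    ⟨fun t => if t ∈ {t | hm.mk β t Set.univ ≤ M} then hm.mk β t else 0,
      Measurable.ite hs hm.measurable_mk measurable_const⟩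
  have hκM : ∀ t, κ t Set.univ ≤ M := by
    intro t
    change (if t ∈ {t | hm.mk β t Set.univ ≤ M} then hm.mk β t else 0) Set.univ ≤ M
    split_ifs with h
    · exact h
    · simp
  have hfin : ProbabilityTheory.IsFiniteKernel κ := ⟨M, hM, hκM⟩
  have hae : ∀ᵐ t, κ t = β t := by
    filter_upwards [hm.ae_eq_mk, hle] with t h1 h2
    change (if t ∈ {t | hm.mk β t Set.univ ≤ M} then hm.mk β t else 0) = β t
    rw [if_pos, h1]
    change hm.mk β t Set.univ ≤ M
    rwa [← h1]
  refine ⟨(volume : Measure ℝ).compProd κ, ⟨⟨fun q => ⟨Metric.ball q.1 1 ×ˢ Set.univ,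
    prod_mem_nhds (Metric.ball_mem_nhds _ one_pos) univ_mem, ?_⟩⟩, fun hf => ?_⟩⟩
  · rw [Measure.compProd_apply_prod Metric.isOpen_ball.measurableSet MeasurableSet.univ]
    refine (lintegral_mono fun t => hκM t).trans_lt ?_
    rw [setLIntegral_const]
    exact ENNReal.mul_lt_top hM measure_ball_lt_top
  · rw [Measure.integral_compProd hf]
    refine integral_congr_ae ?_
    filter_upwards [hae] with t ht
    rw [ht]

/-- Uniform continuity makes the slices depend continuously on time in the sup norm; with compact
support in time this gives an element of `L¹(ℝ; C₀)`, the test space of the weak-* convergence. -/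
theorem exists_zeroAtInfty_slices {Θ : ℝ × Sp d × Sp d → ℝ} (hΘ : Continuous Θ)
    (hc : HasCompactSupport Θ) :
    ∃ g : ℝ → C₀(Sp d × Sp d, ℝ), Integrable g ∧ ∀ t z, g t z = Θ (t, z) := by
  have hsl : ∀ t, HasCompactSupport fun z => Θ (t, z) := fun t =>
    HasCompactSupport.intro (hc.isCompact.image continuous_snd) fun z hz =>
      image_eq_zero_of_notMem_tsupport fun h => hz ⟨_, h, rfl⟩
  let g : ℝ → C₀(Sp d × Sp d, ℝ) := fun t =>
    ⟨⟨fun z => Θ (t, z), hΘ.comp (by fun_prop)⟩,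
      (hsl t).is_zero_at_infty⟩
  have hg : ∀ t z, g t z = Θ (t, z) := fun t z => rfl
  refine ⟨g, ?_, hg⟩
  have hu := hc.uniformContinuous_of_continuous hΘ
  have hcont : Continuous g := by
    rw [continuous_iff_continuousAt]
    intro t
    rw [ContinuousAt, ZeroAtInftyContinuousMap.tendsto_iff_tendstoUniformly,
      Metric.tendstoUniformly_iff]
    intro δ hδ
    obtain ⟨r, hr, H⟩ := Metric.uniformContinuous_iff.1 hu δ hδ
    filter_upwards [Metric.ball_mem_nhds t hr] with s hs z
    rw [hg, hg]
    refine H ?_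
    rw [Prod.dist_eq, dist_self, max_eq_left dist_nonneg, dist_comm]
    exact hs
  refine hcont.integrable_of_hasCompactSupport ?_
  refine HasCompactSupport.intro (hc.isCompact.image continuous_fst) fun t ht => ?_
  ext z
  rw [hg, ZeroAtInftyContinuousMap.zero_apply]
  exact image_eq_zero_of_notMem_tsupport fun h => ht ⟨_, h, rfl⟩

theorem TendstoWeakStar.tendsto_of_hasCompactSupport {μ : ℕ → ℝ → Measure (Sp d × Sp d)}
    (hμ : TendstoWeakStar μ β) (hB : IsSpaceTimeMeasure β B) {Θ : ℝ × Sp d × Sp d → ℝ}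
    (hΘ : Continuous Θ) (hc : HasCompactSupport Θ) :
    Tendsto (fun n => ∫ t, ∫ z, Θ (t, z) ∂(μ n t)) atTop (𝓝 (∫ q, Θ q ∂B)) := by
  have := hB.locallyFinite
  obtain ⟨g, hg, h⟩ := exists_zeroAtInfty_slices hΘ hc
  have h1 := hμ g hg
  simp only [h] at h1
  rwa [hB.integral_eq (hΘ.integrable_of_hasCompactSupport hc)]

theorem continuous_transportField {V : Sp d → ℝ} (hV : IsC1Bounded V) :
    Continuous fun q : ℝ × Sp d × Sp d => (-(1, q.2.2, -gradPot V q.2.1) : ℝ × Sp d × Sp d) := by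
  have h := (continuous_gradPot hV).comp
    (continuous_fst.comp continuous_snd : Continuous fun q : ℝ × Sp d × Sp d => q.2.1)
  exact (continuous_const.prodMk
    ((continuous_snd.comp continuous_snd).prodMk h.neg)).neg

/-- The distribution `φ ↦ -∫ (∂_t φ + p · ∇_x φ - ∇V · ∇_p φ) dB`. -/
theorem exists_transportDistribution {V : Sp d → ℝ} (hV : IsC1Bounded V)
    [IsLocallyFiniteMeasure B] :
    ∃ F : DistTXP d, ∀ φ : TestTXP d, F φ = -∫ q, transportTest V φ q ∂B := by
  -- Written as integration of the Fréchet derivative against a continuous vector field, the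
  -- functional has its continuity built in.
  let L : TestTXP d →L[ℝ] ℝ :=
    (TestFunction.integralAgainstBilinCLM (n := ⊤)
      (ContinuousLinearMap.id ℝ ((ℝ × Sp d × Sp d) →L[ℝ] ℝ)) B
      (fun q : ℝ × Sp d × Sp d => (-(1, q.2.2, -gradPot V q.2.1) : ℝ × Sp d × Sp d))).comp
      (TestFunction.fderivCLM ℝ ⊤ ⊤)
  refine ⟨⟨L.toLinearMap, L.continuous⟩, fun φ => ?_⟩
  change TestFunction.integralAgainstBilinCLM _ _ _ (TestFunction.fderivCLM ℝ ⊤ ⊤ φ) = _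
  rw [TestFunction.integralAgainstBilinCLM_eq_integral
    ((continuous_transportField hV).locallyIntegrable.locallyIntegrableOn _),
    TestFunction.fderivCLM_apply_of_le _ (by simp), ← integral_neg]
  refine integral_congr_ae (ae_of_all _ fun q => ?_)
  simp only [ContinuousLinearMap.id_apply, transportTest, map_neg]

end SpaceTime

end Bohm

namespace Bohm

/-! ### Passage to the limit in momentum moments -/

section MomentLimits

variable {d : ℕ} {β : ℝ → Measure (Sp d × Sp d)} {B : Measure (ℝ × Sp d × Sp d)} {K C T : ℝ}
  {Θ : ℝ × Sp d × Sp d → ℝ}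

theorem MomentBounded.isProbabilityMeasure {μ : ℝ → Measure (Sp d × Sp d)}
    (hμ : MomentBounded μ K) (t : ℝ) : IsProbabilityMeasure (μ t) := ⟨hμ.univ_eq t⟩

theorem MomentBounded.integrable_weight {μ : ℝ → Measure (Sp d × Sp d)}
    (hμ : MomentBounded μ K) (C t : ℝ) :
    Integrable (fun z : Sp d × Sp d => C * (1 + ‖z.2‖ ^ 2)) (μ t) := by
  have := hμ.isProbabilityMeasure t
  have h : Integrable (fun z : Sp d × Sp d => 1 + ‖z.2‖ ^ 2) (μ t) :=
    (integrable_const 1).add (hμ.integrable_sq t)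
  exact h.const_mul C

theorem MomentBounded.integrable_slice {μ : ℝ → Measure (Sp d × Sp d)}
    (hμ : MomentBounded μ K) (hΘ : Continuous Θ)
    (hC : ∀ t x p, |Θ (t, x, p)| ≤ C * (1 + ‖p‖ ^ 2)) (t : ℝ) :
    Integrable (fun z => Θ (t, z)) (μ t) :=
  (hμ.integrable_weight C t).mono' (hΘ.comp (by fun_prop)).aestronglyMeasurable
    (ae_of_all _ fun z => hC t z.1 z.2)

theorem MomentBounded.abs_integral_slice_le {μ : ℝ → Measure (Sp d × Sp d)}
    (hμ : MomentBounded μ K) (hC0 : 0 ≤ C) (hC : ∀ t x p, |Θ (t, x, p)| ≤ C * (1 + ‖p‖ ^ 2))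
    (t : ℝ) : |∫ z, Θ (t, z) ∂(μ t)| ≤ C * (1 + K) := by
  have := hμ.isProbabilityMeasure t
  rw [← Real.norm_eq_abs]
  refine (norm_integral_le_of_norm_le (hμ.integrable_weight C t)
    (ae_of_all _ fun z => hC t z.1 z.2)).trans ?_
  rw [integral_const_mul, integral_add (integrable_const 1) (hμ.integrable_sq t)]
  have := hμ.integral_sq_le t
  simp only [integral_const, probReal_univ, smul_eq_mul, mul_one]
  gcongr

theorem MomentBounded.abs_integral_le {μ : ℝ → Measure (Sp d × Sp d)}
    (hμ : MomentBounded μ K) (hC0 : 0 ≤ C) (hC : ∀ t x p, |Θ (t, x, p)| ≤ C * (1 + ‖p‖ ^ 2))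
    (hT : ∀ t x p, T < ‖((t, x) : ℝ × Sp d)‖ → Θ (t, x, p) = 0) :
    |∫ t, ∫ z, Θ (t, z) ∂(μ t)| ≤ volume.real (Set.Icc (-T) T) * (C * (1 + K)) := by
  have h : ∫ t, (Set.Icc (-T) T).indicator (fun _ => C * (1 + K)) t =
      volume.real (Set.Icc (-T) T) * (C * (1 + K)) := by
    rw [integral_indicator measurableSet_Icc, setIntegral_const, smul_eq_mul]
  rw [← h, ← Real.norm_eq_abs]
  refine norm_integral_le_of_norm_le
    ((integrableOn_const (by simp)).integrable_indicator measurableSet_Icc)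
    (ae_of_all _ fun t => ?_)
  by_cases ht : t ∈ Set.Icc (-T) T
  · rw [Set.indicator_of_mem ht, Real.norm_eq_abs]
    exact hμ.abs_integral_slice_le hC0 hC t
  · rw [Set.indicator_of_notMem ht]
    have : T < |t| := by
      by_contra hlt
      push Not at hlt
      exact ht (abs_le.1 hlt)
    simp [fun z : Sp d × Sp d => hT t z.1 z.2 (this.trans_le (abs_fst_le t z.1))]

/-- A continuous cutoff of the momenta larger than `N + 2`. -/
noncomputable def momentumCut (N : ℕ) (p : Sp d) : ℝ := max 0 (min 1 (N + 2 - ‖p‖))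

theorem continuous_momentumCut (N : ℕ) : Continuous (momentumCut N : Sp d → ℝ) := by
  unfold momentumCut
  fun_prop

theorem momentumCut_nonneg (N : ℕ) (p : Sp d) : 0 ≤ momentumCut N p := le_max_left _ _

theorem momentumCut_le_one (N : ℕ) (p : Sp d) : momentumCut N p ≤ 1 :=
  max_le zero_le_one (min_le_left _ _)

theorem momentumCut_mono (p : Sp d) : Monotone fun N => momentumCut N p := fun m n h => by
  have : (m : ℝ) ≤ n := by exact_mod_cast h
  change max 0 (min 1 ((m : ℝ) + 2 - ‖p‖)) ≤ max 0 (min 1 ((n : ℝ) + 2 - ‖p‖))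
  exact max_le_max le_rfl (min_le_min le_rfl (by linarith))

theorem momentumCut_eq_one {N : ℕ} {p : Sp d} (h : ‖p‖ ≤ N + 1) : momentumCut N p = 1 := by
  rw [momentumCut, min_eq_left (by linarith), max_eq_right zero_le_one]

theorem momentumCut_eq_zero {N : ℕ} {p : Sp d} (h : N + 2 < ‖p‖) : momentumCut N p = 0 := by
  rw [momentumCut, max_eq_left]
  exact (min_le_right _ _).trans (by linarith)

theorem hasCompactSupport_momentumCut_mul (N : ℕ)
    (hT : ∀ t x p, T < ‖((t, x) : ℝ × Sp d)‖ → Θ (t, x, p) = 0) :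
    HasCompactSupport fun q : ℝ × Sp d × Sp d => momentumCut N q.2.2 * Θ q := by
  refine HasCompactSupport.intro (isCompact_closedBall 0 (max T (N + 2))) fun q hq => ?_
  obtain ⟨t, x, p⟩ := q
  by_cases h : T < ‖((t, x) : ℝ × Sp d)‖
  · rw [hT t x p h, mul_zero]
  · rw [momentumCut_eq_zero, zero_mul]
    by_contra h'
    push Not at h h'
    refine hq ?_
    rw [mem_closedBall_zero_iff]
    simp only [Prod.norm_mk, sup_le_iff] at h ⊢
    exact ⟨h.1.trans (le_max_left _ _), h.2.trans (le_max_left _ _), h'.trans (le_max_right _ _)⟩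

theorem continuous_momentumCut_mul (N : ℕ) (hΘ : Continuous Θ) :
    Continuous fun q : ℝ × Sp d × Sp d => momentumCut N q.2.2 * Θ q :=
  ((continuous_momentumCut N).comp (by fun_prop)).mul hΘ

theorem abs_momentumCut_mul_le (N : ℕ) (p : Sp d) (r : ℝ) : |momentumCut N p * r| ≤ |r| := by
  rw [abs_mul, abs_of_nonneg (momentumCut_nonneg N p)]
  exact mul_le_of_le_one_left (abs_nonneg _) (momentumCut_le_one N p)

variable {μ : ℕ → ℝ → Measure (Sp d × Sp d)}

/-- Lower semicontinuity of nonnegative momentum moments. -/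
theorem TendstoWeakStar.integrable_and_integral_le (hlim : TendstoWeakStar μ β)
    (hμ : ∀ n, MomentBounded (μ n) K) (hB : IsSpaceTimeMeasure β B) (hΘ : Continuous Θ)
    (hΘ0 : ∀ q, 0 ≤ Θ q) (hC : ∀ t x p, |Θ (t, x, p)| ≤ C * (1 + ‖p‖ ^ 2))
    (hT : ∀ t x p, T < ‖((t, x) : ℝ × Sp d)‖ → Θ (t, x, p) = 0) {u : ℕ → ℝ} {L : ℝ}
    (hu : ∀ n, ∫ t, ∫ z, Θ (t, z) ∂(μ n t) ≤ u n) (huL : Tendsto u atTop (𝓝 L)) :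
    Integrable Θ B ∧ ∫ q, Θ q ∂B ≤ L := by
  have := hB.locallyFinite
  have hT' : ∀ t x p, T < |t| → Θ (t, x, p) = 0 := fun t x p ht =>
    hT t x p (ht.trans_le (abs_fst_le t x))
  have hL : 0 ≤ L := ge_of_tendsto' huL fun n =>
    (integral_nonneg fun t => integral_nonneg fun z => hΘ0 _).trans (hu n)
  -- The weak-* convergence sees only compactly supported functions; cutting off large momenta of a
  -- nonnegative function decreases its integrals.
  have hcut : ∀ N, ∫ q, momentumCut N q.2.2 * Θ q ∂B ≤ L := by
    intro N
    refine le_of_tendsto_of_tendsto' (hlim.tendsto_of_hasCompactSupport hB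
      (continuous_momentumCut_mul N hΘ) (hasCompactSupport_momentumCut_mul N hT)) huL fun n => ?_
    have hC' : ∀ t x p, |momentumCut N p * Θ (t, x, p)| ≤ C * (1 + ‖p‖ ^ 2) := fun t x p =>
      (abs_momentumCut_mul_le _ _ _).trans (hC t x p)
    refine (integral_mono ((hμ n).integrable (continuous_momentumCut_mul N hΘ) (T := T) hC'
      fun t x p ht => by simp [hT' t x p ht]) ((hμ n).integrable hΘ hC hT') fun t => ?_).trans (hu n)
    exact integral_mono ((hμ n).integrable_slice (continuous_momentumCut_mul N hΘ) hC' t)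
      ((hμ n).integrable_slice hΘ hC t)
      fun z => mul_le_of_le_one_left (hΘ0 _) (momentumCut_le_one N _)
  -- Monotone convergence as the cutoff is removed.
  have hlint : ∫⁻ q, ENNReal.ofReal (Θ q) ∂B ≤ ENNReal.ofReal L := by
    refine le_of_tendsto' (lintegral_tendsto_of_tendsto_of_monotone
      (f := fun N q => ENNReal.ofReal (momentumCut N q.2.2 * Θ q)) (fun N =>
        (continuous_momentumCut_mul N hΘ).measurable.ennreal_ofReal.aemeasurable)
      (ae_of_all _ fun q m n h => ENNReal.ofReal_le_ofReal
        (mul_le_mul_of_nonneg_right (momentumCut_mono q.2.2 h) (hΘ0 q)))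
      (ae_of_all _ fun q => ?_)) fun N => ?_
    · refine tendsto_const_nhds.congr' ?_
      obtain ⟨N, hN⟩ := exists_nat_ge ‖q.2.2‖
      filter_upwards [eventually_ge_atTop N] with n hn
      have : (N : ℝ) ≤ n := by exact_mod_cast hn
      rw [momentumCut_eq_one (by linarith), one_mul]
    · rw [← ofReal_integral_eq_lintegral_ofReal
        ((continuous_momentumCut_mul N hΘ).integrable_of_hasCompactSupport
          (hasCompactSupport_momentumCut_mul N hT))
        (ae_of_all _ fun q => mul_nonneg (momentumCut_nonneg N _) (hΘ0 q))]
      exact ENNReal.ofReal_le_ofReal (hcut N)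
  refine ⟨⟨hΘ.aestronglyMeasurable, ?_⟩, ?_⟩
  · rw [hasFiniteIntegral_iff_ofReal (ae_of_all _ hΘ0)]
    exact hlint.trans_lt ENNReal.ofReal_lt_top
  · rw [integral_eq_lintegral_of_nonneg_ae (ae_of_all _ hΘ0) hΘ.aestronglyMeasurable]
    exact ENNReal.toReal_le_of_le_ofReal hL hlint

/-- Lower semicontinuity applied to `|Θ|`, with the uniform second moment bound as a constant
sequence of majorants. -/
theorem TendstoWeakStar.integrable_of_quadratic (hlim : TendstoWeakStar μ β)
    (hμ : ∀ n, MomentBounded (μ n) K) (hB : IsSpaceTimeMeasure β B) (hΘ : Continuous Θ)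
    (hC0 : 0 ≤ C) (hC : ∀ t x p, |Θ (t, x, p)| ≤ C * (1 + ‖p‖ ^ 2))
    (hT : ∀ t x p, T < ‖((t, x) : ℝ × Sp d)‖ → Θ (t, x, p) = 0) :
    Integrable Θ B ∧ |∫ q, Θ q ∂B| ≤ volume.real (Set.Icc (-T) T) * (C * (1 + K)) := by
  have hC' : ∀ t x p, |(|Θ (t, x, p)|)| ≤ C * (1 + ‖p‖ ^ 2) := by simpa only [abs_abs] using hC
  have hT' : ∀ t x p, T < ‖((t, x) : ℝ × Sp d)‖ → |Θ (t, x, p)| = 0 := fun t x p ht => by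
    rw [hT t x p ht, abs_zero]
  obtain ⟨h1, h2⟩ := hlim.integrable_and_integral_le hμ hB hΘ.abs (fun q => abs_nonneg _) hC' hT'
    (fun n => (le_abs_self _).trans ((hμ n).abs_integral_le (Θ := fun q => |Θ q|) hC0 hC' hT')) tendsto_const_nhds
  exact ⟨(integrable_norm_iff hΘ.aestronglyMeasurable).1 h1, abs_integral_le_integral_abs.trans h2⟩

/-- The cutoff acts only where `‖p‖ > N + 1`, and there `(1 + ‖p‖)(N + 1)` is at most `2 (1 +
‖p‖²)`: linear growth gains a factor `1/(N + 1)` against the second moment. -/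
theorem abs_sub_momentumCut_mul_le (N : ℕ) (hC0 : 0 ≤ C)
    (hC : ∀ t x p, |Θ (t, x, p)| ≤ C * (1 + ‖p‖)) (t : ℝ) (x p : Sp d) :
    |Θ (t, x, p) - momentumCut N p * Θ (t, x, p)| ≤ 2 * C / (N + 1) * (1 + ‖p‖ ^ 2) := by
  rcases le_or_gt ‖p‖ (N + 1) with h | h
  · rw [momentumCut_eq_one h, one_mul, sub_self, abs_zero]
    positivity
  · have h1 : |Θ (t, x, p) - momentumCut N p * Θ (t, x, p)| ≤ |Θ (t, x, p)| := by
      rw [← one_sub_mul, abs_mul,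
        abs_of_nonneg (sub_nonneg.2 (momentumCut_le_one N p))]
      exact mul_le_of_le_one_left (abs_nonneg _) (by linarith [momentumCut_nonneg N p])
    have hN : (0 : ℝ) ≤ N := N.cast_nonneg
    refine h1.trans ((hC t x p).trans ?_)
    rw [div_mul_eq_mul_div, le_div_iff₀ (by positivity), mul_comm 2 C, mul_assoc, mul_assoc]
    refine mul_le_mul_of_nonneg_left ?_ hC0
    nlinarith

/-- Momentum moments of linear growth pass to the limit. -/
theorem TendstoWeakStar.tendsto_of_linear (hlim : TendstoWeakStar μ β)
    (hμ : ∀ n, MomentBounded (μ n) K) (hB : IsSpaceTimeMeasure β B) (hΘ : Continuous Θ)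
    (hC0 : 0 ≤ C) (hC : ∀ t x p, |Θ (t, x, p)| ≤ C * (1 + ‖p‖))
    (hT : ∀ t x p, T < ‖((t, x) : ℝ × Sp d)‖ → Θ (t, x, p) = 0) :
    Tendsto (fun n => ∫ t, ∫ z, Θ (t, z) ∂(μ n t)) atTop (𝓝 (∫ q, Θ q ∂B)) := by
  have := hB.locallyFinite
  have hC2 : ∀ t x p, |Θ (t, x, p)| ≤ 2 * C * (1 + ‖p‖ ^ 2) := fun t x p =>
    (hC t x p).trans (by nlinarith [mul_le_mul_of_nonneg_left (one_add_le_sq ‖p‖) hC0])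
  have hCN : ∀ (N : ℕ) t x p, |momentumCut N p * Θ (t, x, p)| ≤ 2 * C * (1 + ‖p‖ ^ 2) :=
    fun N t x p => (abs_momentumCut_mul_le _ _ _).trans (hC2 t x p)
  have hTN : ∀ (N : ℕ) t x p, T < ‖((t, x) : ℝ × Sp d)‖ → momentumCut N p * Θ (t, x, p) = 0 :=
    fun N t x p ht => by rw [hT t x p ht, mul_zero]
  set S := volume.real (Set.Icc (-T) T) with hS
  have hR : ∀ N : ℕ, Continuous fun q : ℝ × Sp d × Sp d => Θ q - momentumCut N q.2.2 * Θ q :=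
    fun N => hΘ.sub (continuous_momentumCut_mul N hΘ)
  have hRT : ∀ (N : ℕ) t x p, T < ‖((t, x) : ℝ × Sp d)‖ →
      Θ (t, x, p) - momentumCut N p * Θ (t, x, p) = 0 := fun N t x p ht => by
    rw [hT t x p ht, mul_zero, sub_zero]
  have e1 : ∀ N n, |(∫ t, ∫ z, Θ (t, z) ∂(μ n t)) -
      ∫ t, ∫ z, momentumCut N z.2 * Θ (t, z) ∂(μ n t)| ≤ S * (2 * C / (N + 1) * (1 + K)) := by
    intro N n
    rw [← integral_sub ((hμ n).integrable hΘ (T := T) hC2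
      fun t x p ht => hT t x p (ht.trans_le (abs_fst_le t x)))
      ((hμ n).integrable (continuous_momentumCut_mul N hΘ) (T := T) (hCN N)
        fun t x p ht => hTN N t x p (ht.trans_le (abs_fst_le t x)))]
    simp only [← fun t => integral_sub ((hμ n).integrable_slice hΘ hC2 t)
      ((hμ n).integrable_slice (continuous_momentumCut_mul N hΘ) (hCN N) t)]
    exact (hμ n).abs_integral_le (Θ := fun q => Θ q - momentumCut N q.2.2 * Θ q) (by positivity)
      (abs_sub_momentumCut_mul_le N hC0 hC) (hRT N)
  have e2 : ∀ N : ℕ, |(∫ q, Θ q ∂B) - ∫ q, momentumCut N q.2.2 * Θ q ∂B| ≤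
      S * (2 * C / (N + 1) * (1 + K)) := by
    intro N
    rw [← integral_sub (hlim.integrable_of_quadratic hμ hB hΘ (by positivity) hC2 hT).1
      (hlim.integrable_of_quadratic hμ hB (continuous_momentumCut_mul N hΘ) (by positivity)
        (hCN N) (hTN N)).1]
    exact (hlim.integrable_of_quadratic hμ hB (hR N) (by positivity)
      (abs_sub_momentumCut_mul_le N hC0 hC) (hRT N)).2
  have e3 : Tendsto (fun N : ℕ => S * (2 * C / ((N : ℝ) + 1) * (1 + K))) atTop (𝓝 0) := by
    have h := ((tendsto_const_div_atTop_nhds_zero_nat (2 * C)).comp (tendsto_add_atTop_nat 1))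
    have h' := (h.mul_const (1 + K)).const_mul S
    simpa only [Function.comp_def, Nat.cast_add, Nat.cast_one, zero_mul, mul_zero] using h'
  rw [Metric.tendsto_atTop]
  intro δ hδ
  -- A cutoff level is fixed for which the tails are below `δ/3`, uniformly in `n` and for the
  -- limit; the truncated integrals converge.
  obtain ⟨N, hN⟩ := (e3.eventually (gt_mem_nhds (by positivity : 0 < δ / 3))).exists
  obtain ⟨n₀, hn₀⟩ := Metric.tendsto_atTop.1 (hlim.tendsto_of_hasCompactSupport hB
    (continuous_momentumCut_mul N hΘ) (hasCompactSupport_momentumCut_mul N hT)) (δ / 3)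
    (by positivity)
  refine ⟨n₀, fun n hn => ?_⟩
  have h1 := abs_le.1 (e1 N n)
  have h2 := abs_le.1 (e2 N)
  have h3 := abs_lt.1 ((Real.dist_eq _ _).symm.trans_lt (hn₀ n hn))
  rw [Real.dist_eq, abs_lt]
  constructor <;> linarith [h1.1, h1.2, h2.1, h2.2, h3.1, h3.2]

end MomentLimits

end Bohm

namespace Bohm

/-! ### The limit stress and the first moment of the limit force -/

section LimitStress

variable {d : ℕ} {β : ℝ → Measure (Sp d × Sp d)} {B : Measure (ℝ × Sp d × Sp d)} {K : ℝ}
  {μ : ℕ → ℝ → Measure (Sp d × Sp d)}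

theorem TendstoWeakStar.integrable_stressTest (hlim : TendstoWeakStar μ β)
    (hμ : ∀ n, MomentBounded (μ n) K) (hB : IsSpaceTimeMeasure β B) (χ : TestTX d) (i j : Fin d) :
    Integrable (stressTest χ i j) B := by
  obtain ⟨C, T, hC0, hC, hT⟩ := exists_bound_stressTest χ i j
  exact (hlim.integrable_of_quadratic hμ hB (continuous_stressTest χ i j) hC0 hC hT).1

theorem TendstoWeakStar.integral_stressTest (hlim : TendstoWeakStar μ β)
    (hμ : ∀ n, MomentBounded (μ n) K) (hB : IsSpaceTimeMeasure β B) (χ : TestTX d) (i j : Fin d) :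
    ∫ q, stressTest χ i j q ∂B = secondMoment β i j χ :=
  hB.integral_eq (hlim.integrable_stressTest hμ hB χ i j)

theorem sum_sum_stressTest (χ : TestTX d) (ξ : Fin d → ℝ) (q : ℝ × Sp d × Sp d) :
    ∑ i, ∑ j, ξ i * ξ j * stressTest χ i j q =
      (∑ i, ξ i * q.2.2 i) ^ 2 * χ (q.1, q.2.1) := by
  rw [sq, Finset.sum_mul_sum, Finset.sum_mul]
  refine Finset.sum_congr rfl fun i _ => ?_
  rw [Finset.sum_mul]
  exact Finset.sum_congr rfl fun j _ => by rw [stressTest]; ring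

/-- The defect of the convective stress is nonnegative. -/
theorem TendstoWeakStar.isNonnegMatrix (hlim : TendstoWeakStar μ β)
    (hμ : ∀ n, MomentBounded (μ n) K) (hB : IsSpaceTimeMeasure β B) {D : Fin d → Fin d → DistTX d}
    (hD : ∀ i j χ, Tendsto (fun n => ∫ t, ∫ z, stressTest χ i j (t, z) ∂(μ n t)) atTop
      (𝓝 (secondMoment β i j χ + D i j χ))) : IsNonnegMatrix D := by
  intro ξ χ hχ
  obtain ⟨M, R, hM0, -, hM, -, hR⟩ := exists_bound_testTX χ
  have hcont : Continuous fun q : ℝ × Sp d × Sp d =>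
      (∑ i, ξ i * q.2.2 i) ^ 2 * χ (q.1, q.2.1) := by
    have h1 := χ.continuous
    exact Continuous.mul (by fun_prop) (h1.comp (by fun_prop))
  have hbd : ∀ (t : ℝ) (x p : Sp d), |(∑ i, ξ i * p i) ^ 2 * χ (t, x)| ≤
      (∑ i, |ξ i|) ^ 2 * M * (1 + ‖p‖ ^ 2) := by
    intro t x p
    have h1 : |∑ i, ξ i * p i| ≤ (∑ i, |ξ i|) * ‖p‖ := by
      refine (Finset.abs_sum_le_sum_abs _ _).trans ?_
      rw [Finset.sum_mul]
      refine Finset.sum_le_sum fun i _ => ?_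
      rw [abs_mul]
      exact mul_le_mul_of_nonneg_left (abs_apply_le_norm p i) (abs_nonneg _)
    rw [abs_mul, abs_pow]
    calc _ ≤ ((∑ i, |ξ i|) * ‖p‖) ^ 2 * M := by
          gcongr
          exact hM _
      _ = (∑ i, |ξ i|) ^ 2 * M * ‖p‖ ^ 2 := by ring
      _ ≤ _ := mul_le_mul_of_nonneg_left (by linarith) (by positivity)
  have hsum : ∀ n, ∫ t, ∫ z, (∑ i, ξ i * z.2 i) ^ 2 * χ (t, z.1) ∂(μ n t) =
      ∑ i, ∑ j, ξ i * ξ j * ∫ t, ∫ z, stressTest χ i j (t, z) ∂(μ n t) := by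
    intro n
    have hsl : ∀ i j t, Integrable (fun z => ξ i * ξ j * stressTest χ i j (t, z)) (μ n t) :=
      fun i j t => by
        obtain ⟨C, T, hC0, hC, hT⟩ := exists_bound_stressTest χ i j
        exact ((hμ n).integrable_slice (continuous_stressTest χ i j) hC t).const_mul _
    have hti : ∀ i j, Integrable fun t => ξ i * ξ j * ∫ z, stressTest χ i j (t, z) ∂(μ n t) :=
      fun i j => by
        obtain ⟨C, T, hC0, hC, hT⟩ := exists_bound_stressTest χ i j
        exact ((hμ n).integrable (continuous_stressTest χ i j) (T := T) hC
          fun t x p ht => hT t x p (ht.trans_le (abs_fst_le t x))).const_mul _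
    have h1 : ∀ t, ∫ z, (∑ i, ξ i * z.2 i) ^ 2 * χ (t, z.1) ∂(μ n t) =
        ∑ i, ∑ j, ξ i * ξ j * ∫ z, stressTest χ i j (t, z) ∂(μ n t) := by
      intro t
      simp only [← sum_sum_stressTest χ ξ (t, _, _)]
      rw [integral_finsetSum _ fun i _ => integrable_finsetSum _ fun j _ => hsl i j t]
      refine Finset.sum_congr rfl fun i _ => ?_
      rw [integral_finsetSum _ fun j _ => hsl i j t]
      exact Finset.sum_congr rfl fun j _ => integral_const_mul _ _
    simp only [h1]
    rw [integral_finsetSum _ fun i _ => integrable_finsetSum _ fun j _ => hti i j]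
    refine Finset.sum_congr rfl fun i _ => ?_
    rw [integral_finsetSum _ fun j _ => hti i j]
    exact Finset.sum_congr rfl fun j _ => integral_const_mul _ _
  have hlimsum : Tendsto (fun n => ∑ i, ∑ j, ξ i * ξ j *
      ∫ t, ∫ z, stressTest χ i j (t, z) ∂(μ n t)) atTop
      (𝓝 (∑ i, ∑ j, ξ i * ξ j * (secondMoment β i j χ + D i j χ))) :=
    tendsto_finsetSum _ fun i _ => tendsto_finsetSum _ fun j _ => (hD i j χ).const_mul _
  -- Lower semicontinuity for the nonnegative function `(ξ·p)² χ`: part of the second moment may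
  -- escape to infinite momentum in the limit, and the loss is the quadratic form of `D`.
  have hle := (hlim.integrable_and_integral_le hμ hB hcont (T := R)
    (fun q => mul_nonneg (sq_nonneg _) (hχ _)) hbd
    (fun t x p ht => by simp only [hR _ ht, mul_zero]) (fun n => (hsum n).le) hlimsum).2
  have hBsum : ∫ q, (∑ i, ξ i * q.2.2 i) ^ 2 * χ (q.1, q.2.1) ∂B =
      ∑ i, ∑ j, ξ i * ξ j * secondMoment β i j χ := by
    have hi : ∀ i j, Integrable (fun q => ξ i * ξ j * stressTest χ i j q) B := fun i j =>
      (hlim.integrable_stressTest hμ hB χ i j).const_mul _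
    simp only [← sum_sum_stressTest χ ξ]
    rw [integral_finsetSum _ fun i _ => integrable_finsetSum _ fun j _ => hi i j]
    refine Finset.sum_congr rfl fun i _ => ?_
    rw [integral_finsetSum _ fun j _ => hi i j]
    refine Finset.sum_congr rfl fun j _ => ?_
    rw [integral_const_mul, hlim.integral_stressTest hμ hB]
  rw [hBsum] at hle
  simp only [mul_add, Finset.sum_add_distrib] at hle
  linarith

theorem divergence_apply (T : Fin d → Fin d → DistTX d) (i : Fin d) (χ : TestTX d) :
    divergence T i χ = -∑ j, T i j (∂_{((0 : ℝ), (basisVec j : Sp d))} χ) := by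
  let ev : DistTX d →+ ℝ :=
    { toFun := fun T => T χ
      map_zero' := rfl
      map_add' := fun _ _ => rfl }
  change ev (∑ j, ∂_{((0 : ℝ), (basisVec j : Sp d))} (T i j)) = _
  rw [map_sum, ← Finset.sum_neg_distrib]
  refine Finset.sum_congr rfl fun j _ => ?_
  change (∂_{((0 : ℝ), (basisVec j : Sp d))} (T i j)) χ = _
  rw [Distribution.lineDerivOp_apply_apply, map_neg]

theorem transportTest_momentTest (V : Sp d → ℝ) (χ : TestTX d) (θ : 𝓓((⊤ : Opens (Sp d)), ℝ))
    (i : Fin d) (n : ℕ) (t : ℝ) (x p : Sp d) :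
    transportTest V (momentTest χ θ i n) (t, x, p) =
      χ (t, x) * (p i * fderiv ℝ θ (((n : ℝ) + 1)⁻¹ • p) (((n : ℝ) + 1)⁻¹ • -gradPot V x) +
        θ (((n : ℝ) + 1)⁻¹ • p) * -gradPot V x i) +
      p i * θ (((n : ℝ) + 1)⁻¹ • p) * fderiv ℝ χ (t, x) (1, p) := by
  have hχ : HasFDerivAt (fun z : ℝ × Sp d × Sp d => χ (z.1, z.2.1))
      ((fderiv ℝ χ (t, x)).comp ((ContinuousLinearMap.fst ℝ ℝ (Sp d × Sp d)).prod
        ((ContinuousLinearMap.fst ℝ (Sp d) (Sp d)).comp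
          (ContinuousLinearMap.snd ℝ ℝ (Sp d × Sp d))))) (t, x, p) := by
    have h := (χ.contDiff.differentiable (by simp) (t, x)).hasFDerivAt
    exact h.comp (t, x, p) ((ContinuousLinearMap.fst ℝ ℝ (Sp d × Sp d)).prod
        ((ContinuousLinearMap.fst ℝ (Sp d) (Sp d)).comp
          (ContinuousLinearMap.snd ℝ ℝ (Sp d × Sp d)))).hasFDerivAt
  have hp : HasFDerivAt (fun z : ℝ × Sp d × Sp d => z.2.2 i)
      ((EuclideanSpace.proj i : Sp d →L[ℝ] ℝ).comp ((ContinuousLinearMap.snd ℝ (Sp d) (Sp d)).comp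
          (ContinuousLinearMap.snd ℝ ℝ (Sp d × Sp d)))) (t, x, p) :=
    ((EuclideanSpace.proj i : Sp d →L[ℝ] ℝ).comp ((ContinuousLinearMap.snd ℝ (Sp d) (Sp d)).comp
          (ContinuousLinearMap.snd ℝ ℝ (Sp d × Sp d)))).hasFDerivAt
  have hθ : HasFDerivAt (fun z : ℝ × Sp d × Sp d => θ (((n : ℝ) + 1)⁻¹ • z.2.2))
      ((fderiv ℝ θ (((n : ℝ) + 1)⁻¹ • p)).comp (((n : ℝ) + 1)⁻¹ •
        ((ContinuousLinearMap.snd ℝ (Sp d) (Sp d)).comp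
          (ContinuousLinearMap.snd ℝ ℝ (Sp d × Sp d))))) (t, x, p) := by
    have h := (θ.contDiff.differentiable (by simp) (((n : ℝ) + 1)⁻¹ • p)).hasFDerivAt
    exact h.comp (t, x, p) (((n : ℝ) + 1)⁻¹ •
        ((ContinuousLinearMap.snd ℝ (Sp d) (Sp d)).comp
          (ContinuousLinearMap.snd ℝ ℝ (Sp d × Sp d)))).hasFDerivAt
  have h := (hχ.fun_mul (hp.fun_mul hθ)).fderiv
  change fderiv ℝ (fun z : ℝ × Sp d × Sp d => χ (z.1, z.2.1) *
    (z.2.2 i * θ (((n : ℝ) + 1)⁻¹ • z.2.2))) (t, x, p) (1, p, -gradPot V x) = _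
  rw [h]
  simp
  ring

theorem fderiv_test_one_apply (χ : TestTX d) (t : ℝ) (x p : Sp d) :
    fderiv ℝ χ (t, x) (1, p) = (∂_{((1 : ℝ), (0 : Sp d))} χ) (t, x) +
      ∑ j, p j * (∂_{((0 : ℝ), (basisVec j : Sp d))} χ) (t, x) := by
  simp only [lineDerivOp_test_apply]
  have h : ((1 : ℝ), p) = (1, 0) + ∑ j, p j • ((0 : ℝ), (basisVec j : Sp d)) := by
    refine Prod.ext ?_ ?_
    · simp [Prod.fst_sum]
    · simp only [Prod.snd_add, Prod.snd_sum, Prod.smul_snd, zero_add]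
      exact sp_eq_sum p
  conv_lhs => rw [h, map_add, map_sum]
  simp only [map_smul, smul_eq_mul]

theorem fderiv_eq_zero_of_lt_norm {E : Type*} [NormedAddCommGroup E] [NormedSpace ℝ E]
    {f : E → ℝ} {R : ℝ} (hf : ∀ y, R < ‖y‖ → f y = 0) {y : E} (hy : R < ‖y‖) :
    fderiv ℝ f y = 0 := by
  have h : f =ᶠ[𝓝 y] fun _ => 0 := by
    filter_upwards [(isOpen_lt continuous_const continuous_norm).mem_nhds hy] with z hz
    exact hf z hz
  rw [h.fderiv_eq]
  simp

/-- The derivative of the cutoff `θ(p/(n+1))` gains `1/(n+1)` and its values are bounded, so the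
integrands grow at most quadratically in `p`, uniformly in `n`. The second moment of the limit
measure dominates them. -/
theorem TendstoWeakStar.tendsto_firstMoment {V : Sp d → ℝ} (hlim : TendstoWeakStar μ β)
    (hμ : ∀ n, MomentBounded (μ n) K) (hB : IsSpaceTimeMeasure β B) (hV : IsC1Bounded V)
    (χ : TestTX d) (θ : 𝓓((⊤ : Opens (Sp d)), ℝ)) (hθ : ∀ᶠ p in 𝓝 (0 : Sp d), θ p = 1)
    (i : Fin d) :
    Tendsto (fun n : ℕ => ∫ q, transportTest V (momentTest χ θ i n) q ∂B) atTop
      (𝓝 (∫ q, (momentumTest V χ i q +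
        ∑ j, stressTest (∂_{((0 : ℝ), (basisVec j : Sp d))} χ) i j q) ∂B)) := by
  obtain ⟨M, R, hM0, hR0, hM, hM', hR⟩ := exists_bound_testTX χ
  obtain ⟨M₁, hM₁0, -, hM₁, -⟩ := hV.exists_bounds
  have hθd : ContDiff ℝ (⊤ : ℕ∞) θ := θ.contDiff
  have hθc : HasCompactSupport θ := θ.hasCompactSupport
  obtain ⟨A₁, hA₁⟩ := hθc.exists_bound_of_continuous hθd.continuous
  obtain ⟨A₂, hA₂⟩ := (hθc.fderiv ℝ).exists_bound_of_continuous (hθd.continuous_fderiv (by simp))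
  set A := |A₁| + |A₂| with hAdef
  have hA0 : 0 ≤ A := by positivity
  have hA : ∀ p, |θ p| ≤ A := fun p => by
    rw [hAdef]
    linarith [(Real.norm_eq_abs _).symm.le.trans (hA₁ p), le_abs_self A₁, abs_nonneg A₂]
  have hA' : ∀ p, ‖fderiv ℝ θ p‖ ≤ A := fun p => by
    rw [hAdef]
    linarith [hA₂ p, le_abs_self A₂, abs_nonneg A₁]
  set g := (d : ℝ) * M₁ with hg
  have hg0 : 0 ≤ g := by positivity
  set D := 2 * (M * A * (1 + g)) with hD
  have hD0 : 0 ≤ D := by positivity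
  -- The majorant `D (1 + ‖p‖²)` is cut off continuously outside the support of `χ`, so that the
  -- moment bound for continuous functions proves it integrable.
  let Ψ : ℝ × Sp d × Sp d → ℝ := fun q =>
    max 0 (min 1 (R + 1 - ‖(q.1, q.2.1)‖)) * (D * (1 + ‖q.2.2‖ ^ 2))
  have hΨc : Continuous Ψ := by
    have h : Continuous fun q : ℝ × Sp d × Sp d => ‖(q.1, q.2.1)‖ := by fun_prop
    exact (continuous_const.max (continuous_const.min (continuous_const.sub h))).mul (by fun_prop)
  have hΨi : Integrable Ψ B := by
    refine (hlim.integrable_of_quadratic hμ hB hΨc hD0 (T := R + 1) (fun t x p => ?_)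
      fun t x p ht => ?_).1
    · change |max 0 (min 1 (R + 1 - ‖(t, x)‖)) * (D * (1 + ‖p‖ ^ 2))| ≤ _
      rw [abs_mul, abs_of_nonneg (le_max_left (0 : ℝ) _),
        abs_of_nonneg (by positivity : 0 ≤ D * (1 + ‖p‖ ^ 2))]
      exact mul_le_of_le_one_left (by positivity) (max_le zero_le_one (min_le_left _ _))
    · change max 0 (min 1 (R + 1 - ‖(t, x)‖)) * (D * (1 + ‖p‖ ^ 2)) = 0
      rw [max_eq_left ((min_le_right _ _).trans (by linarith)), zero_mul]
  refine tendsto_integral_of_dominated_convergence Ψ (fun n =>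
    (continuous_transportTest hV (momentTest χ θ i n).contDiff).aestronglyMeasurable) hΨi
    (fun n => ae_of_all _ fun q => ?_) (ae_of_all _ fun q => ?_)
  · obtain ⟨t, x, p⟩ := q
    rw [transportTest_momentTest]
    rcases le_or_gt ‖((t, x) : ℝ × Sp d)‖ R with h | h
    · have h1 : Ψ (t, x, p) = D * (1 + ‖p‖ ^ 2) := by
        change max 0 (min 1 (R + 1 - ‖(t, x)‖)) * (D * (1 + ‖p‖ ^ 2)) = _
        rw [min_eq_left (by linarith), max_eq_right zero_le_one, one_mul]
      rw [h1]
      set s : ℝ := ((n : ℝ) + 1)⁻¹ with hs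
      have hs0 : 0 ≤ s := by positivity
      have hs1 : s ≤ 1 := inv_le_one_of_one_le₀ (by linarith [n.cast_nonneg (α := ℝ)])
      have hG : ‖gradPot V x‖ ≤ g := norm_gradPot_le hM₁ x
      have e1 : |fderiv ℝ θ (s • p) (s • -gradPot V x)| ≤ A * g := by
        refine ((fderiv ℝ θ (s • p)).le_opNorm _).trans ?_
        rw [norm_smul, norm_neg, Real.norm_of_nonneg hs0]
        refine mul_le_mul (hA' _) ?_ (by positivity) hA0
        exact (mul_le_of_le_one_left (norm_nonneg _) hs1).trans hG
      have e2 : |fderiv ℝ χ (t, x) (1, p)| ≤ M * (1 + ‖p‖) := by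
        refine ((fderiv ℝ χ (t, x)).le_opNorm _).trans ?_
        refine mul_le_mul (hM' _) ?_ (norm_nonneg _) hM0
        rw [Prod.norm_mk, norm_one]
        exact max_le (by linarith [norm_nonneg p]) (by linarith)
      have e3 := abs_apply_le_norm p i
      have e4 : |-gradPot V x i| ≤ g := by
        rw [abs_neg]
        exact (abs_apply_le_norm _ i).trans hG
      have f1 : |p i * fderiv ℝ θ (s • p) (s • -gradPot V x)| ≤ ‖p‖ * (A * g) := by
        rw [abs_mul]
        exact mul_le_mul e3 e1 (abs_nonneg _) (norm_nonneg _)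
      have f2 : |θ (s • p) * -gradPot V x i| ≤ A * g := by
        rw [abs_mul]
        exact mul_le_mul (hA _) e4 (abs_nonneg _) hA0
      have f3 : |χ (t, x) * (p i * fderiv ℝ θ (s • p) (s • -gradPot V x) +
          θ (s • p) * -gradPot V x i)| ≤ M * (‖p‖ * (A * g) + A * g) := by
        rw [abs_mul]
        exact mul_le_mul (hM _) ((abs_add_le _ _).trans (add_le_add f1 f2)) (abs_nonneg _) hM0
      have f4 : |p i * θ (s • p) * fderiv ℝ χ (t, x) (1, p)| ≤ ‖p‖ * A * (M * (1 + ‖p‖)) := by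
        rw [abs_mul, abs_mul]
        exact mul_le_mul (mul_le_mul e3 (hA _) (abs_nonneg _) (norm_nonneg _)) e2 (abs_nonneg _)
          (by positivity)
      refine (abs_add_le _ _).trans ((add_le_add f3 f4).trans ?_)
      have hp := norm_nonneg p
      calc M * (‖p‖ * (A * g) + A * g) + ‖p‖ * A * (M * (1 + ‖p‖))
          = M * A * ((1 + ‖p‖) * (g + ‖p‖)) := by ring
        _ ≤ M * A * ((1 + g) * (2 * (1 + ‖p‖ ^ 2))) := by
          refine mul_le_mul_of_nonneg_left ?_ (by positivity)
          have k1 : (1 + ‖p‖) * (g + ‖p‖) ≤ (1 + g) * (1 + ‖p‖) ^ 2 := by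
            nlinarith [mul_nonneg hg0 hp, mul_nonneg (mul_nonneg hg0 hp) hp]
          refine k1.trans (mul_le_mul_of_nonneg_left ?_ (by positivity))
          nlinarith [sq_nonneg (‖p‖ - 1)]
        _ = _ := by rw [hD]; ring
    · rw [hR _ h, fderiv_eq_zero_of_lt_norm hR h]
      simp only [zero_mul, _root_.zero_apply, mul_zero, add_zero, norm_zero]
      exact mul_nonneg (le_max_left _ _) (by positivity)
  · obtain ⟨t, x, p⟩ := q
    have hs : Tendsto (fun n : ℕ => ((n : ℝ) + 1)⁻¹ • p) atTop (𝓝 0) := by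
      have h := (tendsto_one_div_add_atTop_nhds_zero_nat (𝕜 := ℝ)).smul_const p
      simpa only [one_div, zero_smul] using h
    -- For fixed `p` the points `p/(n+1)` eventually lie where `θ` is locally equal to one, so the
    -- integrand is eventually constant in `n`.
    refine tendsto_const_nhds.congr' ?_
    filter_upwards [hs.eventually hθ.eventually_nhds] with n hn
    have h1 : θ (((n : ℝ) + 1)⁻¹ • p) = 1 := hn.self_of_nhds
    have h2 : fderiv ℝ θ (((n : ℝ) + 1)⁻¹ • p) = 0 := by
      have h : (θ : Sp d → ℝ) =ᶠ[𝓝 (((n : ℝ) + 1)⁻¹ • p)] fun _ => 1 := hn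
      rw [h.fderiv_eq]
      simp
    rw [transportTest_momentTest, h1, h2, fderiv_test_one_apply]
    simp only [momentumTest, stressTest, _root_.zero_apply]
    rw [mul_add (p i * 1), Finset.mul_sum]
    have h3 : ∀ j, p i * 1 * (p j * (∂_{((0 : ℝ), (basisVec j : Sp d))} χ) (t, x)) =
        p i * p j * (∂_{((0 : ℝ), (basisVec j : Sp d))} χ) (t, x) := fun j => by ring
    simp only [h3]
    ring

end LimitStress

end Bohm

theorem mainTheorem4 {d : ℕ} (V : Bohm.Sp d → ℝ) (hV : Bohm.IsC1Bounded V)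
    (ψ₀ : ℝ → Bohm.L2 d) (ψ : ℝ → ℝ → Bohm.L2 d)
    (hψ₀ : ∀ ε ∈ Set.Ioc (0 : ℝ) 1, Bohm.MemH 3 (ψ₀ ε))
    (hmass : ∀ ε ∈ Set.Ioc (0 : ℝ) 1, ‖ψ₀ ε‖ = 1)
    (henergy : ∃ K : ℝ, ∀ ε ∈ Set.Ioc (0 : ℝ) 1, Bohm.energy V ε (ψ₀ ε) ≤ K)
    (hψ : ∀ ε ∈ Set.Ioc (0 : ℝ) 1, Bohm.IsSchrodingerSolution V ε (ψ₀ ε) (ψ ε))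
    (ε : ℕ → ℝ) (hε : ∀ n, ε n ∈ Set.Ioc (0 : ℝ) 1) (hε0 : Tendsto ε atTop (𝓝 0))
    (β : ℝ → Measure (Bohm.Sp d × Bohm.Sp d)) (hβ : Bohm.IsLinftyMeasure β)
    (hlim : Bohm.TendstoWeakStar
      (fun n t => Bohm.bohmianMeasure (ε n) (ψ (ε n) t)) β)
    (A C : Fin d → Fin d → Bohm.DistTX d)
    (hA : ∀ i j χ, Tendsto (fun n => Bohm.quantumStress (ε n) (ψ (ε n)) i j χ) atTop
      (𝓝 (A i j χ)))
    (hC : ∀ i j χ, Tendsto (fun n => Bohm.convectiveStress (ε n) (ψ (ε n)) i j χ) atTop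
      (𝓝 (Bohm.secondMoment β i j χ + C i j χ))) :
    (∀ n φ, Bohm.BohmForceIntegrable (ε n) (ψ (ε n)) φ) ∧
    Bohm.IsNonnegMatrix C ∧
    ∃ F : Bohm.DistTXP d,
      (∀ φ, Tendsto (fun n => Bohm.bohmForce (ε n) (ψ (ε n)) φ) atTop (𝓝 (F φ))) ∧
      ∀ i, Bohm.HasFirstMoment F i (-Bohm.divergence (A + C) i) := by
  obtain ⟨K, hK⟩ := henergy
  obtain ⟨M, -, hM, -, -⟩ := hV.exists_bounds
  have hpos : ∀ n, 0 < ε n := fun n => (hε n).1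
  choose ψ' b b' c hreg using fun n =>
    (hψ _ (hε n)).exists_regSol hV (hpos n) (hψ₀ _ (hε n))
  have hone : ∀ n t, ‖ψ (ε n) t‖ = 1 := fun n t => by
    rw [(hψ _ (hε n)).norm_eq hV (hpos n) t, hmass _ (hε n)]
  have hen : ∀ n t, Bohm.energy V (ε n) (ψ (ε n) t) ≤ K := fun n t => by
    rw [(hψ _ (hε n)).energy_eq hV (hpos n) t]
    exact hK _ (hε n)
  have hμ := fun n => (hreg n).momentBounded hM (hone n) (hen n)
  -- Conservation of mass and energy makes `ε ∂_kψ` bounded in `L²`, uniformly in time and in `n`.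
  have hkin : ∀ n t k, ε n ^ 2 * ‖b n k t‖ ^ 2 ≤ 2 * (K + M) := fun n t k =>
    (mul_le_mul_of_nonneg_left (Finset.single_le_sum (f := fun j => ‖b n j t‖ ^ 2)
      (fun j _ => by positivity) (Finset.mem_univ k)) (sq_nonneg _)).trans
      (Bohm.kinetic_le (b := fun j => b n j t) (fun j => (hreg n).dir j t) hM (hone n t) (hen n t))
  obtain ⟨B, hB⟩ := hβ.exists_spaceTime
  have := hB.locallyFinite
  obtain ⟨F, hF⟩ := Bohm.exists_transportDistribution (B := B) hV
  have hstress : ∀ i j χ, Tendsto (fun n => ∫ t, ∫ z, Bohm.stressTest χ i j (t, z)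
      ∂(Bohm.bohmianMeasure (ε n) (ψ (ε n) t))) atTop
      (𝓝 (Bohm.secondMoment β i j χ + C i j χ)) := fun i j χ => by
    simpa only [fun n => (hreg n).convectiveStress_eq χ i j] using hC i j χ
  refine ⟨fun n φ => ((hreg n).bohmForce_eq hV (hpos n).ne' φ).1,
    hlim.isNonnegMatrix hμ hB hstress, F, fun φ => ?_, fun i χ θ hθ => ?_⟩
  · simp only [fun n => ((hreg n).bohmForce_eq hV (hpos n).ne' φ).2, hF]
    refine (hlim.tendsto_of_hasCompactSupport hB
      (Bohm.continuous_transportTest hV φ.contDiff) ?_).neg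
    have hc : HasCompactSupport φ := φ.hasCompactSupport
    refine HasCompactSupport.intro (hc.fderiv ℝ).isCompact fun q hq => ?_
    rw [Bohm.transportTest, image_eq_zero_of_notMem_tsupport hq, _root_.zero_apply]
  · have hT := (hlim.tendsto_firstMoment hμ hB hV χ θ hθ i).neg
    simp only [hF]
    convert hT using 2
    obtain ⟨D, T, hD0, hD, hDT⟩ := Bohm.exists_bound_momentumTest hV χ i
    have hint : Integrable (Bohm.momentumTest V χ i) B :=
      (hlim.integrable_of_quadratic hμ hB (Bohm.continuous_momentumTest hV χ i)
        (C := 2 * D) (by positivity) (fun t x p => (hD t x p).trans (by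
          nlinarith [mul_le_mul_of_nonneg_left (Bohm.one_add_le_sq ‖p‖) hD0])) hDT).1
    rw [integral_add hint (integrable_finsetSum _ fun j _ =>
        hlim.integrable_stressTest hμ hB _ i j),
      integral_finsetSum _ fun j _ => hlim.integrable_stressTest hμ hB _ i j]
    simp only [fun j => hlim.integral_stressTest hμ hB
      (∂_{((0 : ℝ), (Bohm.basisVec j : Bohm.Sp d))} χ) i j]
    -- The dispersive term is `O(ε)`, with one constant for each second derivative of `χ`.
    choose E hE using fun k => Bohm.exists_dispersion_bound
      (∂_{((0 : ℝ), (Bohm.basisVec k : Bohm.Sp d))}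
        (∂_{((0 : ℝ), (Bohm.basisVec i : Bohm.Sp d))} χ)) (2 * (K + M))
    have herr : ∀ k, Tendsto (fun n => ε n / 2 * ∫ t, ε n * Bohm.pairR (fun x =>
        (∂_{((0 : ℝ), (Bohm.basisVec k : Bohm.Sp d))}
          (∂_{((0 : ℝ), (Bohm.basisVec i : Bohm.Sp d))} χ)) (t, x)) (ψ (ε n) t) (b n k t))
        atTop (𝓝 0) := fun k => by
      refine squeeze_zero_norm (fun n => ?_) (by simpa using hε0.const_mul (E k))
      rw [Real.norm_eq_abs]
      exact hE k (ε n) (hpos n).le _ _ (hone n) fun t => hkin n t k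
    -- All three groups of terms in the momentum balance converge: the linear moments to those of
    -- `B`, the stresses by hypothesis, the dispersive terms to zero. As the balance is zero for
    -- every `n`, so is its limit.
    have hbal := ((hlim.tendsto_of_linear hμ hB (Bohm.continuous_momentumTest hV χ i) hD0 hD
      hDT).add (tendsto_finsetSum Finset.univ fun k _ =>
        (hC i k (∂_{((0 : ℝ), (Bohm.basisVec k : Bohm.Sp d))} χ)).add
          (hA i k (∂_{((0 : ℝ), (Bohm.basisVec k : Bohm.Sp d))} χ)))).add
      (tendsto_finsetSum Finset.univ fun k _ => herr k)
    simp only [fun n => (hreg n).momentum_stress hV χ i] at hbal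
    have hzero := tendsto_nhds_unique tendsto_const_nhds hbal
    have hdiv : (Bohm.divergence (A + C) i) χ = -∑ k,
        (A i k (∂_{((0 : ℝ), (Bohm.basisVec k : Bohm.Sp d))} χ) +
          C i k (∂_{((0 : ℝ), (Bohm.basisVec k : Bohm.Sp d))} χ)) :=
      Bohm.divergence_apply (A + C) i χ
    change -((Bohm.divergence (A + C) i) χ) = _
    rw [hdiv]
    -- In the moment of `F` the linear moment and the second moments of `β` appear with the opposite
    -- sign; inserting the limit balance leaves exactly `A + C`.
    simp only [Finset.sum_add_distrib, Finset.sum_const_zero] at hzero ⊢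
    linarith
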